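/- Let $d>0$, $a>0$ and $b$ be real numbers, and let $\pi_n$ be the monic polynomials defined by $$\pi_0(x)=1,\qquad \pi_1(x)=x,\qquad \pi_{n+1}(x)=(x-dn)\,\pi_n(x)-(an+b)\,\pi_{n-1}(x)\quad(n\ge1).$$ Put $x=nd+\sqrt n\,z$ with $z\in\mathbb C$. All powers $w^{s}$ and $\sqrt w=w^{1/2}$ are principal, $\sqrt{z^2-4a}$ in (1) means $\sqrt{z-2\sqrt a}\,\sqrt{z+2\sqrt a}$ (analytic off $[-2\sqrt a,2\sqrt a]$ and asymptotic to $z$ at infinity), and $\arccos w=-i\log(w+i\sqrt{1-w^2})$ with the principal logarithm. Then, as $n\to\infty$: **(1) Outer region.** Let $$\Phi_n(z)=\Big(\frac ne\Big)^n\Big(\frac{z+\sqrt{z^2-4a}}{2\sqrt n}\Big)^n\Big(\frac{z+\sqrt{z^2-4a}}{2(\sqrt n d+z)}\Big)^{-\frac a{d^2}-\frac{\sqrt n(\sqrt n d+z)}d}\Big(\frac{\sqrt n d+z}{\sqrt{z^2-4a}}\Big)^{1/2}\exp\Big[\frac{2a-z^2-4\sqrt n dz+(z+4\sqrt n d)\sqrt{z^2-4a}}{4d^2}\Big].$$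 For every $\delta>0$, $\pi_n(nd+\sqrt n z)/\Phi_n(z)\to1$ uniformly for all $z\in\mathbb C$ at distance at least $\delta$ from the cut $[-\sqrt n d,2\sqrt a]$. **(2) Around $(-2\sqrt a,2\sqrt a)$.** Let $$G_n(z)=\Big(\frac ne\Big)^n\Big(\frac{\sqrt a}{\sqrt n}\Big)^{-\frac a{d^2}-\frac{\sqrt n z}d}\Big(d+\frac z{\sqrt n}\Big)^{\frac a{d^2}+\frac{\sqrt n(\sqrt n d+z)}d}\Big(\frac{\sqrt n d+z}{\sqrt{4a-z^2}}\Big)^{1/2}\exp\Big[\frac{2a-z^2-4\sqrt n dz}{4d^2}\Big],$$ $$\Theta_n(z)=\Big(n-\frac a{d^2}-\frac{\sqrt n(\sqrt n d+z)}d\Big)\arccos\frac z{2\sqrt a}-\frac\pi4+\frac{(z+4\sqrt n d)\sqrt{4a-z^2}}{4d^2}.$$ For every $\delta>0$ there is $\eta>0$ such that $$\pi_n(nd+\sqrt n z)=G_n(z)\Big[2\cos\Theta_n(z)+o(1)\,e^{|\operatorname{Im}\Theta_n(z)|}\Big]$$ uniformly for $-2\sqrt a+\delta\le\operatorname{Re}z\le2\sqrt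 a-\delta$, $|\operatorname{Im}z|\le\eta$. **(3) Around $(-\sqrt n d,-2\sqrt a)$.** Let $R(z)=\sqrt{-z-2\sqrt a}\,\sqrt{-z+2\sqrt a}$ and $$H_n(z)=\Big(\frac ne\Big)^n\Big(\frac{-z+R(z)}{2\sqrt n}\Big)^{-\frac a{d^2}-\frac{\sqrt n z}d}\Big(d+\frac z{\sqrt n}\Big)^{\frac a{d^2}+\frac{\sqrt n(\sqrt n d+z)}d}\Big(\frac{\sqrt n d+z}{R(z)}\Big)^{1/2}\exp\Big[\frac{2a-z^2-4\sqrt n dz-(z+4\sqrt n d)R(z)}{4d^2}\Big],$$ $$\Psi_n(z)=\pi\Big(-\frac a{d^2}-\frac{\sqrt n z}d-\frac12\Big).$$ For every $\delta>0$ there is $\eta>0$ such that $$\pi_n(nd+\sqrt n z)=H_n(z)\Big[2\cos\Psi_n(z)+o(1)\,e^{|\operatorname{Im}\Psi_n(z)|}\Big]$$ uniformly for $-\sqrt n d+\delta\le\operatorname{Re}z\le-2\sqrt a-\delta$, $|\operatorname{Im}z|\le\eta$. -/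

import Mathlib

open Filter

noncomputable section

namespace PlancherelRotach

/-- The monic polynomials `π_n` with `π_0 = 1`, `π_1 = x - A_0` and
`π_{n+1} = (x - A_n) π_n - B_n π_{n-1}`, where `A_n = d n` and `B_n = a n + b`. -/
def piPoly (d a b : ℝ) : ℕ → Polynomial ℂ
  | 0 => 1
  | 1 => Polynomial.X
  | (n + 2) =>
      (Polynomial.X - Polynomial.C ((d : ℂ) * ((n : ℂ) + 1))) * piPoly d a b (n + 1)
        - Polynomial.C ((a : ℂ) * ((n : ℂ) + 1) + (b : ℂ)) * piPoly d a b n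

/-- `√n` as a complex number. -/
def rootN (n : ℕ) : ℂ := ((Real.sqrt n : ℝ) : ℂ)

/-- `√a` as a complex number. -/
def rootA (a : ℝ) : ℂ := ((Real.sqrt a : ℝ) : ℂ)

/-- The principal inverse cosine, with cuts `(-∞, -1]` and `[1, ∞)`. -/
def carccos (w : ℂ) : ℂ := -Complex.I * Complex.log (w + Complex.I * Complex.sqrt (1 - w ^ 2))

/-- The value `π_n(n d + √n z)`. -/
def piAt (d a b : ℝ) (n : ℕ) (z : ℂ) : ℂ :=
  (piPoly d a b n).eval ((n : ℂ) * d + rootN n * z)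

/-- The branch of `√(z² - 4a)` that is analytic off `[-2√a, 2√a]` and behaves like `z` at
infinity. -/
def rootOuter (a : ℝ) (z : ℂ) : ℂ := Complex.sqrt (z - 2 * rootA a) * Complex.sqrt (z + 2 * rootA a)

/-- The outer approximation, all powers being principal. -/
def outerApprox (d a : ℝ) (n : ℕ) (z : ℂ) : ℂ :=
  ((n : ℂ) / Complex.exp 1) ^ n
    * ((z + rootOuter a z) / (2 * rootN n)) ^ n
    * ((z + rootOuter a z) / (2 * (rootN n * d + z)))
        ^ (-(a : ℂ) / d ^ 2 - rootN n * (rootN n * d + z) / d)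
    * Complex.sqrt ((rootN n * d + z) / rootOuter a z)
    * Complex.exp ((2 * a - z ^ 2 - 4 * rootN n * d * z
        + (z + 4 * rootN n * d) * rootOuter a z) / (4 * d ^ 2))

/-- The factor in front of `2 cos` in the approximation around `(-2√a, 2√a)`. -/
def midAmp (d a : ℝ) (n : ℕ) (z : ℂ) : ℂ :=
  ((n : ℂ) / Complex.exp 1) ^ n
    * (rootA a / rootN n) ^ (-(a : ℂ) / d ^ 2 - rootN n * z / d)
    * ((d : ℂ) + z / rootN n) ^ ((a : ℂ) / d ^ 2 + rootN n * (rootN n * d + z) / d)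
    * Complex.sqrt ((rootN n * d + z) / Complex.sqrt (4 * a - z ^ 2))
    * Complex.exp ((2 * a - z ^ 2 - 4 * rootN n * d * z) / (4 * d ^ 2))

/-- The argument of the cosine in the approximation around `(-2√a, 2√a)`. -/
def midPhase (d a : ℝ) (n : ℕ) (z : ℂ) : ℂ :=
  ((n : ℂ) - a / d ^ 2 - rootN n * (rootN n * d + z) / d) * carccos (z / (2 * rootA a))
    - Real.pi / 4
    + (z + 4 * rootN n * d) * Complex.sqrt (4 * a - z ^ 2) / (4 * d ^ 2)

/-- The branch `√(-z - 2√a) √(-z + 2√a)`, positive for `z < -2√a`. -/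
def rootLeft (a : ℝ) (z : ℂ) : ℂ := Complex.sqrt (-z - 2 * rootA a) * Complex.sqrt (-z + 2 * rootA a)

/-- The factor in front of `2 cos` in the approximation around `(-√n d, -2√a)`. -/
def leftAmp (d a : ℝ) (n : ℕ) (z : ℂ) : ℂ :=
  ((n : ℂ) / Complex.exp 1) ^ n
    * ((-z + rootLeft a z) / (2 * rootN n)) ^ (-(a : ℂ) / d ^ 2 - rootN n * z / d)
    * ((d : ℂ) + z / rootN n) ^ ((a : ℂ) / d ^ 2 + rootN n * (rootN n * d + z) / d)
    * Complex.sqrt ((rootN n * d + z) / rootLeft a z)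
    * Complex.exp ((2 * a - z ^ 2 - 4 * rootN n * d * z
        - (z + 4 * rootN n * d) * rootLeft a z) / (4 * d ^ 2))

/-- The argument of the cosine in the approximation around `(-√n d, -2√a)`. -/
def leftPhase (d a : ℝ) (n : ℕ) (z : ℂ) : ℂ :=
  Real.pi * (-(a : ℂ) / d ^ 2 - rootN n * z / d - 1 / 2)

/-- `f_n ∼ g_n` uniformly on the sets `S_n`: the ratio tends to `1` uniformly. -/
def UniformEquiv (f g : ℕ → ℂ → ℂ) (S : ℕ → Set ℂ) : Prop :=
  ∀ ε : ℝ, 0 < ε → ∀ᶠ n : ℕ in atTop, ∀ z ∈ S n, ‖f n z / g n z - 1‖ ≤ ε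

/-- `f_n ∼ G_n · 2 cos Θ_n` uniformly on the sets `S_n`, in the sense appropriate to a right-hand
side with zeros: `f_n = G_n (2 cos Θ_n + o(1) e^{|Im Θ_n|})`. On the real axis the error is `o(1)`
against the amplitude of the cosine. -/
def UniformCosEquiv (f G Θ : ℕ → ℂ → ℂ) (S : ℕ → Set ℂ) : Prop :=
  ∀ ε : ℝ, 0 < ε → ∀ᶠ n : ℕ in atTop, ∀ z ∈ S n,
    ‖f n z - G n z * (2 * Complex.cos (Θ n z))‖ ≤ ε * (‖G n z‖ * Real.exp |(Θ n z).im|)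

/-- Points at distance at least `δ` from the cut `[-√n d, 2√a]`. -/
def outerRegion (d a δ : ℝ) (n : ℕ) : Set ℂ :=
  {z | ∀ t : ℝ, -(Real.sqrt n * d) ≤ t → t ≤ 2 * Real.sqrt a → δ ≤ ‖z - (t : ℂ)‖}

/-- The closed rectangle of half-height `η` around the real interval `[l + δ, r - δ]`. -/
def box (l r δ η : ℝ) : Set ℂ :=
  {z | l + δ ≤ z.re ∧ z.re ≤ r - δ ∧ |z.im| ≤ η}

end PlancherelRotach

end

open Filter Asymptotics Complex Topology
open Real (Gamma_pos_of_pos add_one_le_exp arcosh cosh_eq cosh_pos exp_le_exp exp_one_lt_d9 exp_pos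
  log_le_sub_one_of_pos log_nonneg log_sqrt mul_self_sqrt norm_eq_abs norm_of_nonneg one_le_sqrt pi_gt_three
  pi_lt_four pi_ne_zero pi_pos rpow_def_of_pos rpow_nonneg self_le_sinh_iff sin_le sq_sqrt sqrt_div' sqrt_eq_rpow
  sqrt_le_iff sqrt_le_left sqrt_le_sqrt sqrt_mul sqrt_nonneg sqrt_pos sqrt_sq tendsto_exp_neg_atTop_nhds_zero
  tendsto_sqrt_atTop)
open scoped Real ComplexConjugate

noncomputable section

namespace PlancherelRotach

theorem norm_sub_one_le_of_difference_scheme {u e κ : ℕ → ℂ} {N : ℕ} {θ : ℝ} (hθ0 : 0 ≤ θ)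
    (hθ : θ < 1) (h0 : u 0 = 1) (h1 : u 1 - u 0 = e 0 * u 0)
    (hrec : ∀ k, k + 1 < N → u (k + 2) - u (k + 1) = e (k + 1) * u (k + 1) + κ (k + 1) * (u (k + 1) - u k))
    (hκ : ∀ k, k + 1 < N → ‖κ (k + 1)‖ ≤ θ)
    (hS : 2 * (∑ k ∈ Finset.range N, ‖e k‖) ≤ 1 - θ) :
    ∀ n, n ≤ N → ‖u n - 1‖ ≤ 2 * (∑ k ∈ Finset.range N, ‖e k‖) / (1 - θ) := by
  have hθ' : 0 < 1 - θ := by linarith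
  set S := ∑ k ∈ Finset.range N, ‖e k‖ with hSdef
  have hpart : ∀ n ≤ N, ∑ k ∈ Finset.range n, ‖e k‖ ≤ S := fun n hn =>
    Finset.sum_le_sum_of_subset_of_nonneg (Finset.range_mono hn) (fun _ _ _ => norm_nonneg _)
  have htel : ∀ n, ‖u n - 1‖ ≤ ∑ j ∈ Finset.range n, ‖u (j + 1) - u j‖ := by
    intro n
    have : u n - 1 = ∑ j ∈ Finset.range n, (u (j + 1) - u j) := by rw [Finset.sum_range_sub, h0]
    rw [this]
    exact norm_sum_le _ _
  have hu2 : ∀ n, (1 - θ) * (∑ j ∈ Finset.range n, ‖u (j + 1) - u j‖) ≤ 2 * S → ‖u n‖ ≤ 2 := by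
    intro n hn
    have h2 : ∑ j ∈ Finset.range n, ‖u (j + 1) - u j‖ ≤ 1 := by
      by_contra! hcon
      nlinarith
    have h3 := (htel n).trans h2
    calc ‖u n‖ = ‖(u n - 1) + 1‖ := by ring_nf
      _ ≤ ‖u n - 1‖ + ‖(1 : ℂ)‖ := norm_add_le _ _
      _ ≤ 2 := by rw [norm_one]; linarith
  have key : ∀ n, n + 1 ≤ N → (1 - θ) * (∑ j ∈ Finset.range (n + 1), ‖u (j + 1) - u j‖) + θ * ‖u (n + 1) - u n‖
        ≤ 2 * ∑ k ∈ Finset.range (n + 1), ‖e k‖ := by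
    intro n
    induction n with
    | zero =>
      intro _
      have : ‖u 1 - u 0‖ = ‖e 0‖ := by rw [h1, h0, mul_one]
      simp only [Finset.range_one, Finset.sum_singleton, zero_add, this]
      nlinarith [norm_nonneg (e 0)]
    | succ n ih =>
      intro hn
      have ih' := ih (by omega)
      have hb : ‖u (n + 1)‖ ≤ 2 := by
        apply hu2
        nlinarith [hpart (n + 1) (by omega), mul_nonneg hθ0 (norm_nonneg (u (n + 1) - u n))]
      have hst : ‖u (n + 2) - u (n + 1)‖ ≤ 2 * ‖e (n + 1)‖ + θ * ‖u (n + 1) - u n‖ := by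
        rw [hrec n (by omega)]
        grw [norm_add_le]
        rw [norm_mul, norm_mul]
        nlinarith [hκ n (by omega), norm_nonneg (e (n + 1)), norm_nonneg (u (n + 1) - u n)]
      rw [Finset.sum_range_succ _ (n + 1), Finset.sum_range_succ (fun k => ‖e k‖) (n + 1)]
      have : u (n + 1 + 1) = u (n + 2) := rfl
      rw [this]
      nlinarith
  intro n hn
  rw [le_div_iff₀ hθ']
  rcases n with _ | n
  · simp only [h0, sub_self, norm_zero, zero_mul]
    have : 0 ≤ S := Finset.sum_nonneg fun _ _ => norm_nonneg _
    linarith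
  · have h := key n hn
    have := htel (n + 1)
    have h3 := hpart (n + 1) hn
    nlinarith [mul_nonneg hθ0 (norm_nonneg (u (n + 1) - u n))]

theorem arctan_increment_lower {x h : ℝ} (h0 : 0 < h) (h1 : h ≤ 1) :
    h / (3 * (1 + x ^ 2)) ≤ Real.arctan (x + h) - Real.arctan x := by
  obtain ⟨c, hc, hc'⟩ := exists_hasDerivAt_eq_slope Real.arctan (fun t => 1 / (1 + t ^ 2))
    (by linarith : x < x + h) Real.continuous_arctan.continuousOn
    (fun t _ => Real.hasDerivAt_arctan t)
  have hh : x + h - x = h := by ring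
  rw [hh] at hc'
  have h2 : Real.arctan (x + h) - Real.arctan x = h * (1 / (1 + c ^ 2)) := by rw [hc']; field_simp
  rw [h2, div_eq_mul_one_div]
  apply mul_le_mul_of_nonneg_left _ h0.le
  apply one_div_le_one_div_of_le (by positivity)
  have : |c - x| ≤ 1 := by rw [abs_le]; constructor <;> linarith [hc.1, hc.2]
  have : (c - x) ^ 2 ≤ 1 := by rw [← sq_abs]; nlinarith [abs_nonneg (c - x)]
  nlinarith

theorem sum_inv_sq_add_le {ξ N : ℝ} (hN : 1 ≤ N) (n : ℕ) :
    ∑ k ∈ Finset.range n, 1 / ((ξ - k) ^ 2 + N) ≤ 3 * π / √N := by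
  have hs : 1 ≤ √N := by rw [Real.le_sqrt] <;> linarith
  have hs0 : 0 < √N := by linarith
  have hsq : √N ^ 2 = N := sq_sqrt (by linarith)
  have hstep : ∀ k : ℕ, 1 / ((ξ - k) ^ 2 + N) ≤ 3 / √N *
      (Real.arctan (((k + 1 : ℕ) - ξ) / √N) - Real.arctan ((k - ξ) / √N)) := by
    intro k
    have h := arctan_increment_lower (x := (k - ξ) / √N) (h := 1 / √N)
      (by positivity) (by rw [div_le_one hs0]; exact hs)
    have e1 : ((k : ℝ) - ξ) / √N + 1 / √N = ((k + 1 : ℕ) - ξ) / √N := by push_cast; ring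
    rw [e1] at h
    refine le_trans (le_of_eq ?_) (mul_le_mul_of_nonneg_left h (by positivity))
    have : (ξ - k) ^ 2 + N = N * (1 + (((k : ℝ) - ξ) / √N) ^ 2) := by rw [div_pow, hsq]; field_simp; ring
    rw [this]
    have h1 : 0 < 1 + (((k : ℝ) - ξ) / √N) ^ 2 := by positivity
    generalize 1 + (((k : ℝ) - ξ) / √N) ^ 2 = w at *
    nth_rewrite 1 [← hsq]
    field_simp
  refine (Finset.sum_le_sum fun k _ => hstep k).trans ?_
  rw [← Finset.mul_sum, Finset.sum_range_sub (fun k : ℕ => Real.arctan (((k : ℕ) - ξ) / √N))]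
  have h1 := Real.arctan_lt_pi_div_two (((n : ℕ) - ξ) / √N)
  have h2 := Real.neg_pi_div_two_lt_arctan (((0 : ℕ) - ξ) / √N)
  have : Real.arctan (((n : ℕ) - ξ) / √N) - Real.arctan (((0 : ℕ) - ξ) / √N) ≤ π := by linarith
  calc _ ≤ 3 / √N * π := mul_le_mul_of_nonneg_left this (by positivity)
    _ = _ := by ring

theorem csqrt_sq (z : ℂ) : sqrt z ^ 2 = z := by
  unfold sqrt
  exact_mod_cast cpow_nat_inv_pow z (n := 2) (by norm_num)

theorem csqrt_re_nonneg (z : ℂ) : 0 ≤ (sqrt z).re := by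
  rw [sqrt, cpow_inv_two_re]
  positivity

theorem csqrt_ne_zero {z : ℂ} (hz : z ≠ 0) : sqrt z ≠ 0 := by
  intro h
  apply hz
  rw [← csqrt_sq z, h]; simp

theorem eq_of_sq_eq_of_re_mul_conj {R S z : ℂ} (h : R ^ 2 = S ^ 2)
    (hR : 0 ≤ (R * conj z).re) (hS : 0 < (S * conj z).re) : R = S := by
  rcases sq_eq_sq_iff_eq_or_eq_neg.mp h with h | h
  · exact h
  · rw [h] at hR
    simp only [neg_mul, neg_re] at hR
    linarith

/-- The square root of `v ^ 2 - 4 y` with cut `[-2√y, 2√y]` which behaves like `v` at infinity. -/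
def outRoot (v y : ℂ) : ℂ := v * sqrt (1 - 4 * y / v ^ 2)

theorem outRoot_sq {v : ℂ} (hv : v ≠ 0) (y : ℂ) : outRoot v y ^ 2 = v ^ 2 - 4 * y := by
  rw [outRoot, mul_pow, csqrt_sq]
  field_simp

section

/-- The root of larger modulus of `t ^ 2 - v t + y`. -/
def bigRoot (v y : ℂ) : ℂ := (v + outRoot v y) / 2

/-- The root of smaller modulus of `t ^ 2 - v t + y`. -/
def smallRoot (v y : ℂ) : ℂ := (v - outRoot v y) / 2

theorem bigRoot_add_smallRoot (v y : ℂ) : bigRoot v y + smallRoot v y = v := by unfold bigRoot smallRoot; ring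

theorem bigRoot_sub_smallRoot (v y : ℂ) : bigRoot v y - smallRoot v y = outRoot v y := by
  unfold bigRoot smallRoot; ring

theorem bigRoot_mul_smallRoot {v : ℂ} (hv : v ≠ 0) (y : ℂ) : bigRoot v y * smallRoot v y = y := by
  have := outRoot_sq hv y
  unfold bigRoot smallRoot
  linear_combination (-1 / 4 : ℂ) * this

theorem outRoot_mul_conj_re_nonneg (v y : ℂ) : 0 ≤ (outRoot v y * conj v).re := by
  have h : outRoot v y * conj v = (normSq v : ℂ) * sqrt (1 - 4 * y / v ^ 2) := by
    rw [← mul_conj]; unfold outRoot; ring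
  rw [h, re_ofReal_mul]
  exact mul_nonneg (normSq_nonneg _) (csqrt_re_nonneg _)

theorem norm_smallRoot_le (v y : ℂ) : ‖smallRoot v y‖ ≤ ‖bigRoot v y‖ := by
  rw [← sq_le_sq₀ (norm_nonneg _) (norm_nonneg _), Complex.sq_norm, Complex.sq_norm]
  have h := outRoot_mul_conj_re_nonneg v y
  unfold smallRoot bigRoot
  simp only [normSq_apply, mul_re, conj_re, conj_im, div_ofNat_re, div_ofNat_im, add_re, add_im, sub_re, sub_im] at *
  nlinarith

theorem norm_le_two_mul_bigRoot (v y : ℂ) : ‖v‖ ≤ 2 * ‖bigRoot v y‖ := by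
  calc ‖v‖ = ‖bigRoot v y + smallRoot v y‖ := by rw [bigRoot_add_smallRoot]
    _ ≤ _ := norm_add_le _ _
    _ ≤ _ := by linarith [norm_smallRoot_le v y]

theorem norm_outRoot_le_two_mul_bigRoot (v y : ℂ) : ‖outRoot v y‖ ≤ 2 * ‖bigRoot v y‖ := by
  calc ‖outRoot v y‖ = ‖bigRoot v y - smallRoot v y‖ := by rw [bigRoot_sub_smallRoot]
    _ ≤ _ := norm_sub_le _ _
    _ ≤ _ := by linarith [norm_smallRoot_le v y]

/-- `v` has distance at least `D` from the real interval `[-2√y, 2√y]`. -/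
def OffCut (v : ℂ) (y D : ℝ) : Prop := ∀ r : ℝ, |r| ≤ 2 * √y → D ≤ ‖v - r‖

namespace OffCut

variable {v : ℂ} {y D : ℝ} (h : OffCut v y D) (hD : 0 < D) (hy : 0 ≤ y)
include h

theorem norm_ge : D ≤ ‖v‖ := by simpa using h 0 (by simp)

include hD in
theorem ne_zero : v ≠ 0 := by rw [← norm_pos_iff]; linarith [h.norm_ge]

include hD hy

theorem mem_slitPlane : 1 - 4 * (y : ℂ) / v ^ 2 ∈ slitPlane := by
  by_contra hcon
  have hv := h.ne_zero hD
  rw [mem_slitPlane_iff_not_le_zero, not_not, Complex.le_def] at hcon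
  obtain ⟨hre, him⟩ := hcon
  set w : ℂ := 1 - 4 * (y : ℂ) / v ^ 2 with hw
  have hwr : w = ((w.re : ℝ) : ℂ) := by apply Complex.ext <;> simp [him]
  set t := w.re with ht
  have ht0 : t ≤ 0 := by simpa using hre
  have e1 : v ^ 2 * ((1 - t : ℝ) : ℂ) = 4 * y := by
    push_cast
    rw [← hwr, hw]; field_simp; ring
  have ht1 : (0 : ℝ) < 1 - t := by linarith
  have e2 : v ^ 2 = ((4 * y / (1 - t) : ℝ) : ℂ) := by
    have : ((1 - t : ℝ) : ℂ) ≠ 0 := by exact_mod_cast ht1.ne'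
    rw [eq_comm]
    push_cast at this ⊢
    rw [div_eq_iff this]
    push_cast at e1
    exact e1.symm
  set r := √(4 * y / (1 - t)) with hr
  have hr2 : r ^ 2 = 4 * y / (1 - t) := sq_sqrt (by positivity)
  have hr0 : 0 ≤ r := sqrt_nonneg _
  have hrle : r ≤ 2 * √y := by
    rw [hr]
    rw [show 2 * √y = √(4 * y) by
      rw [sqrt_mul (by norm_num), show (4 : ℝ) = 2 ^ 2 by norm_num, sqrt_sq (by norm_num)]]
    apply sqrt_le_sqrt
    rw [div_le_iff₀ ht1]
    nlinarith
  have e3 : v ^ 2 = (r : ℂ) ^ 2 := by rw [e2, ← hr2]; push_cast; ring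
  rcases sq_eq_sq_iff_eq_or_eq_neg.mp e3 with h1 | h1
  · have := h r (by rw [abs_of_nonneg hr0]; exact hrle)
    rw [h1, sub_self, norm_zero] at this
    linarith
  · have := h (-r) (by rw [abs_neg, abs_of_nonneg hr0]; exact hrle)
    rw [h1] at this
    simp at this
    linarith

theorem outRoot_mul_conj_re_pos : 0 < (outRoot v y * conj v).re := by
  have e : outRoot v y * conj v = (normSq v : ℂ) * sqrt (1 - 4 * y / v ^ 2) := by
    rw [← mul_conj]; unfold outRoot; ring
  rw [e, re_ofReal_mul]
  refine mul_pos (normSq_pos.mpr (h.ne_zero hD)) ?_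
  rw [sqrt, cpow_inv_two_re]
  apply sqrt_pos.mpr
  have h2 : 0 < ‖(1 - 4 * (y : ℂ) / v ^ 2)‖ + (1 - 4 * (y : ℂ) / v ^ 2).re := by
    have h3 := abs_re_le_norm (1 - 4 * (y : ℂ) / v ^ 2)
    rcases (h.mem_slitPlane hD hy) with h4 | h4
    · linarith [norm_nonneg (1 - 4 * (y : ℂ) / v ^ 2)]
    · have := abs_re_lt_norm.mpr h4
      linarith [abs_lt.mp this]
  linarith

theorem le_norm_outRoot : D ≤ ‖outRoot v y‖ := by
  have h1 := h (2 * √y) (by rw [abs_of_nonneg (by positivity)])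
  have h2 := h (-(2 * √y)) (by rw [abs_neg, abs_of_nonneg (by positivity)])
  have e : outRoot v y ^ 2 = (v - ((2 * √y : ℝ) : ℂ)) * (v - ((-(2 * √y) : ℝ) : ℂ)) := by
    have hs : ((√y : ℝ) : ℂ) ^ 2 = y := by rw [← ofReal_pow, sq_sqrt hy]
    rw [outRoot_sq (h.ne_zero hD)]
    push_cast
    linear_combination (4 : ℂ) * hs
  have : D ^ 2 ≤ ‖outRoot v y‖ ^ 2 := by
    rw [← norm_pow, e, norm_mul, sq]
    gcongr
  exact (sq_le_sq₀ hD.le (norm_nonneg _)).mp this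

theorem le_norm_bigRoot : D ≤ 2 * ‖bigRoot v y‖ :=
  (h.le_norm_outRoot hD hy).trans (norm_outRoot_le_two_mul_bigRoot _ _)

theorem bigRoot_ne_zero : bigRoot v y ≠ 0 := by rw [← norm_pos_iff]; linarith [h.le_norm_bigRoot hD hy]

theorem sqrt_add_le_norm_bigRoot : √y + D / 2 ≤ ‖bigRoot v y‖ := by
  have hl0 := h.bigRoot_ne_zero hD hy
  set l := bigRoot v y with hl
  have hln := norm_pos_iff.mpr hl0
  have hprod := bigRoot_mul_smallRoot (h.ne_zero hD) y
  set q := √y with hq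
  have hq0 : 0 ≤ q := sqrt_nonneg _
  have hq2 := sq_sqrt hy
  have hlq : q ≤ ‖l‖ := by
    have h1 : y ≤ ‖l‖ ^ 2 := by
      have : ‖l * smallRoot v y‖ = y := by rw [hprod, Complex.norm_of_nonneg hy]
      rw [norm_mul] at this
      nlinarith [norm_smallRoot_le v y, norm_nonneg l]
    exact sqrt_le_left hln.le |>.mpr h1 |> fun h => h
  have hs : smallRoot v y = y * conj l / ‖l‖ ^ 2 := by
    have h1 : l * conj l = (‖l‖ : ℂ) ^ 2 := by rw [mul_conj, normSq_eq_norm_sq]; push_cast; ring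
    have h2 : (‖l‖ : ℂ) ≠ 0 := by exact_mod_cast hln.ne'
    field_simp
    apply mul_left_cancel₀ hl0
    calc l * (smallRoot v y * (‖l‖ : ℂ) ^ 2) = (l * smallRoot v y) * (‖l‖ : ℂ) ^ 2 := by ring
      _ = y * (l * conj l) := by rw [hprod, h1]
      _ = _ := by ring
  have hD' := h (2 * q * l.re / ‖l‖) (by
    rw [abs_div, abs_mul, abs_of_nonneg (by positivity : 0 ≤ 2 * q), abs_of_pos hln, div_le_iff₀ hln]
    exact mul_le_mul_of_nonneg_left (abs_re_le_norm l) (by positivity))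
  have e : v - ((2 * q * l.re / ‖l‖ : ℝ) : ℂ)
      = l * ((1 - q / ‖l‖ : ℝ) : ℂ) + conj l * ((y / ‖l‖ ^ 2 - q / ‖l‖ : ℝ) : ℂ) := by
    have h2 : (‖l‖ : ℂ) ≠ 0 := by exact_mod_cast hln.ne'
    have h3 : (2 * l.re : ℂ) = l + conj l := by rw [add_conj]; push_cast; ring
    have h4 : v = l + y * conj l / ‖l‖ ^ 2 := by rw [← hs, hl, bigRoot_add_smallRoot]
    conv_lhs => rw [h4]
    push_cast
    field_simp
    linear_combination (-(q : ℂ) * ‖l‖) * h3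
  rw [e] at hD'
  have h5 : ‖l * ((1 - q / ‖l‖ : ℝ) : ℂ)‖ = ‖l‖ - q := by
    rw [norm_mul, norm_real, norm_eq_abs, abs_of_nonneg]
    · field_simp
    · rw [sub_nonneg, div_le_one hln]; exact hlq
  have h6 : ‖conj l * ((y / ‖l‖ ^ 2 - q / ‖l‖ : ℝ) : ℂ)‖ ≤ ‖l‖ - q := by
    rw [norm_mul, norm_real, norm_eq_abs, RCLike.norm_conj, abs_of_nonpos]
    · have : ‖l‖ * -(y / ‖l‖ ^ 2 - q / ‖l‖) = q - y / ‖l‖ := by field_simp; ring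
      rw [this, ← hq2]
      have : q - q ^ 2 / ‖l‖ = q * (‖l‖ - q) / ‖l‖ := by field_simp
      rw [this, div_le_iff₀ hln]
      nlinarith
    · rw [← hq2, sub_nonpos, div_le_div_iff₀ (by positivity) hln]
      nlinarith [mul_nonneg hq0 hln.le]
  linarith [hD'.trans (norm_add_le _ _)]

end OffCut

theorem norm_bigRoot_le {v : ℂ} (hv : v ≠ 0) {y : ℝ} (hy : 0 ≤ y) : ‖bigRoot v y‖ ≤ ‖outRoot v y‖ + √y := by
  have h1 : ‖v‖ ^ 2 ≤ (‖outRoot v y‖ + 2 * √y) ^ 2 := by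
    have e : v ^ 2 = outRoot v y ^ 2 + 4 * y := by rw [outRoot_sq hv]; ring
    have : ‖v ^ 2‖ ≤ ‖outRoot v y‖ ^ 2 + 4 * y := by
      rw [e]
      grw [norm_add_le]
      rw [norm_pow, norm_mul, Complex.norm_of_nonneg hy]
      norm_num
    rw [norm_pow] at this
    nlinarith [sq_sqrt hy, mul_nonneg (norm_nonneg (outRoot v y)) (sqrt_nonneg y)]
  have h3 : ‖bigRoot v y‖ ≤ (‖v‖ + ‖outRoot v y‖) / 2 := by
    rw [bigRoot, norm_div]
    have := norm_add_le v (outRoot v y)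
    simp only [norm_ofNat]
    linarith
  linarith [(abs_le_of_sq_le_sq' h1 (by positivity)).2]

theorem hasDerivAt_outRoot {v y : ℂ → ℂ} {v' y' t : ℂ} (hv : HasDerivAt v v' t)
    (hy : HasDerivAt y y' t) (h0 : v t ≠ 0) (hs : 1 - 4 * y t / v t ^ 2 ∈ slitPlane) :
    HasDerivAt (fun t => outRoot (v t) (y t)) ((v t * v' - 2 * y') / outRoot (v t) (y t)) t := by
  have hd : DifferentiableAt ℂ (fun t => outRoot (v t) (y t)) t := by
    unfold outRoot
    apply hv.differentiableAt.mul
    exact (differentiableAt_sqrt hs).comp t ((differentiableAt_const _).sub (((hy.differentiableAt.const_mul 4)).div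
        (hv.differentiableAt.pow 2) (pow_ne_zero _ h0)))
  have hR : outRoot (v t) (y t) ≠ 0 := by
    unfold outRoot
    exact mul_ne_zero h0 (csqrt_ne_zero (slitPlane_ne_zero hs))
  have h2 : HasDerivAt (fun t => outRoot (v t) (y t) ^ 2) (2 * v t * v' - 4 * y') t := by
    have h3 : HasDerivAt (fun t => v t ^ 2 - 4 * y t) (2 * v t * v' - 4 * y') t := by
      have := (hv.pow 2).sub (hy.const_mul 4)
      refine this.congr_deriv ?_
      simp
    refine h3.congr_of_eventuallyEq ?_
    filter_upwards [hv.continuousAt.eventually_ne h0] with u hu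
    exact outRoot_sq hu _
  have h4 := (hd.hasDerivAt.pow 2).unique h2
  refine hd.hasDerivAt.congr_deriv ?_
  rw [eq_div_iff hR]
  simp only [Nat.add_one_sub_one, pow_one, Nat.cast_ofNat] at h4
  linear_combination h4 / 2

theorem hasDerivAt_bigRoot {v y : ℂ → ℂ} {v' y' t : ℂ} (hv : HasDerivAt v v' t)
    (hy : HasDerivAt y y' t) (h0 : v t ≠ 0) (hs : 1 - 4 * y t / v t ^ 2 ∈ slitPlane) :
    HasDerivAt (fun t => bigRoot (v t) (y t)) ((bigRoot (v t) (y t) * v' - y') / outRoot (v t) (y t)) t := by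
  have hR : outRoot (v t) (y t) ≠ 0 := by
    unfold outRoot
    exact mul_ne_zero h0 (csqrt_ne_zero (slitPlane_ne_zero hs))
  refine ((hv.add (hasDerivAt_outRoot hv hy h0 hs)).div_const 2).congr_deriv ?_
  unfold bigRoot
  field_simp
  ring

end

section

/-- The dominant characteristic root at time `s`. -/
def lam (a : ℝ) (x : ℂ) (s : ℝ) : ℂ := bigRoot (x - s) (a * s)

/-- The recessive characteristic root at time `s`. -/
def sig (a : ℝ) (x : ℂ) (s : ℝ) : ℂ := smallRoot (x - s) (a * s)

/-- The discriminant root at time `s`. -/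
def disc (a : ℝ) (x : ℂ) (s : ℝ) : ℂ := outRoot (x - s) (a * s)

/-- The logarithmic derivative of `lam`. -/
def lamLog (a : ℝ) (x : ℂ) (s : ℝ) : ℂ := -(1 + a / lam a x s) / disc a x s

/-- The logarithmic derivative of the amplitude. -/
def ampLog (a : ℝ) (x : ℂ) (s : ℝ) : ℂ := (1 + a / lam a x s) * (x - s) / (2 * disc a x s ^ 2)

/-- The exponent of the approximate solution. -/
def wkbExp (a : ℝ) (x : ℂ) (s : ℝ) : ℂ := -s + (x + a + 1 / 2) * log (1 + s / lam a x s)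
    - log (disc a x s / lam a x s) / 2 - a * s / lam a x s

/-- The approximate solution of the recurrence. -/
def wkb (a : ℝ) (x : ℂ) (n : ℕ) : ℂ := lam a x n ^ n * exp (wkbExp a x n)

/-- The conditions at time `s` under which the approximation is differentiable. -/
structure Good (a : ℝ) (x : ℂ) (D s : ℝ) : Prop where
  ha : 0 < a
  hD : 0 < D
  nonneg : 0 ≤ s
  offCut : OffCut (x - s) (a * s) D
  slit : 1 + (s : ℂ) / lam a x s ∈ slitPlane

variable {a : ℝ} {x : ℂ} {D s : ℝ}

theorem lam_add_sig (a : ℝ) (x : ℂ) (s : ℝ) : lam a x s + sig a x s = x - s := bigRoot_add_smallRoot _ _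

theorem lam_sub_sig (a : ℝ) (x : ℂ) (s : ℝ) : lam a x s - sig a x s = disc a x s := bigRoot_sub_smallRoot _ _

theorem norm_sig_le (a : ℝ) (x : ℂ) (s : ℝ) : ‖sig a x s‖ ≤ ‖lam a x s‖ := norm_smallRoot_le _ _

theorem lam_mul_sig (h : x - s ≠ 0) : lam a x s * sig a x s = a * s := bigRoot_mul_smallRoot h _

theorem norm_lam_mul_norm_sig (ha : 0 ≤ a) (hs : 0 ≤ s) (h : x - s ≠ 0) : ‖lam a x s‖ * ‖sig a x s‖ = a * s := by
  rw [← norm_mul, lam_mul_sig h, norm_mul, Complex.norm_of_nonneg ha, Complex.norm_of_nonneg hs]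

theorem norm_lam_le (h : x - s ≠ 0) (hs : 0 ≤ a * s) : ‖lam a x s‖ ≤ ‖disc a x s‖ + √(a * s) := by
  simpa [lam, disc] using norm_bigRoot_le h hs

theorem OffCut.sqrt_add_le_norm_lam (h : OffCut (x - s) (a * s) D) (hD : 0 < D) (hs : 0 ≤ a * s) :
    √(a * s) + D / 2 ≤ ‖lam a x s‖ := by
  simpa [lam] using h.sqrt_add_le_norm_bigRoot hD hs

theorem OffCut.le_norm_disc (h : OffCut (x - s) (a * s) D) (hD : 0 < D) (hs : 0 ≤ a * s) : D ≤ ‖disc a x s‖ := by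
  simpa [disc] using h.le_norm_outRoot hD hs

namespace Good

theorem disc_le (a : ℝ) (x : ℂ) (s : ℝ) : ‖disc a x s‖ ≤ 2 * ‖lam a x s‖ := norm_outRoot_le_two_mul_bigRoot _ _

theorem v_le (a : ℝ) (x : ℂ) (s : ℝ) : ‖x - s‖ ≤ 2 * ‖lam a x s‖ := norm_le_two_mul_bigRoot _ _

theorem add_disc (a : ℝ) (x : ℂ) (s : ℝ) : x - s + disc a x s = 2 * lam a x s := by unfold disc lam bigRoot; ring

theorem norm_lam_add_le (ha : 0 < a) (hal : a ≤ ‖lam a x s‖) : ‖lam a x s + a‖ ≤ 2 * ‖lam a x s‖ := by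
  grw [norm_add_le]
  rw [Complex.norm_of_nonneg ha.le]
  linarith

theorem norm_one_add_le (ha : 0 < a) (hal : a ≤ ‖lam a x s‖) : ‖1 + a / lam a x s‖ ≤ 2 := by
  grw [norm_add_le]
  rw [norm_div, Complex.norm_of_nonneg ha.le, norm_one]
  have : a / ‖lam a x s‖ ≤ 1 := (div_le_one (by linarith)).mpr hal
  linarith

theorem norm_v_add_le (ha : 0 < a) (hal : a ≤ ‖lam a x s‖) : ‖x - s + 2 * a‖ ≤ 4 * ‖lam a x s‖ := by
  grw [norm_add_le]
  rw [norm_mul, Complex.norm_of_nonneg ha.le, norm_ofNat]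
  linarith [v_le a x s]

variable (h : Good a x D s)
include h

theorem mul_nn : 0 ≤ a * s := mul_nonneg h.ha.le h.nonneg

theorem ne_zero : x - s ≠ 0 := h.offCut.ne_zero h.hD

theorem sqrt_add_le : √(a * s) + D / 2 ≤ ‖lam a x s‖ := h.offCut.sqrt_add_le_norm_lam h.hD h.mul_nn

theorem le_disc : D ≤ ‖disc a x s‖ := h.offCut.le_norm_disc h.hD h.mul_nn

theorem lam_ne : lam a x s ≠ 0 := norm_pos_iff.mp (by linarith [h.sqrt_add_le, sqrt_nonneg (a * s), h.hD])

theorem disc_ne : disc a x s ≠ 0 := norm_pos_iff.mp (h.hD.trans_le h.le_disc)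

theorem sig_lt : ‖sig a x s‖ < ‖lam a x s‖ := by
  have h4 := norm_lam_mul_norm_sig h.ha.le h.nonneg h.ne_zero
  by_contra! hcon
  nlinarith [h.hD, sq_sqrt h.mul_nn, sqrt_nonneg (a * s), h.sqrt_add_le]

theorem sig_le {c : ℝ} (hc : √(a * s) ≤ c * ‖lam a x s‖) : ‖sig a x s‖ ≤ c * ‖lam a x s‖ := by
  have hl := norm_pos_iff.mpr h.lam_ne
  have h1 : √(a * s) ≤ ‖lam a x s‖ := by linarith [h.sqrt_add_le, h.hD]
  refine le_of_mul_le_mul_left ?_ hl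
  rw [norm_lam_mul_norm_sig h.ha.le h.nonneg h.ne_zero]
  nlinarith [mul_le_mul h1 hc (sqrt_nonneg _) hl.le, mul_self_sqrt h.mul_nn]

theorem lam_mul_sig : lam a x s * sig a x s = a * s := PlancherelRotach.lam_mul_sig h.ne_zero

theorem quad : lam a x s * (x - s - lam a x s) = a * s := by rw [← h.lam_mul_sig, ← lam_add_sig a x s]; ring

theorem hasDerivAt_disc : HasDerivAt (disc a x) (-(x - s + 2 * a) / disc a x s) s := by
  have hv : HasDerivAt (fun t : ℂ => x - t) (-1) (s : ℂ) := (hasDerivAt_id _).const_sub x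
  have hy : HasDerivAt (fun t : ℂ => a * t) a (s : ℂ) := by simpa using (hasDerivAt_id (s : ℂ)).const_mul (a : ℂ)
  have hsl := h.offCut.mem_slitPlane h.hD h.mul_nn
  push_cast at hsl
  have := (hasDerivAt_outRoot hv hy (h.ne_zero) hsl).comp_ofReal
  refine this.congr_deriv ?_
  unfold disc; ring

theorem hasDerivAt_lam : HasDerivAt (lam a x) (-(lam a x s + a) / disc a x s) s := by
  have hv : HasDerivAt (fun t : ℂ => x - t) (-1) (s : ℂ) := (hasDerivAt_id _).const_sub x
  have hy : HasDerivAt (fun t : ℂ => a * t) a (s : ℂ) := by simpa using (hasDerivAt_id (s : ℂ)).const_mul (a : ℂ)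
  have hsl := h.offCut.mem_slitPlane h.hD h.mul_nn
  push_cast at hsl
  have := (hasDerivAt_bigRoot hv hy (h.ne_zero) hsl).comp_ofReal
  refine this.congr_deriv ?_
  unfold disc lam; ring

theorem ratio_slit : disc a x s / lam a x s ∈ slitPlane := by
  left
  rw [← lam_sub_sig, sub_div, div_self h.lam_ne, sub_re, one_re]
  have : ‖sig a x s / lam a x s‖ < 1 := by rw [norm_div, div_lt_one (norm_pos_iff.mpr h.lam_ne)]; exact h.sig_lt
  linarith [re_le_norm (sig a x s / lam a x s)]

theorem hasDerivAt_exponent {l : ℂ} (hl : l ≠ 0) (hsl : lam a x s / l ∈ slitPlane) :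
    HasDerivAt (fun s : ℝ => s * log (lam a x s / l) + wkbExp a x s) (log (lam a x s / l) + ampLog a x s) s := by
  have hL := h.lam_ne
  have hR := h.disc_ne
  have dL := h.hasDerivAt_lam
  have did : HasDerivAt (fun s : ℝ => (s : ℂ)) 1 s := ofRealCLM.hasDerivAt
  have d1 := (dL.div_const l).clog_real hsl
  have d2 : HasDerivAt (fun s : ℝ => log (1 + s / lam a x s))
      (((1 * lam a x s - s * (-(lam a x s + a) / disc a x s)) / lam a x s ^ 2) / (1 + s / lam a x s)) s :=
    ((did.div dL hL).const_add 1).clog_real h.slit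
  have d3 : HasDerivAt (fun s : ℝ => log (disc a x s / lam a x s))
      (((-(x - s + 2 * a) / disc a x s * lam a x s - disc a x s * (-(lam a x s + a) / disc a x s))
        / lam a x s ^ 2) / (disc a x s / lam a x s)) s :=
    ((h.hasDerivAt_disc).div dL hL).clog_real (h.ratio_slit)
  have d4 := (did.const_mul (a : ℂ)).div dL hL
  have hfin := (did.mul d1).add (((did.neg.add (d2.const_mul (x + a + 1 / 2))).sub (d3.div_const 2)).sub d4)
  refine hfin.congr_deriv ?_
  have hq := h.quad
  have hRs := Good.add_disc a x s
  have h1 := slitPlane_ne_zero h.slit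
  unfold ampLog
  generalize log (lam a x s / l) = Lg
  generalize lam a x s = L at *
  generalize disc a x s = R at *
  generalize (s : ℂ) = S at *
  generalize (a : ℂ) = A at *
  have hx : x = S + 2 * L - R := by linear_combination hRs
  have hAS : A * S = L * (L - R) := by rw [← hq, hx]; ring
  have h1' : L + S ≠ 0 := by grind
  have T2 : (x + A + 1 / 2) * ((1 * L - S * (-(L + A) / R)) / L ^ 2 / (1 + S / L)) = (x + A + 1 / 2) * (1 / R) := by
    congr 1
    field_simp
    linear_combination hAS
  have T1 : S * (-(L + A) / R / l / (L / l)) = -(S * L + L * (L - R)) / (R * L) := by rw [← hAS]; field_simp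
  have T4 : (A * 1 * L - A * S * (-(L + A) / R)) / L ^ 2 = (A * L + L * (L - R) * (L + A) / R) / L ^ 2 := by
    rw [hAS]; ring
  rw [T1, T2, T4, hx]
  field_simp
  ring

theorem exists_hasDerivAt_lamLog (hal : a ≤ ‖lam a x s‖) {Q : ℝ} (hQ : ‖lam a x s‖ ^ 2 / ‖disc a x s‖ ^ 4 ≤ Q) :
    ∃ g', HasDerivAt (lamLog a x) g' s ∧ ‖g'‖ ≤ 24 * Q := by
  have hL := h.lam_ne
  have hR := h.disc_ne
  have hd : HasDerivAt (lamLog a x) (-(a * (lam a x s + a) / (lam a x s ^ 2 * disc a x s ^ 2)) -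
        (1 + a / lam a x s) * (x - s + 2 * a) / disc a x s ^ 3) s := by
    have := (((hasDerivAt_const s (a : ℂ)).div (h.hasDerivAt_lam) hL).const_add 1).neg.div (h.hasDerivAt_disc) hR
    refine this.congr_deriv ?_
    simp only [Pi.neg_apply, Pi.div_apply]
    field_simp
    ring
  refine ⟨_, hd, ?_⟩
  have b1 := norm_lam_add_le h.ha hal
  have b2 := norm_one_add_le h.ha hal
  have b3 := norm_v_add_le h.ha hal
  have b4 := disc_le a x s
  have hl0 := norm_pos_iff.mpr hL
  have hr0 := norm_pos_iff.mpr hR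
  grw [norm_sub_le]
  rw [norm_neg, norm_div, norm_mul, norm_mul, norm_div, norm_mul, norm_pow, norm_pow, norm_pow, Complex.norm_of_nonneg h.ha.le]
  set l := ‖lam a x s‖
  set r := ‖disc a x s‖
  have c1 : a * ‖lam a x s + a‖ / (l ^ 2 * r ^ 2) ≤ 8 * (l ^ 2 / r ^ 4) := by
    calc a * ‖lam a x s + a‖ / (l ^ 2 * r ^ 2) ≤ l * (2 * l) / (l ^ 2 * r ^ 2) := by gcongr
      _ = 2 * r ^ 2 / r ^ 4 := by field_simp
      _ ≤ 2 * (2 * l) ^ 2 / r ^ 4 := by gcongr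
      _ = _ := by ring
  have c2 : ‖1 + a / lam a x s‖ * ‖x - s + 2 * a‖ / r ^ 3 ≤ 16 * (l ^ 2 / r ^ 4) := by
    calc ‖1 + a / lam a x s‖ * ‖x - s + 2 * a‖ / r ^ 3 ≤ 2 * (4 * l) / r ^ 3 := by gcongr
      _ = 8 * l * r / r ^ 4 := by field_simp; norm_num
      _ ≤ 8 * l * (2 * l) / r ^ 4 := by gcongr
      _ = _ := by ring
  linarith

theorem exists_hasDerivAt_ampLog (hal : a ≤ ‖lam a x s‖) {Q : ℝ} (hQ : ‖lam a x s‖ ^ 2 / ‖disc a x s‖ ^ 4 ≤ Q) :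
    ∃ g', HasDerivAt (ampLog a x) g' s ∧ ‖g'‖ ≤ 24 * Q := by
  have hL := h.lam_ne
  have hR := h.disc_ne
  have dv : HasDerivAt (fun s : ℝ => x - s) (-1) s := (ofRealCLM.hasDerivAt (x := s)).const_sub x
  have hd : HasDerivAt (ampLog a x) (a * (lam a x s + a) * (x - s) / (2 * lam a x s ^ 2 * disc a x s ^ 3)
        - (1 + a / lam a x s) / (2 * disc a x s ^ 2)
        + (1 + a / lam a x s) * (x - s) * (x - s + 2 * a) / disc a x s ^ 4) s := by
    have := ((((hasDerivAt_const s (a : ℂ)).div (h.hasDerivAt_lam) hL).const_add 1).mul dv).div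
      (((h.hasDerivAt_disc).pow 2).const_mul 2) (mul_ne_zero two_ne_zero (pow_ne_zero 2 hR))
    refine this.congr_deriv ?_
    simp only [Nat.add_one_sub_one, pow_one, Nat.cast_ofNat, Pi.pow_apply, Pi.mul_apply, Pi.div_apply]
    field_simp
    ring
  refine ⟨_, hd, ?_⟩
  have b1 := norm_lam_add_le h.ha hal
  have b2 := norm_one_add_le h.ha hal
  have b3 := norm_v_add_le h.ha hal
  have b4 := disc_le a x s
  have b5 := v_le a x s
  have hl0 := norm_pos_iff.mpr hL
  have hr0 := norm_pos_iff.mpr hR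
  refine (norm_add_le _ _).trans ((add_le_add_left (norm_sub_le _ _) _).trans ?_)
  simp only [norm_div, norm_mul, norm_pow, Complex.norm_of_nonneg h.ha.le, norm_ofNat]
  set l := ‖lam a x s‖
  set r := ‖disc a x s‖
  have c1 : a * ‖lam a x s + a‖ * ‖x - s‖ / (2 * l ^ 2 * r ^ 3) ≤ 4 * (l ^ 2 / r ^ 4) := by
    calc a * ‖lam a x s + a‖ * ‖x - s‖ / (2 * l ^ 2 * r ^ 3)
        ≤ l * (2 * l) * (2 * l) / (2 * l ^ 2 * r ^ 3) := by gcongr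
      _ = 2 * l * r / r ^ 4 := by field_simp
      _ ≤ 2 * l * (2 * l) / r ^ 4 := by gcongr
      _ = _ := by ring
  have c2 : ‖1 + a / lam a x s‖ / (2 * r ^ 2) ≤ 4 * (l ^ 2 / r ^ 4) := by
    calc ‖1 + a / lam a x s‖ / (2 * r ^ 2) ≤ 2 / (2 * r ^ 2) := by gcongr
      _ = r ^ 2 / r ^ 4 := by field_simp
      _ ≤ (2 * l) ^ 2 / r ^ 4 := by gcongr
      _ = _ := by ring
  have c3 : ‖1 + a / lam a x s‖ * ‖x - s‖ * ‖x - s + 2 * a‖ / r ^ 4 ≤ 16 * (l ^ 2 / r ^ 4) := by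
    calc ‖1 + a / lam a x s‖ * ‖x - s‖ * ‖x - s + 2 * a‖ / r ^ 4
        ≤ 2 * (2 * l) * (4 * l) / r ^ 4 := by gcongr
      _ = _ := by ring
  linarith

end Good

theorem exponent_step {k h Q : ℝ} (hh : h ^ 2 = 1) (hg : ∀ s ∈ Set.uIcc k (k + h), Good a x D s)
    (hal : ∀ s ∈ Set.uIcc k (k + h), a ≤ ‖lam a x s‖)
    (hnear : ∀ s ∈ Set.uIcc k (k + h), ‖lam a x s / lam a x k - 1‖ < 1)
    (hQ : ∀ s ∈ Set.uIcc k (k + h), ‖lam a x s‖ ^ 2 / ‖disc a x s‖ ^ 4 ≤ Q) :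
    ‖((k + h : ℝ) : ℂ) * log (lam a x (k + h) / lam a x k) + wkbExp a x (k + h)
      - wkbExp a x k - (lamLog a x k / 2 + h * ampLog a x k)‖ ≤ 48 * Q := by
  have habs : |h| = 1 := by grind
  have hkS : k ∈ Set.uIcc k (k + h) := Set.left_mem_uIcc
  have hkhS : k + h ∈ Set.uIcc k (k + h) := Set.right_mem_uIcc
  have hdist : ∀ s ∈ Set.uIcc k (k + h), |s - k| ≤ 1 := by
    intro s hs
    have := Set.abs_sub_left_of_mem_uIcc hs
    simpa [habs] using this
  have hconv : Convex ℝ (Set.uIcc k (k + h)) := convex_uIcc _ _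
  have hl := (hg k hkS).lam_ne
  have hQ0 := le_trans (by positivity) (hQ k hkS)
  have hsl : ∀ s ∈ Set.uIcc k (k + h), lam a x s / lam a x k ∈ slitPlane := by
    intro s hs
    left
    have h1 := hnear s hs
    have h3 := (abs_lt.mp ((abs_re_le_norm (lam a x s / lam a x k - 1)).trans_lt h1)).1
    simp only [sub_re, one_re] at h3
    linarith
  have key : ∀ {f : ℝ → ℂ} {C : ℝ}, 0 ≤ C → (∀ t ∈ Set.uIcc k (k + h), ∃ g, HasDerivAt f g t ∧ ‖g‖ ≤ C) →
      ∀ s ∈ Set.uIcc k (k + h), ‖f s - f k‖ ≤ C := by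
    intro f C hC hf s hs
    choose! g hg hb using hf
    refine (hconv.norm_image_sub_le_of_norm_hasDerivWithin_le (fun t ht => (hg t ht).hasDerivWithinAt) hb hkS hs).trans ?_
    rw [norm_eq_abs]
    exact mul_le_of_le_one_right hC (hdist s hs)
  have hb1 := key (by positivity) fun t ht => (hg t ht).exists_hasDerivAt_lamLog (hal t ht) (hQ t ht)
  have hb2 := key (by positivity) fun t ht => (hg t ht).exists_hasDerivAt_ampLog (hal t ht) (hQ t ht)
  have did : ∀ s : ℝ, HasDerivAt (fun s : ℝ => (s : ℂ) - k) 1 s := fun s =>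
    (ofRealCLM.hasDerivAt (x := s)).sub_const _
  have hb3 := key (f := fun s : ℝ => log (lam a x s / lam a x k) - (s - k) * lamLog a x k) (C := 24 * Q)
    (by positivity) fun t ht => by
      refine ⟨_, ((((hg t ht).hasDerivAt_lam).div_const (lam a x k)).clog_real
        (hsl t ht)).sub ((did t).mul_const (lamLog a x k)), (le_of_eq (congrArg norm ?_)).trans (hb1 t ht)⟩
      have := (hg t ht).lam_ne
      have := (hg t ht).disc_ne
      rw [one_mul, sub_left_inj]
      unfold lamLog
      field_simp
  simp only [sub_self, zero_mul, sub_zero, div_self hl, log_one] at hb3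
  have hfin := key (f := fun s : ℝ => (s * log (lam a x s / lam a x k) + wkbExp a x s)
      - ((s - k) ^ 2 / 2 * lamLog a x k + (s - k) * ampLog a x k)) (C := 48 * Q) (by positivity) (fun t ht => by
      refine ⟨_, ((hg t ht).hasDerivAt_exponent hl (hsl t ht)).sub (((((did t).pow 2).div_const 2).mul_const
        (lamLog a x k)).add ((did t).mul_const (ampLog a x k))), ?_⟩
      refine (le_of_eq (congrArg norm ?_)).trans ((norm_add_le_of_le (hb3 t ht) (hb2 t ht)).trans (by linarith))
      simp
      ring) _ hkhS
  have hhc : (h : ℂ) ^ 2 = 1 := by exact_mod_cast hh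
  have e : ∀ z w : ℂ, z + w - wkbExp a x k - (lamLog a x k / 2 + h * ampLog a x k)
      = (z + w - (((k + h : ℝ) - k) ^ 2 / 2 * lamLog a x k + ((k + h : ℝ) - k) * ampLog a x k))
        - ((k * log (lam a x k / lam a x k) + wkbExp a x k)
          - (((k : ℂ) - k) ^ 2 / 2 * lamLog a x k + ((k : ℂ) - k) * ampLog a x k)) := by
    intro z w
    rw [div_self hl, log_one]
    push_cast
    grind
  rw [e]
  exact hfin

end

section

theorem norm_exp_le_three {z : ℂ} (hz : ‖z‖ ≤ 1) : ‖exp z‖ ≤ 3 := by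
  refine (norm_exp_le_exp_norm z).trans ?_
  have : rexp ‖z‖ ≤ rexp 1 := exp_le_exp.mpr hz
  linarith [exp_one_lt_d9]

theorem residual_bound {l σ g q Jp Jm : ℂ} {b Q T : ℝ} (hσ : ‖σ‖ ≤ ‖l‖)
    (hid : g / 2 + q + σ / l * (g / 2 - q) = 0) (hT0 : 0 ≤ T) (hTQ : T ^ 2 = Q) (hT : 48 * T ≤ 1)
    (h1 : ‖g / 2 + q‖ ≤ 4 * T) (h2 : ‖g / 2 - q‖ ≤ 4 * T)
    (hp : ‖Jp - (g / 2 + q)‖ ≤ 48 * Q) (hm : ‖Jm - (g / 2 - q)‖ ≤ 48 * Q)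
    (hb : |b| / ‖l‖ ^ 2 ≤ 16 * |b| * Q) :
    ‖exp (-Jp) * (1 + σ / l * (1 - exp Jm) - b / l ^ 2 * exp Jm) - 1‖ ≤ (250 + 144 * |b|) * Q := by
  have hQT : 48 * Q ≤ T := by rw [← hTQ]; nlinarith
  have nJp : ‖Jp‖ ≤ 5 * T := by
    calc ‖Jp‖ = ‖(Jp - (g / 2 + q)) + (g / 2 + q)‖ := by ring_nf
      _ ≤ _ := norm_add_le _ _
      _ ≤ _ := by linarith
  have nJm : ‖Jm‖ ≤ 5 * T := by
    calc ‖Jm‖ = ‖(Jm - (g / 2 - q)) + (g / 2 - q)‖ := by ring_nf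
      _ ≤ _ := norm_add_le _ _
      _ ≤ _ := by linarith
  have r1 := norm_exp_sub_one_sub_id_le (x := -Jp) (by rw [norm_neg]; linarith)
  have r2 := norm_exp_sub_one_sub_id_le (x := Jm) (by linarith)
  have E1 := norm_exp_le_three (z := -Jp) (by rw [norm_neg]; linarith)
  have E2 := norm_exp_le_three (z := Jm) (by linarith)
  rw [norm_neg] at r1
  have r1' : ‖exp (-Jp) - 1 - -Jp‖ ≤ 25 * Q := by rw [← hTQ]; nlinarith [norm_nonneg Jp]
  have r2' : ‖exp Jm - 1 - Jm‖ ≤ 25 * Q := by rw [← hTQ]; nlinarith [norm_nonneg Jm]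
  have hw : ‖σ / l‖ ≤ 1 := by rw [norm_div]; exact div_le_one_of_le₀ hσ (norm_nonneg _)
  have hbl : ‖(b : ℂ) / l ^ 2‖ ≤ 16 * |b| * Q := by rw [norm_div, norm_pow, norm_real, norm_eq_abs]; exact hb
  generalize exp (-Jp) = X at *
  generalize exp Jm = Y at *
  generalize (b : ℂ) / l ^ 2 = β at *
  generalize σ / l = w at *
  have e : X * (1 + w * (1 - Y) - β * Y) - 1
      = (-(Jp - (g / 2 + q)) - w * (Jm - (g / 2 - q))) + (X - 1 - -Jp) - w * (Y - 1 - Jm)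
        + w * (Jm + (Y - 1 - Jm)) * (Jp - (X - 1 - -Jp)) - X * (β * Y) := by
    linear_combination -hid
  rw [e]
  have m1 : ‖w * (Jm - (g / 2 - q))‖ ≤ 48 * Q := by rw [norm_mul]; nlinarith [norm_nonneg (Jm - (g / 2 - q))]
  have m2 : ‖w * (Y - 1 - Jm)‖ ≤ 25 * Q := by rw [norm_mul]; nlinarith [norm_nonneg (Y - 1 - Jm)]
  have hQ0 : 0 ≤ Q := by rw [← hTQ]; positivity
  have m3 : ‖w * (Jm + (Y - 1 - Jm)) * (Jp - (X - 1 - -Jp))‖ ≤ 100 * Q := by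
    rw [norm_mul, norm_mul]
    have a1 : ‖Jm + (Y - 1 - Jm)‖ ≤ 10 * T := (norm_add_le _ _).trans (by linarith)
    have a2 : ‖Jp - (X - 1 - -Jp)‖ ≤ 10 * T := (norm_sub_le _ _).trans (by linarith)
    calc ‖w‖ * ‖Jm + (Y - 1 - Jm)‖ * ‖Jp - (X - 1 - -Jp)‖ ≤ 1 * (10 * T) * (10 * T) := by gcongr
      _ = 100 * Q := by rw [← hTQ]; ring
  have m4 : ‖X * (β * Y)‖ ≤ 144 * |b| * Q := by
    rw [norm_mul, norm_mul]
    calc ‖X‖ * (‖β‖ * ‖Y‖) ≤ 3 * (16 * |b| * Q * 3) := by gcongr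
      _ = _ := by ring
  have t1 := norm_sub_le (-(Jp - (g / 2 + q))) (w * (Jm - (g / 2 - q)))
  rw [norm_neg] at t1
  grw [norm_sub_le]
  refine (add_le_add_left (norm_add_le _ _) _).trans ?_
  refine (add_le_add_left (add_le_add_left (norm_sub_le _ _) _) _).trans ?_
  refine (add_le_add_left (add_le_add_left (add_le_add_left (norm_add_le _ _) _) _) _).trans ?_
  linarith

/-- `x` has distance at least `D` from the interval swept by the oscillatory intervals up to
time `N`. -/
def Far (a : ℝ) (x : ℂ) (N D : ℝ) : Prop := ∀ y : ℝ, -a ≤ y → y ≤ N + 2 * √(a * N) → D ≤ ‖x - y‖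

variable {a : ℝ} {x : ℂ} {N D s : ℝ}

theorem neg_le_sub_two_sqrt (ha : 0 < a) (hs : 0 ≤ s) : -a ≤ s - 2 * √(a * s) := by
  rw [sqrt_mul ha.le]
  nlinarith [sq_nonneg (√a - √s), sq_sqrt ha.le, sq_sqrt hs]

theorem Far.offCut_of (ha : 0 < a) (h : Far a x N D) (hs : 0 ≤ s) (hsN : s ≤ N) : OffCut (x - s) (a * s) D := by
  intro r hr
  have h1 := neg_le_sub_two_sqrt ha hs
  have h2 : √(a * s) ≤ √(a * N) := sqrt_le_sqrt (by nlinarith)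
  have h3 := abs_le.mp hr
  have := h (s + r) (by linarith) (by linarith)
  refine this.trans (le_of_eq ?_)
  push_cast; ring_nf

theorem Far.good (ha : 0 < a) (hD : 0 < D) (h : Far a x N D) (hs : 0 ≤ s) (hsN : s ≤ N) : Good a x D s := by
  have hoff := h.offCut_of ha hs hsN
  have hv := hoff.ne_zero hD
  refine ⟨ha, hD, hs, hoff, by_contra fun hcon => ?_⟩
  have hl : lam a x s ≠ 0 := norm_pos_iff.mp (by
    linarith [hoff.sqrt_add_le_norm_lam hD (mul_nonneg ha.le hs), sqrt_nonneg (a * s)])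
  have hbig : a * s ≤ ‖lam a x s‖ ^ 2 := by
    rw [← norm_lam_mul_norm_sig ha.le hs hv, sq]; exact mul_le_mul_of_nonneg_left (norm_sig_le ..) (norm_nonneg _)
  rw [mem_slitPlane_iff_not_le_zero, not_not, Complex.le_def] at hcon
  simp only [add_re, one_re, zero_re, add_im, one_im, zero_add, zero_im] at hcon
  set q := -(s / lam a x s).re
  have hq : 1 ≤ q := by linarith
  have e1 : (s : ℂ) = ((-q : ℝ) : ℂ) * lam a x s := by
    rw [← div_eq_iff hl]; exact Complex.ext (by simp [q]) (by simpa using hcon.2)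
  have hqc : (q : ℂ) ≠ 0 := ofReal_ne_zero.mpr (by linarith)
  have e2 : lam a x s = ((-(s / q) : ℝ) : ℂ) := by push_cast; rw [e1]; push_cast; field_simp
  have hs0 : 0 < s := hs.lt_of_ne (by rintro rfl; simp [hl, hqc] at e1)
  have hr : 0 < s / q := by positivity
  have hrs : s / q ≤ s := div_le_self hs hq
  rw [e2, norm_real, norm_neg, norm_eq_abs, sq_abs] at hbig
  have hx := lam_add_sig a x s
  have hm : lam a x s * sig a x s = a * s := lam_mul_sig hv
  rw [e2] at hx hm
  generalize s / q = r at *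
  have hrc : (r : ℂ) ≠ 0 := ofReal_ne_zero.mpr hr.ne'
  have har : a ≤ r := by nlinarith
  have := h (s - r - a * s / r) ?_ ?_
  · have e : x = ((s - r - a * s / r : ℝ) : ℂ) := by
      push_cast at hx hm ⊢
      field_simp
      linear_combination -r * hx - hm
    rw [← e, sub_self, norm_zero] at this
    linarith
  · have : a * s / r ≤ s - r + a := by
      rw [div_le_iff₀ hr]; nlinarith [mul_nonneg (sub_nonneg.mpr hrs) (sub_nonneg.mpr har)]
    linarith
  · have : 0 ≤ a * s / r := by positivity
    linarith [sqrt_nonneg (a * N)]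

theorem Far.sq_le_disc (ha : 0 < a) {δ : ℝ} (hδ : 0 < δ) (hδ1 : δ ≤ 1) (hN : 0 < N)
    (h : Far a x N (δ * √N)) (hs : 0 ≤ s) (hsN : s ≤ N) :
    δ ^ 2 / (16 * a + 8) * ((x.re - s) ^ 2 + N) ≤ ‖disc a x s‖ ^ 2 := by
  set m := δ ^ 2 / (16 * a + 8) * ((x.re - s) ^ 2 + N) with hm
  have hm0 : 0 < m := by positivity
  have hoff : OffCut (x - s) (a * s) (√m) := by
    intro r hr
    have h1 := h.offCut_of ha hs hsN r hr
    have h2 : |x.re - s| - 2 * √(a * N) ≤ ‖x - s - r‖ := by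
      have h3 := abs_re_le_norm (x - s - r)
      simp only [sub_re, ofReal_re] at h3
      have h4 : |x.re - s| ≤ |x.re - s - r| + |r| := by
        calc |x.re - s| = |(x.re - s - r) + r| := by ring_nf
          _ ≤ _ := abs_add_le _ _
      have h5 : √(a * s) ≤ √(a * N) := sqrt_le_sqrt (by nlinarith)
      linarith
    apply sqrt_le_iff.mpr
    refine ⟨norm_nonneg _, ?_⟩
    have hN2 : (δ * √N) ^ 2 = δ ^ 2 * N := by rw [mul_pow, sq_sqrt hN.le]
    have h6 : δ ^ 2 * N ≤ ‖x - s - r‖ ^ 2 := by rw [← hN2]; gcongr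
    have hH : √(a * N) ^ 2 = a * N := sq_sqrt (by positivity)
    have hδ2 : δ ^ 2 ≤ 1 := by nlinarith
    rw [hm, div_mul_eq_mul_div, div_le_iff₀ (by positivity), ← sq_abs (x.re - s)]
    have hX0 := abs_nonneg (x.re - s)
    generalize |x.re - s| = X at *
    generalize ‖x - s - r‖ = Y at *
    have hH0 := sqrt_nonneg (a * N)
    generalize √(a * N) = H at *
    by_cases hX : 4 * H ≤ X
    · have : (X / 2) ^ 2 ≤ Y ^ 2 := by apply pow_le_pow_left₀ <;> linarith
      nlinarith [mul_nonneg ha.le (sq_nonneg Y), sq_nonneg X]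
    · push Not at hX
      have : X ^ 2 ≤ 16 * (a * N) := by nlinarith
      nlinarith [mul_nonneg ha.le (sq_nonneg Y), sq_nonneg δ]
  have := hoff.le_norm_disc (sqrt_pos.mpr hm0) (mul_nonneg ha.le hs)
  calc m = √m ^ 2 := (sq_sqrt hm0.le).symm
    _ ≤ _ := by gcongr

end

section

variable {a : ℝ} {x : ℂ}

theorem wkb_ne_zero {n : ℕ} (hl : lam a x n ≠ 0) : wkb a x n ≠ 0 := mul_ne_zero (pow_ne_zero _ hl) (exp_ne_zero _)

theorem wkb_succ_div {n : ℕ} (h0 : lam a x n ≠ 0) (h1 : lam a x (n + 1 : ℕ) ≠ 0) :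
    wkb a x (n + 1) = wkb a x n * (lam a x n * exp (((n + 1 : ℕ) : ℂ) * log (lam a x (n + 1 : ℕ) / lam a x n)
        + wkbExp a x (n + 1 : ℕ) - wkbExp a x n)) := by
  have hq : lam a x (n + 1 : ℕ) / lam a x n ≠ 0 := div_ne_zero h1 h0
  unfold wkb
  rw [sub_eq_add_neg, exp_add, exp_add, exp_nat_mul, exp_log hq, exp_neg, div_pow]
  have := exp_ne_zero (wkbExp a x n)
  field_simp
  rw [pow_succ]

theorem wkb_pred_div {n : ℕ} (h0 : lam a x (n + 1 : ℕ) ≠ 0) (h1 : lam a x n ≠ 0) :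
    wkb a x n = wkb a x (n + 1) * ((lam a x (n + 1 : ℕ))⁻¹ * exp ((n : ℂ) * log (lam a x n / lam a x (n + 1 : ℕ))
        + wkbExp a x n - wkbExp a x (n + 1 : ℕ))) := by
  have hq : lam a x n / lam a x (n + 1 : ℕ) ≠ 0 := div_ne_zero h1 h0
  unfold wkb
  rw [sub_eq_add_neg, exp_add, exp_add, exp_nat_mul, exp_log hq, exp_neg, div_pow]
  have := exp_ne_zero (wkbExp a x (n + 1 : ℕ))
  field_simp
  rw [pow_succ']

/-- Quantities attached to the region at relative distance `δ` from the cut. -/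
def qBound (a δ : ℝ) (x : ℂ) (N k : ℝ) : ℝ := 3 * (1 + √a) ^ 2 * (16 * a + 8) / δ ^ 4 * (1 / ((x.re - k) ^ 2 + N))

/-- The analytic input for one step of the recurrence. -/
structure StepBound (a δ : ℝ) (x : ℂ) (N : ℕ) : Prop where
  lam_ne : ∀ k : ℕ, k ≤ N → lam a x k ≠ 0
  ratio : ∀ k : ℕ, k ≤ N → ‖sig a x k / lam a x k‖ ≤ 1 - δ / (2 * √a + 1)
  inv : ∀ k : ℕ, k ≤ N → 1 / ‖lam a x k‖ ^ 2 ≤ 16 * qBound a δ x N k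
  main : ∀ k : ℕ, k ≤ N → ‖lamLog a x k / 2 + ampLog a x k‖ ≤ 4 * √(qBound a δ x N k) ∧
    ‖lamLog a x k / 2 - ampLog a x k‖ ≤ 4 * √(qBound a δ x N k)
  up : ∀ k : ℕ, k + 1 ≤ N → ‖((k + 1 : ℕ) : ℂ) * log (lam a x (k + 1 : ℕ) / lam a x k)
        + wkbExp a x (k + 1 : ℕ) - wkbExp a x k - (lamLog a x k / 2 + ampLog a x k)‖
      ≤ 48 * qBound a δ x N k
  down : ∀ k : ℕ, k + 1 ≤ N → ‖(k : ℂ) * log (lam a x k / lam a x (k + 1 : ℕ)) + wkbExp a x k - wkbExp a x (k + 1 : ℕ)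
        - (lamLog a x (k + 1 : ℕ) / 2 - ampLog a x (k + 1 : ℕ))‖
      ≤ 48 * qBound a δ x N (k + 1 : ℕ)

section
variable (ha : 0 < a) {δ : ℝ} (hδ : 0 < δ) (hδ1 : δ ≤ 1) {N : ℕ} (hN1 : 1 ≤ N) (hD1 : 2 * a ≤ δ * √N)
  (hD2 : 4 * (1 + √a) < δ ^ 2 * √N) (hfar : Far a x N (δ * √N))
include ha hδ hδ1 hN1 hD1 hD2 hfar

theorem stepBound_of_far : StepBound a δ x N := by
  have hN0 : (0 : ℝ) < N := Nat.cast_pos.mpr hN1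
  have hNr : (1 : ℝ) ≤ N := by exact_mod_cast hN1
  have hsN := sqrt_pos.mpr hN0
  have hD := mul_pos hδ hsN
  have hsa := sqrt_nonneg a
  have hg : ∀ s ∈ Set.Icc (0 : ℝ) N, Good a x (δ * √N) s := fun s h => hfar.good ha hD h.1 h.2
  have hal : ∀ s ∈ Set.Icc (0 : ℝ) N, a ≤ ‖lam a x s‖ := fun s h => by
    linarith [(hg s h).sqrt_add_le, sqrt_nonneg (a * s)]
  have hr : ∀ s ∈ Set.Icc (0 : ℝ) N, 0 < ‖disc a x s‖ := fun s h => norm_pos_iff.mpr (hg s h).disc_ne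
  have hSN : ∀ s ∈ Set.Icc (0 : ℝ) N, √(a * s) ≤ √a * √N := fun s h => by
    rw [← sqrt_mul ha.le]; exact sqrt_le_sqrt (by nlinarith [h.2])
  set K := (1 + √a) / δ with hK
  have hK0 : 0 < K := by positivity
  have hKR : ∀ s ∈ Set.Icc (0 : ℝ) N, ‖lam a x s‖ ≤ K * ‖disc a x s‖ := fun s h => by
    refine (norm_lam_le (hg s h).ne_zero (hg s h).mul_nn).trans ?_
    rw [hK, div_mul_eq_mul_div, le_div_iff₀ hδ]
    linarith [mul_le_mul_of_nonneg_left (hg s h).le_disc hsa, mul_le_mul_of_nonneg_right (hSN s h) hδ.le,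
      mul_le_mul_of_nonneg_left hδ1 (norm_nonneg (disc a x s))]
  have hQ : ∀ k : ℝ, ∀ s ∈ Set.Icc (0 : ℝ) N, |s - k| ≤ 1 → ‖lam a x s‖ ^ 2 / ‖disc a x s‖ ^ 4 ≤ qBound a δ x N k := by
    intro k s h hks
    have h4 := hr s h
    calc ‖lam a x s‖ ^ 2 / ‖disc a x s‖ ^ 4
        ≤ (K * ‖disc a x s‖) ^ 2 / ‖disc a x s‖ ^ 4 := by gcongr; exact hKR s h
      _ = K ^ 2 / ‖disc a x s‖ ^ 2 := by field_simp
      _ ≤ K ^ 2 / (δ ^ 2 / (16 * a + 8) * (((x.re - k) ^ 2 + N) / 3)) := by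
        gcongr
        refine le_trans ?_ (hfar.sq_le_disc ha hδ hδ1 hN0 h.1 h.2)
        gcongr
        nlinarith [sq_nonneg ((x.re - s) - (s - k)), (sq_le_one_iff_abs_le_one _).mpr hks]
      _ = _ := by unfold qBound; rw [hK]; field_simp
  have hnear : ∀ k ∈ Set.Icc (0 : ℝ) N, ∀ s ∈ Set.Icc (0 : ℝ) N, |s - k| ≤ 1 → ‖lam a x s / lam a x k - 1‖ < 1 := by
    intro k hk s hs hks
    have hmv := (convex_Icc (0 : ℝ) N).norm_image_sub_le_of_norm_hasDerivWithin_le (C := 2 * K)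
      (fun t ht => (hg t ht).hasDerivAt_lam.hasDerivWithinAt) (fun t ht => by
        rw [norm_div, norm_neg, div_le_iff₀ (hr t ht)]
        linarith [Good.norm_lam_add_le ha (hal t ht), hKR t ht]) hk hs
    have hl := (hg k hk).lam_ne
    rw [div_sub_one hl, norm_div, div_lt_one (norm_pos_iff.mpr hl)]
    have h4 : 4 * K < δ * √N := by rw [hK, mul_div_assoc', div_lt_iff₀ hδ]; linarith
    rw [norm_eq_abs] at hmv
    nlinarith [(hg k hk).sqrt_add_le, sqrt_nonneg (a * k)]
  have hstep : ∀ k h : ℝ, h ^ 2 = 1 → k ∈ Set.Icc (0 : ℝ) N → k + h ∈ Set.Icc (0 : ℝ) N →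
      ‖((k + h : ℝ) : ℂ) * log (lam a x (k + h) / lam a x k) + wkbExp a x (k + h)
        - wkbExp a x k - (lamLog a x k / 2 + h * ampLog a x k)‖ ≤ 48 * qBound a δ x N k := by
    intro k h hh a1 a2
    have hsub := Set.uIcc_subset_Icc a1 a2
    have habs : ∀ s ∈ Set.uIcc k (k + h), |s - k| ≤ 1 := fun s hs => (Set.abs_sub_left_of_mem_uIcc hs).trans (by
      rw [add_sub_cancel_left]; exact (sq_le_one_iff_abs_le_one h).mp hh.le)
    exact exponent_step hh (fun s hs => hg s (hsub hs)) (fun s hs => hal s (hsub hs))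
      (fun s hs => hnear k a1 s (hsub hs) (habs s hs)) fun s hs => hQ k s (hsub hs) (habs s hs)
  have hm : ∀ {k : ℕ}, k ≤ N → (k : ℝ) ∈ Set.Icc (0 : ℝ) N := fun h => ⟨Nat.cast_nonneg _, Nat.cast_le.mpr h⟩
  refine ⟨fun k hk => (hg k (hm hk)).lam_ne, fun k hk => ?_, fun k hk => ?_, fun k hk => ?_, fun k hk => ?_,
    fun k hk => ?_⟩
  · have hl := norm_pos_iff.mpr (hg k (hm hk)).lam_ne
    rw [norm_div, div_le_iff₀ hl]
    refine (hg k (hm hk)).sig_le ?_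
    have h2 := (hg k (hm hk)).sqrt_add_le
    have hden : 0 < 2 * √a + 1 := by positivity
    rw [one_sub_div hden.ne', div_mul_eq_mul_div, le_div_iff₀ hden]
    nlinarith [mul_le_mul_of_nonneg_left h2 (show 0 ≤ 2 * √a + 1 - δ by linarith), mul_nonneg hsa hsN.le, hSN k (hm hk)]
  · have hl := norm_pos_iff.mpr (hg k (hm hk)).lam_ne
    have := hr k (hm hk)
    calc 1 / ‖lam a x k‖ ^ 2 ≤ 16 * (‖lam a x k‖ ^ 2 / ‖disc a x k‖ ^ 4) := by
          rw [mul_div_assoc', div_le_div_iff₀ (by positivity) (by positivity)]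
          calc 1 * ‖disc a x k‖ ^ 4 ≤ (2 * ‖lam a x k‖) ^ 4 := by rw [one_mul]; gcongr; exact Good.disc_le a x k
            _ = _ := by ring
      _ ≤ _ := by linarith [hQ k k (hm hk) (by simp)]
  · have hr := hr k (hm hk)
    have h1 := Good.disc_le a x k
    have h3 := Good.norm_one_add_le ha (hal k (hm hk))
    have hT : ‖lam a x k‖ / ‖disc a x k‖ ^ 2 ≤ √(qBound a δ x N k) := by
      apply Real.le_sqrt_of_sq_le
      rw [div_pow, ← pow_mul]; exact hQ k k (hm hk) (by simp)
    have n1 : ‖lamLog a x k / 2‖ ≤ 2 * (‖lam a x k‖ / ‖disc a x k‖ ^ 2) := by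
      rw [lamLog, norm_div, norm_div, norm_neg, norm_ofNat]
      calc _ ≤ 2 / ‖disc a x k‖ / 2 := by gcongr
        _ = ‖disc a x k‖ / ‖disc a x k‖ ^ 2 := by field_simp
        _ ≤ 2 * ‖lam a x k‖ / ‖disc a x k‖ ^ 2 := by gcongr
        _ = _ := by ring
    have n2 : ‖ampLog a x k‖ ≤ 2 * (‖lam a x k‖ / ‖disc a x k‖ ^ 2) := by
      rw [ampLog, norm_div, norm_mul, norm_mul, norm_pow, norm_ofNat]
      calc _ ≤ 2 * (2 * ‖lam a x k‖) / (2 * ‖disc a x k‖ ^ 2) := by gcongr; exact Good.v_le a x k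
        _ = _ := by field_simp
    exact ⟨(norm_add_le _ _).trans (by linarith), (norm_sub_le _ _).trans (by linarith)⟩
  · have := hstep k 1 (by norm_num) (hm (by omega)) (by exact_mod_cast hm hk)
    push_cast at this ⊢
    simpa using this
  · have h1 : ((k : ℝ) + 1) + (-1) = k := by ring
    have := hstep (k + 1) (-1) (by norm_num) (by exact_mod_cast hm hk) (by rw [h1]; exact hm (by omega))
    rw [h1] at this
    push_cast at this ⊢
    rwa [neg_one_mul, ← sub_eq_add_neg] at this

end

end

section

/-- A solution of the recurrence (with `d = 1`) with the initial values of `π_n`. -/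
structure IsPi (a b : ℝ) (x : ℂ) (p : ℕ → ℂ) : Prop where
  zero : p 0 = 1
  one : p 1 = x
  step : ∀ n : ℕ, p (n + 2) = (x - (n + 1)) * p (n + 1) - (a * (n + 1) + b) * p n

variable {a b : ℝ} {x : ℂ}

theorem lamLog_ampLog_identity {s : ℝ} (hl : lam a x s ≠ 0) : lamLog a x s / 2 + ampLog a x s
      + sig a x s / lam a x s * (lamLog a x s / 2 - ampLog a x s) = 0 := by
  unfold lamLog ampLog
  rw [← lam_add_sig a x s, ← lam_sub_sig]
  field_simp
  ring

theorem recurrence_step_identity {u u₁ u₂ w l σ v Jp Jm β B : ℂ} (hw : w ≠ 0) (hl : l ≠ 0)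
    (hv : v = l + σ) (hB : B = l * σ + β)
    (h : u₂ * (w * (l * exp Jp)) = v * (u₁ * w) - B * (u * (w * (l⁻¹ * exp Jm)))) :
    u₂ - u₁ = (exp (-Jp) * (1 + σ / l * (1 - exp Jm) - β / l ^ 2 * exp Jm) - 1) * u₁
      + (exp (-Jp) * exp Jm * (σ / l + β / l ^ 2)) * (u₁ - u) := by
  have he := exp_ne_zero Jp
  rw [exp_neg]
  generalize exp Jp = X at *
  generalize exp Jm = Y at *
  subst hv hB
  have h2 : u₂ = ((l + σ) * u₁ - (l * σ + β) * (u * (l⁻¹ * Y))) / (l * X) := by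
    rw [eq_div_iff (mul_ne_zero hl he)]
    apply mul_left_cancel₀ hw
    linear_combination h
  rw [h2]
  field_simp
  ring

theorem contraction_bound {Jp Jm w β : ℂ} {T t c : ℝ} (ht : t ≤ 1) (hc : 0 ≤ c)
    (hT0 : 0 ≤ T) (hT : 160 * (1 + c) * T ≤ t)
    (hJp : ‖Jp‖ ≤ 5 * T) (hJm : ‖Jm‖ ≤ 5 * T) (hw : ‖w‖ ≤ 1 - t) (hβ : ‖β‖ ≤ 16 * c * T ^ 2) :
    ‖exp (-Jp) * exp Jm * (w + β)‖ ≤ 1 - t / 2 := by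
  have hcT : 0 ≤ c * T := mul_nonneg hc hT0
  rw [← exp_add, norm_mul]
  have h1 : ‖exp (-Jp + Jm)‖ ≤ 1 + 20 * T := by
    have h2 : ‖-Jp + Jm‖ ≤ 10 * T := (norm_add_le_of_le ((norm_neg Jp).le.trans hJp) hJm).trans (by linarith)
    linarith [norm_exp_sub_one_le (x := -Jp + Jm) (by linarith), norm_le_norm_sub_add (exp (-Jp + Jm)) 1, norm_one (α := ℂ)]
  have h4 : ‖w + β‖ ≤ 1 - t + T / 10 := (norm_add_le _ _).trans (by nlinarith)
  calc ‖exp (-Jp + Jm)‖ * ‖w + β‖ ≤ (1 + 20 * T) * (1 - t + T / 10) := by gcongr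
    _ ≤ _ := by nlinarith

theorem IsPi.norm_div_wkb_sub_one_le (ha : 0 < a) {p : ℕ → ℂ} (hp : IsPi a b x p) {δ t S : ℝ}
    (hδ : 0 < δ) (hδ1 : δ ≤ 1) {N : ℕ} (hN1 : 1 ≤ N) (hD1 : 2 * a ≤ δ * √N)
    (hD2 : 4 * (1 + √a) < δ ^ 2 * √N) (hfar : Far a x N (δ * √N)) (ht : t = δ / (2 * √a + 1))
    (hT : ∀ k : ℕ, 160 * (1 + |b|) * √(qBound a δ x N k) ≤ t)
    (hS : (250 + 144 * |b|) * ∑ k ∈ Finset.range N, qBound a δ x N k = S) (hSt : 4 * S ≤ t) {n : ℕ} (hn : n ≤ N) :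
    ‖p n / wkb a x n - 1‖ ≤ 4 * S / t := by
  have hs := stepBound_of_far ha hδ hδ1 hN1 hD1 hD2 hfar
  have hsN : 0 < √N := sqrt_pos.mpr (Nat.cast_pos.mpr hN1)
  have hsa := sqrt_nonneg a
  have ht0 : 0 < t := by rw [ht]; positivity
  have ht1 : t ≤ 1 := by rw [ht, div_le_one (by positivity)]; linarith
  have hQnn : ∀ k : ℝ, 0 ≤ qBound a δ x N k := fun k => by unfold qBound; positivity
  set T : ℕ → ℝ := fun k => √(qBound a δ x N k) with hTdef
  have hT0 : ∀ k, 0 ≤ T k := fun k => sqrt_nonneg _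
  have hTQ : ∀ k, T k ^ 2 = qBound a δ x N k := fun k => sq_sqrt (hQnn _)
  have hb0 := abs_nonneg b
  have hT48 : ∀ k, 48 * T k ≤ 1 := fun k => by nlinarith [hT k, hT0 k, mul_nonneg hb0 (hT0 k)]
  have hid : ∀ k : ℕ, k ≤ N → lamLog a x k / 2 + ampLog a x k
      + sig a x k / lam a x k * (lamLog a x k / 2 - ampLog a x k) = 0 := fun k hk =>
    lamLog_ampLog_identity (hs.lam_ne k hk)
  have hlσ : ∀ k : ℕ, k ≤ N → lam a x k * sig a x k = a * k := fun k hk => by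
    simpa using (hfar.good ha (mul_pos hδ hsN) (Nat.cast_nonneg k) (Nat.cast_le.mpr hk)).lam_mul_sig
  have hlv : ∀ k : ℕ, x - k = lam a x k + sig a x k := fun k => by simpa using (lam_add_sig a x k).symm
  -- one-step exponents
  set Jp : ℕ → ℂ := fun k => ((k + 1 : ℕ) : ℂ) * log (lam a x (k + 1 : ℕ) / lam a x k)
        + wkbExp a x (k + 1 : ℕ) - wkbExp a x k with hJp
  set Jm : ℕ → ℂ := fun k => (k : ℂ) * log (lam a x k / lam a x (k + 1 : ℕ))
        + wkbExp a x k - wkbExp a x (k + 1 : ℕ) with hJm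
  have nJ : ∀ {J m : ℂ} {k : ℕ}, ‖m‖ ≤ 4 * T k → ‖J - m‖ ≤ 48 * qBound a δ x N k → ‖J‖ ≤ 5 * T k := by
    intro J m k h1 h2
    rw [← hTQ] at h2
    nlinarith [norm_le_norm_sub_add J m, hT0 k, hT48 k]
  set e : ℕ → ℂ := fun k => match k with
    | 0 => exp (-Jp 0) - 1
    | (j + 1) => exp (-Jp (j + 1)) * (1 + sig a x (j + 1 : ℕ) / lam a x (j + 1 : ℕ)
        * (1 - exp (Jm j)) - b / lam a x (j + 1 : ℕ) ^ 2 * exp (Jm j)) - 1 with he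
  set κ : ℕ → ℂ := fun k => exp (-Jp k) * exp (Jm (k - 1)) * (sig a x k / lam a x k + b / lam a x k ^ 2) with hκ
  have hbl : ∀ k : ℕ, k ≤ N → |b| / ‖lam a x k‖ ^ 2 ≤ 16 * |b| * qBound a δ x N k := fun k hk => by
    have := mul_le_mul_of_nonneg_left (hs.inv k hk) hb0
    rw [mul_one_div] at this
    linarith
  have hσ0 : sig a x (0 : ℕ) = 0 := (mul_eq_zero.mp (by simpa using hlσ 0 (Nat.zero_le _))).resolve_left
    (hs.lam_ne 0 (Nat.zero_le _))
  have hebound : ∀ k, k + 1 ≤ N → ‖e k‖ ≤ (250 + 144 * |b|) * qBound a δ x N k := by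
    intro k hk
    rcases k with _ | j
    · have h1 := residual_bound (b := 0) (norm_sig_le ..) (hid 0 (Nat.zero_le _)) (hT0 0) (hTQ 0) (hT48 0)
        (hs.main 0 (Nat.zero_le _)).1 (hs.main 0 (Nat.zero_le _)).2 (hs.up 0 hk)
        (Jm := lamLog a x (0 : ℕ) / 2 - ampLog a x (0 : ℕ))
        (by rw [sub_self, norm_zero]; linarith [hQnn (0 : ℕ)]) (by simp)
      simp only [hσ0, zero_div, zero_mul, add_zero, ofReal_zero, sub_zero, mul_one, abs_zero, mul_zero] at h1
      exact h1.trans (mul_le_mul_of_nonneg_right (by linarith) (hQnn (0 : ℕ)))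
    · exact residual_bound (norm_sig_le ..) (hid (j + 1) (by omega)) (hT0 _) (hTQ _) (hT48 _)
        (hs.main _ (by omega)).1 (hs.main _ (by omega)).2 (hs.up _ hk) (hs.down j (by omega))
        (hbl _ (by omega))
  have hκb : ∀ k, k + 1 < N → ‖κ (k + 1)‖ ≤ 1 - t / 2 := by
    intro k hk
    refine contraction_bound ht1 hb0 (hT0 (k + 1)) (hT (k + 1)) (nJ (hs.main _ (by omega)).1 (hs.up _ (by omega)))
      (nJ (hs.main _ (by omega)).2 (hs.down _ (by omega))) (ht ▸ hs.ratio (k + 1) (by omega)) ?_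
    rw [norm_div, norm_pow, norm_real, norm_eq_abs, hTQ]
    exact hbl _ (by omega)
  have hup : ∀ k, k + 1 ≤ N → wkb a x (k + 1) = wkb a x k * (lam a x k * exp (Jp k)) :=
    fun k hk => wkb_succ_div (hs.lam_ne k (by omega)) (hs.lam_ne _ hk)
  have hdown : ∀ k, k + 1 ≤ N → wkb a x k = wkb a x (k + 1) * ((lam a x (k + 1 : ℕ))⁻¹ * exp (Jm k)) :=
    fun k hk => wkb_pred_div (hs.lam_ne _ hk) (hs.lam_ne k (by omega))
  have hw : ∀ k, k ≤ N → wkb a x k ≠ 0 := fun k hk => wkb_ne_zero (hs.lam_ne k hk)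
  set u : ℕ → ℂ := fun k => p k / wkb a x k with hu
  have hup' : ∀ k, k ≤ N → p k = u k * wkb a x k := fun k hk => (div_mul_cancel₀ _ (hw k hk)).symm
  have hlam0 : lam a x (0 : ℕ) = x := by have := hlv 0; rw [hσ0] at this; simpa using this.symm
  have hx : x ≠ 0 := by rw [← hlam0]; exact hs.lam_ne 0 (Nat.zero_le _)
  have hw0 : wkb a x 0 = 1 := by
    have hd := lam_sub_sig a x (0 : ℕ)
    rw [hlam0, hσ0, sub_zero] at hd
    unfold wkb wkbExp
    rw [← hd, hlam0, div_self hx]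
    simp
  have hu0 : u 0 = 1 := by simp [u, hw0, hp.zero]
  have hsum : ∑ k ∈ Finset.range N, ‖e k‖ ≤ S := by
    rw [← hS, Finset.mul_sum]
    exact Finset.sum_le_sum fun k hk => hebound k (Finset.mem_range.mp hk)
  refine (norm_sub_one_le_of_difference_scheme (u := u) (e := e) (κ := κ) (N := N)
    (θ := 1 - t / 2) (by linarith) (by linarith) hu0 ?_ ?_ hκb (by linarith) n hn).trans ?_
  · have h1 := hup' 1 hN1
    have h2 := hup 0 hN1
    rw [zero_add, hw0, hlam0, one_mul] at h2
    rw [hp.one, h2] at h1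
    rw [hu0]
    simp only [e, exp_neg]
    have h3 := exp_ne_zero (Jp 0)
    field_simp
    exact mul_left_cancel₀ hx (by linear_combination -h1)
  · intro k hk
    have h0 := hp.step k
    rw [hup' (k + 2) (by omega), hup' (k + 1) (by omega), hup' k (by omega),
      hup (k + 1) (by omega), hdown k (by omega)] at h0
    refine recurrence_step_identity (hw (k + 1) (by omega)) (hs.lam_ne (k + 1) (by omega))
      (v := x - (k + 1)) (B := a * (k + 1) + b) (by simpa using hlv (k + 1)) ?_ h0
    rw [hlσ (k + 1) (by omega)]; push_cast; rfl
  · rw [div_le_div_iff₀ (by linarith) ht0]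
    nlinarith

theorem exists_norm_div_wkb_sub_one_le (ha : 0 < a) (b : ℝ) :
    ∃ K > 0, ∀ (x : ℂ) (p : ℕ → ℂ), IsPi a b x p → ∀ (δ : ℝ) (N : ℕ), 0 < δ → δ ≤ 1 →
      K ≤ δ ^ 5 * √N → Far a x N (δ * √N) →
      ∀ n ≤ N, ‖p n / wkb a x n - 1‖ ≤ K / (δ ^ 5 * √N) := by
  set c := 2 * √a + 1 with hc
  have hsa := sqrt_nonneg a
  have hc1 : 1 ≤ c := by rw [hc]; linarith
  set M := 3 * (1 + √a) ^ 2 * (16 * a + 8) with hM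
  have hM0 : 0 < M := by positivity
  have hb0 := abs_nonneg b
  set K1 := 4 * (250 + 144 * |b|) * M * (3 * π) * c with hK1
  set K2 := 160 * (1 + |b|) * √M * c with hK2
  have hK10 : 0 ≤ K1 := by positivity
  have hK20 : 0 ≤ K2 := by positivity
  refine ⟨1 + 2 * a + 5 * (1 + √a) + K1 + K2, by positivity, ?_⟩
  intro x p hp δ N hδ hδ1 hK hfar n hn
  have hd2 : δ ^ 5 ≤ δ ^ 2 := pow_le_pow_of_le_one hδ.le hδ1 (by norm_num)
  have hd1 : δ ^ 5 ≤ δ := by simpa using pow_le_pow_of_le_one hδ.le hδ1 (show 1 ≤ 5 by norm_num)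
  have hd3 : δ ^ 5 ≤ δ ^ 3 := pow_le_pow_of_le_one hδ.le hδ1 (by norm_num)
  have hs0 := sqrt_nonneg (N : ℝ)
  have hN1 : 1 ≤ N := by
    by_contra hcon
    rw [show N = 0 by omega] at hK
    simp at hK
    linarith
  have hNr : (1 : ℝ) ≤ N := by exact_mod_cast hN1
  have hsN : 0 < √N := sqrt_pos.mpr (by linarith)
  have hsN2 := sq_sqrt (show (0 : ℝ) ≤ N by linarith)
  have m1 := mul_le_mul_of_nonneg_right hd1 hs0
  have m2 := mul_le_mul_of_nonneg_right hd2 hs0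
  have m3 := mul_le_mul_of_nonneg_right hd3 hs0
  have hqb : ∀ k : ℕ, qBound a δ x N k = M / δ ^ 4 * (1 / ((x.re - k) ^ 2 + N)) := fun k => rfl
  have hsum : ∑ k ∈ Finset.range N, qBound a δ x N k ≤ M / δ ^ 4 * (3 * π / √N) := by
    simp only [hqb, ← Finset.mul_sum]
    exact mul_le_mul_of_nonneg_left (sum_inv_sq_add_le hNr N) (by positivity)
  have hT : ∀ k : ℕ, 160 * (1 + |b|) * √(qBound a δ x N k) ≤ δ / c := by
    intro k
    have h1 : qBound a δ x N k ≤ (√M / (δ ^ 2 * √N)) ^ 2 := by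
      rw [hqb, div_pow, mul_pow, sq_sqrt hM0.le, hsN2, ← pow_mul, div_mul_div_comm, mul_one]
      gcongr
      nlinarith [sq_nonneg (x.re - k)]
    have h2 : √(qBound a δ x N k) ≤ √M / (δ ^ 2 * √N) := (sqrt_le_sqrt h1).trans (le_of_eq (sqrt_sq (by positivity)))
    calc 160 * (1 + |b|) * √(qBound a δ x N k)
        ≤ 160 * (1 + |b|) * (√M / (δ ^ 2 * √N)) := by gcongr
      _ = K2 / c / (δ ^ 2 * √N) := by rw [hK2]; field_simp
      _ ≤ δ / c := by
        rw [div_div, div_le_div_iff₀ (by positivity) (by positivity)]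
        have h3 : K2 ≤ δ ^ 3 * √N := by linarith
        have : 0 < c := by linarith
        calc K2 * c ≤ δ ^ 3 * √N * c := by gcongr
          _ = _ := by ring
  have hpos : 0 < δ ^ 5 * √N := by positivity
  have hS4 : 4 * ((250 + 144 * |b|) * ∑ k ∈ Finset.range N, qBound a δ x N k) ≤ K1 / (δ ^ 5 * √N) * (δ / c) := by
    calc _ ≤ 4 * ((250 + 144 * |b|) * (M / δ ^ 4 * (3 * π / √N))) := by gcongr
      _ = _ := by rw [hK1]; field_simp
  refine (hp.norm_div_wkb_sub_one_le ha hδ hδ1 hN1 (by linarith) (by linarith) hfar rfl hT rfl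
    (hS4.trans (mul_le_of_le_one_left (by positivity) ((div_le_one hpos).mpr (by linarith)))) hn).trans ?_
  rw [← hc, div_le_iff₀ (by positivity)]
  refine hS4.trans ?_
  gcongr
  linarith

end

section

/-- Two numbers lie in the same open half plane, or are both real and of the same sign. -/
def SameSide (u w : ℂ) : Prop := 0 < u.im * w.im ∨ (u.im = 0 ∧ w.im = 0 ∧ 0 < u.re * w.re)

namespace SameSide

variable {u w t : ℂ}

theorem symm (h : SameSide u w) : SameSide w u := by
  rcases h with h | ⟨h1, h2, h3⟩
  · left; rwa [mul_comm]
  · right; exact ⟨h2, h1, by rwa [mul_comm]⟩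

theorem trans (h : SameSide u w) (h' : SameSide w t) : SameSide u t := by
  have key : ∀ {p q r : ℝ}, 0 < p * q → 0 < q * r → 0 < p * r := by
    intro p q r h1 h2
    rcases lt_trichotomy q 0 with hq | hq | hq
    · exact mul_pos_of_neg_of_neg (neg_of_mul_pos_left h1 hq.le) (neg_of_mul_pos_right h2 hq.le)
    · simp [hq] at h1
    · exact mul_pos (pos_of_mul_pos_left h1 hq.le) (pos_of_mul_pos_right h2 hq.le)
  rcases h with h | ⟨h1, h2, h3⟩ <;> rcases h' with h' | ⟨g1, g2, g3⟩
  · exact Or.inl (key h h')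
  · simp [g1] at h
  · simp [h2] at h'
  · exact Or.inr ⟨h1, g2, key h3 g3⟩

theorem ne_zero_left (h : SameSide u w) : u ≠ 0 := by
  rintro rfl
  rcases h with h | ⟨_, _, h⟩ <;> simp at h

theorem log_div (h : SameSide u w) : log (u / w) = log u - log w := by
  have hu := h.ne_zero_left
  have hw := h.symm.ne_zero_left
  have e : u / w = exp (log u - log w) := by rw [exp_sub, exp_log hu, exp_log hw]
  have him : (log u - log w).im = u.arg - w.arg := by rw [sub_im, log_im, log_im]
  have hpi := pi_pos
  have key : -π < u.arg - w.arg ∧ u.arg - w.arg ≤ π := by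
    rcases h with h | ⟨h1, h2, h3⟩
    · rcases pos_and_pos_or_neg_and_neg_of_mul_pos h with ⟨a1, a2⟩ | ⟨a1, a2⟩
      · have b1 := arg_nonneg_iff.mpr a1.le
        have b2 := arg_nonneg_iff.mpr a2.le
        have b3 := arg_lt_pi_iff.mpr (Or.inr a1.ne')
        have b4 := arg_lt_pi_iff.mpr (Or.inr a2.ne')
        constructor <;> linarith
      · have b1 := arg_neg_iff.mpr a1
        have b2 := arg_neg_iff.mpr a2
        have b3 := neg_pi_lt_arg u
        have b4 := neg_pi_lt_arg w
        constructor <;> linarith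
    · have : u.arg = w.arg := by
        rcases pos_and_pos_or_neg_and_neg_of_mul_pos h3 with ⟨a1, a2⟩ | ⟨a1, a2⟩
        · rw [arg_eq_zero_iff.mpr ⟨a1.le, h1⟩, arg_eq_zero_iff.mpr ⟨a2.le, h2⟩]
        · rw [arg_eq_pi_iff.mpr ⟨a1, h1⟩, arg_eq_pi_iff.mpr ⟨a2, h2⟩]
      rw [this, sub_self]
      constructor <;> linarith
  rw [e, log_exp (by rw [him]; exact key.1) (by rw [him]; exact key.2)]

end SameSide

theorem csqrt_eq_exp {z : ℂ} (hz : z ≠ 0) : sqrt z = exp (log z / 2) := by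
  rw [sqrt, cpow_def_of_ne_zero hz]
  ring_nf

variable {a : ℝ} {x : ℂ} {D s N : ℝ}

namespace Good

variable (h : Good a x D s)
include h

theorem sub_eq : x - s = lam a x s + a * s / lam a x s ∧ disc a x s = lam a x s - a * s / lam a x s := by
  rw [← lam_add_sig, ← lam_sub_sig, ← h.lam_mul_sig, mul_div_cancel_left₀ _ h.lam_ne]
  exact ⟨rfl, rfl⟩

theorem mul_lt_normSq : a * s < normSq (lam a x s) := by
  rw [normSq_eq_norm_sq]
  nlinarith [h.sqrt_add_le, sq_sqrt h.mul_nn, sqrt_nonneg (a * s), h.hD]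

theorem sameSide_lam : SameSide (lam a x s) (x - s) ∧ SameSide (lam a x s) (disc a x s) := by
  obtain ⟨h1, h2⟩ := h.sub_eq
  have hl := normSq_pos.mpr h.lam_ne
  have him : ((a * s / lam a x s : ℂ)).im = -(a * s / normSq (lam a x s)) * (lam a x s).im := by
    rw [← ofReal_mul, div_im, ofReal_re, ofReal_im]; ring
  have hre : ((a * s / lam a x s : ℂ)).re = (a * s / normSq (lam a x s)) * (lam a x s).re := by
    rw [← ofReal_mul, div_re, ofReal_re, ofReal_im]; ring
  have hq1 : a * s / normSq (lam a x s) < 1 := (div_lt_one hl).mpr h.mul_lt_normSq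
  have hq0 : 0 ≤ a * s / normSq (lam a x s) := div_nonneg h.mul_nn hl.le
  rw [h1, h2]
  unfold SameSide
  rw [add_im, add_re, sub_im, sub_re, him, hre]
  generalize a * s / normSq (lam a x s) = q at *
  by_cases hi : (lam a x s).im = 0
  · have hr : (lam a x s).re ≠ 0 := fun hr => h.lam_ne (Complex.ext hr hi)
    have hr2 : 0 < (lam a x s).re ^ 2 := by positivity
    rw [hi]
    constructor <;> right <;> refine ⟨rfl, by ring, ?_⟩ <;> nlinarith
  · have hi2 : 0 < (lam a x s).im ^ 2 := by positivity
    constructor <;> left <;> nlinarith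

theorem add_mul_add : lam a x s * (x + a) = (lam a x s + a) * (lam a x s + s) := by linear_combination h.quad

end Good

theorem Far.sameSide (ha : 0 < a) (hD : 0 < D) (h : Far a x N D) (hs : 0 ≤ s) (hsN : s ≤ N) :
    SameSide x (x - s) ∧ SameSide (x + a) (x - s) ∧ SameSide (lam a x s + a) (x - s) := by
  have hg := h.good ha hD hs hsN
  have hreal : x.im = 0 → x.re < -a ∨ N + 2 * √(a * N) < x.re := by
    intro hi
    by_contra! hcon
    have := h x.re hcon.1 hcon.2
    have e : x = (x.re : ℂ) := Complex.ext rfl (by simp [hi])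
    rw [← e, sub_self, norm_zero] at this
    linarith
  have hsq := sqrt_nonneg (a * N)
  have key : ∀ c : ℝ, 0 ≤ c → c ≤ a → SameSide (x + c) (x - s) := by
    intro c hc hca
    unfold SameSide
    simp only [sub_im, ofReal_im, sub_zero, sub_re, ofReal_re, add_im, add_re, add_zero]
    by_cases hi : x.im = 0
    · refine .inr ⟨hi, hi, ?_⟩
      rcases hreal hi with h | h
      · exact mul_pos_of_neg_of_neg (by linarith) (by linarith)
      · exact mul_pos (by linarith) (by linarith)
    · exact .inl (mul_self_pos.mpr hi)
  have h1 : SameSide x (x - s) := by simpa using key 0 le_rfl ha.le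
  have h2 := key a ha.le le_rfl
  refine ⟨h1, h2, ?_⟩
  have h3 := (hg.sameSide_lam).1
  have h4 := hg.add_mul_add
  have hl := hg.lam_ne
  refine SameSide.trans ?_ h2
  have h5 := h3.trans h2.symm
  have hsl := hg.slit
  have e : (x + a) = (lam a x s + a) * (1 + s / lam a x s) := by
    field_simp
    linear_combination h4
  rcases h5 with h5 | ⟨h5, h6, h7⟩
  · left; simpa using h5
  · right
    refine ⟨by simpa using h5, h6, ?_⟩
    have hlr : lam a x s = ((lam a x s).re : ℂ) := Complex.ext rfl (by simp [h5])
    rw [hlr] at hsl e ⊢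
    generalize (lam a x s).re = r at *
    rw [← ofReal_div, ← ofReal_one, ← ofReal_add] at hsl e
    rw [ofReal_mem_slitPlane] at hsl
    rw [← ofReal_add, e, ← ofReal_add, ← ofReal_mul, ofReal_re, ofReal_re]
    have hne : r + a ≠ 0 := by
      intro h0
      rw [← ofReal_add, h0] at e
      rw [e] at h7
      simp at h7
    have : 0 < (r + a) ^ 2 := by positivity
    nlinarith

/-- The outer approximation in the variable `x`. -/
def outerX (a : ℝ) (x : ℂ) (n : ℝ) : ℂ := exp (-n - (x + a) * log (lam a x n / x) + log (x / disc a x n) / 2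
    - 2 * (a * n / lam a x n) - (a * n / lam a x n) ^ 2 / (2 * n))

theorem log_taylor_bounds {w : ℂ} (hw : ‖w‖ ≤ 1 / 2) :
    ‖log (1 + w) - w‖ ≤ ‖w‖ ^ 2 ∧ ‖log (1 + w) - (w - w ^ 2 / 2)‖ ≤ ‖w‖ ^ 3 := by
  have hw1 : ‖w‖ < 1 := by linarith
  have hinv : (1 - ‖w‖)⁻¹ ≤ 2 := by rw [inv_le_comm₀ (by linarith) (by norm_num)]; linarith
  have hn := norm_nonneg w
  constructor
  · refine (norm_log_one_add_sub_self_le hw1).trans ?_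
    have : ‖w‖ ^ 2 * (1 - ‖w‖)⁻¹ ≤ ‖w‖ ^ 2 * 2 := by gcongr
    linarith
  · have h := norm_log_sub_logTaylor_le 2 hw1
    have e : logTaylor 3 w = w - w ^ 2 / 2 := by simp [logTaylor_succ, logTaylor_zero]; ring
    rw [show 2 + 1 = 3 from rfl, e] at h
    refine h.trans ?_
    have : ‖w‖ ^ 3 * (1 - ‖w‖)⁻¹ ≤ ‖w‖ ^ 3 * 2 := by gcongr
    push_cast
    have h3 : 0 ≤ ‖w‖ ^ 3 := by positivity
    linarith

theorem exponent_comparison {l x ℓ₁ ℓ₂ : ℂ} {a n : ℝ} (ha : 0 < a) (hn : 0 < n)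
    (hx : 2 * a ≤ ‖x‖) (hl : 2 * a ≤ ‖l‖) (hnl : a * n ≤ ‖l‖ ^ 2)
    (hid : l * (x + a) = (l + a) * (l + n))
    (h1 : ‖ℓ₁ - a / x‖ ≤ ‖(a : ℂ) / x‖ ^ 2)
    (h2 : ‖ℓ₂ - (a / l - (a / l) ^ 2 / 2)‖ ≤ ‖(a : ℂ) / l‖ ^ 3) :
    ‖(x + a + 1 / 2) * (ℓ₁ - ℓ₂) + a * n / l + (a * n / l) ^ 2 / (2 * n)‖
      ≤ (4 * a ^ 2 + a) / ‖x‖ + (8 * a ^ 2 + a) / ‖l‖ := by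
  have hx' : 0 < ‖x‖ := by linarith
  have hl' : 0 < ‖l‖ := by linarith
  have hx0 := norm_pos_iff.mp hx'
  have hl0 := norm_pos_iff.mp hl'
  have hn0 : (n : ℂ) ≠ 0 := ofReal_ne_zero.mpr hn.ne'
  have hna := Complex.norm_of_nonneg ha.le
  have hnn := Complex.norm_of_nonneg hn.le
  have hE : x + a = l + a + n + n * (a / l) := by field_simp; linear_combination hid
  have hp : x * (a / x) = a := mul_div_cancel₀ _ hx0
  have hq : l * (a / l) = a := mul_div_cancel₀ _ hl0
  have p3 : ‖x‖ * ‖(a : ℂ) / x‖ = a := by rw [← norm_mul, hp, hna]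
  have q3 : ‖l‖ * ‖(a : ℂ) / l‖ = a := by rw [← norm_mul, hq, hna]
  have e1 : a * n / l + (a * n / l) ^ 2 / (2 * n) = n * (a / l) + n * (a / l) ^ 2 / 2 := by field_simp
  have f : (4 * a ^ 2 + a) / ‖x‖ + (8 * a ^ 2 + a) / ‖l‖ = (4 * a + 1) * ‖(a : ℂ) / x‖ + (8 * a + 1) * ‖(a : ℂ) / l‖ := by
    rw [norm_div, norm_div, hna]; ring
  rw [f, add_assoc, e1]
  generalize (a : ℂ) / x = p at *
  generalize (a : ℂ) / l = q at *
  obtain ⟨ε₁, rfl⟩ : ∃ e, ℓ₁ = e + p := ⟨_, (sub_add_cancel _ _).symm⟩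
  obtain ⟨ε₂, rfl⟩ : ∃ e, ℓ₂ = e + (q - q ^ 2 / 2) := ⟨_, (sub_add_cancel _ _).symm⟩
  rw [add_sub_cancel_right] at h1 h2
  have key : (x + a + 1 / 2) * (ε₁ + p - (ε₂ + (q - q ^ 2 / 2))) + (n * q + n * q ^ 2 / 2)
      = (x + a) * ε₁ + a * p + ε₁ / 2 + p / 2 - (l + a + n + n * q) * ε₂ - ε₂ / 2 - q / 2 + q ^ 2 / 4
        - (a * q / 2 - a * q ^ 2 / 2 - n * q ^ 3 / 2) := by
    linear_combination (-ε₂ - q + q ^ 2 / 2) * hE + hp + (q / 2 - 1) * hq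
  have P0 : ‖p‖ ≤ 1 / 2 := by nlinarith [norm_nonneg p]
  have Q0 : ‖q‖ ≤ 1 / 2 := by nlinarith [norm_nonneg q]
  have P2 : ‖p‖ ^ 2 ≤ ‖p‖ / 2 := by nlinarith [norm_nonneg p]
  have Q2 : ‖q‖ ^ 2 ≤ ‖q‖ / 2 := by nlinarith [norm_nonneg q]
  have Q3 : ‖q‖ ^ 3 ≤ ‖q‖ / 4 := by nlinarith [norm_nonneg q]
  have hnQ : n * ‖q‖ ^ 2 ≤ a := by
    refine le_of_mul_le_mul_left ?_ ha
    calc a * (n * ‖q‖ ^ 2) = a * n * ‖q‖ ^ 2 := by ring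
      _ ≤ ‖l‖ ^ 2 * ‖q‖ ^ 2 := by gcongr
      _ = a * a := by rw [← mul_pow, q3, sq]
  have hnQ3 := mul_le_mul_of_nonneg_right hnQ (norm_nonneg q)
  have t1 : ‖(x + a) * ε₁‖ ≤ 2 * a * ‖p‖ := by
    rw [norm_mul]
    calc _ ≤ (2 * ‖x‖) * ‖p‖ ^ 2 := by gcongr; exact (norm_add_le_of_le le_rfl hna.le).trans (by linarith)
      _ = 2 * (‖x‖ * ‖p‖) * ‖p‖ := by ring
      _ = _ := by rw [p3]
  have t5 : ‖(l + a + n + n * q) * ε₂‖ ≤ 3 * a * ‖q‖ := by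
    rw [norm_mul]
    calc _ ≤ (2 * ‖l‖ + 2 * n) * ‖q‖ ^ 3 := by
          gcongr
          refine (norm_add_le_of_le (norm_add_le_of_le (norm_add_le_of_le le_rfl hna.le) hnn.le) le_rfl).trans ?_
          rw [norm_mul, hnn]
          nlinarith
      _ = 2 * (‖l‖ * ‖q‖) * ‖q‖ ^ 2 + 2 * (n * ‖q‖ ^ 2 * ‖q‖) := by ring
      _ ≤ _ := by rw [q3]; nlinarith
  rw [key]
  refine (norm_sub_le_of_le (norm_add_le_of_le (norm_sub_le_of_le (norm_sub_le_of_le (norm_sub_le_of_le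
    (norm_add_le_of_le (norm_add_le_of_le (norm_add_le_of_le t1 le_rfl) le_rfl) le_rfl) t5) le_rfl) le_rfl) le_rfl)
    (norm_sub_le_of_le (norm_sub_le_of_le le_rfl le_rfl) le_rfl)).trans ?_
  simp only [norm_div, norm_mul, norm_pow, norm_ofNat, hna, hnn]
  nlinarith [mul_le_mul_of_nonneg_left Q2 ha.le]

theorem norm_wkb_div_outerX_sub_one_le (ha : 0 < a) (hD : 0 < D) {n : ℕ} (hn : 1 ≤ n)
    (h : Far a x n D) (hx : 2 * a ≤ ‖x‖) (hl : 2 * a ≤ ‖lam a x n‖)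
    (hsmall : (4 * a ^ 2 + a) / ‖x‖ + (8 * a ^ 2 + a) / ‖lam a x n‖ ≤ 1) :
    ‖wkb a x n / (lam a x n ^ n * outerX a x n) - 1‖
      ≤ 2 * ((4 * a ^ 2 + a) / ‖x‖ + (8 * a ^ 2 + a) / ‖lam a x n‖) := by
  have hn0 : (0 : ℝ) < n := by exact_mod_cast hn
  have hg : Good a x D (n : ℝ) := h.good ha hD hn0.le le_rfl
  have hl0 : lam a x n ≠ 0 := hg.lam_ne
  have hR0 : disc a x n ≠ 0 := hg.disc_ne
  obtain ⟨k1, k2, k3⟩ := h.sameSide ha hD hn0.le le_rfl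
  obtain ⟨k4, k5⟩ := hg.sameSide_lam
  have hid := hg.add_mul_add
  have hx0 := k1.ne_zero_left
  have hla0 := k3.ne_zero_left
  have e1 : log (1 + (n : ℝ) / lam a x n) = log (x + a) - log (lam a x n + a) := by
    rw [← (k2.trans k3.symm).log_div]
    congr 1
    field_simp
    linear_combination -hid
  have e2 := k5.symm.log_div
  have e3 := (k4.trans k1.symm).log_div
  have e4 : log (x / disc a x n) = log x - log (disc a x n) := (k1.trans (k4.symm.trans k5)).log_div
  have e5 : log (1 + a / x) = log (x + a) - log x := by
    rw [← (k2.trans k1.symm).log_div]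
    congr 1
    field_simp
  have e6 : log (1 + a / lam a x n) = log (lam a x n + a) - log (lam a x n) := by
    rw [← (k3.trans k4.symm).log_div]
    congr 1
    field_simp
  have w : ∀ {v : ℂ}, 2 * a ≤ ‖v‖ → ‖(a : ℂ) / v‖ ≤ 1 / 2 := fun h => by
    rw [norm_div, Complex.norm_of_nonneg ha.le]
    exact div_le_of_le_mul₀ (norm_nonneg _) (by norm_num) (by linarith)
  have hcmp := exponent_comparison ha hn0 hx hl (by rw [← normSq_eq_norm_sq]; exact hg.mul_lt_normSq.le)
    hid (log_taylor_bounds (w hx)).1 (log_taylor_bounds (w hl)).2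
  have e : wkb a x n / (lam a x n ^ n * outerX a x n)
      = exp ((x + a + 1 / 2) * (log (1 + a / x) - log (1 + a / lam a x n))
          + a * (n : ℝ) / lam a x n + (a * (n : ℝ) / lam a x n) ^ 2 / (2 * (n : ℝ))) := by
    unfold wkb outerX wkbExp
    rw [mul_div_mul_left _ _ (pow_ne_zero n hl0), ← exp_sub]
    congr 1
    rw [e1, e2, e3, e4, e5, e6]
    ring
  rw [e]
  exact (norm_exp_sub_one_le (hcmp.trans hsmall)).trans (by linarith)

end

section

theorem csqrt_ofReal_mul {r : ℝ} (hr : 0 < r) (z : ℂ) : sqrt (r * z) = (√r : ℝ) * sqrt z := by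
  by_cases hz : z = 0
  · simp [hz, sqrt]
  have hr' : (r : ℂ) ≠ 0 := by exact_mod_cast hr.ne'
  rw [csqrt_eq_exp (mul_ne_zero hr' hz), csqrt_eq_exp hz, log_ofReal_mul hr hz, add_div, exp_add]
  congr 1
  rw [sqrt_eq_rpow, rpow_def_of_pos hr]
  push_cast
  ring_nf

theorem csqrt_im_mul_nonneg {u w : ℂ} (h : u.im = w.im) : 0 ≤ (sqrt u).im * (sqrt w).im := by
  have e : ∀ u : ℂ, u.im = 2 * (sqrt u).re * (sqrt u).im := by
    intro u
    conv_lhs => rw [← csqrt_sq u]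
    rw [pow_two, mul_im]; ring
  have hnn : ∀ u : ℂ, 0 ≤ u.im → 0 ≤ (sqrt u).im := by
    intro u hu
    by_cases hz : u = 0
    · simp [hz, sqrt]
    rw [csqrt_eq_exp hz, exp_im]
    have hs : (log u / 2).im = u.arg / 2 := by rw [div_ofNat_im, log_im]
    rw [hs]
    have h0 := arg_nonneg_iff.mpr hu
    have h1 := arg_le_pi u
    exact mul_nonneg (exp_pos _).le (Real.sin_nonneg_of_nonneg_of_le_pi (by linarith) (by linarith [pi_pos]))
  by_cases hu : 0 ≤ u.im
  · exact mul_nonneg (hnn u hu) (hnn w (h ▸ hu))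
  · push Not at hu
    have h1 := e u
    have h2 := e w
    have r1 := csqrt_re_nonneg u
    have r2 := csqrt_re_nonneg w
    have a1 : (sqrt u).im < 0 := by by_contra! hcon; nlinarith [mul_nonneg r1 hcon]
    have a2 : (sqrt w).im < 0 := by by_contra! hcon; nlinarith [mul_nonneg r2 hcon]
    nlinarith

theorem re_csqrt_mul_csqrt_mul_conj_nonneg {u w z : ℂ} (h : u.im = w.im) (hz : u + w = 2 * z) :
    0 ≤ (sqrt u * sqrt w * conj z).re := by
  set p := sqrt u with hp
  set q := sqrt w with hq
  have h1 : z = (p ^ 2 + q ^ 2) / 2 := by rw [hp, hq, csqrt_sq, csqrt_sq, hz]; ring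
  have h2 : 0 ≤ p.re * q.re + p.im * q.im := by
    have := csqrt_im_mul_nonneg h
    have := mul_nonneg (csqrt_re_nonneg u) (csqrt_re_nonneg w)
    linarith
  have h3 : (p * q * conj z).re = (normSq p + normSq q) / 2 * (p.re * q.re + p.im * q.im) := by
    rw [h1]
    simp only [pow_two, normSq_apply, mul_re, mul_im, conj_re, conj_im, div_ofNat_re, div_ofNat_im, add_re, add_im]
    ring
  rw [h3]
  have := normSq_nonneg p
  have := normSq_nonneg q
  positivity

theorem rootN_sq (n : ℕ) : rootN n ^ 2 = n := by
  unfold rootN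
  rw [← ofReal_pow, sq_sqrt (Nat.cast_nonneg n), ofReal_natCast]

theorem rootA_sq {a : ℝ} (ha : 0 ≤ a) : rootA a ^ 2 = a := by
  unfold rootA
  rw [← ofReal_pow, sq_sqrt ha]

theorem rootN_ne_zero {n : ℕ} (hn : 1 ≤ n) : rootN n ≠ 0 :=
  pow_ne_zero_iff two_ne_zero |>.mp (by rw [rootN_sq]; exact Nat.cast_ne_zero.mpr (by omega))

theorem rootOuter_sq {a : ℝ} (ha : 0 ≤ a) (z : ℂ) : rootOuter a z ^ 2 = z ^ 2 - 4 * a := by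
  unfold rootOuter
  rw [mul_pow, csqrt_sq, csqrt_sq, ← rootA_sq ha]; ring

theorem re_rootOuter_mul_conj_nonneg (a : ℝ) (z : ℂ) : 0 ≤ (rootOuter a z * conj z).re := by
  refine re_csqrt_mul_csqrt_mul_conj_nonneg ?_ (by ring)
  simp [rootA]

/-- The point `n + √n z`. -/
def xAt (n : ℕ) (z : ℂ) : ℂ := n + rootN n * z

theorem xAt_sub (n : ℕ) (z : ℂ) : xAt n z - (n : ℝ) = rootN n * z := by unfold xAt; push_cast; ring

variable {a : ℝ} {D : ℝ} {n : ℕ} {z : ℂ}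

theorem disc_xAt (ha : 0 < a) (hD : 0 < D) (h : OffCut (xAt n z - (n : ℝ)) (a * n) D) :
    disc a (xAt n z) n = rootN n * rootOuter a z := by
  have hpos := h.outRoot_mul_conj_re_pos hD (mul_nonneg ha.le (Nat.cast_nonneg n))
  have hv := h.ne_zero hD
  push_cast at hpos
  refine (eq_of_sq_eq_of_re_mul_conj (z := xAt n z - (n : ℝ)) ?_ ?_ (by simpa [disc] using hpos)).symm
  · rw [disc, outRoot_sq hv, mul_pow, rootOuter_sq ha.le, rootN_sq, xAt_sub, mul_pow, rootN_sq]
    push_cast; ring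
  · rw [xAt_sub, map_mul, show rootN n * rootOuter a z * (conj (rootN n) * conj z)
        = ((√n * √n : ℝ) : ℂ) * (rootOuter a z * conj z) by
      rw [show rootN n = ((√n : ℝ) : ℂ) from rfl, conj_ofReal]; push_cast; ring, re_ofReal_mul]
    exact mul_nonneg (mul_self_nonneg _) (re_rootOuter_mul_conj_nonneg a z)

theorem lam_xAt (ha : 0 < a) (hD : 0 < D) (h : OffCut (xAt n z - (n : ℝ)) (a * n) D) :
    lam a (xAt n z) n = rootN n * (z + rootOuter a z) / 2 := by
  have h1 := Good.add_disc a (xAt n z) n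
  rw [disc_xAt ha hD h, xAt_sub] at h1
  linear_combination -h1 / 2

theorem outerApprox_one_eq (ha : 0 < a) (hD : 0 < D) (hn : 1 ≤ n) (h : Far a (xAt n z) n D) :
    outerApprox 1 a n z = lam a (xAt n z) n ^ n * outerX a (xAt n z) n := by
  have hn0 : (0 : ℝ) < n := by exact_mod_cast hn
  have hg : Good a (xAt n z) D (n : ℝ) := h.good ha hD hn0.le le_rfl
  have hl0 := hg.lam_ne
  have hR0 := hg.disc_ne
  have hx0 := (h.sameSide ha hD hn0.le le_rfl).1.ne_zero_left
  have hr0 := rootN_ne_zero hn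
  have hnc : (n : ℂ) ≠ 0 := by exact_mod_cast hn0.ne'
  have hoff : OffCut (xAt n z - (n : ℝ)) (a * n) D := hg.offCut
  have e1 := lam_xAt ha hD hoff
  have e2 := disc_xAt ha hD hoff
  have hrn := rootN_sq n
  have f1 : (z + rootOuter a z) / (2 * rootN n) = lam a (xAt n z) n / n := by rw [e1, ← hrn]; field_simp
  have hx : xAt n z = rootN n * (rootN n * (1 : ℝ) + z) := by unfold xAt; rw [← hrn]; push_cast; ring
  have f2 : (z + rootOuter a z) / (2 * (rootN n * (1 : ℝ) + z)) = lam a (xAt n z) n / xAt n z := by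
    rw [hx] at hx0
    have := right_ne_zero_of_mul hx0
    rw [e1]
    conv_rhs => rw [hx]
    field_simp
  have f3 : (rootN n * (1 : ℝ) + z) / rootOuter a z = xAt n z / disc a (xAt n z) n := by
    rw [e2] at hR0
    have := right_ne_zero_of_mul hR0
    rw [e2]
    conv_rhs => rw [hx]
    field_simp
  have f4 : (-(a : ℂ) / (1 : ℝ) ^ 2 - rootN n * (rootN n * (1 : ℝ) + z) / (1 : ℝ)) = -(xAt n z + a) := by
    rw [hx]; push_cast; ring
  have hσ : (a * (n : ℝ) / lam a (xAt n z) n : ℂ) = rootN n * (z - rootOuter a z) / 2 := by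
    obtain ⟨h3, h4⟩ := hg.sub_eq
    rw [e2] at h4
    rw [xAt_sub] at h3
    linear_combination (h4 - h3) / 2
  have hq := rootOuter_sq ha.le z
  unfold outerApprox outerX
  rw [f1, f2, f3, f4, cpow_def_of_ne_zero (div_ne_zero hl0 hx0),
    csqrt_eq_exp (div_ne_zero hx0 hR0), hσ, div_pow, div_pow, ← exp_nat_mul]
  have g : ∀ A B C E : ℂ, (n : ℂ) ^ n / exp (n * 1) * (A / (n : ℂ) ^ n) * exp B
      * exp C * exp E = A * exp (-n + B + C + E) := by
    intro A B C E
    rw [exp_add, exp_add, exp_add, exp_neg, mul_one]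
    have := pow_ne_zero n hnc
    field_simp
  rw [g]
  congr 2
  have hz : ((2 : ℂ) * a - z ^ 2 - 4 * rootN n * (1 : ℝ) * z
        + (z + 4 * rootN n * (1 : ℝ)) * rootOuter a z) / (4 * (1 : ℝ) ^ 2)
      = -(2 * (rootN n * (z - rootOuter a z) / 2)) - (rootN n * (z - rootOuter a z) / 2) ^ 2 / (2 * (n : ℝ)) := by
    have e : (rootN n * (z - rootOuter a z) / 2) ^ 2 / (2 * (n : ℝ)) = (z - rootOuter a z) ^ 2 / 8 := by
      rw [div_pow, mul_pow, hrn]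
      push_cast
      field_simp
      norm_num
    rw [e]
    push_cast
    linear_combination (1 / 8) * hq
  rw [hz]
  push_cast
  ring

theorem isPi_piPoly (a b : ℝ) (x : ℂ) : IsPi a b x (fun k => (piPoly 1 a b k).eval x) where
  zero := by simp [piPoly]
  one := by simp [piPoly]
  step n := by simp [piPoly]

theorem piAt_one (a b : ℝ) (n : ℕ) (z : ℂ) : piAt 1 a b n z = (piPoly 1 a b n).eval (xAt n z) := by
  unfold piAt xAt; simp

theorem exists_norm_piAt_div_outerApprox_sub_one_le (ha : 0 < a) (b : ℝ) :
    ∃ K > 0, ∀ (δ : ℝ) (n : ℕ) (z : ℂ), 0 < δ → δ ≤ 1 → K ≤ δ ^ 5 * √n → Far a (xAt n z) n (δ * √n) →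
      ‖piAt 1 a b n z / outerApprox 1 a n z - 1‖ ≤ K / (δ ^ 5 * √n) := by
  obtain ⟨K, hK, hmain⟩ := exists_norm_div_wkb_sub_one_le ha b
  set M := (4 * a ^ 2 + a) + 2 * (8 * a ^ 2 + a) with hM
  have hM0 : 0 < M := by positivity
  refine ⟨4 * (K + M + 4 * a + 1), by positivity, ?_⟩
  intro δ n z hδ hδ1 hKn hfar
  have hd1 : δ ^ 5 ≤ δ := by simpa using pow_le_pow_of_le_one hδ.le hδ1 (show 1 ≤ 5 by norm_num)
  have hs0 := sqrt_nonneg (n : ℝ)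
  have hn1 : 1 ≤ n := by
    by_contra hcon
    rw [show n = 0 by omega] at hKn
    simp at hKn
    linarith
  have hn0 : (0 : ℝ) < n := by exact_mod_cast hn1
  have hsn : 0 < √n := sqrt_pos.mpr hn0
  have hD : 0 < δ * √n := by positivity
  have m1 := mul_le_mul_of_nonneg_right hd1 hs0
  have hg : Good a (xAt n z) (δ * √n) (n : ℝ) := hfar.good ha hD hn0.le le_rfl
  have hx : δ * √n ≤ ‖xAt n z‖ := by simpa using hfar 0 (by linarith) (by positivity)
  have hl : δ * √n / 2 ≤ ‖lam a (xAt n z) n‖ := by linarith [hg.sqrt_add_le, sqrt_nonneg (a * n)]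
  set q := δ ^ 5 * √n with hq
  have hq0 : 0 < q := by positivity
  have hsum : (4 * a ^ 2 + a) / ‖xAt n z‖ + (8 * a ^ 2 + a) / ‖lam a (xAt n z) n‖ ≤ M / q := by
    have h1 : (4 * a ^ 2 + a) / ‖xAt n z‖ ≤ (4 * a ^ 2 + a) / q := by gcongr; linarith
    have h2 : (8 * a ^ 2 + a) / ‖lam a (xAt n z) n‖ ≤ (8 * a ^ 2 + a) / (q / 2) := by gcongr; linarith
    calc _ ≤ (4 * a ^ 2 + a) / q + (8 * a ^ 2 + a) / (q / 2) := add_le_add h1 h2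
      _ = M / q := by rw [hM]; field_simp
  have hMq : M / q ≤ 1 := by rw [div_le_one hq0]; linarith
  have h1 := norm_wkb_div_outerX_sub_one_le ha hD hn1 hfar (by linarith) (by linarith) (hsum.trans hMq)
  have h2 := hmain (xAt n z) _ (isPi_piPoly a b (xAt n z)) δ n hδ hδ1 (by linarith) hfar n le_rfl
  rw [piAt_one, outerApprox_one_eq ha hD hn1 hfar, ← div_mul_div_cancel₀ (wkb_ne_zero hg.lam_ne)]
  generalize (piPoly 1 a b n).eval (xAt n z) / wkb a (xAt n z) n = A at *
  generalize wkb a (xAt n z) n / (lam a (xAt n z) n ^ n * outerX a (xAt n z) n) = B at *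
  have hA1 : ‖A - 1‖ ≤ 1 := h2.trans (by rw [div_le_one hq0]; linarith)
  have hB := h1.trans (mul_le_mul_of_nonneg_left hsum zero_le_two)
  calc ‖A * B - 1‖ = ‖(A - 1) * (B - 1) + (A - 1) + (B - 1)‖ := by ring_nf
    _ ≤ ‖A - 1‖ * ‖B - 1‖ + ‖A - 1‖ + ‖B - 1‖ := norm_add_le_of_le (norm_add_le_of_le (norm_mul_le _ _) le_rfl) le_rfl
    _ ≤ 1 * ‖B - 1‖ + ‖A - 1‖ + ‖B - 1‖ := by gcongr
    _ ≤ K / q + 4 * (M / q) := by linarith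
    _ ≤ _ := by
      rw [← mul_div_assoc, ← add_div]
      gcongr
      nlinarith

end

theorem piPoly_eval_scale (d a b : ℝ) (x : ℂ) (n : ℕ) :
    (piPoly d (d ^ 2 * a) (d ^ 2 * b) n).eval (d * x) = d ^ n * (piPoly 1 a b n).eval x := by
  induction n using Nat.strong_induction_on with
  | _ n ih =>
    match n with
    | 0 => simp [piPoly]
    | 1 => simp [piPoly]
    | (k + 2) =>
      simp only [piPoly, Polynomial.eval_sub, Polynomial.eval_mul, Polynomial.eval_X, Polynomial.eval_C,
        ih (k + 1) (by omega), ih k (by omega)]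
      push_cast
      ring

section
variable {d : ℝ} (hd : 0 < d) (a : ℝ) (n : ℕ) (z : ℂ)
include hd

theorem piAt_scale (b : ℝ) : piAt d (d ^ 2 * a) (d ^ 2 * b) n (d * z) = d ^ n * piAt 1 a b n z := by
  unfold piAt
  rw [← piPoly_eval_scale]
  congr 1
  push_cast; ring

theorem rootA_scale : rootA (d ^ 2 * a) = d * rootA a := by
  unfold rootA
  rw [sqrt_mul (by positivity), sqrt_sq hd.le, ofReal_mul]

theorem csqrt_mul_csqrt_scale (u w : ℂ) : sqrt (d * u) * sqrt (d * w) = d * (sqrt u * sqrt w) := by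
  rw [csqrt_ofReal_mul hd, csqrt_ofReal_mul hd]
  have : ((√d : ℝ) : ℂ) * (√d : ℝ) = d := by rw [← ofReal_mul, mul_self_sqrt hd.le]
  linear_combination (sqrt u * sqrt w) * this

theorem rootOuter_scale : rootOuter (d ^ 2 * a) (d * z) = d * rootOuter a z := by
  unfold rootOuter
  rw [← csqrt_mul_csqrt_scale hd, rootA_scale hd]
  ring_nf

theorem rootLeft_scale : rootLeft (d ^ 2 * a) (d * z) = d * rootLeft a z := by
  unfold rootLeft
  rw [← csqrt_mul_csqrt_scale hd, rootA_scale hd]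
  ring_nf

theorem csqrt_scale : sqrt (4 * ((d ^ 2 * a : ℝ) : ℂ) - (d * z) ^ 2) = d * sqrt (4 * a - z ^ 2) := by
  rw [show 4 * ((d ^ 2 * a : ℝ) : ℂ) - (d * z) ^ 2 = ((d ^ 2 : ℝ) : ℂ) * (4 * a - z ^ 2) by push_cast; ring,
    csqrt_ofReal_mul (by positivity), sqrt_sq hd.le]

theorem ratio_scale (q : ℂ) : (rootN n * d + d * z) / (d * q) = (rootN n * (1 : ℝ) + z) / q := by
  rw [mul_comm _ (d : ℂ), ← mul_add, ofReal_one, mul_one, mul_div_mul_left _ _ (ofReal_ne_zero.mpr hd.ne')]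

theorem outerApprox_scale : outerApprox d (d ^ 2 * a) n (d * z) = d ^ n * outerApprox 1 a n z := by
  have hdc := ofReal_ne_zero.mpr hd.ne'
  unfold outerApprox
  rw [rootOuter_scale hd, ratio_scale hd, ← mul_add, mul_div_assoc, mul_pow,
    show 2 * (rootN n * d + d * z) = d * (2 * (rootN n * (1 : ℝ) + z)) by push_cast; ring,
    mul_div_mul_left _ _ hdc]
  push_cast
  field_simp

theorem midPhase_scale : midPhase d (d ^ 2 * a) n (d * z) = midPhase 1 a n z := by
  have hdc := ofReal_ne_zero.mpr hd.ne'
  unfold midPhase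
  rw [csqrt_scale hd, rootA_scale hd, mul_left_comm, mul_div_mul_left _ _ hdc]
  push_cast
  field_simp

theorem leftPhase_scale : leftPhase d (d ^ 2 * a) n (d * z) = leftPhase 1 a n z := by
  have hdc := ofReal_ne_zero.mpr hd.ne'
  unfold leftPhase
  push_cast
  field_simp

theorem ofReal_mul_cpow {w : ℂ} (hw : w ≠ 0) (s : ℂ) : (d * w) ^ s = (d : ℂ) ^ s * w ^ s := by
  have hdc := ofReal_ne_zero.mpr hd.ne'
  rw [cpow_def_of_ne_zero (mul_ne_zero hdc hw), log_ofReal_mul hd hw, cpow_def_of_ne_zero hdc,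
    cpow_def_of_ne_zero hw, ← exp_add, ofReal_log hd.le, add_mul]

theorem amp_scale {u z : ℂ} (hu : u ≠ 0) (hw : 1 + z / rootN n ≠ 0) :
    (d * u) ^ (-((d ^ 2 * a : ℝ) : ℂ) / d ^ 2 - rootN n * (d * z) / d) *
      ((d : ℂ) + d * z / rootN n) ^ (((d ^ 2 * a : ℝ) : ℂ) / d ^ 2 + rootN n * (rootN n * d + d * z) / d)
    = d ^ n * (u ^ (-(a : ℂ) / (1 : ℝ) ^ 2 - rootN n * z / (1 : ℝ)) *
      ((1 : ℝ) + z / rootN n) ^ ((a : ℂ) / (1 : ℝ) ^ 2 + rootN n * (rootN n * (1 : ℝ) + z) / (1 : ℝ))) := by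
  have hdc := ofReal_ne_zero.mpr hd.ne'
  have hN := rootN_sq n
  rw [show -((d ^ 2 * a : ℝ) : ℂ) / d ^ 2 - rootN n * (d * z) / d = -a - rootN n * z by push_cast; field_simp,
    show ((d ^ 2 * a : ℝ) : ℂ) / d ^ 2 + rootN n * (rootN n * d + d * z) / d = n - (-a - rootN n * z) by
      rw [← hN]; push_cast; field_simp; ring, mul_div_assoc, ← mul_one_add, ofReal_mul_cpow hd hu,
    ofReal_mul_cpow hd hw, cpow_sub (n : ℂ) _ hdc, cpow_natCast]
  simp only [ofReal_one, one_pow, div_one, mul_one]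
  rw [show a + rootN n * (rootN n + z) = n - (-a - rootN n * z) by rw [← hN]; ring]
  have h1 : (d : ℂ) ^ (-a - rootN n * z) ≠ 0 := by simp [cpow_eq_zero_iff, hdc]
  field_simp

theorem midAmp_scale (ha : 0 < a) {n : ℕ} (hn : 1 ≤ n) {z : ℂ} (hw : 1 + z / rootN n ≠ 0) :
    midAmp d (d ^ 2 * a) n (d * z) = d ^ n * midAmp 1 a n z := by
  have hdc := ofReal_ne_zero.mpr hd.ne'
  unfold midAmp
  rw [csqrt_scale hd, ratio_scale hd, rootA_scale hd, mul_div_assoc, mul_assoc (_ ^ n),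
    amp_scale hd a n (u := rootA a / rootN n) (div_ne_zero (ofReal_ne_zero.mpr (sqrt_pos.mpr ha).ne')
      (rootN_ne_zero hn)) hw]
  push_cast
  field_simp

theorem leftAmp_scale {n : ℕ} (hn : 1 ≤ n) {z : ℂ} (hw : 1 + z / rootN n ≠ 0) (hl : -z + rootLeft a z ≠ 0) :
    leftAmp d (d ^ 2 * a) n (d * z) = d ^ n * leftAmp 1 a n z := by
  have hdc := ofReal_ne_zero.mpr hd.ne'
  unfold leftAmp
  rw [rootLeft_scale hd, ratio_scale hd, ← mul_neg, ← mul_add, mul_div_assoc, mul_assoc (_ ^ n),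
    amp_scale hd a n (div_ne_zero hl (mul_ne_zero two_ne_zero (rootN_ne_zero hn))) hw]
  push_cast
  field_simp

end

theorem uniformEquiv_outer_one {a : ℝ} (ha : 0 < a) (b : ℝ) {δ : ℝ} (hδ : 0 < δ) :
    UniformEquiv (piAt 1 a b) (outerApprox 1 a) (outerRegion 1 a δ) := by
  obtain ⟨K, hK, hmain⟩ := exists_norm_piAt_div_outerApprox_sub_one_le ha b
  intro ε hε
  set δ' := min (δ / 2) 1 with hδ'
  have hδ0 : 0 < δ' := lt_min (by linarith) one_pos
  have ht : Tendsto (fun n : ℕ => √n) atTop atTop := tendsto_sqrt_atTop.comp tendsto_natCast_atTop_atTop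
  filter_upwards [ht.eventually_ge_atTop (K / δ' ^ 5), ht.eventually_ge_atTop (K / (δ' ^ 5 * ε)),
    ht.eventually_ge_atTop (2 * a / δ), ht.eventually_gt_atTop 0] with n h1 h2 h3 h4 z hz
  have hd5 : 0 < δ' ^ 5 := by positivity
  rw [div_le_iff₀ hd5] at h1
  rw [div_le_iff₀ (by positivity)] at h2
  rw [div_le_iff₀ hδ] at h3
  refine (hmain δ' n z hδ0 (min_le_right _ _) (by linarith) ?_).trans ?_
  · intro y hy1 hy2
    have hdd : δ' * √n ≤ δ * √n / 2 := by
      have := min_le_left (δ / 2) 1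
      nlinarith
    have hsn : √n * √n = n := mul_self_sqrt (Nat.cast_nonneg n)
    have hpos : ∀ y : ℝ, 0 ≤ y → y ≤ n + 2 * √(a * n) → δ * √n ≤ ‖xAt n z - y‖ := by
      intro y y1 y2
      have h5 := hz ((y - n) / √n) (by rw [le_div_iff₀ h4]; nlinarith) (by
          rw [div_le_iff₀ h4, mul_assoc, ← sqrt_mul ha.le]; linarith)
      have e : xAt n z - y = (√n : ℝ) * (z - ((y - n) / √n : ℝ)) := by
        have : ((√n : ℝ) : ℂ) ≠ 0 := by exact_mod_cast h4.ne'
        unfold xAt rootN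
        push_cast
        field_simp
        ring
      rw [e, norm_mul, Complex.norm_of_nonneg h4.le]
      nlinarith
    by_cases hy0 : 0 ≤ y
    · have := hpos y hy0 hy2
      nlinarith [mul_pos hδ h4]
    · push Not at hy0
      have h6 := hpos 0 le_rfl (by positivity)
      have h7 : ‖xAt n z - (0 : ℝ)‖ ≤ ‖xAt n z - y‖ + |y| := by
        calc ‖xAt n z - (0 : ℝ)‖ = ‖(xAt n z - y) + (y : ℂ)‖ := by push_cast; ring_nf
          _ ≤ _ := by
            refine (norm_add_le _ _).trans ?_
            rw [norm_real, norm_eq_abs]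
      have h8 : |y| ≤ a := by rw [abs_of_neg hy0]; linarith
      linarith
  · rw [div_le_iff₀ (by positivity)]
    linarith

theorem sqrt_scale {d : ℝ} (hd : 0 < d) (a : ℝ) : √(d ^ 2 * a) = d * √a := by
  rw [sqrt_mul (by positivity), sqrt_sq hd.le]

theorem exists_eq_ofReal_mul {d : ℝ} (hd : 0 < d) (z : ℂ) : ∃ w, z = d * w :=
  ⟨z / d, (mul_div_cancel₀ z (ofReal_ne_zero.mpr hd.ne')).symm⟩

theorem uniformEquiv_outer {d a : ℝ} (hd : 0 < d) (ha : 0 < a) (b : ℝ) {δ : ℝ} (hδ : 0 < δ) : UniformEquiv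
    (piAt d (d ^ 2 * a) (d ^ 2 * b)) (outerApprox d (d ^ 2 * a)) (outerRegion d (d ^ 2 * a) δ) := by
  intro ε hε
  filter_upwards [uniformEquiv_outer_one ha b (div_pos hδ hd) ε hε] with n hn z hz
  obtain ⟨z, rfl⟩ := exists_eq_ofReal_mul hd z
  have hdc : (d : ℂ) ^ n ≠ 0 := pow_ne_zero n (ofReal_ne_zero.mpr hd.ne')
  rw [piAt_scale hd, outerApprox_scale hd, mul_div_mul_left _ _ hdc]
  refine hn z fun t h1 h2 => ?_
  have h3 := hz (d * t) (by nlinarith) (by rw [sqrt_scale hd]; nlinarith)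
  rwa [ofReal_mul, ← mul_sub, norm_mul, Complex.norm_of_nonneg hd.le, mul_comm, ← div_le_iff₀ hd] at h3

/-- The general term of the confluent series. -/
def kTerm (a ν E : ℂ) (j : ℕ) : ℂ := (-a) ^ j / (j.factorial : ℂ) * (Gamma (ν - j + 1))⁻¹ * (Gamma (E - ν + j + 1))⁻¹

/-- A regularised confluent hypergeometric series. -/
def kSer (a ν E : ℂ) : ℂ := ∑' j, kTerm a ν E j

theorem rGamma_eq (s : ℂ) : (Gamma s)⁻¹ = s * (Gamma (s + 1))⁻¹ := one_div_Gamma_eq_self_mul_one_div_Gamma_add_one s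

theorem differentiable_rGamma : Differentiable ℂ fun s => (Gamma s)⁻¹ := differentiable_one_div_Gamma

theorem kTerm_succ (a ν E : ℂ) (j : ℕ) :
    (j + 1) * (E - ν + j + 1) * kTerm a ν E (j + 1) = -a * (ν - j) * kTerm a ν E j := by
  have h1 := rGamma_eq (ν - j)
  have h2 := rGamma_eq (E - ν + j + 1)
  have hj : ((j : ℂ) + 1) ≠ 0 := Nat.cast_add_one_ne_zero j
  have hf : ((j.factorial : ℕ) : ℂ) ≠ 0 := by exact_mod_cast j.factorial_ne_zero
  unfold kTerm
  rw [Nat.factorial_succ]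
  push_cast
  rw [show ν - (j + 1) + 1 = ν - j by ring, show E - ν + (j + 1) + 1 = E - ν + j + 1 + 1 by ring, h1, h2]
  field_simp
  ring

theorem exists_kTerm_bound (B : ℝ) : ∃ C : ℝ, ∀ (j : ℕ) (a ν E : ℂ), ‖a‖ ≤ B → ‖ν‖ ≤ B → ‖E‖ ≤ B →
    ‖kTerm a ν E j‖ ≤ C * (1 / 2) ^ j := by
  set J := ⌈8 * B⌉₊ with hJ
  have hcomp : IsCompact (Metric.closedBall (0 : ℂ × ℂ × ℂ) B) := isCompact_closedBall _ _
  have hcont : ∀ j, Continuous fun q : ℂ × ℂ × ℂ => kTerm q.1 q.2.1 q.2.2 j := by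
    intro j
    have := differentiable_rGamma.continuous
    unfold kTerm
    exact (((continuous_fst.neg.pow j).div_const _).mul (this.comp (by fun_prop))).mul (this.comp (by fun_prop))
  have hb : ∀ j, ∃ C, ∀ q ∈ Metric.closedBall (0 : ℂ × ℂ × ℂ) B, ‖kTerm q.1 q.2.1 q.2.2 j‖ ≤ C :=
    fun j => hcomp.exists_bound_of_continuousOn (hcont j).continuousOn
  choose Cf hCf using hb
  have hmem : ∀ {a ν E : ℂ}, ‖a‖ ≤ B → ‖ν‖ ≤ B → ‖E‖ ≤ B → (a, ν, E) ∈ Metric.closedBall (0 : ℂ × ℂ × ℂ) B := by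
    intro a ν E h1 h2 h3
    rw [mem_closedBall_zero_iff]
    exact max_le h1 (max_le h2 h3)
  set C0 := ∑ j ∈ Finset.range (J + 1), |Cf j| with hC0
  have hC00 : 0 ≤ C0 := Finset.sum_nonneg fun _ _ => abs_nonneg _
  have hsmall : ∀ j ≤ J, ∀ {a ν E : ℂ}, ‖a‖ ≤ B → ‖ν‖ ≤ B → ‖E‖ ≤ B → ‖kTerm a ν E j‖ ≤ C0 := by
    intro j hj a ν E h1 h2 h3
    refine (hCf j _ (hmem h1 h2 h3)).trans ((le_abs_self _).trans ?_)
    exact Finset.single_le_sum (f := fun j => |Cf j|) (fun _ _ => abs_nonneg _) (Finset.mem_range.mpr (by omega))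
  refine ⟨C0 * 2 ^ J, ?_⟩
  intro j a ν E h1 h2 h3
  have hB : 0 ≤ B := (norm_nonneg _).trans h1
  rcases le_total j J with hj | hj
  · refine (hsmall j hj h1 h2 h3).trans ?_
    have : (1 : ℝ) ≤ 2 ^ J * (1 / 2) ^ j := by
      rw [one_div, inv_pow, ← div_eq_mul_inv, one_le_div (by positivity)]
      exact pow_le_pow_right₀ (by norm_num) hj
    nlinarith
  · obtain ⟨i, rfl⟩ := Nat.exists_eq_add_of_le hj
    have e : C0 * 2 ^ J * (1 / 2 : ℝ) ^ (J + i) = C0 * (1 / 2) ^ i := by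
      rw [pow_add, mul_assoc, ← mul_assoc (2 ^ J), ← mul_pow]; norm_num
    rw [e]
    clear e hj
    induction i with
    | zero => simpa using hsmall J le_rfl h1 h2 h3
    | succ i ih =>
      have hrec := kTerm_succ a ν E (J + i)
      have hJB : 8 * B ≤ J := Nat.le_ceil _
      set j : ℕ := J + i with hjdef
      have hjJ : (J : ℝ) ≤ j := by rw [hjdef]; push_cast; linarith [Nat.cast_nonneg (α := ℝ) i]
      have hj0 : (0 : ℝ) ≤ j := Nat.cast_nonneg j
      have hn := congrArg norm hrec
      rw [norm_mul, norm_mul, norm_mul, norm_mul, norm_neg] at hn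
      have n1 : ‖(j : ℂ) + 1‖ = j + 1 := by rw [← Nat.cast_add_one, Complex.norm_natCast]; push_cast; ring
      have n2 : (j : ℝ) + 1 - 2 * B ≤ ‖E - ν + j + 1‖ := by
        have h4 : ‖((j : ℂ) + 1)‖ ≤ ‖E - ν + j + 1‖ + ‖ν - E‖ := by
          calc ‖((j : ℂ) + 1)‖ = ‖(E - ν + j + 1) + (ν - E)‖ := by ring_nf
            _ ≤ _ := norm_add_le _ _
        rw [n1] at h4
        have := norm_sub_le ν E
        linarith
      have n3 : ‖ν - j‖ ≤ B + j := by
        refine (norm_sub_le _ _).trans ?_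
        rw [Complex.norm_natCast]; linarith
      rw [n1] at hn
      have hT := norm_nonneg (kTerm a ν E j)
      have hT' := norm_nonneg (kTerm a ν E (j + 1))
      have h5 : (j + 1) * ((j + 1 : ℝ) / 2) * ‖kTerm a ν E (j + 1)‖ ≤ B * (2 * (j + 1)) * ‖kTerm a ν E j‖ := by
        calc (j + 1) * ((j + 1 : ℝ) / 2) * ‖kTerm a ν E (j + 1)‖
            ≤ (j + 1) * ‖E - ν + j + 1‖ * ‖kTerm a ν E (j + 1)‖ := by gcongr; linarith
          _ = _ := hn
          _ ≤ B * (2 * (j + 1)) * ‖kTerm a ν E j‖ := by gcongr; linarith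
      have h6 : ‖kTerm a ν E (j + 1)‖ ≤ ‖kTerm a ν E j‖ / 2 := by
        have hpos : (0 : ℝ) < (j + 1) * ((j + 1 : ℝ) / 2) := by positivity
        refine le_of_mul_le_mul_left (h5.trans ?_) hpos
        have : 0 ≤ ((j : ℝ) + 1) * ‖kTerm a ν E j‖ := by positivity
        nlinarith
      rw [show J + (i + 1) = j + 1 by omega, pow_succ]
      linarith

theorem summable_kTerm (a ν E : ℂ) : Summable (kTerm a ν E) := by
  obtain ⟨C, hC⟩ := exists_kTerm_bound (max ‖a‖ (max ‖ν‖ ‖E‖))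
  refine Summable.of_norm_bounded (g := fun j => C * (1 / 2 : ℝ) ^ j)
    ((summable_geometric_of_lt_one (by norm_num) (by norm_num)).mul_left C) fun j => ?_
  exact hC j a ν E (le_max_left _ _) ((le_max_left _ _).trans (le_max_right _ _))
    ((le_max_right _ _).trans (le_max_right _ _))

theorem hasSum_kTerm (a ν E : ℂ) : HasSum (kTerm a ν E) (kSer a ν E) := (summable_kTerm a ν E).hasSum

section
variable {h f g : ℂ → ℂ} (hh : Differentiable ℂ h) (hf : Differentiable ℂ f) (hg : Differentiable ℂ g)
include hh hf hg

theorem differentiable_kTerm (j : ℕ) : Differentiable ℂ fun w => kTerm (h w) (f w) (g w) j := by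
  unfold kTerm
  exact (((hh.neg.pow j).div_const _).mul (differentiable_rGamma.comp ((hf.sub_const _).add_const _))).mul
    (differentiable_rGamma.comp (((hg.sub hf).add_const _).add_const _))

theorem kSer_local (w₀ : ℂ) : ∃ (U : Set ℂ) (u : ℕ → ℝ), IsOpen U ∧ w₀ ∈ U ∧ Summable u ∧
    ∀ j, ∀ w ∈ U, ‖kTerm (h w) (f w) (g w) j‖ ≤ u j := by
  set B := max ‖h w₀‖ (max ‖f w₀‖ ‖g w₀‖) + 1 with hB
  obtain ⟨C, hC⟩ := exists_kTerm_bound B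
  refine ⟨{w | ‖h w‖ < B} ∩ ({w | ‖f w‖ < B} ∩ {w | ‖g w‖ < B}), fun j => C * (1 / 2 : ℝ) ^ j, ?_, ?_, ?_, ?_⟩
  · exact (isOpen_lt hh.continuous.norm continuous_const).inter ((isOpen_lt hf.continuous.norm continuous_const).inter
      (isOpen_lt hg.continuous.norm continuous_const))
  · refine ⟨?_, ?_, ?_⟩ <;> rw [Set.mem_ofPred_eq, hB]
    · linarith [le_max_left ‖h w₀‖ (max ‖f w₀‖ ‖g w₀‖)]
    · linarith [le_max_left ‖f w₀‖ ‖g w₀‖, le_max_right ‖h w₀‖ (max ‖f w₀‖ ‖g w₀‖)]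
    · linarith [le_max_right ‖f w₀‖ ‖g w₀‖, le_max_right ‖h w₀‖ (max ‖f w₀‖ ‖g w₀‖)]
  · exact (summable_geometric_of_lt_one (by norm_num) (by norm_num)).mul_left C
  · rintro j w ⟨h1, h2, h3⟩
    exact hC j _ _ _ (le_of_lt h1) (le_of_lt h2) (le_of_lt h3)

theorem differentiable_kSer : Differentiable ℂ fun w => kSer (h w) (f w) (g w) := by
  intro w₀
  obtain ⟨U, u, hU, hw, hu, hb⟩ := kSer_local hh hf hg w₀
  exact (differentiableOn_tsum_of_summable_norm hu
    (fun j => (differentiable_kTerm hh hf hg j).differentiableOn) hU hb).differentiableAt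
    (hU.mem_nhds hw)

end

theorem hasDerivAt_kSer (a ν E : ℂ) : HasDerivAt (fun a => kSer a ν E) (-kSer a (ν - 1) E) a := by
  have h1 : Differentiable ℂ fun a : ℂ => a := differentiable_id
  have h2 : Differentiable ℂ fun _ : ℂ => ν := differentiable_const _
  have h3 : Differentiable ℂ fun _ : ℂ => E := differentiable_const _
  obtain ⟨U, u, hU, hw, hu, hb⟩ := kSer_local h1 h2 h3 a
  have hs := hasSum_deriv_of_summable_norm hu (fun j => (differentiable_kTerm h1 h2 h3 j).differentiableOn) hU hb hw
  have hd0 : deriv (fun a => kTerm a ν E 0) a = 0 := by simp [kTerm]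
  have hd : ∀ j, deriv (fun a => kTerm a ν E (j + 1)) a = -kTerm a (ν - 1) E j := by
    intro j
    have hf : ((j.factorial : ℕ) : ℂ) ≠ 0 := by exact_mod_cast j.factorial_ne_zero
    have hj : ((j : ℂ) + 1) ≠ 0 := Nat.cast_add_one_ne_zero j
    have : HasDerivAt (fun a => kTerm a ν E (j + 1)) (-kTerm a (ν - 1) E j) a := by
      unfold kTerm
      have := (((((hasDerivAt_id a).neg).pow (j + 1)).div_const
        (((j + 1).factorial : ℕ) : ℂ)).mul_const (Gamma (ν - (j + 1 : ℕ) + 1))⁻¹).mul_const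
        (Gamma (E - ν + (j + 1 : ℕ) + 1))⁻¹
      refine this.congr_deriv ?_
      rw [Nat.factorial_succ]
      push_cast
      rw [show ν - (j + 1) + 1 = ν - 1 - j + 1 by ring, show E - ν + (j + 1) + 1 = E - (ν - 1) + j + 1 by ring]
      simp only [Pi.neg_apply, id]
      field_simp
    exact this.deriv
  have hs2 : HasSum (fun j => deriv (fun a => kTerm a ν E j) a) (deriv (fun a => kSer a ν E) a) := hs
  have hs' := (hasSum_nat_add_iff' 1).mpr hs2
  rw [Finset.sum_range_one, hd0, sub_zero] at hs'
  simp only [hd] at hs'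
  have he := hs'.unique (hasSum_kTerm a (ν - 1) E).neg
  rw [← he]
  exact (differentiable_kSer h1 h2 h3 a).hasDerivAt

theorem natCast_mul_kTerm (a ν E : ℂ) (j : ℕ) :
    ((j + 1 : ℕ) : ℂ) * kTerm a ν E (j + 1) = -a * kTerm a (ν - 1) E j := by
  have hf : ((j.factorial : ℕ) : ℂ) ≠ 0 := by exact_mod_cast j.factorial_ne_zero
  have hj : ((j : ℂ) + 1) ≠ 0 := Nat.cast_add_one_ne_zero j
  unfold kTerm
  rw [Nat.factorial_succ]
  push_cast
  rw [show ν - (j + 1) + 1 = ν - 1 - j + 1 by ring, show E - ν + (j + 1) + 1 = E - (ν - 1) + j + 1 by ring]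
  field_simp
  ring

theorem hasSum_natCast_mul_kTerm (a ν E : ℂ) :
    HasSum (fun j : ℕ => (j : ℂ) * kTerm a ν E j) (-a * kSer a (ν - 1) E) := by
  have h : HasSum (fun j : ℕ => ((j + 1 : ℕ) : ℂ) * kTerm a ν E (j + 1)) (-a * kSer a (ν - 1) E) := by
    simp only [natCast_mul_kTerm]
    exact (hasSum_kTerm a (ν - 1) E).mul_left _
  have := (hasSum_nat_add_iff (f := fun j : ℕ => (j : ℂ) * kTerm a ν E j) 1).mp h
  simpa using this

theorem kSer_rec (a ν E : ℂ) : (ν + 1) * kSer a (ν + 1) E = (E - a - ν) * kSer a ν E - a * kSer a (ν - 1) E := by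
  have h1 := hasSum_natCast_mul_kTerm a (ν + 1) E
  rw [show ν + 1 - 1 = ν by ring] at h1
  have h2 := hasSum_natCast_mul_kTerm a ν E
  have h3 := ((hasSum_kTerm a ν E).mul_left (E - ν)).add (h1.add h2)
  have h4 := (hasSum_kTerm a (ν + 1) E).mul_left (ν + 1)
  have e : (fun j : ℕ => (ν + 1) * kTerm a (ν + 1) E j) = fun j : ℕ => (E - ν) * kTerm a ν E j
        + ((j : ℂ) * kTerm a (ν + 1) E j + (j : ℂ) * kTerm a ν E j) := by
    funext j
    have g1 := rGamma_eq (ν - j + 1)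
    have g2 := rGamma_eq (E - ν + j)
    unfold kTerm
    rw [show ν + 1 - j + 1 = ν - j + 1 + 1 by ring, show E - (ν + 1) + j + 1 = E - ν + j by ring, g1, g2]
    ring
  rw [e] at h4
  have := h4.unique h3
  linear_combination this

theorem kSer_snd (a ν E : ℂ) : (ν + 1) * kSer a E (ν + 1) = kSer a E ν + kSer a (E - 1) ν := by
  have h1 := (hasSum_kTerm a E (ν + 1)).mul_left (ν + 1)
  have h2 := (hasSum_kTerm a E ν).add (hasSum_kTerm a (E - 1) ν)
  have e : (fun j : ℕ => (ν + 1) * kTerm a E (ν + 1) j) = fun j : ℕ => kTerm a E ν j + kTerm a (E - 1) ν j := by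
    funext j
    have g1 := rGamma_eq (E - j)
    have g2 := rGamma_eq (ν - E + j + 1)
    unfold kTerm
    rw [show ν + 1 - E + j + 1 = ν - E + j + 1 + 1 by ring, show E - 1 - j + 1 = E - j by ring,
      show ν - (E - 1) + j + 1 = ν - E + j + 1 + 1 by ring, g1, g2]
    ring
  rw [e] at h1
  exact h1.unique h2

theorem kSer_snd_pred (a ν E : ℂ) : kSer a E (ν - 1) = (ν - E) * kSer a E ν - a * kSer a (E - 1) ν := by
  have h1 := hasSum_natCast_mul_kTerm a E ν
  have h2 := ((hasSum_kTerm a E ν).mul_left (ν - E)).add h1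
  have e : kTerm a E (ν - 1) = fun j : ℕ => (ν - E) * kTerm a E ν j + (j : ℂ) * kTerm a E ν j := by
    funext j
    have g2 := rGamma_eq (ν - E + j)
    unfold kTerm
    rw [show ν - 1 - E + j + 1 = ν - E + j by ring, g2]
    ring
  have h3 := hasSum_kTerm a E (ν - 1)
  rw [e] at h3
  rw [h3.unique h2]; ring

theorem kSer_snd_rec (a ν E : ℂ) :
    a * (ν + 1) * kSer a E (ν + 1) + (E - a - ν) * kSer a E ν + kSer a E (ν - 1) = 0 := by
  linear_combination a * kSer_snd a ν E + kSer_snd_pred a ν E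

theorem kSer_zero (ν E : ℂ) : kSer 0 ν E = (Gamma (ν + 1))⁻¹ * (Gamma (E - ν + 1))⁻¹ := by
  unfold kSer
  rw [tsum_eq_single 0]
  · simp [kTerm]
  · intro j hj; simp [kTerm, hj]

theorem kSer_casoratian (a ν E : ℂ) : kSer a ν E * kSer a E (ν - 1) + a * kSer a (ν - 1) E * kSer a E ν
      = -(exp a / π) * sin (π * (E - ν)) * ((Gamma (ν + 1))⁻¹ * (Gamma (E + 1))⁻¹) := by
  set X : ℂ → ℂ := fun a => kSer a ν E * kSer a E (ν - 1) + a * kSer a (ν - 1) E * kSer a E ν with hX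
  have hd : ∀ a, HasDerivAt X (X a) a := by
    intro a
    have h := ((hasDerivAt_kSer a ν E).mul (hasDerivAt_kSer a E (ν - 1))).add
      (((hasDerivAt_id a).mul (hasDerivAt_kSer a (ν - 1) E)).mul (hasDerivAt_kSer a E ν))
    refine h.congr_deriv ?_
    have r1 := kSer_rec a (ν - 1) E
    have r2 := kSer_snd a (ν - 1) E
    have r3 := kSer_snd_pred a ν E
    rw [show ν - 1 + 1 = ν by ring] at r1 r2
    simp only [hX, id, Pi.mul_apply]
    linear_combination -kSer a E ν * r1 + kSer a ν E * r2 - kSer a (ν - 1) E * r3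
  have hc : ∀ a, HasDerivAt (fun a => X a * exp (-a)) 0 a := by
    intro a
    have := (hd a).mul ((hasDerivAt_id a).neg.cexp)
    refine this.congr_deriv ?_
    simp only [Pi.neg_apply, id]
    ring
  have hconst : X a * exp (-a) = X 0 * exp (-0) := is_const_of_deriv_eq_zero (f := fun a => X a * exp (-a))
      (fun a => (hc a).differentiableAt) (fun a => (hc a).deriv) a 0
  have h0 : X 0 = -(1 / π) * sin (π * (E - ν)) * ((Gamma (ν + 1))⁻¹ * (Gamma (E + 1))⁻¹) := by
    simp only [hX, kSer_zero, zero_mul, add_zero]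
    have hr := Gamma_mul_Gamma_one_sub (E - ν + 1)
    have hr' : (Gamma (E - ν + 1))⁻¹ * (Gamma (ν - 1 - E + 1))⁻¹ = -(1 / π) * sin (π * (E - ν)) := by
      rw [← mul_inv, show ν - 1 - E + 1 = 1 - (E - ν + 1) by ring, hr, inv_div, mul_add, mul_one, sin_add_pi]
      ring
    linear_combination ((Gamma (ν + 1))⁻¹ * (Gamma (E + 1))⁻¹) * hr'
  change X a = _
  have he : X a = X 0 * exp a := by
    rw [neg_zero, exp_zero, mul_one] at hconst
    rw [← hconst, mul_assoc, ← exp_add, neg_add_cancel, exp_zero, mul_one]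
  rw [he, h0]
  ring

theorem kSer_add_nat (a ν : ℂ) (k : ℕ) : kSer a (ν + k) ν = (-a) ^ k * kSer a ν (ν + k) := by
  have h1 : ∀ j < k, kTerm a (ν + k) ν j = 0 := by
    intro j hj
    unfold kTerm
    have : ν - (ν + k) + j + 1 = -((k - 1 - j : ℕ) : ℂ) := by
      rw [Nat.cast_sub (by omega), Nat.cast_sub (by omega)]; push_cast; ring
    rw [this, Gamma_neg_nat_eq_zero, inv_zero, mul_zero]
  have h2 : ∀ j, kTerm a (ν + k) ν (j + k) = (-a) ^ k * kTerm a ν (ν + k) j := by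
    intro j
    unfold kTerm
    rw [show ν + k - (j + k : ℕ) + 1 = ν - j + 1 by push_cast; ring,
      show ν - (ν + k) + (j + k : ℕ) + 1 = (j : ℂ) + 1 by push_cast; ring,
      show ν + k - ν + j + 1 = ((j + k : ℕ) : ℂ) + 1 by push_cast; ring,
      Gamma_nat_eq_factorial, Gamma_nat_eq_factorial, pow_add]
    ring
  have h3 := (hasSum_nat_add_iff' k).mpr (hasSum_kTerm a (ν + k) ν)
  rw [Finset.sum_eq_zero fun j hj => h1 j (Finset.mem_range.mp hj), sub_zero] at h3
  simp only [h2] at h3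
  exact h3.unique ((hasSum_kTerm a ν (ν + k)).mul_left _)

theorem norm_kSer_sub_le {a ν E : ℂ} {ρ : ℝ} (hρ : ∀ j : ℕ, ρ ≤ ‖E - ν + j + 1‖)
    (hρ0 : 0 < ρ) (hρa : 2 * ‖a‖ * (‖ν‖ + 1) ≤ ρ) :
    ‖kSer a ν E - (Gamma (ν + 1))⁻¹ * (Gamma (E - ν + 1))⁻¹‖ ≤ 2 * ‖a‖ * (‖ν‖ + 1) / ρ
        * ‖(Gamma (ν + 1))⁻¹ * (Gamma (E - ν + 1))⁻¹‖ := by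
  set q := ‖a‖ * (‖ν‖ + 1) / ρ with hq
  have hν := norm_nonneg ν
  have hq0 : 0 ≤ q := by positivity
  have hq1 : q ≤ 1 / 2 := by rw [hq, div_le_div_iff₀ hρ0 two_pos]; linarith
  have ht0 : kTerm a ν E 0 = (Gamma (ν + 1))⁻¹ * (Gamma (E - ν + 1))⁻¹ := by simp [kTerm]
  rw [← ht0]
  set t0 := ‖kTerm a ν E 0‖ with ht0'
  have hstep : ∀ j, ‖kTerm a ν E (j + 1)‖ ≤ q * ‖kTerm a ν E j‖ := by
    intro j
    have hn := congrArg norm (kTerm_succ a ν E j)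
    rw [norm_mul, norm_mul, norm_mul, norm_mul, norm_neg] at hn
    have n1 : ‖(j : ℂ) + 1‖ = j + 1 := by rw [← Nat.cast_add_one, Complex.norm_natCast]; push_cast; ring
    rw [n1] at hn
    have hj : (0 : ℝ) ≤ j := Nat.cast_nonneg j
    have n3 : ‖ν - j‖ ≤ (‖ν‖ + 1) * (j + 1) := by
      refine (norm_sub_le _ _).trans ?_
      rw [Complex.norm_natCast]; nlinarith
    have hpos : (0 : ℝ) < (j + 1) * ρ := by positivity
    refine le_of_mul_le_mul_left ?_ hpos
    calc (j + 1) * ρ * ‖kTerm a ν E (j + 1)‖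
        ≤ (j + 1) * ‖E - ν + j + 1‖ * ‖kTerm a ν E (j + 1)‖ := by gcongr; exact hρ j
      _ = _ := hn
      _ ≤ ‖a‖ * ((‖ν‖ + 1) * (j + 1)) * ‖kTerm a ν E j‖ := by gcongr
      _ = _ := by rw [hq]; field_simp
  have hb : ∀ j, ‖kTerm a ν E j‖ ≤ q ^ j * t0 := by
    intro j
    induction j with
    | zero => simp [ht0']
    | succ j ih =>
      calc _ ≤ q * ‖kTerm a ν E j‖ := hstep j
        _ ≤ q * (q ^ j * t0) := by gcongr
        _ = _ := by ring
  have h3 := (hasSum_nat_add_iff' 1).mpr (hasSum_kTerm a ν E)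
  rw [Finset.sum_range_one] at h3
  have hgeo : HasSum (fun j : ℕ => q * t0 * q ^ j) (q * t0 * (1 - q)⁻¹) :=
    (hasSum_geometric_of_lt_one hq0 (by linarith)).mul_left _
  have h4 := tsum_of_norm_bounded hgeo (f := fun j => kTerm a ν E (j + 1)) fun j => by
    refine (hb (j + 1)).trans (le_of_eq (by ring))
  rw [h3.tsum_eq] at h4
  refine h4.trans ?_
  have hinv : (1 - q)⁻¹ ≤ 2 := by rw [inv_le_comm₀ (by linarith) (by norm_num)]; linarith
  have ht00 : 0 ≤ t0 := norm_nonneg _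
  calc q * t0 * (1 - q)⁻¹ ≤ q * t0 * 2 := by gcongr
    _ = _ := by rw [hq]; ring

section

/-- The recurrence of `π_n` (with `d = 1`) from index `m` on. -/
def SolvesFrom (a b : ℝ) (x : ℂ) (m : ℕ) (u : ℕ → ℂ) : Prop :=
  ∀ k, m ≤ k → u (k + 2) = (x - (k + 1)) * u (k + 1) - (a * (k + 1) + b) * u k

/-- The Casoratian of two sequences. -/
def casor (u v : ℕ → ℂ) (k : ℕ) : ℂ := u (k + 1) * v k - u k * v (k + 1)

/-- The periodic factor `e^{2πi(x+a)}`. -/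
def per (a : ℝ) (x : ℂ) : ℂ := exp (2 * π * I * (x + a))

/-- The solution which is dominant in the upper half plane. -/
def solL (a b : ℝ) (x : ℂ) (k : ℕ) : ℂ := Gamma (k + b / a + 1) * kSer a (k + b / a) (x + a + b / a)

/-- The solution which is recessive in the upper half plane. -/
def solM (a b : ℝ) (x : ℂ) (k : ℕ) : ℂ := Gamma (k + b / a + 1) * exp ((π * I - Real.log a) * (x + a - k))
    * kSer a (x + a + b / a) (k + b / a)

/-- The constant in the Casoratian. -/
def kap (a b : ℝ) (x : ℂ) (k : ℕ) : ℂ := Gamma (k + b / a + 1) * (Gamma (x + a + b / a + 1))⁻¹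
    * exp (Real.log a * (k - (x + a))) * exp a / (2 * π)

variable {a b : ℝ} {x : ℂ} {m : ℕ}

theorem SolvesFrom.add {u v : ℕ → ℂ} (hu : SolvesFrom a b x m u) (hv : SolvesFrom a b x m v) :
    SolvesFrom a b x m (fun k => u k + v k) := fun k hk => by
  simp only [hu k hk, hv k hk]; ring

theorem SolvesFrom.const_mul {u : ℕ → ℂ} (hu : SolvesFrom a b x m u) (c : ℂ) :
    SolvesFrom a b x m (fun k => c * u k) := fun k hk => by
  simp only [hu k hk]; ring

theorem SolvesFrom.eq {u v : ℕ → ℂ} (hu : SolvesFrom a b x m u) (hv : SolvesFrom a b x m v)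
    (h0 : u m = v m) (h1 : u (m + 1) = v (m + 1)) {k : ℕ} (hk : m ≤ k) : u k = v k := by
  have : ∀ j, u (m + j) = v (m + j) ∧ u (m + j + 1) = v (m + j + 1) := by
    intro j
    induction j with
    | zero => exact ⟨h0, h1⟩
    | succ j ih =>
      refine ⟨ih.2, ?_⟩
      have e1 := hu (m + j) (by omega)
      have e2 := hv (m + j) (by omega)
      rw [show m + (j + 1) + 1 = m + j + 2 by ring, e1, e2, ih.1, ih.2]
  obtain ⟨j, rfl⟩ := Nat.exists_eq_add_of_le hk
  exact (this j).1

theorem SolvesFrom.cramer {p u v : ℕ → ℂ} (hp : SolvesFrom a b x m p)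
    (hu : SolvesFrom a b x m u) (hv : SolvesFrom a b x m v) {j : ℕ} (hj : m ≤ j)
    (hc : casor u v j ≠ 0) {k : ℕ} (hk : j ≤ k) :
    p k = casor p v j / casor u v j * u k + casor u p j / casor u v j * v k := by
  have mono : ∀ {w : ℕ → ℂ}, SolvesFrom a b x m w → SolvesFrom a b x j w := fun hw i hi => hw i (hj.trans hi)
  refine SolvesFrom.eq (mono hp) (((mono hu).const_mul _).add ((mono hv).const_mul _)) ?_ ?_ hk
  · rw [div_mul_eq_mul_div, div_mul_eq_mul_div, ← add_div, eq_div_iff hc]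
    unfold casor; ring
  · rw [div_mul_eq_mul_div, div_mul_eq_mul_div, ← add_div, eq_div_iff hc]
    unfold casor; ring

theorem IsPi.solvesFrom {p : ℕ → ℂ} (hp : IsPi a b x p) (m : ℕ) : SolvesFrom a b x m p := fun k _ => hp.step k

theorem index_ne_zero (hm : 0 < m + 1 + b / a) {k : ℕ} (hk : m ≤ k) :
    (k + 1 + b / a : ℂ) ≠ 0 ∧ (k + 1 + b / a + 1 : ℂ) ≠ 0 := by
  have hkr : (m : ℝ) ≤ k := by exact_mod_cast hk
  constructor
  · have : (k : ℝ) + 1 + b / a ≠ 0 := by linarith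
    exact_mod_cast this
  · have : (k : ℝ) + 1 + b / a + 1 ≠ 0 := by linarith
    exact_mod_cast this

theorem solL_solvesFrom (ha : 0 < a) (hm : 0 < m + 1 + b / a) : SolvesFrom a b x m (solL a b x) := by
  intro k hk
  obtain ⟨h1, h2⟩ := index_ne_zero hm hk
  have hac : (a : ℂ) ≠ 0 := by exact_mod_cast ha.ne'
  unfold solL
  have hr := kSer_rec a (k + 1 + b / a) (x + a + b / a)
  push_cast
  rw [show (k : ℂ) + 2 + b / a + 1 = (k + 1 + b / a + 1) + 1 by ring,
    show (k : ℂ) + 2 + b / a = k + 1 + b / a + 1 by ring,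
    Gamma_add_one _ h2, Gamma_add_one _ h1,
    show (k : ℂ) + b / a + 1 = k + 1 + b / a by ring,
    show (k : ℂ) + b / a = k + 1 + b / a - 1 by ring]
  have hB : (a * (k + 1) + b : ℂ) = a * (k + 1 + b / a) := by field_simp
  rw [hB]
  linear_combination (k + 1 + b / a) * Gamma (k + 1 + b / a) * hr

theorem solM_exp_succ (ha : 0 < a) (k : ℕ) : exp ((π * I - Real.log a) * (x + a - (k + 1 : ℕ))) * a
      = -exp ((π * I - Real.log a) * (x + a - k)) * (a * a) := by
  have hexp : exp (Real.log a) = a := by rw [← ofReal_exp, Real.exp_log ha]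
  have : ((π : ℂ) * I - Real.log a) * (x + a - k) = (π * I - Real.log a) * (x + a - (k + 1 : ℕ))
        + (π * I - Real.log a) := by push_cast; ring
  have hac : (a : ℂ) ≠ 0 := by exact_mod_cast ha.ne'
  rw [this, exp_add, exp_sub, exp_pi_mul_I, hexp]
  field_simp

theorem solM_solvesFrom (ha : 0 < a) (hm : 0 < m + 1 + b / a) : SolvesFrom a b x m (solM a b x) := by
  intro k hk
  obtain ⟨h1, h2⟩ := index_ne_zero hm hk
  have hac : (a : ℂ) ≠ 0 := by exact_mod_cast ha.ne'
  unfold solM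
  have hr := kSer_snd_rec a (k + 1 + b / a) (x + a + b / a)
  have s1 := solM_exp_succ (x := x) ha k
  have s2 := solM_exp_succ (x := x) ha (k + 1)
  set w := exp ((π * I - Real.log a) * (x + a - k))
  have s1' : exp ((π * I - Real.log a) * (x + a - (k + 1 : ℕ))) = -(w * a) := by
    apply mul_right_cancel₀ hac; rw [s1]; ring
  have s2' : exp ((π * I - Real.log a) * (x + a - (k + 2 : ℕ))) = w * a * a := by
    apply mul_right_cancel₀ hac; rw [s2, s1']; ring
  rw [s1', s2']
  push_cast
  rw [show (k : ℂ) + 2 + b / a + 1 = (k + 1 + b / a + 1) + 1 by ring,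
    show (k : ℂ) + 2 + b / a = k + 1 + b / a + 1 by ring,
    Gamma_add_one _ h2, Gamma_add_one _ h1,
    show (k : ℂ) + b / a + 1 = k + 1 + b / a by ring,
    show (k : ℂ) + b / a = k + 1 + b / a - 1 by ring]
  have hB : (a * (k + 1) + b : ℂ) = a * (k + 1 + b / a) := by field_simp
  rw [hB]
  linear_combination (k + 1 + b / a) * Gamma (k + 1 + b / a) * w * a * hr

theorem per_sub_nat (a : ℝ) (x : ℂ) (k : ℕ) : exp (2 * π * I * (x + a - k)) = per a x := by
  unfold per
  rw [show 2 * (π : ℂ) * I * (x + a - k) = 2 * π * I * (x + a) - k * (2 * π * I) by ring, exp_sub,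
    exp_nat_mul_two_pi_mul_I, div_one]

theorem sin_mul_exp (τ : ℂ) : sin (π * τ) * exp (π * I * τ) = I / 2 * (1 - exp (2 * π * I * τ)) := by
  rw [show 2 * (π : ℂ) * I * τ = π * I * τ + π * I * τ by ring, exp_add, sin]
  have h : exp (-(π * τ) * I) * exp (π * I * τ) = 1 := by rw [← exp_add]; ring_nf; simp
  rw [show (π : ℂ) * τ * I = π * I * τ by ring]
  linear_combination I / 2 * h

theorem casor_solL_solM (ha : 0 < a) {k : ℕ} (hk : 0 < k + 1 + b / a) :
    casor (solL a b x) (solM a b x) k = I * (1 - per a x) * kap a b x k := by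
  obtain ⟨h1, h2⟩ := index_ne_zero hk le_rfl
  have hac : (a : ℂ) ≠ 0 := by exact_mod_cast ha.ne'
  have hpi : (π : ℂ) ≠ 0 := by exact_mod_cast pi_ne_zero
  have s1 := solM_exp_succ (x := x) ha k
  have hX := kSer_casoratian a (k + 1 + b / a) (x + a + b / a)
  have hsin := sin_mul_exp (x + a - k)
  rw [per_sub_nat] at hsin
  have hw : exp ((π * I - Real.log a) * (x + a - k)) = exp (π * I * (x + a - k))
        * exp (Real.log a * (k - (x + a))) := by
    rw [← exp_add]; ring_nf
  unfold casor solL solM kap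
  set w := exp ((π * I - Real.log a) * (x + a - k))
  have s1' : exp ((π * I - Real.log a) * (x + a - (k + 1 : ℕ))) = -(w * a) := by
    apply mul_right_cancel₀ hac; rw [s1]; ring
  rw [s1']
  push_cast
  have hS : sin (π * (x + a + b / a - (k + 1 + b / a))) = -sin (π * (x + a - k)) := by
    rw [show (π : ℂ) * (x + a + b / a - (k + 1 + b / a)) = π * (x + a - k) - π by ring, sin_sub_pi]
  rw [hS] at hX
  rw [show (k : ℂ) + b / a + 1 = k + 1 + b / a by ring, show (k : ℂ) + b / a = k + 1 + b / a - 1 by ring]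
  have hG : Gamma (k + 1 + b / a + 1) * (Gamma (k + 1 + b / a + 1))⁻¹ = 1 := by
    apply mul_inv_cancel₀
    have : (0 : ℝ) < k + 1 + b / a + 1 := by linarith
    have h3 := (Gamma_pos_of_pos this).ne'
    have h4 : ((Real.Gamma (k + 1 + b / a + 1) : ℝ) : ℂ) ≠ 0 := by exact_mod_cast h3
    rw [← Gamma_ofReal] at h4
    push_cast at h4
    exact h4
  set G := Gamma (k + 1 + b / a + 1)
  set G1 := Gamma (k + 1 + b / a)
  rw [hw] at *
  set q := exp (Real.log a * (k - (x + a)))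
  set eπ := exp (π * I * (x + a - k))
  set S := sin (π * (x + a - k))
  set rE := (Gamma (x + a + b / a + 1))⁻¹
  have hfin : G * G1 * eπ * q * (exp a / π * S * (G⁻¹ * rE))
      = I * (1 - per a x) * (G1 * rE * q * exp a / (2 * π)) := by
    have : G * G1 * eπ * q * (exp a / π * S * (G⁻¹ * rE)) = (G * G⁻¹) * (S * eπ) * G1 * q * rE * exp a / π := by ring
    rw [this, hG, hsin]
    field_simp
  rw [← hfin]
  linear_combination G * G1 * eπ * q * hX

theorem solL_eq_solM_of_per_eq_one (ha : 0 < a) (h : per a x = 1) (k : ℕ) : solL a b x k = solM a b x k := by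
  rw [← per_sub_nat a x k, exp_eq_one_iff] at h
  obtain ⟨t, ht⟩ := h
  have hac : (a : ℂ) ≠ 0 := by exact_mod_cast ha.ne'
  have hτ : x + a - k = t := by
    have h2 : (2 * (π : ℂ) * I) ≠ 0 := two_pi_I_ne_zero
    apply mul_left_cancel₀ h2
    rw [ht]; ring
  have hexp : exp (π * I - Real.log a) = -(1 / a) := by
    rw [exp_sub, exp_pi_mul_I, ← ofReal_exp, Real.exp_log ha]; ring
  unfold solL solM
  rw [hτ, mul_comm (_ - _ : ℂ) (t : ℂ), exp_int_mul, hexp]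
  obtain ⟨s, rfl | rfl⟩ := t.eq_nat_or_neg
  · have hE : x + a + b / a = (k + b / a : ℂ) + s := by push_cast at hτ; linear_combination hτ
    rw [hE, kSer_add_nat, zpow_natCast, mul_assoc, ← mul_assoc ((-(1 / (a : ℂ))) ^ s), ← mul_pow]
    rw [show -(1 / (a : ℂ)) * -a = 1 by field_simp, one_pow, one_mul]
  · have hE : (k + b / a : ℂ) = x + a + b / a + s := by push_cast at hτ; linear_combination -hτ
    rw [mul_assoc]
    congr 1
    rw [hE, kSer_add_nat, zpow_neg, zpow_natCast, ← inv_pow]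
    congr 2
    field_simp

end

section

/-- The quotient `h / s` with the singularities at simple zeros of `s` removed. -/
def remQuot (h s : ℂ → ℂ) (x : ℂ) : ℂ := if s x = 0 then deriv h x / deriv s x else h x / s x

theorem remQuot_of_ne {h s : ℂ → ℂ} {x : ℂ} (hx : s x ≠ 0) : remQuot h s x = h x / s x := if_neg hx

theorem differentiable_remQuot {h s : ℂ → ℂ} (hh : Differentiable ℂ h) (hs : Differentiable ℂ s)
    (hz : ∀ x, s x = 0 → h x = 0 ∧ deriv s x ≠ 0) : Differentiable ℂ (remQuot h s) := by
  intro x₀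
  by_cases h0 : s x₀ = 0
  · obtain ⟨h1, h2⟩ := hz x₀ h0
    have dh : Differentiable ℂ (dslope h x₀) := by
      rw [← differentiableOn_univ] at hh ⊢
      exact (differentiableOn_dslope Filter.univ_mem).mpr hh
    have ds : Differentiable ℂ (dslope s x₀) := by
      rw [← differentiableOn_univ] at hs ⊢
      exact (differentiableOn_dslope Filter.univ_mem).mpr hs
    have hne : dslope s x₀ x₀ ≠ 0 := by rwa [dslope_same]
    have hev : ∀ᶠ x in 𝓝 x₀, dslope s x₀ x ≠ 0 := ds.continuous.continuousAt.eventually_ne hne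
    refine DifferentiableAt.congr_of_eventuallyEq ((dh x₀).div (ds x₀) hne) ?_
    filter_upwards [hev] with x hx
    by_cases hxx : x = x₀
    · subst hxx
      simp only [Pi.div_apply, dslope_same, remQuot, if_pos h0]
    · have e1 : (x - x₀) * dslope s x₀ x = s x := by
        have := sub_smul_dslope s x₀ x
        rw [smul_eq_mul, h0, sub_zero] at this; exact this
      have e2 : (x - x₀) * dslope h x₀ x = h x := by
        have := sub_smul_dslope h x₀ x
        rw [smul_eq_mul, h1, sub_zero] at this; exact this
      have hd : x - x₀ ≠ 0 := sub_ne_zero.mpr hxx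
      rw [remQuot_of_ne (by rw [← e1]; exact mul_ne_zero hd hx), ← e1, ← e2, Pi.div_apply, mul_div_mul_left _ _ hd]
  · have hev : ∀ᶠ x in 𝓝 x₀, s x ≠ 0 := hs.continuous.continuousAt.eventually_ne h0
    refine DifferentiableAt.congr_of_eventuallyEq ((hh x₀).div (hs x₀) h0) ?_
    filter_upwards [hev] with x hx
    rw [remQuot_of_ne hx, Pi.div_apply]

variable {a b : ℝ} {x : ℂ} {m : ℕ}

theorem differentiable_solL (a b : ℝ) (k : ℕ) : Differentiable ℂ fun x => solL a b x k := by
  unfold solL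
  exact (differentiable_kSer (differentiable_const _) (differentiable_const _)
    ((differentiable_id.add_const _).add_const _)).const_mul _

theorem differentiable_solM (a b : ℝ) (k : ℕ) : Differentiable ℂ fun x => solM a b x k := by
  unfold solM
  exact ((((differentiable_id.add_const _).sub_const _).const_mul _).cexp.const_mul _).mul
    (differentiable_kSer (differentiable_const _) ((differentiable_id.add_const _).add_const _)
      (differentiable_const _))

theorem hasDerivAt_per (a : ℝ) (x : ℂ) : HasDerivAt (per a) (per a x * (2 * π * I)) x := by
  unfold per
  have := (((hasDerivAt_id x).add_const (a : ℂ)).const_mul (2 * π * I)).cexp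
  simpa using this

theorem differentiable_per (a : ℝ) : Differentiable ℂ (per a) := fun x => (hasDerivAt_per a x).differentiableAt

theorem one_sub_per_zero (a : ℝ) (x : ℂ) (h : 1 - per a x = 0) : deriv (fun x => 1 - per a x) x ≠ 0 := by
  rw [((hasDerivAt_per a x).const_sub 1).deriv, ← sub_eq_zero.mp h, one_mul, neg_ne_zero]
  exact two_pi_I_ne_zero

/-- The solution `(M - eL)/(1 - e)`, entire in `x`. -/
def solP (a b : ℝ) (x : ℂ) (k : ℕ) : ℂ :=
  remQuot (fun x => solM a b x k - per a x * solL a b x k) (fun x => 1 - per a x) x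

/-- The solution `(L - M)/(1 - e)`, entire in `x`. -/
def solN (a b : ℝ) (x : ℂ) (k : ℕ) : ℂ := remQuot (fun x => solL a b x k - solM a b x k) (fun x => 1 - per a x) x

theorem differentiable_solP (ha : 0 < a) (b : ℝ) (k : ℕ) : Differentiable ℂ fun x => solP a b x k := by
  refine differentiable_remQuot ((differentiable_solM a b k).sub
    ((differentiable_per a).mul (differentiable_solL a b k)))
    ((differentiable_const _).sub (differentiable_per a)) fun x hx => ⟨?_, one_sub_per_zero a x hx⟩
  rw [← sub_eq_zero.mp hx, one_mul, solL_eq_solM_of_per_eq_one ha (sub_eq_zero.mp hx).symm, sub_self]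

theorem differentiable_solN (ha : 0 < a) (b : ℝ) (k : ℕ) : Differentiable ℂ fun x => solN a b x k := by
  refine differentiable_remQuot ((differentiable_solL a b k).sub (differentiable_solM a b k))
    ((differentiable_const _).sub (differentiable_per a)) fun x hx => ⟨?_, one_sub_per_zero a x hx⟩
  rw [solL_eq_solM_of_per_eq_one ha (sub_eq_zero.mp hx).symm, sub_self]

theorem solP_eq (h : 1 - per a x ≠ 0) (k : ℕ) :
    solP a b x k = (solM a b x k - per a x * solL a b x k) / (1 - per a x) := remQuot_of_ne h

theorem solN_eq (h : 1 - per a x ≠ 0) (k : ℕ) :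
    solN a b x k = (solL a b x k - solM a b x k) / (1 - per a x) := remQuot_of_ne h

/-- The values of the polynomials at a fixed point. -/
def piSeq (a b : ℝ) (x : ℂ) (k : ℕ) : ℂ := (piPoly 1 a b k).eval x

theorem isPi_piSeq (a b : ℝ) (x : ℂ) : IsPi a b x (piSeq a b x) := isPi_piPoly a b x

theorem differentiable_piSeq (a b : ℝ) (k : ℕ) : Differentiable ℂ fun x => piSeq a b x k :=
  (piPoly 1 a b k).differentiable

/-- The part of `π_n` that is recessive in the upper half plane up to exponentially small terms. -/
def gTwo (a b : ℝ) (m : ℕ) (x : ℂ) (n : ℕ) : ℂ :=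
  I * (kap a b x m)⁻¹ * casor (piSeq a b x) (solN a b x) m * solP a b x n

theorem Gamma_real_ne_zero {r : ℝ} (hr : 0 < r) : Gamma (r : ℂ) ≠ 0 := by
  rw [Gamma_ofReal]
  exact_mod_cast (Gamma_pos_of_pos hr).ne'

theorem kap_ne_zero (hm : 0 < m + 1 + b / a) (hx : 0 < x.re + a + b / a + 1) : kap a b x m ≠ 0 := by
  have hpi : (π : ℂ) ≠ 0 := by exact_mod_cast pi_ne_zero
  unfold kap
  refine div_ne_zero (mul_ne_zero (mul_ne_zero (mul_ne_zero ?_ (inv_ne_zero ?_))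
    (exp_ne_zero _)) (exp_ne_zero _)) (mul_ne_zero two_ne_zero hpi)
  · have := Gamma_real_ne_zero (r := m + b / a + 1) (by linarith)
    push_cast at this; exact this
  · refine Gamma_ne_zero_of_re_pos ?_
    have : (x + a + b / a + 1 : ℂ).re = x.re + a + b / a + 1 := by
      have h : (b / a : ℂ) = ((b / a : ℝ) : ℂ) := by push_cast; rfl
      rw [h]; simp
    rw [this]; exact hx

theorem differentiable_kap (a b : ℝ) (m : ℕ) : Differentiable ℂ fun x => kap a b x m := by
  unfold kap
  refine (((Differentiable.mul ?_ ?_).mul_const _).div_const _)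
  · exact (differentiable_rGamma.comp (((differentiable_id.add_const _).add_const _).add_const _) ).const_mul _
  · exact (((differentiable_id.add_const _).const_sub _).const_mul _).cexp

theorem differentiableAt_gTwo (ha : 0 < a) (hm : 0 < m + 1 + b / a) (hx : 0 < x.re + a + b / a + 1) (n : ℕ) :
    DifferentiableAt ℂ (fun x => gTwo a b m x n) x := by
  unfold gTwo casor
  have h1 := ((differentiable_kap a b m) x).inv (kap_ne_zero hm hx)
  exact ((h1.const_mul _).mul (((differentiable_piSeq a b (m + 1) x).mul
    (differentiable_solN ha b m x)).sub ((differentiable_piSeq a b m x).mul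
    (differentiable_solN ha b (m + 1) x)))).mul (differentiable_solP ha b n x)

theorem conj_kSer (a : ℝ) (ν E : ℂ) : conj (kSer a (conj ν) (conj E)) = kSer a ν E := by
  unfold kSer
  rw [conj_tsum]
  congr 1
  funext j
  unfold kTerm
  simp only [map_mul, map_div₀, map_pow, map_neg, conj_ofReal, map_natCast, map_inv₀,
    ← Gamma_conj, map_add, map_sub, map_one, conj_conj]

theorem conj_solL (a b : ℝ) (x : ℂ) (k : ℕ) : conj (solL a b (conj x) k) = solL a b x k := by
  unfold solL
  rw [map_mul, ← Gamma_conj, ← conj_kSer a (k + b / a) (x + a + b / a)]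
  simp [conj_ofReal]

theorem conj_per (a : ℝ) (x : ℂ) : conj (per a (conj x)) = (per a x)⁻¹ := by
  unfold per
  rw [← exp_conj, ← exp_neg]
  congr 1
  simp only [map_mul, map_add, conj_conj, conj_I, conj_ofReal, map_ofNat]
  ring

theorem conj_solM (a b : ℝ) (x : ℂ) (k : ℕ) : conj (solM a b (conj x) k) = (per a x)⁻¹ * solM a b x k := by
  rw [← per_sub_nat a x k]
  unfold solM
  rw [map_mul, map_mul, ← Gamma_conj, ← exp_conj, ← conj_kSer a (x + a + b / a) (k + b / a), ← exp_neg]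
  have e : conj ((π * I - Real.log a) * (conj x + a - k)) = -(2 * π * I * (x + a - k))
        + (π * I - Real.log a) * (x + a - k) := by
    simp only [map_mul, map_sub, map_add, conj_I, conj_ofReal, conj_conj, map_natCast]
    ring
  have hG : conj (k + b / a + 1 : ℂ) = k + b / a + 1 := by simp
  have h1 : conj (x + a + b / a) = conj x + a + b / a := by simp
  have h2 : conj (k + b / a : ℂ) = k + b / a := by simp
  rw [e, exp_add, hG, h1, h2]
  ring

theorem conj_piSeq (a b : ℝ) (x : ℂ) (k : ℕ) : conj (piSeq a b (conj x) k) = piSeq a b x k := by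
  induction k using Nat.strong_induction_on with
  | _ k ih =>
    match k with
    | 0 => simp [piSeq, piPoly]
    | 1 => simp [piSeq, piPoly]
    | (j + 2) =>
      have h0 := ih j (by omega)
      have h1 := ih (j + 1) (by omega)
      rw [(isPi_piSeq a b x).step, (isPi_piSeq a b (conj x)).step, ← h0, ← h1]
      simp [conj_ofReal]

theorem conj_kap (a b : ℝ) (x : ℂ) (k : ℕ) : conj (kap a b (conj x) k) = kap a b x k := by
  unfold kap
  simp only [map_mul, map_div₀, map_inv₀, ← Gamma_conj, ← exp_conj, map_add,
    map_sub, map_natCast, conj_ofReal, map_one, conj_conj, map_ofNat]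

theorem casor_solP_solN (ha : 0 < a) (hm : 0 < m + 1 + b / a) (h : 1 - per a x ≠ 0) :
    casor (solP a b x) (solN a b x) m = -(I * kap a b x m) := by
  have hc := casor_solL_solM (x := x) ha hm
  unfold casor at hc ⊢
  rw [solP_eq h, solP_eq h, solN_eq h, solN_eq h]
  field_simp
  linear_combination (-1 + per a x) * hc

theorem piSeq_eq_of_ne (ha : 0 < a) (hm : 0 < m + 1 + b / a) (hx : 0 < x.re + a + b / a + 1)
    (h : 1 - per a x ≠ 0) {n : ℕ} (hn : m ≤ n) :
    piSeq a b x n = gTwo a b m x n + conj (gTwo a b m (conj x) n) := by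
  have hk := kap_ne_zero hm hx
  have hcas := casor_solP_solN ha hm h
  have hL := solL_solvesFrom (x := x) ha hm
  have hM := solM_solvesFrom (x := x) ha hm
  have hP : SolvesFrom a b x m (solP a b x) := by
    have : solP a b x = fun k => (1 - per a x)⁻¹ * (solM a b x k + -per a x * solL a b x k) := by
      funext k; rw [solP_eq h]; ring
    rw [this]
    exact (hM.add (hL.const_mul _)).const_mul _
  have hN : SolvesFrom a b x m (solN a b x) := by
    have : solN a b x = fun k => (1 - per a x)⁻¹ * (solL a b x k + -1 * solM a b x k) := by
      funext k; rw [solN_eq h]; ring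
    rw [this]
    exact (hL.add (hM.const_mul _)).const_mul _
  have hpi := (isPi_piSeq a b x).solvesFrom m
  have hmain := hpi.cramer hP hN (j := m) le_rfl (by rw [hcas]; exact neg_ne_zero.mpr (mul_ne_zero I_ne_zero hk)) hn
  have he0 : per a x ≠ 0 := exp_ne_zero _
  have h2 : 1 - (per a x)⁻¹ ≠ 0 := fun h0 => h (by rw [inv_eq_one.mp (sub_eq_zero.mp h0).symm, sub_self])
  have h' : 1 - per a (conj x) ≠ 0 := fun h0 => h2 (by rw [← conj_per, ← map_one conj, ← map_sub, h0, map_zero])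
  have h3 : per a x - 1 ≠ 0 := fun h0 => h (by linear_combination -h0)
  have cP : ∀ k, conj (solP a b (conj x) k) = solN a b x k := by
    intro k
    rw [solP_eq h', solN_eq h, map_div₀, map_sub, map_sub, map_mul, conj_solM, conj_solL, conj_per, map_one]
    field_simp
    ring
  have cN : ∀ k, conj (solN a b (conj x) k) = solP a b x k := by
    intro k
    rw [solN_eq h', solP_eq h, map_div₀, map_sub, map_sub, conj_solM, conj_solL, conj_per, map_one]
    field_simp
    ring
  rw [hmain, hcas]
  unfold gTwo casor
  simp only [map_mul, map_sub, map_inv₀, conj_kap, conj_piSeq, cP, cN, conj_I]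
  field_simp
  linear_combination (-(piSeq a b x (m + 1) * solN a b x m - piSeq a b x m * solN a b x (m + 1))
    * solP a b x n - (solP a b x (m + 1) * piSeq a b x m - solP a b x m * piSeq a b x (m + 1))
    * solN a b x n) * I_sq

theorem piSeq_eq (ha : 0 < a) (hm : 0 < m + 1 + b / a) (hx : 0 < x.re + a + b / a + 1) {n : ℕ} (hn : m ≤ n) :
    piSeq a b x n = gTwo a b m x n + conj (gTwo a b m (conj x) n) := by
  set F : ℝ → ℂ := fun t => piSeq a b (x + t * I) n - (gTwo a b m (x + t * I) n
    + conj (gTwo a b m (conj (x + t * I)) n)) with hF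
  have hre : ∀ t : ℝ, (x + t * I).re = x.re := fun t => by simp
  have hcont : Continuous F := by
    have hl : Continuous fun t : ℝ => x + t * I := by fun_prop
    have hg : ∀ y : ℂ, y.re = x.re → ContinuousAt (fun x => gTwo a b m x n) y := fun y hy =>
      (differentiableAt_gTwo ha hm (by rw [hy]; exact hx) n).continuousAt
    refine ((differentiable_piSeq a b n).continuous.comp hl).sub (Continuous.add ?_ ?_)
    · rw [continuous_iff_continuousAt]
      intro t
      exact ContinuousAt.comp (f := fun t : ℝ => x + t * I) (hg _ (hre t)) hl.continuousAt
    · refine continuous_conj.comp ?_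
      rw [continuous_iff_continuousAt]
      intro t
      exact ContinuousAt.comp (f := fun t : ℝ => conj (x + t * I)) (hg _ (by rw [conj_re, hre]))
        (continuous_conj.comp hl).continuousAt
  have hzero : ∀ t : ℝ, t ≠ -x.im → F t = 0 := by
    intro t ht
    rw [hF]
    simp only
    rw [← piSeq_eq_of_ne ha hm (by rw [hre]; exact hx) _ hn, sub_self]
    intro h0
    have h1 : ‖per a (x + t * I)‖ = 1 := by rw [← sub_eq_zero.mp h0, norm_one]
    unfold per at h1
    rw [norm_exp, Real.exp_eq_one_iff] at h1
    have h2 : (2 * π * I * (x + t * I + a)).re = -(2 * π) * (x.im + t) := by simp [mul_re, mul_im]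
    rw [h2] at h1
    have := pi_pos
    have h3 : x.im + t = 0 := by
      rcases mul_eq_zero.mp h1 with h | h
      · linarith
      · exact h
    exact ht (by linarith)
  have hdense : Dense {t : ℝ | t ≠ -x.im} := dense_compl_singleton _
  have hall : F = fun _ => 0 := hcont.ext_on hdense continuous_const fun t ht => hzero t ht
  have h0 := congrFun hall 0
  simp only [hF, ofReal_zero, zero_mul, add_zero] at h0
  exact sub_eq_zero.mp h0

end

/-- The logarithm of the Stirling approximation of the Gamma function. -/
def stirLog (w : ℂ) : ℂ := (w - 1 / 2) * log w - w + Real.log (√(2 * π))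

/-- One step of the Stirling remainder. -/
def stirStep (w : ℂ) : ℂ := (w + 1 / 2) * log (1 + 1 / w) - 1

theorem norm_stirStep_le {w : ℂ} (hw : 2 ≤ ‖w‖) : ‖stirStep w‖ ≤ 1 / ‖w‖ ^ 2 := by
  have hw0 : w ≠ 0 := by rw [← norm_pos_iff]; linarith
  set u : ℂ := 1 / w with hu
  have hun : ‖u‖ = 1 / ‖w‖ := by rw [hu, norm_div, norm_one]
  have hu2 : ‖u‖ ≤ 1 / 2 := by rw [hun]; exact one_div_le_one_div_of_le two_pos hw
  have hu0 := norm_nonneg u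
  have hwu : w * u = 1 := by rw [hu]; field_simp
  have hnwu : ‖w‖ * ‖u‖ = 1 := by rw [← norm_mul, hwu, norm_one]
  have h := norm_log_sub_logTaylor_le 3 (z := u) (by linarith)
  have e : logTaylor 4 u = u - u ^ 2 / 2 + u ^ 3 / 3 := by simp [logTaylor_succ, logTaylor_zero]; ring
  rw [show 3 + 1 = 4 from rfl, e] at h
  have hinv : (1 - ‖u‖)⁻¹ ≤ 2 := by rw [inv_le_comm₀ (by linarith) (by norm_num)]; linarith
  have h' : ‖log (1 + u) - (u - u ^ 2 / 2 + u ^ 3 / 3)‖ ≤ ‖u‖ ^ 4 / 2 := by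
    refine h.trans ?_
    have : ‖u‖ ^ 4 * (1 - ‖u‖)⁻¹ ≤ ‖u‖ ^ 4 * 2 := by gcongr
    push_cast
    linarith
  have key : stirStep w = u ^ 2 / 12 + u ^ 3 / 6 + w * (log (1 + u) - (u - u ^ 2 / 2 + u ^ 3 / 3))
      + (log (1 + u) - (u - u ^ 2 / 2 + u ^ 3 / 3)) / 2 := by
    unfold stirStep
    rw [← hu]
    linear_combination (1 - u / 2 + u ^ 2 / 3) * hwu
  rw [key, show 1 / ‖w‖ ^ 2 = ‖u‖ ^ 2 by rw [hun, div_pow, one_pow]]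
  generalize log (1 + u) - (u - u ^ 2 / 2 + u ^ 3 / 3) = A at *
  have t1 : ‖u ^ 2 / 12‖ = ‖u‖ ^ 2 / 12 := by rw [norm_div, norm_pow, norm_ofNat]
  have t2 : ‖u ^ 3 / 6‖ ≤ ‖u‖ ^ 2 / 12 := by rw [norm_div, norm_pow, norm_ofNat]; nlinarith [sq_nonneg ‖u‖]
  have t3 : ‖w * A‖ ≤ ‖u‖ ^ 2 / 4 := by
    rw [norm_mul]
    calc ‖w‖ * ‖A‖ ≤ ‖w‖ * (‖u‖ ^ 4 / 2) := by gcongr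
      _ = ‖w‖ * ‖u‖ * ‖u‖ ^ 3 / 2 := by ring
      _ = ‖u‖ ^ 3 / 2 := by rw [hnwu]; ring
      _ ≤ _ := by nlinarith [sq_nonneg ‖u‖]
  have t4 : ‖A / 2‖ ≤ ‖u‖ ^ 2 / 4 := by
    rw [norm_div, norm_ofNat]
    have : ‖u‖ ^ 4 ≤ ‖u‖ ^ 2 := by exact pow_le_pow_of_le_one hu0 (by linarith) (by norm_num)
    linarith
  have s1 := norm_add_le (u ^ 2 / 12 + u ^ 3 / 6 + w * A) (A / 2)
  have s2 := norm_add_le (u ^ 2 / 12 + u ^ 3 / 6) (w * A)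
  have s3 := norm_add_le (u ^ 2 / 12) (u ^ 3 / 6)
  nlinarith [sq_nonneg ‖u‖]

/-- The Gamma function divided by the Stirling approximation. -/
def stirRatio (w : ℂ) : ℂ := Gamma w * exp (-stirLog w)

theorem log_one_add_one_div {w : ℂ} (hw : 0 ≤ w.re) (hw0 : w ≠ 0) : log (1 + 1 / w) = log (w + 1) - log w := by
  have hs : SameSide (w + 1) w := by
    unfold SameSide
    rw [add_im, one_im, add_zero, add_re, one_re]
    by_cases hi : w.im = 0
    · right
      have : w.re ≠ 0 := fun h => hw0 (Complex.ext h hi)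
      exact ⟨hi, hi, by positivity⟩
    · left; exact mul_self_pos.mpr hi
  rw [← hs.log_div]
  congr 1
  field_simp

theorem stirRatio_add_one {w : ℂ} (hw : 0 ≤ w.re) (hw0 : w ≠ 0) :
    stirRatio w = stirRatio (w + 1) * exp (stirStep w) := by
  unfold stirRatio
  rw [Gamma_add_one w hw0, mul_comm w, mul_assoc, mul_assoc, ← exp_add]
  congr 1
  rw [← exp_log hw0, ← exp_add, exp_log hw0]
  congr 1
  unfold stirStep stirLog
  rw [log_one_add_one_div hw hw0]
  ring

theorem stirRatio_add_nat {w : ℂ} (hw : 0 ≤ w.re) (hw0 : w ≠ 0) (N : ℕ) : stirRatio w = stirRatio (w + N)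
      * exp (∑ k ∈ Finset.range N, stirStep (w + k)) := by
  induction N with
  | zero => simp
  | succ N ih =>
    have h1 : 0 ≤ (w + N).re := by rw [add_re, natCast_re]; positivity
    have h2 : w + N ≠ 0 := by
      intro h
      have hr := congrArg re h
      have hi := congrArg im h
      simp only [add_re, natCast_re, zero_re, add_im, natCast_im, zero_im, add_zero] at hr hi
      have hN : (0 : ℝ) ≤ N := Nat.cast_nonneg N
      exact hw0 (Complex.ext (by rw [zero_re]; linarith) hi)
    rw [ih, stirRatio_add_one h1 h2, Finset.sum_range_succ, exp_add]
    push_cast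
    rw [add_assoc w]
    ring

theorem norm_add_nat_sq_ge {w : ℂ} (hw : 0 ≤ w.re) (k : ℕ) : ‖w‖ ^ 2 + (k : ℝ) ^ 2 ≤ ‖w + k‖ ^ 2 := by
  rw [← normSq_eq_norm_sq, ← normSq_eq_norm_sq, normSq_apply, normSq_apply]
  simp only [add_re, natCast_re, add_im, natCast_im, add_zero]
  have : 0 ≤ w.re * (k : ℝ) := by positivity
  nlinarith

theorem norm_sum_stirStep_le {w : ℂ} (hw : 0 ≤ w.re) (hw2 : 2 ≤ ‖w‖) (N : ℕ) :
    ‖∑ k ∈ Finset.range N, stirStep (w + k)‖ ≤ 3 * π / ‖w‖ := by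
  have hpos : 0 < ‖w‖ := by linarith
  have h1 : ∀ k : ℕ, ‖stirStep (w + k)‖ ≤ 1 / ((0 - (k : ℝ)) ^ 2 + ‖w‖ ^ 2) := by
    intro k
    have h2 := norm_add_nat_sq_ge hw k
    have h3 : 2 ≤ ‖w + k‖ := by
      have : ‖w‖ ^ 2 ≤ ‖w + k‖ ^ 2 := by nlinarith [sq_nonneg (k : ℝ)]
      exact hw2.trans ((pow_le_pow_iff_left₀ hpos.le (norm_nonneg _) two_ne_zero).mp this)
    refine (norm_stirStep_le h3).trans ?_
    apply one_div_le_one_div_of_le (by positivity)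
    linarith
  refine (norm_sum_le _ _).trans ((Finset.sum_le_sum fun k _ => h1 k).trans ?_)
  have := sum_inv_sq_add_le (ξ := 0) (N := ‖w‖ ^ 2) (by nlinarith) N
  rwa [sqrt_sq hpos.le] at this

theorem tendsto_linear_mul_log (w : ℂ) :
    Tendsto (fun N : ℕ => (w + N + 1 / 2) * log (1 + (w + 1) / N)) atTop (𝓝 (w + 1)) := by
  have hinv : Tendsto (fun N : ℕ => ((N : ℝ))⁻¹) atTop (𝓝 0) := tendsto_inv_atTop_nhds_zero_nat
  rw [tendsto_iff_norm_sub_tendsto_zero]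
  set c := ‖w + 1‖ with hc
  set M := (‖w + 1 / 2‖ + 1) * c ^ 2 + ‖w + 1 / 2‖ * c with hM
  refine squeeze_zero' (Eventually.of_forall fun _ => norm_nonneg _) ?_
    (g := fun N : ℕ => M * ((N : ℝ))⁻¹) (by simpa using hinv.const_mul M)
  filter_upwards [eventually_ge_atTop 1, eventually_ge_atTop ⌈2 * c⌉₊] with N h1 h2
  have hN1 : (1 : ℝ) ≤ N := by exact_mod_cast h1
  have hN2 : 2 * c ≤ N := (Nat.le_ceil _).trans (by exact_mod_cast h2)
  have hNc : (N : ℂ) ≠ 0 := by exact_mod_cast (by omega : N ≠ 0)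
  set u := (w + 1) / (N : ℂ) with hu
  have hun : ‖u‖ = c / N := by rw [hu, norm_div, Complex.norm_natCast]
  have hu2 : ‖u‖ ≤ 1 / 2 := by rw [hun, div_le_div_iff₀ (by linarith) two_pos]; linarith
  have hb := (log_taylor_bounds hu2).1
  have e : (w + N + 1 / 2) * log (1 + u) - (w + 1) = (w + N + 1 / 2) * (log (1 + u) - u) + (w + 1 / 2) * u := by
    have : (N : ℂ) * u = w + 1 := by rw [hu]; field_simp
    linear_combination this
  rw [e]
  have hn1 : ‖w + N + 1 / 2‖ ≤ (‖w + 1 / 2‖ + 1) * N := by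
    calc ‖w + N + 1 / 2‖ = ‖(w + 1 / 2) + N‖ := by ring_nf
      _ ≤ ‖w + 1 / 2‖ + N := by
        refine (norm_add_le _ _).trans ?_
        rw [Complex.norm_natCast]
      _ ≤ _ := by nlinarith [norm_nonneg (w + 1 / 2)]
  calc ‖(w + N + 1 / 2) * (log (1 + u) - u) + (w + 1 / 2) * u‖
      ≤ ‖w + N + 1 / 2‖ * ‖log (1 + u) - u‖ + ‖w + 1 / 2‖ * ‖u‖ := by
        refine (norm_add_le _ _).trans ?_
        rw [norm_mul, norm_mul]
    _ ≤ (‖w + 1 / 2‖ + 1) * N * (c / N) ^ 2 + ‖w + 1 / 2‖ * (c / N) := by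
        rw [hun] at hb ⊢
        gcongr
    _ = M * ((N : ℝ))⁻¹ := by rw [hM]; field_simp

theorem tendsto_stirRatio_add_nat {w : ℂ} (hw : 0 < w.re) :
    Tendsto (fun N : ℕ => stirRatio (w + N + 1)) atTop (𝓝 1) := by
  have hw0 : w ≠ 0 := by rintro rfl; simp at hw
  have hG : Gamma w ≠ 0 := Gamma_ne_zero_of_re_pos hw
  have t1 : Tendsto (fun N : ℕ => Gamma w / GammaSeq w N) atTop (𝓝 1) := by
    have := (tendsto_const_nhds (x := Gamma w)).div (GammaSeq_tendsto_Gamma w) hG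
    rwa [div_self hG] at this
  have t2 : Tendsto (fun N : ℕ => ((Stirling.stirlingSeq N / √π : ℝ) : ℂ)) atTop (𝓝 1) := by
    have hp : √π ≠ 0 := (sqrt_pos.mpr pi_pos).ne'
    have := Stirling.tendsto_stirlingSeq_sqrt_pi.div_const (√π)
    rw [div_self hp] at this
    exact_mod_cast (continuous_ofReal.tendsto 1).comp this
  have t3 : Tendsto (fun N : ℕ => exp ((w + 1) - (w + N + 1 / 2) * log (1 + (w + 1) / N))) atTop (𝓝 1) := by
    have := (continuous_exp.tendsto _).comp ((tendsto_linear_mul_log w).const_sub (w + 1))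
    rw [sub_self, exp_zero] at this
    exact this
  have := (t1.mul t2).mul t3
  rw [one_mul, one_mul] at this
  refine this.congr' ?_
  filter_upwards [eventually_ge_atTop 1] with N hN
  have hNr : (0 : ℝ) < N := by exact_mod_cast hN
  have hNc : (N : ℂ) ≠ 0 := by exact_mod_cast hNr.ne'
  have hprod : ∀ M : ℕ, Gamma (w + M) = Gamma w * ∏ j ∈ Finset.range M, (w + j) := by
    intro M
    induction M with
    | zero => simp
    | succ M ih =>
      have hne : w + M ≠ 0 := by
        intro h
        have hr := congrArg re h
        simp only [add_re, natCast_re, zero_re] at hr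
        have : (0 : ℝ) ≤ M := Nat.cast_nonneg M
        linarith
      push_cast
      rw [← add_assoc, Gamma_add_one _ hne, ih, Finset.prod_range_succ]; ring
  have hp := hprod (N + 1)
  push_cast at hp
  rw [← add_assoc] at hp
  have hP : ∏ j ∈ Finset.range (N + 1), (w + j) ≠ 0 := by
    rw [Finset.prod_ne_zero_iff]
    intro j _ h
    have hr := congrArg re h
    simp only [add_re, natCast_re, zero_re] at hr
    have : (0 : ℝ) ≤ j := Nat.cast_nonneg j
    linarith
  have hlog : log (1 + (w + 1) / N) = log (w + N + 1) - log N := by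
    have hs : SameSide (w + N + 1) N ∨ (w.im ≠ 0) := by
      by_cases hi : w.im = 0
      · left; right
        refine ⟨by simp [hi], by simp, ?_⟩
        simp only [add_re, natCast_re, one_re]
        positivity
      · right; exact hi
    have e : (1 + (w + 1) / N : ℂ) = ((N : ℝ)⁻¹ : ℝ) * (w + N + 1) := by push_cast; field_simp; ring
    have hne : w + N + 1 ≠ 0 := by
      intro h
      have hr := congrArg re h
      simp only [add_re, natCast_re, zero_re, one_re] at hr
      linarith
    rw [e, log_ofReal_mul (inv_pos.mpr hNr) hne, Real.log_inv, ← natCast_log]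
    push_cast; ring
  have hfac : (N.factorial : ℂ) = ((Stirling.stirlingSeq N : ℝ) : ℂ) * (((√(2 * N) : ℝ) : ℂ) * (N / exp 1) ^ N) := by
    have hs : Stirling.stirlingSeq N * (√(2 * N) * ((N : ℝ) / rexp 1) ^ N) = N.factorial := by
      unfold Stirling.stirlingSeq
      rw [div_mul_cancel₀]
      positivity
    have := congrArg (fun r : ℝ => (r : ℂ)) hs
    push_cast at this
    rw [← this]
  unfold stirRatio
  rw [hp, GammaSeq, hfac]
  have hS : Stirling.stirlingSeq N ≠ 0 := by
    obtain ⟨M, rfl⟩ : ∃ M, N = M + 1 := ⟨N - 1, by omega⟩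
    exact (Stirling.stirlingSeq'_pos M).ne'
  have hSc : ((Stirling.stirlingSeq N : ℝ) : ℂ) ≠ 0 := by exact_mod_cast hS
  have hNw : (N : ℂ) ^ w ≠ 0 := by rw [cpow_def_of_ne_zero hNc]; exact exp_ne_zero _
  have hsq : ((√(2 * N) : ℝ) : ℂ) ≠ 0 := by exact_mod_cast (sqrt_pos.mpr (by linarith : (0 : ℝ) < 2 * N)).ne'
  have hpow : ((N : ℂ) / exp 1) ^ N ≠ 0 := pow_ne_zero _ (div_ne_zero hNc (exp_ne_zero _))
  have hsp : ((√π : ℝ) : ℂ) ≠ 0 := by exact_mod_cast (sqrt_pos.mpr pi_pos).ne'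
  have key : exp ((w + 1) - (w + N + 1 / 2) * log (1 + (w + 1) / N))
      = (N : ℂ) ^ w * ((√(2 * N) : ℝ) : ℂ) * (N / exp 1) ^ N * ((√π : ℝ) : ℂ) * exp (-stirLog (w + N + 1)) := by
    have e1 : ((√(2 * N) : ℝ) : ℂ) * ((√π : ℝ) : ℂ) = exp (log N / 2 + Real.log (√(2 * π))) := by
      rw [← ofReal_mul, ← sqrt_mul (by positivity),
        show 2 * (N : ℝ) * π = N * (2 * π) by ring, sqrt_mul (by positivity)]
      rw [exp_add, ← ofReal_exp, Real.exp_log (sqrt_pos.mpr (by positivity)), ofReal_mul]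
      congr 1
      rw [sqrt_eq_rpow, rpow_def_of_pos hNr, ← natCast_log]
      push_cast
      ring_nf
    have e2 : ((N : ℂ) / exp 1) ^ N = exp (N * log N - N) := by
      rw [div_pow, exp_sub, ← exp_nat_mul, mul_one, exp_nat_mul, exp_log hNc]
    rw [show (N : ℂ) ^ w * ((√(2 * N) : ℝ) : ℂ) * (N / exp 1) ^ N * ((√π : ℝ) : ℂ) * exp (-stirLog (w + N + 1))
        = (N : ℂ) ^ w * (N / exp 1) ^ N * (((√(2 * N) : ℝ) : ℂ) * ((√π : ℝ) : ℂ))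
          * exp (-stirLog (w + N + 1)) by ring, e1, e2,
      cpow_def_of_ne_zero hNc, ← exp_add, ← exp_add, ← exp_add]
    congr 1
    rw [hlog]
    unfold stirLog
    ring
  rw [key]
  push_cast
  field_simp

theorem norm_stirRatio_sub_one_le {w : ℂ} (hw : 0 < w.re) (hw2 : 3 * π ≤ ‖w‖) : ‖stirRatio w - 1‖ ≤ 6 * π / ‖w‖ := by
  have hpi := pi_gt_three
  have hpos : 0 < ‖w‖ := by linarith
  have hw0 : w ≠ 0 := norm_pos_iff.mp hpos
  have hlim : Tendsto (fun N : ℕ => exp (∑ k ∈ Finset.range (N + 1), stirStep (w + k))) atTop (𝓝 (stirRatio w)) := by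
    have h1 := tendsto_stirRatio_add_nat hw
    have h2 : Tendsto (fun N : ℕ => stirRatio w / stirRatio (w + N + 1)) atTop (𝓝 (stirRatio w)) := by
      have := (tendsto_const_nhds (x := stirRatio w)).div h1 one_ne_zero
      rwa [div_one] at this
    refine h2.congr' ?_
    filter_upwards [h1.eventually_ne one_ne_zero] with N hN
    have := stirRatio_add_nat hw.le hw0 (N + 1)
    push_cast at this
    rw [← add_assoc] at this
    rw [this]
    field_simp
  refine le_of_tendsto (hlim.sub_const 1).norm (Eventually.of_forall fun N => ?_)
  have hb := norm_sum_stirStep_le hw.le (by linarith) (N + 1)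
  have h1 : 3 * π / ‖w‖ ≤ 1 := by rw [div_le_one hpos]; exact hw2
  refine (norm_exp_sub_one_le (hb.trans h1)).trans ?_
  rw [show 6 * π / ‖w‖ = 2 * (3 * π / ‖w‖) by ring]
  linarith

theorem Gamma_eq_stirRatio_mul (w : ℂ) : Gamma w = stirRatio w * exp (stirLog w) := by
  unfold stirRatio
  rw [mul_assoc, ← exp_add, neg_add_cancel, exp_zero, mul_one]

section

variable {a b : ℝ} {x : ℂ} {m : ℕ}

theorem exists_eq_mul_of_norm_le {u v : ℂ} {c : ℝ} (hc : 0 ≤ c) (h : ‖u‖ ≤ c * ‖v‖) :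
    ∃ s : ℂ, ‖s‖ ≤ c ∧ u = s * v := by
  by_cases hv : v = 0
  · refine ⟨0, by simpa using hc, ?_⟩
    rw [hv, norm_zero, mul_zero] at h
    rw [norm_le_zero_iff.mp h, zero_mul]
  · refine ⟨u / v, ?_, by field_simp⟩
    rw [norm_div, div_le_iff₀ (norm_pos_iff.mpr hv)]
    exact h

theorem far_of_le_im {D : ℝ} (h : D ≤ x.im) (N : ℝ) : Far a x N D := by
  intro y _ _
  have := abs_im_le_norm (x - y)
  simp only [sub_im, ofReal_im, sub_zero] at this
  exact h.trans ((le_abs_self _).trans this)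

theorem eventually_solM_ratio (ha : 0 < a) (b : ℝ) (x : ℂ) :
    ∀ᶠ k : ℕ in atTop, ‖solM a b x (k + 1)‖ ≤ 4 * a * ‖solM a b x k‖ := by
  set E : ℂ := x + a + b / a with hE
  filter_upwards [eventually_ge_atTop ⌈8 * a * (‖E‖ + 1) + 3 * ‖x + a‖ + |b / a| + 1⌉₊] with k hk
  have hkK := Nat.ceil_le.mp hk
  have hna : ‖(a : ℂ)‖ = a := Complex.norm_of_nonneg ha.le
  have hxa0 := norm_nonneg (x + a)
  have hb0 := abs_nonneg (b / a)
  have hpos : 0 < 8 * a * (‖E‖ + 1) := by positivity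
  have hlow : ∀ y : ℝ, 0 ≤ y → y ≤ ‖(y + b / a - E : ℂ)‖ + ‖x + a‖ := fun y hy => by
    have := norm_add_le (y + b / a - E) (x + a)
    rwa [show (y + b / a - E) + (x + a) = (y : ℂ) by rw [hE]; ring, Complex.norm_of_nonneg hy] at this
  have hser : ∀ l : ℕ, k ≤ l → ‖kSer a E (l + b / a) - (Gamma (E + 1))⁻¹ * (Gamma ((l + b / a : ℂ) - E + 1))⁻¹‖
      ≤ 1 / 4 * ‖(Gamma (E + 1))⁻¹ * (Gamma ((l + b / a : ℂ) - E + 1))⁻¹‖ := by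
    intro l hl
    have hl' : (k : ℝ) ≤ l := mod_cast hl
    refine (norm_kSer_sub_le (fun j => ?_) hpos (by rw [hna]; linarith)).trans
      (mul_le_mul_of_nonneg_right (le_of_eq ?_) (norm_nonneg _))
    · have := hlow (l + j + 1) (by positivity)
      rw [show (((l + j + 1 : ℝ) : ℂ) + b / a - E) = (l + b / a : ℂ) - E + j + 1 by push_cast; ring] at this
      linarith [(Nat.cast_nonneg j : (0 : ℝ) ≤ j)]
    · rw [hna]; field_simp; norm_num
  have s0 := hser k le_rfl
  have s1 := hser (k + 1) (k.le_succ)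
  set t1 := (Gamma (E + 1))⁻¹ * (Gamma (((k + 1 : ℕ) + b / a : ℂ) - E + 1))⁻¹
  have ht : (Gamma (E + 1))⁻¹ * (Gamma ((k + b / a : ℂ) - E + 1))⁻¹ = (k + b / a - E + 1) * t1 := by
    rw [rGamma_eq ((k + b / a : ℂ) - E + 1),
      show (k + b / a : ℂ) - E + 1 + 1 = ((k + 1 : ℕ) + b / a : ℂ) - E + 1 by push_cast; ring]
    ring
  rw [ht] at s0
  have l0 : 3 / 4 * (‖(k + b / a : ℂ) - E + 1‖ * ‖t1‖) ≤ ‖kSer a E (k + b / a)‖ := by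
    rw [← norm_mul]
    linarith [norm_le_norm_add_norm_sub' ((k + b / a - E + 1) * t1) (kSer a E (k + b / a)),
      norm_sub_rev ((k + b / a - E + 1) * t1) (kSer a E (k + b / a))]
  have l1 : ‖kSer a E ((k + 1 : ℕ) + b / a)‖ ≤ 5 / 4 * ‖t1‖ := by
    linarith [norm_sub_norm_le (kSer a E ((k + 1 : ℕ) + b / a)) t1]
  have hkp : 0 < (k : ℝ) + b / a + 1 := by linarith [neg_abs_le (b / a)]
  have hcast : (k + b / a + 1 : ℂ) = ((k + b / a + 1 : ℝ) : ℂ) := by push_cast; ring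
  have hcmp : ‖(k + b / a + 1 : ℂ)‖ ≤ 2 * ‖(k + b / a : ℂ) - E + 1‖ := by
    have := hlow (k + 1) (by positivity)
    rw [show (((k + 1 : ℝ) : ℂ) + b / a - E) = (k + b / a : ℂ) - E + 1 by push_cast; ring] at this
    rw [hcast, Complex.norm_of_nonneg hkp.le]
    linarith [le_abs_self (b / a)]
  unfold solM
  rw [← hE]
  set w := exp ((π * I - Real.log a) * (x + a - k))
  have hw : exp ((π * I - Real.log a) * (x + a - (k + 1 : ℕ))) = -(w * a) := by
    apply mul_right_cancel₀ (ofReal_ne_zero.mpr ha.ne'); rw [solM_exp_succ ha k]; ring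
  have hG : Gamma ((k + 1 : ℕ) + b / a + 1) = (k + b / a + 1) * Gamma (k + b / a + 1) := by
    rw [← Gamma_add_one _ (by rw [hcast]; exact ofReal_ne_zero.mpr hkp.ne')]; push_cast; ring_nf
  rw [hw, hG]
  simp only [norm_mul, norm_neg, hna]
  set G := ‖Gamma (k + b / a + 1)‖
  calc ‖(k + b / a + 1 : ℂ)‖ * G * (‖w‖ * a) * ‖kSer a E ((k + 1 : ℕ) + b / a)‖
      ≤ 2 * ‖(k + b / a : ℂ) - E + 1‖ * G * (‖w‖ * a) * (5 / 4 * ‖t1‖) := by gcongr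
    _ = 10 / 3 * a * (G * ‖w‖ * (3 / 4 * (‖(k + b / a : ℂ) - E + 1‖ * ‖t1‖))) := by ring
    _ ≤ 10 / 3 * a * (G * ‖w‖ * ‖kSer a E (k + b / a)‖) := by gcongr
    _ ≤ 4 * a * (G * ‖w‖ * ‖kSer a E (k + b / a)‖) := by gcongr; norm_num

theorem eventually_sig_le (ha : 0 < a) (x : ℂ) : ∀ᶠ k : ℕ in atTop, ‖sig a x ((k + 1 : ℕ) : ℝ)‖ ≤ 4 * a := by
  filter_upwards [eventually_ge_atTop ⌈2 * ‖x‖ + 1⌉₊] with k hk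
  have hkx := Nat.ceil_le.mp hk
  set s : ℝ := ((k + 1 : ℕ) : ℝ) with hs
  have hsk : s = k + 1 := by rw [hs]; push_cast; ring
  have hs0 : 0 < s := by linarith [norm_nonneg x]
  have hv := norm_sub_norm_le (s : ℂ) x
  rw [Complex.norm_of_nonneg hs0.le, norm_sub_rev] at hv
  have h3 := norm_lam_mul_norm_sig ha.le hs0.le (norm_pos_iff.mp (by linarith [norm_nonneg x]) : x - s ≠ 0)
  have h4 : s / 4 ≤ ‖lam a x s‖ := by linarith [Good.v_le a x s]
  nlinarith [norm_nonneg (sig a x s)]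

theorem solM_ratio (ha : 0 < a) {κ D : ℝ} (hκ0 : 0 < κ) (hκ1 : κ ≤ 1) (hκa : a * κ ^ 2 ≤ 4)
    (hD : |b| + 1024 / κ ^ 3 + 2 * a ≤ D) (him : D ≤ x.im)
    (hoff : ∀ s : ℝ, 0 ≤ s → OffCut (x - s) (a * s) (κ * √(a * s)))
    (hm : 0 < m + 1 + b / a) :
    ∀ k, m ≤ k → ∃ r : ℂ, ‖r‖ ≤ 32 / κ ^ 2 ∧ solM a b x (k + 1) = (sig a x ((k + 1 : ℕ) : ℝ) + r) * solM a b x k := by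
  have hb0 := abs_nonneg b
  have hκ3 : 0 < 1024 / κ ^ 3 := by positivity
  have hD0 : 0 < D := by linarith
  have hgood : ∀ s : ℝ, 0 ≤ s → Good a x D s := fun s hs => (far_of_le_im him s).good ha hD0 hs le_rfl
  have hlR : ∀ s : ℝ, 0 ≤ s → ‖lam a x s‖ ≤ 2 / κ * ‖disc a x s‖ := by
    intro s hs
    have hg := hgood s hs
    have h2 := norm_lam_le hg.ne_zero hg.mul_nn
    have h3 : κ * √(a * s) ≤ ‖disc a x s‖ := by
      rcases (sqrt_nonneg (a * s)).eq_or_lt with h0 | h0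
      · simp [← h0]
      · exact (hoff s hs).le_norm_disc (by positivity) hg.mul_nn
    rw [div_mul_eq_mul_div, le_div_iff₀ hκ0]
    nlinarith [norm_nonneg (disc a x s)]
  have hslow : ∀ k : ℕ, ‖sig a x ((k + 1 + 1 : ℕ) : ℝ) - sig a x ((k + 1 : ℕ) : ℝ)‖ ≤ 4 / κ := by
    intro k
    have hd : ∀ s : ℝ, 0 ≤ s → HasDerivAt (sig a x) ((sig a x s + a) / disc a x s) s := by
      intro s hs
      have hR := (hgood s hs).disc_ne
      rw [show sig a x s = lam a x s - disc a x s by rw [← lam_sub_sig]; ring,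
        show sig a x = fun s : ℝ => (x - s) - lam a x s by funext s; rw [← lam_add_sig a x s]; ring]
      refine (((ofRealCLM.hasDerivAt (x := s)).const_sub x).sub (hgood s hs).hasDerivAt_lam).congr_deriv ?_
      simp only [ofRealCLM_apply, ofReal_one]
      field_simp
      ring
    have h := (convex_Ici (0 : ℝ)).norm_image_sub_le_of_norm_hasDerivWithin_le (C := 4 / κ)
      (x := ((k + 1 : ℕ) : ℝ)) (y := ((k + 1 + 1 : ℕ) : ℝ)) (fun s hs => (hd s hs).hasDerivWithinAt)
      (fun s hs => by
        have hg := hgood s hs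
        rw [norm_div, div_le_iff₀ (norm_pos_iff.mpr hg.disc_ne)]
        have h2 := norm_add_le (sig a x s) a
        rw [Complex.norm_of_nonneg ha.le] at h2
        rw [show 4 / κ * ‖disc a x s‖ = 2 * (2 / κ * ‖disc a x s‖) by ring]
        linarith [norm_sig_le a x s, hlR s hs, hg.sqrt_add_le, sqrt_nonneg (a * s)])
      (Set.mem_Ici.mpr (Nat.cast_nonneg _)) (Set.mem_Ici.mpr (Nat.cast_nonneg _))
    simpa using h
  have hratio : ∀ s : ℝ, 0 < s → ‖sig a x s‖ ≤ (1 - κ / 4) * ‖lam a x s‖ := by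
    intro s hs
    have hg := hgood s hs.le
    have hS0 : 0 < √(a * s) := sqrt_pos.mpr (mul_pos ha hs)
    have h1 := (hoff s hs.le).sqrt_add_le_norm_lam (mul_pos hκ0 hS0) hg.mul_nn
    refine hg.sig_le ?_
    nlinarith [mul_le_mul_of_nonneg_left h1 (show 0 ≤ 1 - κ / 4 by linarith),
      mul_nonneg (mul_pos hS0 hκ0).le (show 0 ≤ 1 - κ / 2 by linarith)]
  set Y := 32 / κ ^ 2 with hY
  set G := 4 / κ with hG
  have hG0 : 0 < G := by positivity
  have hYG : Y * κ = 8 * G := by rw [hY, hG]; field_simp; norm_num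
  have hY0 : 0 < Y := by positivity
  have hG4 : 4 ≤ G := by rw [hG, le_div_iff₀ hκ0]; linarith
  have hGY : G ≤ Y := by nlinarith
  have hY2 : 2 * Y ^ 2 = 512 / κ ^ 3 * G := by rw [hY, hG]; field_simp; norm_num
  have hD3 : 1024 / κ ^ 3 = 2 * (512 / κ ^ 3) := by ring
  -- downward induction
  have hdown : ∀ k, m ≤ k → (∃ r : ℂ, ‖r‖ ≤ Y ∧
      solM a b x (k + 1 + 1) = (sig a x ((k + 1 + 1 : ℕ) : ℝ) + r) * solM a b x (k + 1)) →
      ∃ r : ℂ, ‖r‖ ≤ Y ∧ solM a b x (k + 1) = (sig a x ((k + 1 : ℕ) : ℝ) + r) * solM a b x k := by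
    rintro k hk ⟨r', hr', hrec⟩
    have hM := solM_solvesFrom (x := x) ha hm k hk
    have hg := hgood ((k + 1 : ℕ) : ℝ) (Nat.cast_nonneg _)
    have hσ := hratio ((k + 1 : ℕ) : ℝ) (by positivity)
    have hls := lam_add_sig a x ((k + 1 : ℕ) : ℝ)
    have hq := hg.lam_mul_sig
    push_cast at hq hls
    set τ := r' + (sig a x ((k + 1 + 1 : ℕ) : ℝ) - sig a x ((k + 1 : ℕ) : ℝ)) with hτ
    have hτb : ‖τ‖ ≤ Y + G := norm_add_le_of_le hr' (hslow k)
    have hlow := hg.sqrt_add_le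
    have hsq := sqrt_nonneg (a * ((k + 1 : ℕ) : ℝ))
    push_cast at hlow hsq hσ hτ
    set l := lam a x (k + 1)
    set σ := sig a x (k + 1)
    have hkey : |b| + Y * (Y + G) ≤ ‖l‖ * G := by
      have h4 : |b| / 2 + 512 / κ ^ 3 ≤ ‖l‖ := by linarith
      nlinarith
    have hdiff : Y + G < ‖l‖ := by
      by_contra! hcon
      nlinarith [mul_le_mul_of_nonneg_right hcon hG0.le, mul_le_mul_of_nonneg_left hκ1 hY0.le]
    have hne : l - τ ≠ 0 := fun h => by rw [sub_eq_zero.mp h] at hdiff; linarith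
    have heq : (l - τ) * solM a b x (k + 1) = (a * (k + 1) + b) * solM a b x k := by
      rw [show k + 2 = k + 1 + 1 by ring, hrec, ← hls] at hM
      rw [hτ]
      push_cast at hM ⊢
      linear_combination -hM
    refine ⟨(b + σ * τ) / (l - τ), ?_, ?_⟩
    · rw [norm_div, div_le_iff₀ (norm_pos_iff.mpr hne)]
      have h1 : ‖(b : ℂ) + σ * τ‖ ≤ |b| + (1 - κ / 4) * ‖l‖ * (Y + G) :=
        norm_add_le_of_le (by simp) ((norm_mul_le _ _).trans
          (mul_le_mul hσ hτb (norm_nonneg _) (mul_nonneg (by linarith) (norm_nonneg _))))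
      have h4 : Y * (‖l‖ - (Y + G)) ≤ Y * ‖l - τ‖ := by gcongr; linarith [norm_sub_norm_le l τ]
      have h6 : ‖l‖ * ((1 - κ / 4) * (Y + G)) ≤ ‖l‖ * (Y - G) := by gcongr; nlinarith
      nlinarith
    · push_cast
      rw [show σ + (b + σ * τ) / (l - τ) = (l * σ + b) / (l - τ) by field_simp; ring, div_mul_eq_mul_div,
        eq_div_iff hne, hq, ← heq]
      ring
  obtain ⟨K, hK⟩ := eventually_atTop.mp ((eventually_solM_ratio ha b x).and (eventually_sig_le ha x))
  have hstart : ∀ k, K ≤ k → ∃ r : ℂ, ‖r‖ ≤ Y ∧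
      solM a b x (k + 1) = (sig a x ((k + 1 : ℕ) : ℝ) + r) * solM a b x k := by
    intro k hk
    obtain ⟨h1, h2⟩ := hK k hk
    obtain ⟨s, hs, hs'⟩ := exists_eq_mul_of_norm_le (by positivity) h1
    refine ⟨s - sig a x ((k + 1 : ℕ) : ℝ), ?_, by rw [hs']; ring⟩
    have : 8 * a ≤ Y := by rw [hY, le_div_iff₀ (by positivity)]; linarith
    linarith [norm_sub_le s (sig a x ((k + 1 : ℕ) : ℝ))]
  intro k hk
  rcases le_total K k with hkK | hkK
  · exact hstart k hkK
  · induction hkK using Nat.decreasingInduction with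
    | self => exact hstart K le_rfl
    | of_succ j _ ih => exact hdown j hk (ih (by omega))

end

section

/-- A family of points `x` of the upper half plane, of degrees `n`, with `√n = T ^ 20`, at height
at least `√n / T`. -/
structure Edge {ι : Type*} (δ : ℝ) (l : Filter ι) (T : ι → ℝ) (n : ι → ℕ) (x : ι → ℂ) : Prop where
  pos : 0 < δ
  tendsto : Tendsto T l atTop
  sqrt_eq : ∀ᶠ i in l, √(n i) = T i ^ 20
  le_im : ∀ᶠ i in l, T i ^ 19 ≤ (x i).im
  im_le : ∀ᶠ i in l, (x i).im ≤ T i ^ 20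
  le_re : ∀ᶠ i in l, δ * T i ^ 20 ≤ (x i).re
  re_le : ∀ᶠ i in l, (x i).re ≤ 2 * T i ^ 40

variable {ι : Type*} {δ a b : ℝ} {l : Filter ι} {T : ι → ℝ} {n : ι → ℕ} {x : ι → ℂ} {m : ℕ}

namespace Edge

variable (ha : 0 < a) (b : ℝ) (hm : 0 < m + 1 + b / a) (h : Edge δ l T n x)
include h

theorem cast_eq : ∀ᶠ i in l, (n i : ℝ) = T i ^ 40 := by
  filter_upwards [h.sqrt_eq] with i hi
  rw [← sq_sqrt (Nat.cast_nonneg (n i)), hi]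
  ring

theorem one_le : ∀ᶠ i in l, 1 ≤ T i := h.tendsto.eventually_ge_atTop 1

theorem norm_le : ∀ᶠ i in l, ‖x i‖ ≤ 3 * T i ^ 40 := by
  filter_upwards [h.one_le, h.le_im, h.im_le, h.le_re, h.re_le] with i h1 h2 h3 h4 h5
  have e := norm_le_abs_re_add_abs_im (x i)
  have hp := h.pos
  have hT : 0 ≤ T i ^ 20 := by positivity
  have hT' : 0 ≤ T i ^ 19 := by positivity
  rw [abs_of_nonneg ((mul_nonneg hp.le hT).trans h4), abs_of_nonneg (hT'.trans h2)] at e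
  have : T i ^ 20 ≤ T i ^ 40 := pow_le_pow_right₀ h1 (by norm_num)
  linarith

theorem le_norm : ∀ᶠ i in l, T i ^ 19 ≤ ‖x i‖ := by
  filter_upwards [h.le_im] with i h2
  exact h2.trans ((le_abs_self _).trans (abs_im_le_norm _))

theorem tendsto_pow {k : ℕ} (hk : k ≠ 0) : Tendsto (fun i => T i ^ k) l atTop := (tendsto_pow_atTop hk).comp h.tendsto

theorem tendsto_norm : Tendsto (fun i => ‖x i‖) l atTop :=
  tendsto_atTop_mono' l h.le_norm (h.tendsto_pow (by norm_num))

theorem tendsto_re : Tendsto (fun i => (x i).re) l atTop :=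
  tendsto_atTop_mono' l h.le_re ((h.tendsto_pow (by norm_num)).const_mul_atTop h.pos)

theorem tendsto_n : Tendsto n l atTop := by
  rw [← tendsto_natCast_atTop_iff (R := ℝ)]
  exact (h.tendsto_pow (k := 40) (by norm_num)).congr' (h.cast_eq.mono fun i hi => hi.symm)

/-- The lower bound for the relative distance to the cut. -/
def cutConst (a : ℝ) : ℝ := 1 / (1 + 8 * a)

include ha in
theorem offCut : ∀ᶠ i in l, ∀ s : ℝ, 0 ≤ s → OffCut (x i - s) (a * s) (cutConst a / T i * √(a * s)) := by
  filter_upwards [h.one_le, h.le_im, h.re_le, (h.tendsto_pow (k := 40) (by norm_num)).eventually_ge_atTop (2 * a)]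
    with i h1 h2 h3 h4 s hs r hr
  have hT : 0 < T i := by linarith
  have hc0 : 0 < cutConst a := by unfold cutConst; positivity
  rcases le_total s (8 * T i ^ 40) with hs' | hs'
  · refine le_trans ?_ ((le_abs_self _).trans (abs_im_le_norm _))
    have e : (x i - s - r).im = (x i).im := by simp
    rw [e]
    refine le_trans ?_ h2
    have h5 : √(a * s) ≤ (1 + 8 * a) * T i ^ 20 := by
      rw [sqrt_le_iff]
      refine ⟨by positivity, ?_⟩
      have e2 : ((1 + 8 * a) * T i ^ 20) ^ 2 = (1 + 8 * a) ^ 2 * T i ^ 40 := by ring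
      rw [e2]
      have : a * s ≤ a * (8 * T i ^ 40) := by gcongr
      have h6 : 0 < T i ^ 40 := by positivity
      nlinarith [mul_pos ha h6, mul_pos (mul_pos ha ha) h6]
    calc cutConst a / T i * √(a * s) ≤ cutConst a / T i * ((1 + 8 * a) * T i ^ 20) := by
          gcongr
      _ = T i ^ 19 := by unfold cutConst; field_simp
  · have hc : cutConst a / T i ≤ 1 := by
      rw [div_le_one hT]
      refine le_trans ?_ h1
      unfold cutConst
      rw [div_le_one (by positivity)]; linarith
    have h5 : cutConst a / T i * √(a * s) ≤ 1 * √(a * s) := by gcongr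
    have h6 : √(a * s) ≤ s / 4 := by
      rw [sqrt_le_iff]
      refine ⟨by positivity, ?_⟩
      have : 16 * a ≤ s := by linarith
      nlinarith
    have h7 := abs_re_le_norm (x i - s - r)
    have h8 := neg_abs_le (x i - s - r).re
    have e : (x i - s - r).re = (x i).re - s - r := by simp
    have h9 := neg_abs_le r
    rw [e] at h7 h8
    linarith

include ha hm in
theorem solM_ratio : ∃ C : ℝ, 0 < C ∧ ∀ᶠ i in l, ∀ k, m ≤ k → ∃ r : ℂ, ‖r‖ ≤ C * T i ^ 2 ∧
      solM a b (x i) (k + 1) = (sig a (x i) ((k + 1 : ℕ) : ℝ) + r) * solM a b (x i) k := by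
  have hc0 : 0 < cutConst a := by unfold cutConst; positivity
  have hc1 : cutConst a ≤ 1 := by
    unfold cutConst
    rw [div_le_one (by positivity)]; linarith
  refine ⟨32 / cutConst a ^ 2, by positivity, ?_⟩
  filter_upwards [h.one_le, h.le_im, h.offCut ha, (h.tendsto_pow (k := 16) (by norm_num)).eventually_ge_atTop
      (|b| + 1024 / cutConst a ^ 3 + 2 * a)] with i h1 h2 h3 h4 k hk
  have hT : 0 < T i := by linarith
  have hκ := div_le_self hc0.le h1
  have hD : |b| + 1024 / (cutConst a / T i) ^ 3 + 2 * a ≤ T i ^ 19 := by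
    have e1 : 1024 / (cutConst a / T i) ^ 3 = 1024 / cutConst a ^ 3 * T i ^ 3 := by field_simp
    have e2 : T i ^ 19 = T i ^ 16 * T i ^ 3 := by ring
    rw [e1, e2]
    have hT3 : 1 ≤ T i ^ 3 := one_le_pow₀ h1
    have h5 := mul_le_mul_of_nonneg_right h4 (show 0 ≤ T i ^ 3 by positivity)
    nlinarith [abs_nonneg b]
  have haκ : a * (cutConst a / T i) ^ 2 ≤ 4 := by
    have e1 : (cutConst a / T i) ^ 2 ≤ cutConst a ^ 2 := by gcongr
    have e2 : a * cutConst a ≤ 1 := by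
      unfold cutConst
      rw [mul_one_div, div_le_one (by positivity)]; linarith
    nlinarith
  obtain ⟨r, hr, hr'⟩ := PlancherelRotach.solM_ratio ha (b := b) (div_pos hc0 hT) (hκ.trans hc1) haκ hD h2 h3 hm k hk
  refine ⟨r, hr.trans (le_of_eq ?_), hr'⟩
  field_simp

theorem one_sub_per (a : ℝ) : Tendsto (fun i => per a (x i)) l (𝓝 0) := by
  rw [tendsto_zero_iff_norm_tendsto_zero]
  have h1 : ∀ i, ‖per a (x i)‖ = rexp (-(2 * π * (x i).im)) := by
    intro i
    unfold per
    rw [norm_exp]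
    congr 1
    simp
  simp only [h1]
  refine tendsto_exp_neg_atTop_nhds_zero.comp ?_
  refine Tendsto.const_mul_atTop (by positivity) ?_
  exact tendsto_atTop_mono' l h.le_im (h.tendsto_pow (by norm_num))

theorem per_ne (a : ℝ) : ∀ᶠ i in l, 1 - per a (x i) ≠ 0 := by
  have := (h.one_sub_per a).eventually (isOpen_ne.mem_nhds (zero_ne_one (α := ℂ)))
  filter_upwards [this] with i hi
  exact sub_ne_zero.mpr (Ne.symm hi)

include ha hm in
theorem solM_ne_zero : ∃ C : ℝ, 0 < C ∧ ∀ᶠ i in l, ∀ k, m ≤ k → solM a b (x i) k ≠ 0 ∧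
      ‖solM a b (x i) (k + 1) / solM a b (x i) k - sig a (x i) ((k + 1 : ℕ) : ℝ)‖ ≤ C * T i ^ 2 := by
  obtain ⟨C, hC, hC'⟩ := h.solM_ratio ha b hm
  refine ⟨C, hC, ?_⟩
  filter_upwards [hC', h.per_ne a, h.tendsto_re.eventually_gt_atTop (-(a + b / a + 1))] with i h1 h2 h3 k hk
  have hmk : 0 < k + 1 + b / a := by
    have : (m : ℝ) ≤ k := by exact_mod_cast hk
    linarith
  have hne : solM a b (x i) k ≠ 0 := by
    intro h0
    obtain ⟨r, -, hr⟩ := h1 k hk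
    rw [h0, mul_zero] at hr
    have h4 := casor_solL_solM (x := x i) ha hmk
    unfold casor at h4
    rw [h0, hr, mul_zero, mul_zero, sub_zero] at h4
    exact mul_ne_zero (mul_ne_zero I_ne_zero h2) (kap_ne_zero hmk (by linarith)) h4.symm
  refine ⟨hne, ?_⟩
  obtain ⟨r, hr, hr'⟩ := h1 k hk
  rw [hr', mul_div_cancel_right₀ _ hne, add_sub_cancel_left]
  exact hr

end Edge

end

section

variable {ι : Type*} {δ a b : ℝ} {l : Filter ι} {T : ι → ℝ} {n : ι → ℕ} {x : ι → ℂ} {m : ℕ}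

theorem tendsto_piSeq_div (hx : Tendsto (fun i => ‖x i‖) l atTop) (a b : ℝ) (k : ℕ) :
    Tendsto (fun i => piSeq a b (x i) k / x i ^ k) l (𝓝 1) := by
  have hinv : Tendsto (fun i => (x i)⁻¹) l (𝓝 0) := by
    rw [tendsto_zero_iff_norm_tendsto_zero]
    simp only [norm_inv]
    exact hx.inv_tendsto_atTop
  have hne : ∀ᶠ i in l, x i ≠ 0 := (hx.eventually_gt_atTop 0).mono fun i hi => norm_pos_iff.mp hi
  suffices H : Tendsto (fun i => piSeq a b (x i) k / x i ^ k) l (𝓝 1) ∧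
      Tendsto (fun i => piSeq a b (x i) (k + 1) / x i ^ (k + 1)) l (𝓝 1) from H.1
  induction k with
  | zero =>
    constructor
    · simp only [(isPi_piSeq a b _).zero, pow_zero, div_one]; exact tendsto_const_nhds
    · refine Tendsto.congr' (f₁ := fun _ => 1) ?_ tendsto_const_nhds
      filter_upwards [hne] with i hi
      rw [zero_add, (isPi_piSeq a b _).one, pow_one, div_self hi]
  | succ k ih =>
    refine ⟨ih.2, ?_⟩
    have h1 := (((hinv.const_mul ((k : ℂ) + 1)).const_sub 1).mul ih.2).sub
      (((hinv.pow 2).const_mul ((a : ℂ) * (k + 1) + b)).mul ih.1)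
    simp only [mul_zero, sub_zero, one_mul, ne_eq, OfNat.ofNat_ne_zero, not_false_eq_true, zero_pow, zero_mul] at h1
    refine h1.congr' ?_
    filter_upwards [hne] with i hi
    rw [(isPi_piSeq a b _).step]
    field_simp
    ring

namespace Edge

variable (ha : 0 < a) (b : ℝ) (hm : 0 < m + 1 + b / a) (h : Edge δ l T n x)
include h

theorem tendsto_inv_x : Tendsto (fun i => (x i)⁻¹) l (𝓝 0) := by
  rw [tendsto_zero_iff_norm_tendsto_zero]
  simp only [norm_inv]
  exact h.tendsto_norm.inv_tendsto_atTop

theorem x_ne : ∀ᶠ i in l, x i ≠ 0 := (h.tendsto_norm.eventually_gt_atTop 0).mono fun _ hi => norm_pos_iff.mp hi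

theorem tendsto_x_add_div (c : ℂ) : Tendsto (fun i => (x i + c) / x i) l (𝓝 1) := by
  have := (h.tendsto_inv_x.const_mul c).const_add 1
  rw [mul_zero, add_zero] at this
  refine this.congr' ?_
  filter_upwards [h.x_ne] with i hi
  field_simp

theorem tendsto_solL_div {k : ℕ} (hk : 0 < k + 1 + b / a) :
    Tendsto (fun i => solL a b (x i) k / (Gamma (x i + a - k + 1))⁻¹) l (𝓝 1) := by
  have hG : Gamma ((k : ℂ) + b / a + 1) ≠ 0 := by
    have := Gamma_real_ne_zero (show 0 < (k : ℝ) + b / a + 1 by linarith)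
    push_cast at this
    exact this
  set W := 2 * ‖(a : ℂ)‖ * (‖((k : ℂ) + b / a)‖ + 1) with hW
  have hre : Tendsto (fun i => (x i).re + a - k) l atTop := by
    simpa only [add_sub_assoc] using tendsto_atTop_add_const_right l (a - k : ℝ) h.tendsto_re
  rw [tendsto_iff_norm_sub_tendsto_zero]
  refine squeeze_zero' (g := fun i => W / ((x i).re + a - k)) (Eventually.of_forall fun i => norm_nonneg _) ?_
    (hre.const_div_atTop W)
  filter_upwards [hre.eventually_gt_atTop 0, hre.eventually_ge_atTop W] with i h1 h2
  have hG2 : Gamma (x i + a - k + 1) ≠ 0 := by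
    refine Gamma_ne_zero_of_re_pos ?_
    simp; linarith
  have hE : (x i + a + b / a : ℂ) - (k + b / a) = x i + a - k := by ring
  have h3 := norm_kSer_sub_le (a := a) (ν := k + b / a) (E := x i + a + b / a) (ρ := (x i).re + a - k) (fun j => by
      rw [hE]
      refine le_trans ?_ ((le_abs_self _).trans (abs_re_le_norm _))
      simp
      have : (0 : ℝ) ≤ j := Nat.cast_nonneg j
      linarith) h1 h2
  rw [hE, ← hW] at h3
  have e : solL a b (x i) k / (Gamma (x i + a - k + 1))⁻¹ - 1 = (kSer a (k + b / a) (x i + a + b / a)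
        - (Gamma (k + b / a + 1))⁻¹ * (Gamma (x i + a - k + 1))⁻¹)
        * (Gamma (k + b / a + 1) * Gamma (x i + a - k + 1)) := by
    unfold solL
    field_simp
  rw [e, norm_mul]
  refine (mul_le_mul_of_nonneg_right h3 (norm_nonneg _)).trans (le_of_eq ?_)
  rw [mul_assoc, ← norm_mul]
  have : ((Gamma (k + b / a + 1))⁻¹ * (Gamma (x i + a - k + 1))⁻¹)
      * (Gamma (k + b / a + 1) * Gamma (x i + a - k + 1)) = 1 := by
    field_simp
  rw [this, norm_one, mul_one]

theorem tendsto_gamma_shift (c : ℂ) (k : ℕ) :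
    Tendsto (fun i => x i ^ k * Gamma (x i + c + 1 - k) / Gamma (x i + c + 1)) l (𝓝 1) := by
  have hne : ∀ᶠ i in l, Gamma (x i + c + 1) ≠ 0 := by
    filter_upwards [h.tendsto_re.eventually_gt_atTop (-(c.re + 1))] with i hi
    refine Gamma_ne_zero_of_re_pos ?_
    simp; linarith
  induction k with
  | zero =>
    refine Tendsto.congr' (f₁ := fun _ => 1) ?_ tendsto_const_nhds
    filter_upwards [hne] with i hi
    simp [hi]
  | succ k ih =>
    have h1 := ih.div (h.tendsto_x_add_div (c - k)) one_ne_zero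
    rw [div_one] at h1
    refine h1.congr' ?_
    filter_upwards [h.x_ne, h.tendsto_re.eventually_gt_atTop (k - c.re)] with i hi h2
    have h3 : x i + (c - k) ≠ 0 := by
      intro h0
      have := congrArg re h0
      simp at this
      linarith
    have e : Gamma (x i + c + 1 - k) = (x i + (c - k)) * Gamma (x i + (c - k)) := by
      rw [← Gamma_add_one _ h3]; congr 1; ring
    have e2 : x i + c + 1 - ((k + 1 : ℕ) : ℂ) = x i + (c - k) := by push_cast; ring
    rw [Pi.div_apply, e, e2]
    field_simp
    ring

include ha hm in
theorem tendsto_solM_ratio_div : Tendsto (fun i => solM a b (x i) (m + 1) / solM a b (x i) m / x i) l (𝓝 0) := by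
  obtain ⟨C, hC, hC'⟩ := h.solM_ne_zero ha b hm
  rw [tendsto_zero_iff_norm_tendsto_zero]
  have hT : Tendsto (fun i => (C + 2 * a * (m + 1)) / T i) l (𝓝 0) := h.tendsto.const_div_atTop _
  refine squeeze_zero' (Eventually.of_forall fun i => norm_nonneg _) ?_ hT
  filter_upwards [hC', h.one_le, h.le_im, h.le_norm, h.x_ne] with i h1 h2 h3 h4 h5
  have h6 := (h1 m le_rfl).2
  have hT0 : 0 < T i := by linarith
  have hT19 : 1 ≤ T i ^ 19 := one_le_pow₀ h2
  have hv : 1 ≤ ‖x i - ((m + 1 : ℕ) : ℝ)‖ := by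
    have := im_le_norm (x i - ((m + 1 : ℕ) : ℝ))
    rw [sub_im, ofReal_im, sub_zero] at this
    linarith
  have hs : ‖sig a (x i) ((m + 1 : ℕ) : ℝ)‖ ≤ 2 * a * (m + 1) := by
    have e := norm_lam_mul_norm_sig ha.le (Nat.cast_nonneg (m + 1)) (norm_pos_iff.mp (by linarith))
    push_cast at e hv ⊢
    have e2 := Good.v_le a (x i) (m + 1)
    push_cast at e2
    nlinarith [norm_nonneg (sig a (x i) (m + 1))]
  have h7 : ‖solM a b (x i) (m + 1) / solM a b (x i) m‖ ≤ C * T i ^ 2 + 2 * a * (m + 1) := by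
    have := norm_add_le (solM a b (x i) (m + 1) / solM a b (x i) m
      - sig a (x i) ((m + 1 : ℕ) : ℝ)) (sig a (x i) ((m + 1 : ℕ) : ℝ))
    rw [sub_add_cancel] at this
    linarith
  rw [norm_div, div_le_div_iff₀ (norm_pos_iff.mpr h5) hT0]
  have hT2 : 1 ≤ T i ^ 2 := one_le_pow₀ h2
  have hm0 : (0 : ℝ) ≤ 2 * a * (m + 1) := by positivity
  have h8 : C * T i ^ 2 + 2 * a * (m + 1) ≤ (C + 2 * a * (m + 1)) * T i ^ 2 := by nlinarith
  calc _ ≤ (C + 2 * a * (m + 1)) * T i ^ 2 * T i := by gcongr; exact h7.trans h8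
    _ = (C + 2 * a * (m + 1)) * T i ^ 3 := by ring
    _ ≤ (C + 2 * a * (m + 1)) * T i ^ 19 := by gcongr ?_ * ?_; exact pow_le_pow_right₀ h2 (by norm_num)
    _ ≤ _ := by gcongr

end Edge

/-- The coefficient of the dominant solution. -/
def coefL (a b : ℝ) (m : ℕ) (x : ℂ) : ℂ := casor (piSeq a b x) (solM a b x) m / casor (solL a b x) (solM a b x) m

/-- The coefficient of the recessive solution. -/
def coefM (a b : ℝ) (m : ℕ) (x : ℂ) : ℂ := casor (solL a b x) (piSeq a b x) m / casor (solL a b x) (solM a b x) m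

namespace Edge

variable (ha : 0 < a) (b : ℝ) (hm : 0 < m + 1 + b / a) (h : Edge δ l T n x)
include h

include hm in
theorem tendsto_solL_pred_div : Tendsto (fun i => x i * (solL a b (x i) m / (Gamma (x i + a - m))⁻¹)) l (𝓝 1) := by
  have h1 := (h.tendsto_solL_div b hm).div (h.tendsto_x_add_div (a - m : ℂ)) one_ne_zero
  rw [div_one] at h1
  refine h1.congr' ?_
  filter_upwards [h.tendsto_re.eventually_gt_atTop (m - a), h.x_ne] with i h2 hx
  have h3 : x i + a - m ≠ 0 := by
    intro h0
    have := congrArg re h0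
    simp at this
    linarith
  have h4 : x i + (a - m) ≠ 0 := by rw [← add_sub_assoc]; exact h3
  have h5 : Gamma (x i + a - m) ≠ 0 := by
    refine Gamma_ne_zero_of_re_pos ?_
    simp; linarith
  rw [Pi.div_apply, Gamma_add_one _ h3, ← add_sub_assoc]
  field_simp

include ha hm in
theorem tendsto_coefL_div : Tendsto (fun i => coefL a b m (x i) / Gamma (x i + a + 1)) l (𝓝 1) := by
  obtain ⟨C, hC, hC'⟩ := h.solM_ne_zero ha b hm
  have hs := h.tendsto_solM_ratio_div ha b hm
  have h1 : Tendsto (fun i => piSeq a b (x i) (m + 1) / x i ^ (m + 1)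
      - solM a b (x i) (m + 1) / solM a b (x i) m / x i * (piSeq a b (x i) m / x i ^ m)) l (𝓝 1) := by
    have := (tendsto_piSeq_div h.tendsto_norm a b (m + 1)).sub (hs.mul (tendsto_piSeq_div h.tendsto_norm a b m))
    simpa using this
  have hm1 : 0 < ((m + 1 : ℕ) : ℝ) + 1 + b / a := by push_cast; linarith
  have h2 := h.tendsto_solL_div b hm1
  have h3 : Tendsto (fun i => solL a b (x i) (m + 1) / (Gamma (x i + a - (m + 1 : ℕ) + 1))⁻¹
      - solM a b (x i) (m + 1) / solM a b (x i) m / x i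
        * (x i * (solL a b (x i) m / (Gamma (x i + a - m))⁻¹))) l (𝓝 1) := by
    have := h2.sub (hs.mul (h.tendsto_solL_pred_div b hm))
    simpa using this
  have h4 := h.tendsto_gamma_shift a (m + 1)
  have h5 := (h1.div h3 one_ne_zero).mul h4
  rw [div_one, one_mul] at h5
  refine h5.congr' ?_
  have hd : ∀ᶠ i in l, solL a b (x i) (m + 1) / (Gamma (x i + a - (m + 1 : ℕ) + 1))⁻¹
      - solM a b (x i) (m + 1) / solM a b (x i) m / x i * (x i * (solL a b (x i) m / (Gamma (x i + a - m))⁻¹)) ≠ 0 :=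
    h3.eventually_ne one_ne_zero
  filter_upwards [hd, hC', h.x_ne, h.tendsto_re.eventually_gt_atTop (m - a)] with i h6 h7 h8 h9
  have hM := (h7 m le_rfl).1
  have e1 : x i + a - ((m + 1 : ℕ) : ℂ) + 1 = x i + a - m := by push_cast; ring
  have e2 : x i + a + 1 - ((m + 1 : ℕ) : ℂ) = x i + a - m := by push_cast; ring
  rw [e1] at h6
  rw [Pi.div_apply, e1, e2]
  have hΓ : Gamma (x i + a - m) ≠ 0 := by
    refine Gamma_ne_zero_of_re_pos ?_
    simp; linarith
  have e3 : casor (solL a b (x i)) (solM a b (x i)) m = solM a b (x i) m * (Gamma (x i + a - m))⁻¹ *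
      (solL a b (x i) (m + 1) / (Gamma (x i + a - m))⁻¹
      - solM a b (x i) (m + 1) / solM a b (x i) m / x i * (x i * (solL a b (x i) m / (Gamma (x i + a - m))⁻¹))) := by
    unfold casor
    field_simp
  have e4 : casor (piSeq a b (x i)) (solM a b (x i)) m
      = solM a b (x i) m * x i ^ (m + 1) * (piSeq a b (x i) (m + 1) / x i ^ (m + 1)
      - solM a b (x i) (m + 1) / solM a b (x i) m / x i * (piSeq a b (x i) m / x i ^ m)) := by
    unfold casor
    field_simp
    ring
  unfold coefL
  rw [e3, e4]
  set A := solL a b (x i) (m + 1) / (Gamma (x i + a - m))⁻¹ - solM a b (x i) (m + 1) / solM a b (x i) m / x i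
        * (x i * (solL a b (x i) m / (Gamma (x i + a - m))⁻¹))
  set B := piSeq a b (x i) (m + 1) / x i ^ (m + 1)
      - solM a b (x i) (m + 1) / solM a b (x i) m / x i * (piSeq a b (x i) m / x i ^ m)
  field_simp

end Edge

end

section

variable {ι : Type*} {δ a b : ℝ} {l : Filter ι} {T : ι → ℝ} {n : ι → ℕ} {x w : ι → ℂ} {m : ℕ}

theorem log_one_add_div {w c : ℂ} (hw : 0 < w.re) (hc : 0 < (w + c).re) : log (1 + c / w) = log (w + c) - log w := by
  have hw0 : w ≠ 0 := by rintro rfl; simp at hw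
  have hc0 : w + c ≠ 0 := by intro h; rw [h] at hc; simp at hc
  have h1 := abs_lt.mp (abs_arg_lt_pi_div_two_iff.mpr (Or.inl hw))
  have h2 := abs_lt.mp (abs_arg_lt_pi_div_two_iff.mpr (Or.inl hc))
  have e : 1 + c / w = exp (log (w + c) - log w) := by
    rw [exp_sub, exp_log hc0, exp_log hw0]
    field_simp
  rw [e, log_exp]
  · rw [sub_im, log_im, log_im]; linarith
  · rw [sub_im, log_im, log_im]; linarith

theorem tendsto_inv_of_norm (hw : Tendsto (fun i => ‖w i‖) l atTop) : Tendsto (fun i => (w i)⁻¹) l (𝓝 0) := by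
  rw [tendsto_zero_iff_norm_tendsto_zero]
  simp only [norm_inv]
  exact hw.inv_tendsto_atTop

theorem tendsto_norm_of_re (hw : Tendsto (fun i => (w i).re) l atTop) : Tendsto (fun i => ‖w i‖) l atTop :=
  tendsto_atTop_mono (fun i => re_le_norm (w i)) hw

theorem tendsto_mul_log_one_add_div (hw : Tendsto (fun i => ‖w i‖) l atTop) (c e : ℂ) :
    Tendsto (fun i => (w i + e) * log (1 + c / w i)) l (𝓝 c) := by
  have hinv := tendsto_inv_of_norm hw
  have hne : ∀ᶠ i in l, w i ≠ 0 := (hw.eventually_gt_atTop 0).mono fun i hi => norm_pos_iff.mp hi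
  have h1 : Tendsto (fun i => c + e * c * (w i)⁻¹) l (𝓝 c) := by simpa using (hinv.const_mul (e * c)).const_add c
  have h2 : Tendsto (fun i => ‖c‖ ^ 2 * (‖1 + e * (w i)⁻¹‖ * ‖(w i)⁻¹‖)) l (𝓝 0) := by
    simpa using (((hinv.const_mul e).const_add 1).norm.mul hinv.norm).const_mul (‖c‖ ^ 2)
  have h3 : Tendsto (fun i => (w i + e) * log (1 + c / w i) - (c + e * c * (w i)⁻¹)) l (𝓝 0) := by
    refine squeeze_zero_norm' ?_ h2
    filter_upwards [hne, hw.eventually_ge_atTop (2 * ‖c‖)] with i hi hc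
    have hu : ‖c / w i‖ ≤ 1 / 2 := by rw [norm_div, div_le_iff₀ (norm_pos_iff.mpr hi)]; linarith
    have h4 := (log_taylor_bounds hu).1
    have e1 : (w i + e) * log (1 + c / w i) - (c + e * c * (w i)⁻¹)
        = (w i + e) * (log (1 + c / w i) - c / w i) := by field_simp
    have e2 : ‖w i + e‖ = ‖1 + e * (w i)⁻¹‖ * ‖w i‖ := by rw [← norm_mul]; congr 1; field_simp
    rw [e1, norm_mul, e2]
    calc _ ≤ ‖1 + e * (w i)⁻¹‖ * ‖w i‖ * ‖c / w i‖ ^ 2 := by gcongr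
      _ = _ := by
        have := norm_pos_iff.mpr hi
        rw [norm_div, norm_inv]
        field_simp
  simpa using h3.add h1

theorem tendsto_stirRatio (hw : Tendsto (fun i => (w i).re) l atTop) :
    Tendsto (fun i => stirRatio (w i)) l (𝓝 1) := by
  have hn := tendsto_norm_of_re hw
  rw [tendsto_iff_norm_sub_tendsto_zero]
  refine squeeze_zero' (Eventually.of_forall fun i => norm_nonneg _) ?_ (hn.const_div_atTop (6 * π))
  filter_upwards [hw.eventually_gt_atTop 0, hn.eventually_ge_atTop (3 * π)] with i h1 h2
  exact norm_stirRatio_sub_one_le h1 h2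

theorem tendsto_gamma_add_div (hw : Tendsto (fun i => (w i).re) l atTop) (c : ℂ) : Tendsto (fun i => Gamma (w i + c)
      / (Gamma (w i) * exp (c * log (w i)))) l (𝓝 1) := by
  have hwc : Tendsto (fun i => (w i + c).re) l atTop := by
    simp only [add_re]
    exact tendsto_atTop_add_const_right l c.re hw
  have h1 := (tendsto_stirRatio hwc).div (tendsto_stirRatio hw) one_ne_zero
  have h2 := tendsto_mul_log_one_add_div (tendsto_norm_of_re hw) c (c - 1 / 2)
  have h3 : Tendsto (fun i => exp ((w i + (c - 1 / 2)) * log (1 + c / w i) - c)) l (𝓝 1) := by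
    have := (h2.sub_const c).cexp
    rwa [sub_self, exp_zero] at this
  have h4 := h1.mul h3
  rw [div_one, one_mul] at h4
  refine h4.congr' ?_
  filter_upwards [hw.eventually_gt_atTop 0, hwc.eventually_gt_atTop 0] with i h5 h6
  rw [Pi.div_apply, Gamma_eq_stirRatio_mul (w i), Gamma_eq_stirRatio_mul (w i + c), log_one_add_div h5 h6]
  have e : exp ((w i + (c - 1 / 2)) * (log (w i + c) - log (w i)) - c)
      = exp (stirLog (w i + c)) / (exp (stirLog (w i)) * exp (c * log (w i))) := by
    rw [← exp_add, ← exp_sub]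
    congr 1
    unfold stirLog
    ring
  rw [e]
  ring

theorem eventually_norm_inv_gamma_le (hw : Tendsto (fun i => (w i).re) l atTop) {B : ℝ}
    (hB : ∀ᶠ i in l, |(w i).im| ≤ B * (w i).re) (A : ℝ) :
    ∀ᶠ i in l, ‖(Gamma (w i))⁻¹‖ ≤ rexp (-A * (w i).re) := by
  have hn := tendsto_norm_of_re hw
  have hlog := Real.tendsto_log_atTop.comp hn
  have hs := (tendsto_stirRatio hw).norm.eventually (lt_mem_nhds (show (1 / 2 : ℝ) < ‖(1 : ℂ)‖ by norm_num))
  filter_upwards [hs, hB, hw.eventually_ge_atTop 1, hw.eventually_gt_atTop 0,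
    hlog.eventually_ge_atTop (2 * (|A| + B * π + 3))] with i h1 h2 h3 h4 h5
  rw [Gamma_eq_stirRatio_mul, norm_inv, norm_mul, norm_exp]
  simp only [Function.comp_apply] at h5
  set R := (w i).re
  have hB0 : 0 ≤ B * R := (abs_nonneg _).trans h2
  have hre : (stirLog (w i)).re = (R - 1 / 2) * Real.log ‖w i‖ - (w i).im * arg (w i) - R + Real.log (√(2 * π)) := by
    unfold stirLog
    simp [log_re, log_im, R]
  have hpi : 0 ≤ Real.log (√(2 * π)) := by
    refine log_nonneg ?_
    rw [one_le_sqrt]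
    linarith [pi_gt_three]
  have harg : (w i).im * arg (w i) ≤ B * R * π := by
    refine (le_abs_self _).trans ?_
    rw [abs_mul]
    exact mul_le_mul h2 (abs_arg_le_pi _) (abs_nonneg _) hB0
  have h6 : R / 2 * (2 * (|A| + B * π + 3)) ≤ (R - 1 / 2) * Real.log ‖w i‖ := by
    have hB1 : 0 ≤ B := by
      by_contra! hc
      nlinarith
    have : 0 ≤ 2 * (|A| + B * π + 3) := by positivity
    exact mul_le_mul (by linarith) h5 this (by linarith)
  have h7 : |A| * R + 2 * R ≤ (stirLog (w i)).re := by
    rw [hre]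
    nlinarith
  have h8 : 2⁻¹ * rexp (|A| * R + 2 * R) ≤ ‖stirRatio (w i)‖ * rexp (stirLog (w i)).re := by
    gcongr
    linarith
  have h9 : rexp (A * R) ≤ 2⁻¹ * rexp (|A| * R + 2 * R) := by
    have e1 : 2 ≤ rexp (2 * R) := by have := add_one_le_exp (2 * R); linarith
    rw [Real.exp_add]
    have e2 : rexp (A * R) ≤ rexp (|A| * R) := by gcongr; exact le_abs_self _
    nlinarith [exp_pos (|A| * R)]
  rw [neg_mul, Real.exp_neg]
  exact inv_anti₀ (exp_pos _) (h9.trans h8)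

namespace Edge

variable (ha : 0 < a) (b : ℝ) (hm : 0 < m + 1 + b / a) (h : Edge δ l T n x)
include h

theorem tendsto_re_add (c : ℂ) : Tendsto (fun i => (x i + c).re) l atTop := by
  simp only [add_re]
  exact tendsto_atTop_add_const_right l c.re h.tendsto_re

theorem abs_im_le : ∀ᶠ i in l, |(x i).im| ≤ δ⁻¹ * (x i).re := by
  filter_upwards [h.im_le, h.le_im, h.le_re, h.one_le] with i h1 h2 h3 h4
  have : 0 ≤ T i ^ 19 := by positivity
  rw [abs_of_nonneg (this.trans h2), inv_mul_eq_div, le_div_iff₀ h.pos]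
  nlinarith [h.pos]

theorem norm_le_re : ∀ᶠ i in l, ‖x i‖ ≤ (1 + δ⁻¹) * (x i).re := by
  filter_upwards [h.abs_im_le, h.tendsto_re.eventually_ge_atTop 0] with i h1 h2
  have := norm_le_abs_re_add_abs_im (x i)
  rw [abs_of_nonneg h2] at this
  linarith

theorem norm_inv_gamma_le {c : ℂ} (hc0 : 0 ≤ c.re) (hc1 : c.im = 0) (A : ℝ) :
    ∀ᶠ i in l, ‖(Gamma (x i + c))⁻¹‖ ≤ rexp (-A * (x i + c).re) := by
  refine eventually_norm_inv_gamma_le (B := δ⁻¹) (h.tendsto_re_add c) ?_ A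
  filter_upwards [h.abs_im_le] with i hi
  have := inv_pos.mpr h.pos
  rw [add_im, add_re, hc1, add_zero]
  nlinarith

end Edge

end

section

variable {ι : Type*} {δ a b : ℝ} {l : Filter ι} {T : ι → ℝ} {n : ι → ℕ} {x : ι → ℂ} {m : ℕ}

theorem norm_kap_inv (a b : ℝ) (x : ℂ) (k : ℕ) : ‖(kap a b x k)⁻¹‖ = 2 * π / rexp a * ‖(Gamma (k + b / a + 1))⁻¹‖
      * ‖Gamma (x + a + b / a + 1)‖ * rexp (Real.log a * (x.re + a - k)) := by
  unfold kap
  have e : rexp (Real.log a * (x.re + a - k)) = (‖exp (Real.log a * (k - (x + a)))‖)⁻¹ := by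
    rw [norm_exp, ← Real.exp_neg]
    congr 1
    rw [re_ofReal_mul]
    simp
    ring
  rw [e]
  rw [norm_inv]
  simp only [norm_inv, norm_div, norm_mul]
  rw [show ‖exp (a : ℂ)‖ = rexp a by rw [← ofReal_exp, norm_real, norm_of_nonneg (exp_pos _).le]]
  have e2 : ‖(2 : ℂ)‖ = 2 := by norm_num
  have e3 : ‖(π : ℂ)‖ = π := by rw [norm_real, norm_of_nonneg pi_pos.le]
  rw [e2, e3]
  field_simp

theorem norm_exp_mul_log_le {w : ℂ} (hw : 1 ≤ ‖w‖) (c : ℝ) : ‖exp (c * log w)‖ ≤ rexp (|c| * ‖w‖) := by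
  rw [norm_exp, exp_le_exp, re_ofReal_mul, log_re]
  have h1 : 0 ≤ Real.log ‖w‖ := log_nonneg hw
  have h2 : Real.log ‖w‖ ≤ ‖w‖ := (log_le_sub_one_of_pos (by linarith)).trans (by linarith)
  calc c * Real.log ‖w‖ ≤ |c| * Real.log ‖w‖ := by gcongr; exact le_abs_self c
    _ ≤ _ := by gcongr

namespace Edge

variable (ha : 0 < a) (b : ℝ) (hm : 0 < m + 1 + b / a) (h : Edge δ l T n x)
include h

theorem exists_norm_kap_inv_le (a b : ℝ) (k : ℕ) : ∃ A : ℝ, ∀ᶠ i in l, ‖(kap a b (x i) k)⁻¹‖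
      ≤ rexp (A * (x i).re) * ‖Gamma (x i + a + 1)‖ := by
  set c := b / a with hc
  set K := 2 * π / rexp a * ‖(Gamma (k + b / a + 1))⁻¹‖
    * (2 * rexp (|c| * (|a| + 1) + |Real.log a| * (|a| + k))) with hK
  have hK0 : 0 ≤ K := by positivity
  refine ⟨|c| * (1 + δ⁻¹) + |Real.log a| + 1, ?_⟩
  have hw : Tendsto (fun i => (x i + ((a : ℂ) + 1)).re) l atTop := h.tendsto_re_add _
  have h1 := (tendsto_gamma_add_div hw (c : ℂ)).norm.eventually (gt_mem_nhds (show ‖(1 : ℂ)‖ < 2 by norm_num))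
  have h2 := (Real.tendsto_exp_atTop.comp h.tendsto_re).eventually_ge_atTop K
  filter_upwards [h1, h2, h.norm_le_re, h.tendsto_re.eventually_ge_atTop 0,
    (tendsto_norm_of_re hw).eventually_ge_atTop 1, hw.eventually_gt_atTop 0] with i h3 h4 h5 h6 h7 h8
  simp only [Function.comp_apply] at h4
  have hΓ : Gamma (x i + (a + 1)) ≠ 0 := Gamma_ne_zero_of_re_pos h8
  rw [norm_div, norm_mul, div_lt_iff₀ (mul_pos (norm_pos_iff.mpr hΓ) (norm_pos_iff.mpr (exp_ne_zero _)))] at h3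
  have h9 := norm_exp_mul_log_le h7 c
  have h10 : ‖x i + ((a : ℂ) + 1)‖ ≤ (1 + δ⁻¹) * (x i).re + (|a| + 1) := by
    refine (norm_add_le _ _).trans (add_le_add h5 ?_)
    refine (norm_add_le _ _).trans ?_
    rw [norm_real, norm_one, norm_eq_abs]
  have e1 : x i + a + b / a + 1 = x i + (a + 1) + c := by rw [hc]; push_cast; ring
  have e2 : x i + a + 1 = x i + ((a : ℂ) + 1) := by ring
  rw [norm_kap_inv, e1, e2]
  have h11 : Real.log a * ((x i).re + a - k) ≤ |Real.log a| * (x i).re + |Real.log a| * (|a| + k) := by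
    rw [← mul_add]
    refine (le_abs_self _).trans ?_
    rw [abs_mul]
    gcongr
    rw [abs_le]
    have := neg_abs_le a
    have := le_abs_self a
    have : (0 : ℝ) ≤ k := Nat.cast_nonneg k
    constructor <;> linarith
  have h12 : ‖Gamma (x i + (a + 1) + c)‖ ≤ 2 * (‖Gamma (x i + (a + 1))‖
      * rexp (|c| * ((1 + δ⁻¹) * (x i).re + (|a| + 1)))) := by
    refine h3.le.trans ?_
    gcongr
    refine h9.trans ?_
    gcongr
  calc _ ≤ 2 * π / rexp a * ‖(Gamma (k + b / a + 1))⁻¹‖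
      * (2 * (‖Gamma (x i + (a + 1))‖
      * rexp (|c| * ((1 + δ⁻¹) * (x i).re + (|a| + 1)))))
      * rexp (|Real.log a| * (x i).re + |Real.log a| * (|a| + k)) := by gcongr
    _ = K * (rexp ((|c| * (1 + δ⁻¹) + |Real.log a|) * (x i).re)) * ‖Gamma (x i + (a + 1))‖ := by
      rw [hK]
      have : rexp (|c| * ((1 + δ⁻¹) * (x i).re + (|a| + 1)))
          * rexp (|Real.log a| * (x i).re + |Real.log a| * (|a| + k))
          = rexp (|c| * (|a| + 1) + |Real.log a| * (|a| + k))
            * rexp ((|c| * (1 + δ⁻¹) + |Real.log a|) * (x i).re) := by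
        rw [← Real.exp_add, ← Real.exp_add]; congr 1; ring
      linear_combination 2 * π / rexp a * ‖(Gamma (k + b / a + 1))⁻¹‖ * 2 * ‖Gamma (x i + (a + 1))‖ * this
    _ ≤ rexp (x i).re * (rexp ((|c| * (1 + δ⁻¹) + |Real.log a|) * (x i).re))
        * ‖Gamma (x i + (a + 1))‖ := by gcongr
    _ = _ := by rw [← Real.exp_add]; congr 2; ring

include hm in
theorem eventually_norm_casor_le : ∀ᶠ i in l, ‖casor (solL a b (x i)) (piSeq a b (x i)) m‖
      ≤ 2 * ‖x i‖ ^ (2 * m + 1) * ‖(Gamma (x i + a + 1))⁻¹‖ := by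
  have hm1 : 0 < ((m + 1 : ℕ) : ℝ) + 1 + b / a := by push_cast; linarith
  have h1 := ((h.tendsto_solL_div b hm1).mul (tendsto_piSeq_div h.tendsto_norm a b m)).sub
    ((h.tendsto_solL_pred_div b hm).mul (tendsto_piSeq_div h.tendsto_norm a b (m + 1)))
  rw [mul_one, sub_self] at h1
  have h2 := ((h.tendsto_gamma_shift a (m + 1)).inv₀ one_ne_zero).norm
  rw [inv_one, norm_one] at h2
  have h1' := h1.norm
  rw [norm_zero] at h1'
  filter_upwards [h1'.eventually (gt_mem_nhds one_pos), h2.eventually (gt_mem_nhds one_lt_two), h.x_ne,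
    (h.tendsto_re_add (a - m)).eventually_gt_atTop 0, (h.tendsto_re_add (a + 1)).eventually_gt_atTop 0]
    with i h3 h3' h4 h5 h6
  have e1 : x i + a - ((m + 1 : ℕ) : ℂ) + 1 = x i + (a - m) := by push_cast; ring
  have e2 : x i + a + 1 - ((m + 1 : ℕ) : ℂ) = x i + (a - m) := by push_cast; ring
  have e3 : x i + a - m = x i + (a - m) := by ring
  have e4 : x i + a + 1 = x i + (a + 1) := by ring
  have hΓ := Gamma_ne_zero_of_re_pos h5
  have hΓ' := Gamma_ne_zero_of_re_pos h6
  rw [e1, e3] at h3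
  rw [e2, e4] at h3'
  rw [e4]
  have e : casor (solL a b (x i)) (piSeq a b (x i)) m
      = (solL a b (x i) (m + 1) / (Gamma (x i + (a - m)))⁻¹ * (piSeq a b (x i) m / x i ^ m)
        - x i * (solL a b (x i) m / (Gamma (x i + (a - m)))⁻¹) * (piSeq a b (x i) (m + 1) / x i ^ (m + 1)))
        * (x i ^ (m + 1) * Gamma (x i + (a - m)) / Gamma (x i + (a + 1)))⁻¹
        * (x i ^ (2 * m + 1) * (Gamma (x i + (a + 1)))⁻¹) := by
    unfold casor
    field_simp
    ring
  rw [e, norm_mul, norm_mul, norm_mul, norm_pow]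
  calc _ ≤ 1 * 2 * (‖x i‖ ^ (2 * m + 1) * ‖(Gamma (x i + (a + 1)))⁻¹‖) := by gcongr
    _ = _ := by ring

include ha hm in
theorem tendsto_coefM_div : Tendsto (fun i => coefM a b m (x i) / coefL a b m (x i)) l (𝓝 0) := by
  obtain ⟨A, hA⟩ := h.exists_norm_kap_inv_le a b m
  have hp := (((h.tendsto_coefL_div ha b hm).inv₀ one_ne_zero).norm).eventually
    (gt_mem_nhds (show ‖(1 : ℂ)⁻¹‖ < 2 by norm_num))
  have hone : Tendsto (fun i => ‖(1 - per a (x i))⁻¹‖) l (𝓝 1) := by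
    have := (((h.one_sub_per a).const_sub 1).inv₀ (by simp)).norm
    simpa using this
  set B := (1 + δ⁻¹) * ((2 * m + 1 : ℕ) : ℝ) + A + 1 with hB
  have hΓ := h.norm_inv_gamma_le (c := a + 1) (by simp; linarith) (by simp) |B|
  rw [tendsto_zero_iff_norm_tendsto_zero]
  have hlim : Tendsto (fun i => 8 * rexp (-(x i).re)) l (𝓝 0) := by
    simpa using (tendsto_exp_neg_atTop_nhds_zero.comp h.tendsto_re).const_mul 8
  refine squeeze_zero' (Eventually.of_forall fun i => norm_nonneg _) ?_ hlim
  filter_upwards [hA, hp, hone.eventually (gt_mem_nhds one_lt_two), hΓ, h.eventually_norm_casor_le b hm,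
    h.norm_le_re, h.tendsto_re.eventually_ge_atTop 0, (h.tendsto_re_add (a + 1)).eventually_gt_atTop 0,
    h.tendsto_norm.eventually_ge_atTop 1]
    with i h1 h2 h3 h4 h5 h6 h7 h8 h9
  have e4 : x i + a + 1 = x i + (a + 1) := by ring
  have hG := Gamma_ne_zero_of_re_pos h8
  rw [e4] at h1 h2 h5
  set G := Gamma (x i + (a + 1)) with hGdef
  have hG0 := norm_pos_iff.mpr hG
  have hcM : coefM a b m (x i) = casor (solL a b (x i)) (piSeq a b (x i)) m
      * (-I * (1 - per a (x i))⁻¹ * (kap a b (x i) m)⁻¹) := by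
    unfold coefM
    rw [casor_solL_solM ha hm, div_eq_mul_inv, mul_inv, mul_inv, inv_I]
  have e : coefM a b m (x i) / coefL a b m (x i) = casor (solL a b (x i)) (piSeq a b (x i)) m
      * (-I * (1 - per a (x i))⁻¹ * (kap a b (x i) m)⁻¹) * (coefL a b m (x i) / G)⁻¹ * G⁻¹ := by
    rw [hcM, inv_div]
    field_simp
  rw [e]
  simp only [norm_mul, norm_neg, norm_I, one_mul]
  have h10 : ‖x i‖ ^ (2 * m + 1) ≤ rexp ((1 + δ⁻¹) * ((2 * m + 1 : ℕ) : ℝ) * (x i).re) := by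
    have e1 : (1 + δ⁻¹) * ((2 * m + 1 : ℕ) : ℝ) * (x i).re = ((2 * m + 1 : ℕ) : ℝ) * ((1 + δ⁻¹) * (x i).re) := by ring
    rw [e1, Real.exp_nat_mul]
    gcongr
    refine h6.trans ?_
    linarith [add_one_le_exp ((1 + δ⁻¹) * (x i).re)]
  have h11 : ‖G⁻¹‖ ≤ rexp (-B * (x i).re) := by
    refine h4.trans ?_
    rw [exp_le_exp]
    have : (x i).re ≤ (x i + ((a : ℂ) + 1)).re := by simp; linarith
    nlinarith [le_abs_self B, abs_nonneg B]
  calc _ ≤ 2 * rexp ((1 + δ⁻¹) * ((2 * m + 1 : ℕ) : ℝ) * (x i).re) * ‖G⁻¹‖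
        * (2 * (rexp (A * (x i).re) * ‖G‖)) * 2 * ‖G⁻¹‖ := by
        gcongr
        exact h5.trans (by gcongr)
    _ = 8 * (rexp ((1 + δ⁻¹) * ((2 * m + 1 : ℕ) : ℝ) * (x i).re) * rexp (A * (x i).re) * ‖G⁻¹‖) := by
        rw [norm_inv]; field_simp; ring
    _ ≤ 8 * (rexp ((1 + δ⁻¹) * ((2 * m + 1 : ℕ) : ℝ) * (x i).re) * rexp (A * (x i).re)
        * rexp (-B * (x i).re)) := by gcongr
    _ = _ := by rw [← Real.exp_add, ← Real.exp_add, hB]; congr 2; ring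

end Edge

/-- `f` tends to `1` faster than `1 / T ^ 14`. -/
def FastOne (l : Filter ι) (T : ι → ℝ) (f : ι → ℂ) : Prop := Tendsto (fun i => (T i : ℂ) ^ 14 * (f i - 1)) l (𝓝 0)

namespace FastOne

variable {f g : ι → ℂ}

theorem tendsto (h : FastOne l T f) (hT : Tendsto T l atTop) : Tendsto f l (𝓝 1) := by
  have h1 : Tendsto (fun i => (((T i) : ℂ) ^ 14)⁻¹) l (𝓝 0) := by
    refine tendsto_inv_of_norm ?_
    refine tendsto_atTop_mono' l ?_ hT
    filter_upwards [hT.eventually_ge_atTop 1] with i hi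
    rw [norm_pow, norm_real, norm_of_nonneg (by linarith)]
    exact le_self_pow₀ hi (by norm_num)
  have h2 := (h.mul h1).add_const 1
  simp only [zero_mul, zero_add] at h2
  refine h2.congr' ?_
  filter_upwards [hT.eventually_gt_atTop 0] with i hi
  have : (T i : ℂ) ≠ 0 := by exact_mod_cast hi.ne'
  field_simp
  ring

theorem mul (hf : FastOne l T f) (hg : FastOne l T g) (hT : Tendsto T l atTop) :
    FastOne l T (fun i => f i * g i) := by
  have h1 := (Tendsto.mul hf (hg.tendsto hT)).add hg
  rw [zero_mul, zero_add] at h1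
  refine h1.congr fun i => ?_
  ring

theorem inv (hf : FastOne l T f) (hT : Tendsto T l atTop) : FastOne l T (fun i => (f i)⁻¹) := by
  have h0 := hf.tendsto hT
  have h1 := (Tendsto.mul hf (h0.inv₀ one_ne_zero)).neg
  rw [zero_mul, neg_zero] at h1
  refine h1.congr' ?_
  filter_upwards [h0.eventually_ne one_ne_zero] with i hi
  field_simp
  ring

theorem of_norm_le {C : ℝ} (hT : Tendsto T l atTop) (h : ∀ᶠ i in l, ‖f i - 1‖ ≤ C / T i ^ 15) : FastOne l T f := by
  refine squeeze_zero_norm' ?_ (hT.const_div_atTop C)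
  filter_upwards [h, hT.eventually_gt_atTop 0] with i hi h0
  rw [norm_mul, norm_pow, norm_real, norm_of_nonneg h0.le]
  calc _ ≤ T i ^ 14 * (C / T i ^ 15) := by gcongr
    _ = _ := by field_simp

end FastOne

namespace Edge

variable (ha : 0 < a) (b : ℝ) (hm : 0 < m + 1 + b / a) (h : Edge δ l T n x)
include h

theorem far (a : ℝ) : ∀ᶠ i in l, Far a (x i) (n i) (1 / T i * √(n i)) := by
  filter_upwards [h.le_im, h.sqrt_eq, h.one_le] with i h1 h2 h3
  refine far_of_le_im ?_ _
  rw [h2]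
  refine le_trans (le_of_eq ?_) h1
  have : T i ≠ 0 := by linarith
  field_simp

include ha in
theorem exists_piSeq_div_wkb :
    ∃ K : ℝ, ∀ᶠ i in l, ∀ k ≤ n i, ‖piSeq a b (x i) k / wkb a (x i) k - 1‖ ≤ K / T i ^ 15 := by
  obtain ⟨K, hK0, hK⟩ := exists_norm_div_wkb_sub_one_le ha b
  refine ⟨K, ?_⟩
  filter_upwards [h.far a, h.one_le, h.sqrt_eq,
    (h.tendsto_pow (k := 15) (by norm_num)).eventually_ge_atTop K] with i h1 h2 h3 h4 k hk
  have hT : 0 < T i := by linarith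
  have e : (1 / T i) ^ 5 * √(n i) = T i ^ 15 := by rw [h3]; field_simp
  have := hK (x i) _ (isPi_piSeq a b (x i)) (1 / T i) (n i) (by positivity)
    (by rw [div_le_one hT]; exact h2) (by rw [e]; exact h4) h1 k hk
  rwa [e] at this

include ha in
theorem fastOne_ratio :
    FastOne l T (fun i => piSeq a b (x i) (n i - 1) / piSeq a b (x i) (n i) * lam a (x i) (n i)) := by
  obtain ⟨K, hK⟩ := h.exists_piSeq_div_wkb ha b
  have h1 : FastOne l T (fun i => piSeq a b (x i) (n i) / wkb a (x i) (n i)) :=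
    FastOne.of_norm_le h.tendsto (hK.mono fun i hi => hi _ le_rfl)
  have h2 : FastOne l T (fun i => piSeq a b (x i) (n i - 1) / wkb a (x i) (n i - 1)) :=
    FastOne.of_norm_le h.tendsto (hK.mono fun i hi => hi _ (Nat.sub_le _ _))
  set C0 := 3 * (1 + √a) ^ 2 * (16 * a + 8) with hC0
  have hC00 : 0 ≤ C0 := by positivity
  have hJ : ∀ᶠ i in l, (∀ k : ℕ, k ≤ n i → lam a (x i) k ≠ 0) ∧
      ‖((n i - 1 : ℕ) : ℂ) * log (lam a (x i) (n i - 1 : ℕ) / lam a (x i) (n i))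
        + wkbExp a (x i) (n i - 1 : ℕ) - wkbExp a (x i) (n i)‖ ≤ (4 * √C0 + 48 * C0) / T i ^ 16 := by
    filter_upwards [h.far a, h.one_le, h.sqrt_eq, h.cast_eq, h.tendsto_n.eventually_ge_atTop 1,
      (h.tendsto_pow (k := 19) (by norm_num)).eventually_ge_atTop (2 * a),
      (h.tendsto_pow (k := 18) (by norm_num)).eventually_gt_atTop (4 * (1 + √a))]
      with i h1 h2 h3 h3' h4 h5 h6
    have hT : 0 < T i := by linarith
    have e19 : 1 / T i * T i ^ 20 = T i ^ 19 := by field_simp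
    have e18 : (1 / T i) ^ 2 * T i ^ 20 = T i ^ 18 := by field_simp
    have S := stepBound_of_far (δ := 1 / T i) ha (by positivity) (by rw [div_le_one hT]; exact h2) h4
      (by rw [h3, e19]; exact h5) (by rw [h3, e18]; exact h6) h1
    refine ⟨S.lam_ne, ?_⟩
    obtain ⟨k, hk⟩ : ∃ k, n i = k + 1 := ⟨n i - 1, by omega⟩
    have h7 := S.down k (by omega)
    have h8 := (S.main (k + 1) (by omega)).2
    rw [hk, Nat.add_sub_cancel]
    rw [hk] at h7 h8
    have hq : qBound a (1 / T i) (x i) ((k + 1 : ℕ) : ℝ) ((k + 1 : ℕ) : ℝ) ≤ C0 / T i ^ 36 := by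
      unfold qBound
      rw [← hk, h3', ← hC0]
      have e : C0 / T i ^ 36 = C0 / (1 / T i) ^ 4 * (1 / T i ^ 40) := by field_simp
      rw [e]
      gcongr
      nlinarith [sq_nonneg ((x i).re - T i ^ 40)]
    have hsq : √(qBound a (1 / T i) (x i) ((k + 1 : ℕ) : ℝ) ((k + 1 : ℕ) : ℝ)) ≤ √C0 / T i ^ 18 := by
      refine (sqrt_le_sqrt hq).trans (le_of_eq ?_)
      rw [Real.sqrt_div hC00, show T i ^ 36 = (T i ^ 18) ^ 2 by ring, sqrt_sq (by positivity)]
    have h9 : √C0 / T i ^ 18 ≤ √C0 / T i ^ 16 := by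
      gcongr
      norm_num
    have h10 : C0 / T i ^ 36 ≤ C0 / T i ^ 16 := by
      gcongr
      norm_num
    have e : (4 * √C0 + 48 * C0) / T i ^ 16 = 48 * (C0 / T i ^ 16) + 4 * (√C0 / T i ^ 16) := by ring
    rw [e]
    have := norm_add_le _ _ |>.trans (add_le_add h7 h8)
    rw [sub_add_cancel] at this
    linarith
  set J : ι → ℂ := fun i => ((n i - 1 : ℕ) : ℂ) * log (lam a (x i) (n i - 1 : ℕ) / lam a (x i) (n i))
        + wkbExp a (x i) (n i - 1 : ℕ) - wkbExp a (x i) (n i) with hJdef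
  have h3 : FastOne l T (fun i => exp (J i)) := by
    refine FastOne.of_norm_le (C := 2 * (4 * √C0 + 48 * C0)) h.tendsto ?_
    filter_upwards [hJ, h.one_le, h.tendsto.eventually_ge_atTop (4 * √C0 + 48 * C0)] with i h4 h5 h6
    have hT : 0 < T i := by linarith
    have hC1 : 0 ≤ 4 * √C0 + 48 * C0 := by positivity
    have h7 : (4 * √C0 + 48 * C0) / T i ^ 16 ≤ 1 := by
      rw [div_le_one (by positivity)]
      exact h6.trans (le_self_pow₀ h5 (by norm_num))
    refine (norm_exp_sub_one_le (h4.2.trans h7)).trans ?_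
    rw [mul_div_assoc]
    gcongr
    refine h4.2.trans ?_
    gcongr
    norm_num
  have h4 := (h2.mul (h1.inv h.tendsto) h.tendsto).mul h3 h.tendsto
  refine h4.congr' ?_
  filter_upwards [hJ, h.tendsto_n.eventually_ge_atTop 1] with i h5 h6
  obtain ⟨k, hk⟩ : ∃ k, n i = k + 1 := ⟨n i - 1, by omega⟩
  have hl1 := h5.1 (n i) le_rfl
  have hl0 := h5.1 (n i - 1) (Nat.sub_le _ _)
  have e := wkb_pred_div (a := a) (x := x i) (n := k) (by rw [← hk]; exact hl1)
    (by rw [show k = n i - 1 by omega]; exact hl0)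
  have hw := wkb_ne_zero (a := a) (x := x i) hl1
  have e2 : wkb a (x i) (n i - 1) = wkb a (x i) (n i) * ((lam a (x i) (n i))⁻¹ * exp (J i)) := by
    rw [hJdef]
    simp only
    rw [hk, Nat.add_sub_cancel]
    exact e
  rw [e2]
  congr 2
  have := exp_ne_zero (J i)
  rw [inv_div]
  field_simp

end Edge

namespace Edge

variable (ha : 0 < a) (b : ℝ) (hm : 0 < m + 1 + b / a) (h : Edge δ l T n x)
include h

include ha in
theorem roots_bounds : ∃ C : ℝ, 0 < C ∧ ∀ᶠ i in l,
    T i ^ 19 ≤ ‖disc a (x i) (n i)‖ ∧ ‖lam a (x i) (n i)‖ ≤ C * T i * ‖disc a (x i) (n i)‖ ∧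
    lam a (x i) (n i) * sig a (x i) (n i) = a * n i ∧ lam a (x i) (n i) ≠ 0 := by
  have hc0 : 0 < cutConst a := by unfold cutConst; positivity
  refine ⟨1 + 1 / cutConst a, by positivity, ?_⟩
  filter_upwards [h.far a, h.one_le, h.sqrt_eq, h.cast_eq, h.offCut ha, h.le_im] with i h1 h2 h3 h4 h5 h6
  have hT : 0 < T i := by linarith
  have hf : Far a (x i) (n i) (T i ^ 19) := far_of_le_im h6 _
  have hD : 0 < T i ^ 19 := by positivity
  have hg := hf.good ha hD (Nat.cast_nonneg (n i)) le_rfl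
  have hn : (0 : ℝ) < n i := by rw [h4]; positivity
  have h8 := (h5 (n i) hn.le).le_norm_disc (by positivity) hg.mul_nn
  refine ⟨hg.le_disc, (norm_lam_le hg.ne_zero hg.mul_nn).trans ?_, hg.lam_mul_sig, hg.lam_ne⟩
  have h10 : √(a * n i) ≤ T i / cutConst a * ‖disc a (x i) (n i)‖ := by
    rw [div_mul_eq_mul_div, div_le_iff₀ hT] at h8
    rw [div_mul_eq_mul_div, le_div_iff₀ hc0]
    linarith
  rw [show (1 + 1 / cutConst a) * T i * ‖disc a (x i) (n i)‖
    = T i * ‖disc a (x i) (n i)‖ + T i / cutConst a * ‖disc a (x i) (n i)‖ by ring]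
  exact add_le_add (le_mul_of_one_le_left (norm_nonneg _) h2) h10

include ha hm in
theorem solM_last : ∃ C : ℝ, 0 < C ∧ ∀ᶠ i in l, solM a b (x i) (n i - 1) ≠ 0 ∧ solM a b (x i) (n i) ≠ 0 ∧
      ‖solM a b (x i) (n i) / solM a b (x i) (n i - 1) - sig a (x i) (n i)‖ ≤ C * T i ^ 2 := by
  obtain ⟨C, hC, hC'⟩ := h.solM_ne_zero ha b hm
  refine ⟨C, hC, ?_⟩
  filter_upwards [hC', h.tendsto_n.eventually_ge_atTop (m + 1)] with i h1 h2
  have h3 := h1 (n i - 1) (by omega)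
  rw [show n i - 1 + 1 = n i by omega] at h3
  exact ⟨h3.1, (h1 (n i) (by omega)).1, h3.2⟩

include ha hm in
theorem tendsto_ratio_defect : Tendsto (fun i => (1 - solM a b (x i) (n i) / solM a b (x i) (n i - 1)
        * (piSeq a b (x i) (n i - 1) / piSeq a b (x i) (n i)))
      * lam a (x i) (n i) / disc a (x i) (n i)) l (𝓝 1) := by
  obtain ⟨C, hC, hM⟩ := h.solM_last ha b hm
  obtain ⟨C', hC', hR⟩ := h.roots_bounds ha
  have hρ := h.fastOne_ratio ha b
  have hρ1 := (Tendsto.norm hρ).eventually (ge_mem_nhds (show ‖(0 : ℂ)‖ < 1 by norm_num))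
  rw [tendsto_iff_norm_sub_tendsto_zero]
  refine squeeze_zero' (Eventually.of_forall fun i => norm_nonneg _) ?_ (h.tendsto.const_div_atTop (C + C' + C))
  filter_upwards [hM, hR, hρ1, h.one_le] with i h1 h2 h3 h4
  have hT : 0 < T i := by linarith
  obtain ⟨-, -, h1⟩ := h1
  obtain ⟨hd, hl, -, hl0⟩ := h2
  set s := solM a b (x i) (n i) / solM a b (x i) (n i - 1)
  set ρ := piSeq a b (x i) (n i - 1) / piSeq a b (x i) (n i)
  set L := lam a (x i) (n i)
  set D := disc a (x i) (n i) with hDdef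
  have hD0 : 0 < ‖D‖ := lt_of_lt_of_le (by positivity) hd
  have hDne := norm_pos_iff.mp hD0
  have hσ : L - sig a (x i) (n i) = D := lam_sub_sig a (x i) (n i)
  have e : (1 - s * ρ) * L / D - 1 = -((s - sig a (x i) (n i)) + s * (ρ * L - 1)) / D := by
    rw [eq_div_iff hDne, sub_mul, div_mul_cancel₀ _ hDne, ← hσ]; ring
  rw [norm_mul, norm_pow, norm_real, norm_of_nonneg hT.le] at h3
  have h5 : ‖ρ * L - 1‖ ≤ 1 / T i ^ 14 := by rw [le_div_iff₀ (by positivity)]; linarith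
  have hs : ‖s‖ ≤ C * T i ^ 2 + C' * T i * ‖D‖ := by
    have h6 := norm_add_le (s - sig a (x i) (n i)) (sig a (x i) (n i))
    rw [sub_add_cancel] at h6
    linarith [norm_sig_le a (x i) (n i)]
  have hT2 : T i ^ 2 ≤ ‖D‖ / T i := by
    rw [le_div_iff₀ hT]
    calc T i ^ 2 * T i = T i ^ 3 := by ring
      _ ≤ T i ^ 19 := pow_le_pow_right₀ h4 (by norm_num)
      _ ≤ _ := hd
  rw [e, norm_div, norm_neg, div_le_iff₀ hD0]
  calc _ ≤ ‖s - sig a (x i) (n i)‖ + ‖s * (ρ * L - 1)‖ := norm_add_le _ _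
    _ ≤ C * T i ^ 2 + (C * T i ^ 2 + C' * T i * ‖D‖) * (1 / T i ^ 14) := by rw [norm_mul]; gcongr
    _ ≤ C * T i ^ 2 + (C * T i ^ 2 + C' * T i * ‖D‖) * (1 / T i ^ 2) := by
        have : T i ^ 2 ≤ T i ^ 14 := pow_le_pow_right₀ h4 (by norm_num)
        gcongr
    _ = C * T i ^ 2 + C * 1 + C' * (‖D‖ / T i) := by field_simp; ring
    _ ≤ C * (‖D‖ / T i) + C * (‖D‖ / T i) + C' * (‖D‖ / T i) := by
        have : 1 ≤ ‖D‖ / T i := le_trans (one_le_pow₀ h4) hT2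
        gcongr
    _ = _ := by field_simp; ring

include ha in
theorem piSeq_ne_zero : ∀ᶠ i in l, piSeq a b (x i) (n i) ≠ 0 := by
  have h1 := (h.fastOne_ratio ha b).tendsto h.tendsto
  filter_upwards [h1.eventually_ne one_ne_zero] with i hi h0
  rw [h0] at hi
  simp at hi

include ha hm in
theorem tendsto_recessive : Tendsto (fun i => coefL a b m (x i) * solM a b (x i) (n i) * piSeq a b (x i) (n i)
      / (solM a b (x i) (n i) / solM a b (x i) (n i - 1) * lam a (x i) (n i) / disc a (x i) (n i)
        * (Gamma (x i + a + 1) ^ 2 * (I * kap a b (x i) (n i - 1))))) l (𝓝 1) := by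
  obtain ⟨C, hC, hM⟩ := h.solM_last ha b hm
  obtain ⟨C', hC', hR⟩ := h.roots_bounds ha
  have hdef := h.tendsto_ratio_defect ha b hm
  have hp := h.tendsto_coefL_div ha b hm
  have he := (h.one_sub_per a).const_sub 1
  rw [sub_zero] at he
  have h1 := ((hp.pow 2).mul he).div hdef one_ne_zero
  rw [one_pow, one_mul, div_one] at h1
  refine h1.congr' ?_
  filter_upwards [hM, hR, h.tendsto_n.eventually_ge_atTop (m + 1), h.piSeq_ne_zero ha b,
    hdef.eventually_ne one_ne_zero, h.tendsto_re.eventually_gt_atTop (-(a + b / a + 1)), h.per_ne a,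
    h.one_le, (h.tendsto_re_add (a + 1)).eventually_gt_atTop 0]
    with i h2 h3 h4 h5 h6 h7 h8 h9 h10
  obtain ⟨hM0, hM1, -⟩ := h2
  obtain ⟨hd, -, -, hl0⟩ := h3
  have hT : 0 < T i := by linarith
  have hD0 : disc a (x i) (n i) ≠ 0 := norm_pos_iff.mp (lt_of_lt_of_le (by positivity) hd)
  obtain ⟨k, hk⟩ : ∃ k, n i = k + 1 := ⟨n i - 1, by omega⟩
  have hmk : m ≤ k := by omega
  have hk0 : 0 < (k : ℝ) + 1 + b / a := by
    have : (m : ℝ) ≤ k := by exact_mod_cast hmk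
    linarith
  have hkap := kap_ne_zero (a := a) (b := b) (x := x i) hk0 (by linarith)
  have hkap' := kap_ne_zero (a := a) (b := b) (x := x i) hm (by linarith)
  have hΓ : Gamma (x i + a + 1) ≠ 0 := by rw [add_assoc]; exact Gamma_ne_zero_of_re_pos h10
  have hcas : casor (piSeq a b (x i)) (solM a b (x i)) k
      = coefL a b m (x i) * casor (solL a b (x i)) (solM a b (x i)) k := by
    have hL := solL_solvesFrom (x := x i) ha hm
    have hMs := solM_solvesFrom (x := x i) ha hm
    have hπ := (isPi_piSeq a b (x i)).solvesFrom m
    have hne : casor (solL a b (x i)) (solM a b (x i)) m ≠ 0 := by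
      rw [casor_solL_solM ha hm]
      exact mul_ne_zero (mul_ne_zero I_ne_zero h8) hkap'
    have e1 := hπ.cramer hL hMs le_rfl hne hmk
    have e2 := hπ.cramer hL hMs le_rfl hne (Nat.le_succ_of_le hmk)
    unfold coefL
    conv_lhs => unfold casor
    rw [e1, e2]
    conv_rhs => arg 2; unfold casor
    ring
  rw [casor_solL_solM ha hk0] at hcas
  unfold casor at hcas
  rw [Pi.div_apply]
  rw [hk, Nat.add_sub_cancel] at h6 hM0 ⊢
  rw [hk] at h5 hM1 hD0 hl0
  set p := coefL a b m (x i)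
  set G := Gamma (x i + a + 1)
  set M1 := solM a b (x i) (k + 1)
  set M0 := solM a b (x i) k
  set P1 := piSeq a b (x i) (k + 1)
  set P0 := piSeq a b (x i) k
  set L := lam a (x i) ((k + 1 : ℕ) : ℝ)
  set D := disc a (x i) ((k + 1 : ℕ) : ℝ)
  set K := kap a b (x i) k
  have hdne : P1 * M0 - P0 * M1 ≠ 0 := by
    intro h0
    refine h6 ?_
    have : 1 - M1 / M0 * (P0 / P1) = (P1 * M0 - P0 * M1) / (P1 * M0) := by field_simp
    rw [this, h0]
    simp
  have e1 : (1 - M1 / M0 * (P0 / P1)) * L / D = (P1 * M0 - P0 * M1) / (P1 * M0) * L / D := by congr 2; field_simp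
  rw [e1]
  have e2 : p * M1 * P1 / (M1 / M0 * L / D * (G ^ 2 * (I * K)))
      = p * P1 * M0 * D / (L * G ^ 2 * (I * K)) := by field_simp
  rw [e2]
  have e3 : (1 - per a (x i)) * I * K * p = P1 * M0 - P0 * M1 := by rw [hcas]; ring
  have hI := I_ne_zero
  have hp0 : p ≠ 0 := by intro h0; rw [h0, mul_zero] at e3; exact hdne e3.symm
  rw [← e3]
  field_simp

end Edge

theorem gTwo_mul_one_sub_per {x : ℂ} {n : ℕ} (ha : 0 < a) (hm : 0 < m + 1 + b / a)
    (hx : 0 < x.re + a + b / a + 1) (h : 1 - per a x ≠ 0) (hn : m ≤ n) (hp : coefL a b m x ≠ 0) :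
    gTwo a b m x n * (1 - per a x) = (1 + coefM a b m x / coefL a b m x)
      * (coefL a b m x * solM a b x n - per a x * piSeq a b x n
        + per a x * (coefM a b m x / coefL a b m x) * (coefL a b m x * solM a b x n)) := by
  have hkap := kap_ne_zero (a := a) (b := b) (x := x) hm hx
  have hI := I_ne_zero
  have hW := casor_solL_solM (x := x) ha hm
  have hW0 : casor (solL a b x) (solM a b x) m ≠ 0 := by rw [hW]; exact mul_ne_zero (mul_ne_zero hI h) hkap
  have hπ := ((isPi_piSeq a b x).solvesFrom m).cramer (solL_solvesFrom (x := x) ha hm)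
    (solM_solvesFrom (x := x) ha hm) le_rfl hW0 hn
  change piSeq a b x n = coefL a b m x * _ + coefM a b m x * _ at hπ
  have h1 : casor (piSeq a b x) (solM a b x) m = coefL a b m x * (I * (1 - per a x) * kap a b x m) := by
    unfold coefL; rw [← hW]; field_simp
  have h2 : casor (solL a b x) (piSeq a b x) m = coefM a b m x * (I * (1 - per a x) * kap a b x m) := by
    unfold coefM; rw [← hW]; field_simp
  have h3 : casor (piSeq a b x) (solN a b x) m = -((coefL a b m x + coefM a b m x) * (I * kap a b x m)) := by
    have e : casor (piSeq a b x) (solN a b x) m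
        = -(casor (solL a b x) (piSeq a b x) m + casor (piSeq a b x) (solM a b x) m) / (1 - per a x) := by
      unfold casor
      rw [solN_eq h, solN_eq h]
      field_simp
      ring
    rw [e, h1, h2]
    field_simp
    ring
  unfold gTwo
  rw [h3, solP_eq h, hπ]
  field_simp
  rw [show I ^ 2 = -1 from I_sq]
  ring

namespace Edge

variable (ha : 0 < a) (b : ℝ) (hm : 0 < m + 1 + b / a) (h : Edge δ l T n x)
include h

include ha hm in
theorem coefL_ne : ∀ᶠ i in l, coefL a b m (x i) ≠ 0 := by
  filter_upwards [(h.tendsto_coefL_div ha b hm).eventually_ne one_ne_zero] with i hi h0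
  rw [h0] at hi
  simp at hi

include ha hm in
theorem tendsto_gTwo_of_recessive (hr : Tendsto (fun i => per a (x i) * piSeq a b (x i) (n i)
      / (coefL a b m (x i) * solM a b (x i) (n i))) l (𝓝 0)) :
    Tendsto (fun i => gTwo a b m (x i) (n i) / (coefL a b m (x i) * solM a b (x i) (n i))) l (𝓝 1) := by
  have hκ := h.tendsto_coefM_div ha b hm
  have he := h.one_sub_per a
  obtain ⟨C, -, hM⟩ := h.solM_last ha b hm
  have h1 := ((hκ.const_add 1).mul ((hr.const_sub 1).add (he.mul hκ))).div (he.const_sub 1) (by simp)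
  simp only [add_zero, sub_zero, mul_zero, mul_one, div_one] at h1
  refine h1.congr' ?_
  filter_upwards [hM, h.coefL_ne ha b hm, h.per_ne a, h.tendsto_n.eventually_ge_atTop m,
    h.tendsto_re.eventually_gt_atTop (-(a + b / a + 1))] with i h2 h3 h4 h5 h6
  have hM0 := h2.2.1
  rw [Pi.div_apply, div_eq_div_iff h4 (mul_ne_zero h3 hM0), gTwo_mul_one_sub_per ha hm (by linarith) h4 h5 h3]
  field_simp

include ha hm in
theorem tendsto_gTwo_of_dominant (hr : Tendsto (fun i => coefL a b m (x i) * solM a b (x i) (n i)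
      / (per a (x i) * piSeq a b (x i) (n i))) l (𝓝 0)) :
    Tendsto (fun i => gTwo a b m (x i) (n i) / -(per a (x i) * piSeq a b (x i) (n i))) l (𝓝 1) := by
  have hκ := h.tendsto_coefM_div ha b hm
  have he := h.one_sub_per a
  have h1 := ((hκ.const_add 1).mul ((hr.const_sub 1).add ((he.mul hκ).mul hr).neg)).div (he.const_sub 1) (by simp)
  simp only [add_zero, sub_zero, mul_zero, mul_one, div_one, neg_zero] at h1
  refine Tendsto.congr' ?_ h1
  filter_upwards [h.coefL_ne ha b hm, h.per_ne a, h.tendsto_n.eventually_ge_atTop m,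
    h.tendsto_re.eventually_gt_atTop (-(a + b / a + 1)), h.piSeq_ne_zero ha b] with i h3 h4 h5 h6 h7
  have h8 : per a (x i) ≠ 0 := exp_ne_zero _
  rw [Pi.div_apply, div_eq_div_iff h4 (neg_ne_zero.mpr (mul_ne_zero h8 h7)),
    gTwo_mul_one_sub_per ha hm (by linarith) h4 h5 h3]
  field_simp
  ring

/-- The explicit factor of the recessive part. -/
def recFactor (a b : ℝ) (x : ℂ) (n : ℕ) : ℂ := I * (a * n / disc a x n) * Gamma (x + a + 1) ^ 2 * kap a b x (n - 1)

/-- The exponent in the asymptotic form of `recFactor`. -/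
def recExp (a b : ℝ) (x : ℂ) (n : ℕ) : ℂ :=
  (x + a + 1 / 2 - b / a) * log (x + a) - (x + a) + (n - 1 / 2 + b / a) * Real.log n - n
    + Real.log a * (n - (x + a)) + a

include ha in
theorem tendsto_recFactor : Tendsto (fun i => recFactor a b (x i) (n i)
      / (I * (n i / disc a (x i) (n i)) * exp (recExp a b (x i) (n i)))) l (𝓝 1) := by
  have hE := h.tendsto_re_add (a : ℂ)
  have hn : Tendsto (fun i => ((n i : ℂ)).re) l atTop := by
    simp only [natCast_re]
    exact tendsto_natCast_atTop_atTop.comp h.tendsto_n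
  obtain ⟨C, -, hR⟩ := h.roots_bounds ha
  have h1 := (((tendsto_stirRatio hE).mul (tendsto_stirRatio hn)).mul
    (tendsto_gamma_add_div hn (b / a))).div (tendsto_gamma_add_div hE (b / a + 1)) one_ne_zero
  simp only [mul_one, div_one] at h1
  refine h1.congr' ?_
  filter_upwards [hR, h.tendsto_n.eventually_ge_atTop 1, h.one_le, hE.eventually_gt_atTop 0,
    hE.eventually_gt_atTop (-(b / a + 1))] with i h2 h3 h4 h5 h6
  have hT : 0 < T i := by linarith
  have hD0 : disc a (x i) (n i) ≠ 0 := norm_pos_iff.mp (lt_of_lt_of_le (by positivity) h2.1)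
  have hE0 : x i + (a : ℂ) ≠ 0 := by intro h0; rw [h0] at h5; simp at h5
  have hn0 : (n i : ℂ) ≠ 0 := by
    have : n i ≠ 0 := by omega
    exact_mod_cast this
  have ha0 : (a : ℂ) ≠ 0 := by exact_mod_cast ha.ne'
  have hΓE := Gamma_ne_zero_of_re_pos h5
  have hΓn : Gamma (n i : ℂ) ≠ 0 := by
    refine Gamma_ne_zero_of_re_pos ?_
    simp; omega
  have hΓc : Gamma (x i + a + (b / a + 1)) ≠ 0 := by
    refine Gamma_ne_zero_of_re_pos ?_
    have : (x i + (a : ℂ) + (b / a + 1)).re = (x i + (a : ℂ)).re + (b / a + 1) := by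
      have : ((b : ℂ) / a + 1) = ((b / a + 1 : ℝ) : ℂ) := by push_cast; ring
      rw [this, add_re, ofReal_re]
    rw [this]; linarith
  have e1 : stirRatio (x i + a) = Gamma (x i + a) * exp (-stirLog (x i + a)) := rfl
  have e2 : stirRatio (n i) = Gamma (n i) * exp (-stirLog (n i)) := rfl
  have e3 : Gamma (x i + a + 1) = (x i + a) * Gamma (x i + a) := Gamma_add_one _ hE0
  have e4 : x i + a + b / a + 1 = x i + a + (b / a + 1) := by ring
  have e5 : ((n i - 1 : ℕ) : ℂ) + b / a + 1 = n i + b / a := by rw [Nat.cast_sub h3]; push_cast; ring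
  have e6 : exp (Real.log a * (((n i - 1 : ℕ) : ℂ) - (x i + a)))
      = (a : ℂ)⁻¹ * exp (Real.log a * (n i - (x i + a))) := by
    rw [Nat.cast_sub h3]
    have : (a : ℂ)⁻¹ = exp (-(Real.log a : ℂ)) := by rw [exp_neg, ← ofReal_exp, Real.exp_log ha]
    rw [this, ← exp_add]; congr 1; push_cast; ring
  have hlog : log (n i : ℂ) = (Real.log (n i) : ℂ) := by rw [← ofReal_natCast, ofReal_log (Nat.cast_nonneg _)]
  have hpi : exp (Real.log (√(2 * π)) : ℂ) ^ 2 = 2 * π := by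
    rw [← ofReal_exp, Real.exp_log (sqrt_pos.mpr (by positivity)), ← ofReal_pow, sq_sqrt (by positivity)]
    push_cast; ring
  have e7 : exp (recExp a b (x i) (n i)) * exp (-stirLog (x i + a))
      * exp (-stirLog (n i)) * exp (-(b / a) * log (n i))
      * exp ((b / a + 1) * log (x i + a)) * (2 * π)
      = (x i + a) ^ 2 * exp (Real.log a * (n i - (x i + a))) * exp a := by
    have : (x i + a) ^ 2 = exp (2 * log (x i + a)) := by rw [two_mul, exp_add, exp_log hE0]; ring
    rw [this, ← hpi, pow_two]
    simp only [← exp_add]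
    congr 1
    unfold recExp stirLog
    rw [hlog]
    ring
  rw [Pi.div_apply]
  unfold recFactor kap
  rw [e1, e2, e3, e4, e5, e6]
  have hpi0 : (π : ℂ) ≠ 0 := by exact_mod_cast pi_ne_zero
  have hI := I_ne_zero
  have hx1 := exp_ne_zero (recExp a b (x i) (n i))
  have hx2 := exp_ne_zero (b / a * log (n i))
  rw [neg_mul, exp_neg (b / a * _)] at e7
  have hx3 := exp_ne_zero ((b / a + 1) * log (x i + a))
  generalize exp (recExp a b (x i) (n i)) = Y1 at *
  generalize exp (b / a * log (n i)) = Y2 at *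
  generalize exp ((b / a + 1) * log (x i + a)) = Y3 at *
  generalize exp (Real.log a * (n i - (x i + a))) = Y4 at *
  generalize Gamma (n i + b / a) = G1 at *
  generalize Gamma (x i + a + (b / a + 1)) = G2 at *
  generalize exp (a : ℂ) = Y5 at *
  field_simp
  field_simp at e7
  linear_combination G1 * e7

end Edge

end

section

variable {a : ℝ} {n : ℕ} {z w : ℂ}

theorem csqrt_re_im (w : ℂ) : 2 * ((sqrt w).re * (sqrt w).im) = w.im := by
  conv_rhs => rw [← csqrt_sq w, pow_two, mul_im]
  ring

theorem csqrt_re_pos_of_im_ne (hw : w.im ≠ 0) : 0 < (sqrt w).re :=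
  (csqrt_re_nonneg w).lt_of_ne fun h => hw (by rw [← csqrt_re_im w, ← h]; ring)

theorem csqrt_pos_of_im_pos (hw : 0 < w.im) : 0 < (sqrt w).re ∧ 0 < (sqrt w).im := by
  have h1 := csqrt_re_im w
  have h3 := csqrt_re_pos_of_im_ne hw.ne'
  exact ⟨h3, by by_contra! hc; nlinarith⟩

theorem csqrt_of_im_neg (hw : w.im < 0) : 0 < (sqrt w).re ∧ (sqrt w).im < 0 := by
  have h1 := csqrt_re_im w
  have h3 := csqrt_re_pos_of_im_ne hw.ne
  exact ⟨h3, by by_contra! hc; nlinarith⟩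

theorem csqrt_eq_of_re_pos {s : ℂ} (h : s ^ 2 = w) (hs : 0 < s.re) : sqrt w = s :=
  eq_of_sq_eq_of_re_mul_conj (z := 1) (by rw [csqrt_sq, h]) (by simpa using csqrt_re_nonneg w) (by simpa using hs)

theorem csqrt_re_pos_of_re_pos (hw : 0 < w.re) : 0 < (sqrt w).re ∧ (sqrt w).im ^ 2 < (sqrt w).re ^ 2 := by
  have h1 : w.re = (sqrt w).re ^ 2 - (sqrt w).im ^ 2 := by
    conv_lhs => rw [← csqrt_sq w, pow_two, mul_re]
    ring
  refine ⟨lt_of_le_of_ne (csqrt_re_nonneg w) ?_, by linarith⟩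
  intro h; rw [← h] at h1; nlinarith [sq_nonneg (sqrt w).im]

theorem rootOuter_im_pos (hz : 0 < z.im) : 0 < (rootOuter a z).im := by
  obtain ⟨h1, h2⟩ := csqrt_pos_of_im_pos (w := z - 2 * rootA a) (by simpa [rootA] using hz)
  obtain ⟨h3, h4⟩ := csqrt_pos_of_im_pos (w := z + 2 * rootA a) (by simpa [rootA] using hz)
  unfold rootOuter
  rw [mul_im]
  positivity

theorem rootOuter_eq_I_mul (ha : 0 < a) (hz : 0 < z.im) : rootOuter a z = I * sqrt (4 * a - z ^ 2) := by
  have h1 : rootOuter a z ^ 2 = (I * sqrt (4 * a - z ^ 2)) ^ 2 := by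
    rw [rootOuter_sq ha.le, mul_pow, I_sq, csqrt_sq]; ring
  rcases sq_eq_sq_iff_eq_or_eq_neg.mp h1 with h | h
  · exact h
  · have h2 := rootOuter_im_pos (a := a) hz
    rw [h] at h2
    simp at h2
    linarith [csqrt_re_nonneg (4 * a - z ^ 2)]

theorem rootLeft_sq (ha : 0 < a) (z : ℂ) : rootLeft a z ^ 2 = z ^ 2 - 4 * a := by
  unfold rootLeft
  rw [mul_pow, csqrt_sq, csqrt_sq, ← rootA_sq ha.le]; ring

theorem rootOuter_eq_neg_rootLeft (ha : 0 < a) (hz : 0 < z.im) : rootOuter a z = -rootLeft a z := by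
  rcases sq_eq_sq_iff_eq_or_eq_neg.mp ((rootOuter_sq ha.le z).trans (rootLeft_sq ha z).symm) with h | h
  · have h2 := rootOuter_im_pos (a := a) hz
    obtain ⟨h1, h2'⟩ := csqrt_of_im_neg (w := -z - 2 * rootA a) (by simpa [rootA] using hz)
    obtain ⟨h3, h4⟩ := csqrt_of_im_neg (w := -z + 2 * rootA a) (by simpa [rootA] using hz)
    rw [h] at h2
    unfold rootLeft at h2
    rw [mul_im] at h2
    nlinarith
  · exact h

theorem natCast_div_exp_pow (hn : 1 ≤ n) : ((n : ℂ) / exp 1) ^ n = exp (n * Real.log n - n) := by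
  have h : (n : ℂ) / exp 1 = exp (Real.log n - 1) := by
    rw [exp_sub, ← ofReal_exp, Real.exp_log (by exact_mod_cast hn)]
    simp
  rw [h, ← exp_nat_mul]; congr 1; ring

theorem cpow_eq_exp {y : ℂ} (hy : y ≠ 0) (s : ℂ) : y ^ s = exp (s * log y) := by rw [cpow_def_of_ne_zero hy, mul_comm]

theorem outerApprox_eq_exp (hn : 1 ≤ n) (hz : 0 < z.im) : outerApprox 1 a n z = exp (n * Real.log n - n
        + (n - (xAt n z + a)) * log ((z + rootOuter a z) / (2 * rootN n))
        + (xAt n z + a) * log (1 + z / rootN n))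
      * sqrt ((rootN n + z) / rootOuter a z)
      * exp ((2 * a - z ^ 2 - 4 * rootN n * z + (z + 4 * rootN n) * rootOuter a z) / 4) := by
  have hr0 := rootN_ne_zero hn
  have hs : 0 < √n := sqrt_pos.mpr (by exact_mod_cast hn)
  have hY : 0 < ((z + rootOuter a z) / (2 * rootN n)).im := by
    have : (2 * rootN n : ℂ) = ((2 * √n : ℝ) : ℂ) := by unfold rootN; push_cast; ring
    rw [this, div_ofReal_im, add_im]
    have := rootOuter_im_pos (a := a) hz
    positivity
  have hU : 0 < (1 + z / rootN n).im := by
    unfold rootN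
    rw [add_im, div_ofReal_im, one_im]
    positivity
  have hY0 : (z + rootOuter a z) / (2 * rootN n) ≠ 0 := by intro h; rw [h] at hY; simp at hY
  have hU0 : 1 + z / rootN n ≠ 0 := by intro h; rw [h] at hU; simp at hU
  have e1 : (z + rootOuter a z) / (2 * (rootN n + z)) = (z + rootOuter a z) / (2 * rootN n) / (1 + z / rootN n) := by
    have : rootN n + z ≠ 0 := by intro h; apply hU0; rw [one_add_div hr0, h, zero_div]
    field_simp
  have hx : rootN n * (rootN n + z) = xAt n z := by unfold xAt; rw [mul_add, ← pow_two, rootN_sq]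
  unfold outerApprox
  simp only [ofReal_one, one_pow, mul_one, div_one]
  rw [natCast_div_exp_pow hn, e1, cpow_eq_exp (div_ne_zero hY0 hU0),
    SameSide.log_div (Or.inl (mul_pos hY hU)), hx, ← exp_log (pow_ne_zero n hY0),
    exp_log (pow_ne_zero n hY0)]
  have e2 : ((z + rootOuter a z) / (2 * rootN n)) ^ n = exp (n * log ((z + rootOuter a z) / (2 * rootN n))) := by
    rw [exp_nat_mul, exp_log hY0]
  rw [e2, ← exp_add, ← exp_add]
  congr 3
  ring

theorem log_rootA_div_rootN (ha : 0 < a) (hn : 1 ≤ n) : rootA a / rootN n ≠ 0 ∧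
    log (rootA a / rootN n) = (((Real.log a - Real.log n) / 2 : ℝ) : ℂ) := by
  have hn0 : (0 : ℝ) < n := by exact_mod_cast hn
  have e : rootA a / rootN n = ((√a / √n : ℝ) : ℂ) := by unfold rootA rootN; push_cast; ring
  have hp : 0 < √a / √n := by positivity
  rw [e, ← ofReal_log hp.le, Real.log_div (by positivity) (by positivity), log_sqrt ha.le, log_sqrt hn0.le]
  exact ⟨by exact_mod_cast hp.ne', by congr 1; ring⟩

theorem exp_I_mul_carccos (w : ℂ) : exp (I * carccos w) = w + I * sqrt (1 - w ^ 2) := by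
  have h0 : w + I * sqrt (1 - w ^ 2) ≠ 0 := by
    intro h
    have h1 : (w + I * sqrt (1 - w ^ 2)) * (w - I * sqrt (1 - w ^ 2)) = 1 := by
      linear_combination csqrt_sq (1 - w ^ 2) - (sqrt (1 - w ^ 2)) ^ 2 * I_sq
    rw [h, zero_mul] at h1
    exact zero_ne_one h1
  unfold carccos
  rw [← mul_assoc, mul_neg, I_mul_I, neg_neg, one_mul, exp_log h0]

theorem csqrt_one_sub_sq (ha : 0 < a) (z : ℂ) :
    2 * rootA a * sqrt (1 - (z / (2 * rootA a)) ^ 2) = sqrt (4 * a - z ^ 2) := by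
  have h := csqrt_ofReal_mul (r := 4 * a) (by positivity) (1 - (z / (2 * rootA a)) ^ 2)
  have hs : √(4 * a) = 2 * √a := by
    rw [sqrt_mul (by norm_num), show (4 : ℝ) = 2 ^ 2 by norm_num, sqrt_sq (by norm_num)]
  have h0 : rootA a ≠ 0 := by
    intro h; have := rootA_sq ha.le; rw [h] at this; simp at this; exact ha.ne (by exact_mod_cast this)
  rw [hs] at h
  have e : ((4 * a : ℝ) : ℂ) * (1 - (z / (2 * rootA a)) ^ 2) = 4 * a - z ^ 2 := by
    push_cast; rw [div_pow, mul_pow, rootA_sq ha.le]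
    have : (a : ℂ) ≠ 0 := by exact_mod_cast ha.ne'
    field_simp
    ring
  rw [e] at h
  rw [h]; unfold rootA; push_cast; ring

theorem outerApprox_eq_mid (ha : 0 < a) (hn : 1 ≤ n) (hz : 0 < z.im) (hx : 0 < (xAt n z).re) :
    outerApprox 1 a n z = midAmp 1 a n z * exp (I * midPhase 1 a n z) := by
  have hr0 := rootN_ne_zero hn
  have hs : 0 < √n := sqrt_pos.mpr (by exact_mod_cast hn)
  obtain ⟨hA0, hAl⟩ := log_rootA_div_rootN ha hn
  have h0 : rootA a ≠ 0 := by intro h; rw [h, zero_div] at hA0; exact hA0 rfl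
  have hR := rootOuter_eq_I_mul ha hz
  have hq := csqrt_one_sub_sq ha z
  have hxx : rootN n * (rootN n + z) = xAt n z := by unfold xAt; rw [mul_add, ← pow_two, rootN_sq]
  set q := sqrt (4 * a - z ^ 2) with hqdef
  have hRim := rootOuter_im_pos (a := a) hz
  have hqre : 0 < q.re := by rw [hR] at hRim; simpa using hRim
  have hX : 0 < (rootN n + z).re ∧ 0 < (rootN n + z).im := by
    constructor
    · rw [← hxx] at hx
      unfold rootN at hx ⊢
      rw [re_ofReal_mul] at hx
      exact pos_of_mul_pos_right hx hs.le
    · simpa [rootN] using hz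
  have hlog : log ((z + rootOuter a z) / (2 * rootN n))
      = I * carccos (z / (2 * rootA a)) + log (rootA a / rootN n) := by
    have e : rootA a / rootN n = ((√a / √n : ℝ) : ℂ) := by unfold rootA rootN; push_cast; rfl
    have hp : 0 < √a / √n := by positivity
    have e1 : (z + rootOuter a z) / (2 * rootN n) = ((√a / √n : ℝ) : ℂ) * (z / (2 * rootA a)
          + I * sqrt (1 - (z / (2 * rootA a)) ^ 2)) := by
      rw [hR, ← hq, ← e]; field_simp
    rw [e1, log_ofReal_mul hp (by rw [← exp_I_mul_carccos]; exact exp_ne_zero _), e, ← ofReal_log hp.le]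
    unfold carccos
    rw [← mul_assoc, mul_neg, I_mul_I, neg_neg, one_mul, add_comm]
  have hsq : sqrt ((rootN n + z) / rootOuter a z) = sqrt ((rootN n + z) / q) * exp (-(I * (π / 4))) := by
    have hc : exp (-(I * (π / 4))) = ((√2 / 2 : ℝ) : ℂ) * (1 - I) := by
      have : -(I * (π / 4)) = ((-(π / 4) : ℝ) : ℂ) * I := by push_cast; ring
      rw [this, exp_mul_I, ← ofReal_cos, ← ofReal_sin, Real.cos_neg,
        Real.sin_neg, Real.cos_pi_div_four, Real.sin_pi_div_four]
      push_cast; ring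
    have hq0 : q ≠ 0 := by intro h; rw [h] at hqre; simp at hqre
    refine csqrt_eq_of_re_pos ?_ ?_
    · rw [mul_pow, csqrt_sq, ← exp_nat_mul, hR]
      have : ((2 : ℕ) : ℂ) * -(I * (π / 4)) = -(π / 2 * I) := by push_cast; ring
      rw [this, exp_neg, exp_pi_div_two_mul_I, inv_I]
      rw [div_mul_eq_mul_div, div_eq_div_iff hq0 (mul_ne_zero I_ne_zero hq0)]
      linear_combination -q * (rootN n + z) * I_sq
    · rw [hc, mul_left_comm, re_ofReal_mul]
      refine mul_pos (by positivity) ?_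
      have e : (sqrt ((rootN n + z) / q) * (1 - I)).re
          = (sqrt ((rootN n + z) / q)).re + (sqrt ((rootN n + z) / q)).im := by
        simp
      rw [e]
      have hN : 0 < normSq q := normSq_pos.mpr hq0
      rcases lt_or_ge 0 ((rootN n + z) / q).im with h1 | h1
      · have := csqrt_pos_of_im_pos h1; linarith
      · have h2 : 0 < ((rootN n + z) / q).re := by
          rw [div_im, ← sub_div] at h1
          have h3 : (rootN n + z).im * q.re - (rootN n + z).re * q.im ≤ 0 := by
            by_contra! hcon
            linarith [div_pos hcon hN]
          rw [div_re, ← add_div]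
          refine div_pos ?_ hN
          have h4 : 0 ≤ q.im := by
            by_contra! hcon
            nlinarith [mul_pos hX.2 hqre, mul_pos hX.1 (neg_pos.mpr hcon)]
          nlinarith [mul_pos hX.1 hqre, mul_nonneg hX.2.le h4]
        obtain ⟨h3, h4⟩ := csqrt_re_pos_of_re_pos h2
        have := abs_lt_of_sq_lt_sq' h4 h3.le
        linarith [this.1]
  rw [outerApprox_eq_exp hn hz, hlog, hsq]
  have hU0 : 1 + z / rootN n ≠ 0 := by
    intro h
    have : rootN n + z = 0 := by
      rw [one_add_div hr0] at h
      exact (div_eq_zero_iff.mp h).resolve_right hr0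
    rw [this] at hX; simp at hX
  unfold midAmp midPhase
  simp only [ofReal_one, one_pow, mul_one, div_one]
  rw [natCast_div_exp_pow hn, cpow_eq_exp hA0, cpow_eq_exp hU0, hxx, ← hqdef, hR]
  have e : ∀ S A P B C D E F G : ℂ, A + P + B = C + D + E + F + G → exp A * (S * exp P) * exp B
        = exp C * exp D * exp E * S * exp F * exp G := by
    intro S A P B C D E F G h
    have := congrArg exp h
    simp only [exp_add] at this
    linear_combination S * this
  refine e _ _ _ _ _ _ _ _ _ ?_
  rw [hAl]
  unfold xAt
  ring

theorem csqrt_im_sq_lt (hw : 0 < w.re) : -(sqrt w).re < (sqrt w).im ∧ (sqrt w).im < (sqrt w).re := by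
  obtain ⟨h1, h2⟩ := csqrt_re_pos_of_re_pos hw
  exact abs_lt.mp (abs_lt_of_sq_lt_sq h2 h1.le)

theorem rootLeft_re_pos (hz : z.re < -(2 * √a)) : 0 < (rootLeft a z).re := by
  have hs := sqrt_nonneg a
  obtain ⟨h1, h2⟩ := csqrt_im_sq_lt (w := -z - 2 * rootA a) (by simp [rootA]; linarith)
  obtain ⟨h3, h4⟩ := csqrt_im_sq_lt (w := -z + 2 * rootA a) (by simp [rootA]; linarith)
  unfold rootLeft
  rw [mul_re]
  nlinarith [mul_pos (sub_pos.mpr h2) (neg_lt_iff_pos_add.mp h3), mul_pos (neg_lt_iff_pos_add.mp h1) (sub_pos.mpr h4)]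

theorem rootLeft_im_neg (hz : 0 < z.im) : (rootLeft a z).im < 0 := by
  obtain ⟨h1, h2⟩ := csqrt_of_im_neg (w := -z - 2 * rootA a) (by simpa [rootA] using hz)
  obtain ⟨h3, h4⟩ := csqrt_of_im_neg (w := -z + 2 * rootA a) (by simpa [rootA] using hz)
  unfold rootLeft
  rw [mul_im]
  nlinarith [mul_pos h1 (neg_pos.mpr h4), mul_pos h3 (neg_pos.mpr h2)]

theorem outerApprox_eq_left (ha : 0 < a) (hn : 1 ≤ n) (hz : 0 < z.im)
    (hz2 : z.re < -(2 * √a)) (hx : 0 < (xAt n z).re) :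
    outerApprox 1 a n z = leftAmp 1 a n z * exp (I * leftPhase 1 a n z) := by
  have hr0 := rootN_ne_zero hn
  have hs : 0 < √n := sqrt_pos.mpr (by exact_mod_cast hn)
  have hR := rootOuter_eq_neg_rootLeft ha hz
  have hxx : rootN n * (rootN n + z) = xAt n z := by unfold xAt; rw [mul_add, ← pow_two, rootN_sq]
  have hq := rootLeft_re_pos hz2
  have hq' := rootLeft_im_neg (a := a) hz
  set q := rootLeft a z
  have hX : 0 < (rootN n + z).re ∧ 0 < (rootN n + z).im := by
    constructor
    · rw [← hxx] at hx
      unfold rootN at hx ⊢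
      rw [re_ofReal_mul] at hx
      exact pos_of_mul_pos_right hx hs.le
    · simpa [rootN] using hz
  have hζ : ((-z + q) / (2 * rootN n)).im < 0 := by
    have : (2 * rootN n : ℂ) = ((2 * √n : ℝ) : ℂ) := by unfold rootN; push_cast; ring
    rw [this, div_ofReal_im, add_im, neg_im]
    exact div_neg_of_neg_of_pos (by linarith) (by positivity)
  have hζ0 : (-z + q) / (2 * rootN n) ≠ 0 := by intro h; rw [h] at hζ; simp at hζ
  have hU0 : 1 + z / rootN n ≠ 0 := by
    intro h
    have : rootN n + z = 0 := by grind
    rw [this] at hX; simp at hX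
  have hlog : log ((z + rootOuter a z) / (2 * rootN n)) = log ((-z + q) / (2 * rootN n)) + π * I := by
    have e : (z + rootOuter a z) / (2 * rootN n) = -((-z + q) / (2 * rootN n)) := by rw [hR]; ring
    rw [e, log, log, norm_neg, arg_neg_eq_arg_add_pi_of_im_neg hζ]
    push_cast; ring
  have hq0 : q ≠ 0 := by intro h; rw [h] at hq; simp at hq
  have hsq : sqrt ((rootN n + z) / rootOuter a z) = sqrt ((rootN n + z) / q) * exp (-(π / 2 * I)) := by
    rw [exp_neg, exp_pi_div_two_mul_I, inv_I]
    refine csqrt_eq_of_re_pos ?_ ?_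
    · rw [mul_pow, csqrt_sq, hR, neg_pow, I_sq, div_neg]; ring
    · have h1 : 0 < ((rootN n + z) / q).im := by
        rw [div_im, ← sub_div]
        exact div_pos (by nlinarith [mul_pos hX.2 hq, mul_pos hX.1 (neg_pos.mpr hq')]) (normSq_pos.mpr hq0)
      simpa using (csqrt_pos_of_im_pos h1).2
  rw [outerApprox_eq_exp hn hz, hlog, hsq, hR]
  unfold leftAmp leftPhase
  simp only [ofReal_one, one_pow, mul_one, div_one]
  rw [natCast_div_exp_pow hn, cpow_eq_exp hζ0, cpow_eq_exp hU0, hxx]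
  have e : ∀ S A P B C D E F G : ℂ, A + P + B = C + D + E + F + G → exp A * (S * exp P) * exp B
        = exp C * exp D * exp E * S * exp F * exp G := by
    intro S A P B C D E F G h
    have := congrArg exp h
    simp only [exp_add] at this
    linear_combination S * this
  refine e _ _ _ _ _ _ _ _ _ ?_
  unfold xAt
  ring

theorem exp_neg_leftPhase (a : ℝ) (n : ℕ) (z : ℂ) : exp (-(I * leftPhase 1 a n z))
      = -(per a (xAt n z) * exp (I * leftPhase 1 a n z)) := by
  have h : per a (xAt n z) = exp (2 * π * I * (rootN n * z + a)) := by
    rw [← per_sub_nat a _ n]; unfold xAt; congr 1; ring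
  have h2 := exp_pi_mul_I.symm
  rw [h, ← exp_add, neg_eq_neg_one_mul (exp _), h2, ← exp_add]
  congr 1
  unfold leftPhase
  push_cast
  ring

theorem im_sub_mem_of_hasDerivAt {F F' : ℂ → ℂ} {A B : ℝ} (hz : 0 ≤ z.im)
    (hF : ∀ t : ℝ, 0 ≤ t → t ≤ z.im → HasDerivAt F (F' (z.re + t * I)) (z.re + t * I) ∧
      A ≤ (F' (z.re + t * I)).re ∧ (F' (z.re + t * I)).re ≤ B) :
    A * z.im ≤ (F z).im - (F z.re).im ∧ (F z).im - (F z.re).im ≤ B * z.im := by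
  have hd : ∀ t ∈ Set.Icc 0 z.im, HasDerivAt (fun t : ℝ => (F (z.re + t * I)).im) (F' (z.re + t * I)).re t := by
    intro t ht
    have h1 : HasDerivAt (fun t : ℝ => (z.re : ℂ) + t * I) (1 * I) t :=
      ((ofRealCLM.hasDerivAt (x := t)).mul_const I).const_add _
    have h2 := (hF t ht.1 ht.2).1.comp t h1
    have h3 := (imCLM.hasFDerivAt (x := F (z.re + t * I))).comp_hasDerivAt t h2
    refine h3.congr_deriv ?_
    simp
  have hc : ContinuousOn (fun t : ℝ => (F (z.re + t * I)).im) (Set.Icc 0 z.im) :=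
    fun t ht => (hd t ht).continuousAt.continuousWithinAt
  have hd' : ∀ t ∈ interior (Set.Icc 0 z.im), HasDerivAt (fun t : ℝ => (F (z.re + t * I)).im)
      (F' (z.re + t * I)).re t := fun t ht => hd t (interior_subset ht)
  have hdo : DifferentiableOn ℝ (fun t : ℝ => (F (z.re + t * I)).im) (interior (Set.Icc 0 z.im)) :=
    fun t ht => (hd' t ht).differentiableAt.differentiableWithinAt
  have e1 : (z.re : ℂ) + (z.im : ℝ) * I = z := re_add_im z
  have e0 : (z.re : ℂ) + ((0 : ℝ) : ℂ) * I = z.re := by simp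
  have hu := (convex_Icc (0 : ℝ) z.im).image_sub_le_mul_sub_of_deriv_le hc hdo (C := B) (fun t ht => by
      rw [(hd' t ht).deriv]
      exact (hF t (interior_subset ht).1 (interior_subset ht).2).2.2)
    0 ⟨le_rfl, hz⟩ z.im ⟨hz, le_rfl⟩ hz
  have hl := (convex_Icc (0 : ℝ) z.im).mul_sub_le_image_sub_of_le_deriv hc hdo (C := A) (fun t ht => by
      rw [(hd' t ht).deriv]
      exact (hF t (interior_subset ht).1 (interior_subset ht).2).2.1)
    0 ⟨le_rfl, hz⟩ z.im ⟨hz, le_rfl⟩ hz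
  simp only [e1, e0, sub_zero] at hu hl
  exact ⟨hl, hu⟩

theorem one_sub_sq_re (w : ℂ) : (1 - w ^ 2).re = 1 - w.re ^ 2 + w.im ^ 2 := by rw [pow_two]; simp; ring

theorem abs_im_lt_csqrt_re (hw : |w.re| < 1) : |w.im| < (sqrt (1 - w ^ 2)).re ∧
    1 - w.re ^ 2 ≤ ((sqrt (1 - w ^ 2)).re - |w.im|) * ((sqrt (1 - w ^ 2)).re + |w.im|) := by
  have h1 := one_sub_sq_re w
  have h2 : (1 - w ^ 2).re = (sqrt (1 - w ^ 2)).re ^ 2 - (sqrt (1 - w ^ 2)).im ^ 2 := by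
    conv_lhs => rw [← csqrt_sq (1 - w ^ 2), pow_two, mul_re]
    ring
  have h3 := csqrt_re_nonneg (1 - w ^ 2)
  have h4 : w.re ^ 2 < 1 := by rw [← sq_abs]; nlinarith [abs_nonneg w.re]
  have h5 := sq_nonneg (sqrt (1 - w ^ 2)).im
  refine ⟨abs_lt_of_sq_lt_sq (by nlinarith) h3, ?_⟩
  nlinarith [sq_abs w.im]

theorem xi_im_pos (hw : |w.re| < 1) : 0 < (w + I * sqrt (1 - w ^ 2)).im := by
  have := (abs_lt.mp (abs_im_lt_csqrt_re hw).1).1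
  simp
  linarith

theorem slit_one_sub_sq (hw : |w.re| < 1) : 1 - w ^ 2 ∈ slitPlane := by
  left
  rw [one_sub_sq_re]
  have h4 : w.re ^ 2 < 1 := by rw [← sq_abs]; nlinarith [abs_nonneg w.re]
  nlinarith [sq_nonneg w.im]

theorem hasDerivAt_csqrt {f : ℂ → ℂ} {f' : ℂ} (hf : HasDerivAt f f' z) (h : f z ∈ slitPlane) :
    HasDerivAt (fun z => sqrt (f z)) (f' / (2 * sqrt (f z))) z := by
  have hd : DifferentiableAt ℂ (fun z => sqrt (f z)) z := (differentiableAt_sqrt h).comp z hf.differentiableAt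
  have h0 := csqrt_ne_zero (slitPlane_ne_zero h)
  have h1 := hd.hasDerivAt.pow 2
  have h2 : HasDerivAt (fun z => sqrt (f z) ^ 2) f' z := by simpa only [csqrt_sq] using hf
  have h3 := h1.unique h2
  refine hd.hasDerivAt.congr_deriv ?_
  rw [eq_div_iff (by simpa using h0), ← h3]
  push_cast
  ring

theorem hasDerivAt_carccos (hw : |w.re| < 1) : HasDerivAt carccos (-1 / sqrt (1 - w ^ 2)) w := by
  have hs := slit_one_sub_sq hw
  have h0 := csqrt_ne_zero (slitPlane_ne_zero hs)
  have h1 : HasDerivAt (fun w : ℂ => 1 - w ^ 2) (-(2 * w)) w := by simpa using ((hasDerivAt_id w).pow 2).const_sub 1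
  have h2 := hasDerivAt_csqrt h1 hs
  have hξ := xi_im_pos hw
  have hξ0 : w + I * sqrt (1 - w ^ 2) ≠ 0 := by intro h; rw [h] at hξ; simp at hξ
  have h3 := (((hasDerivAt_id w).add (h2.const_mul I)).clog (Or.inr hξ.ne')).const_mul (-I)
  refine h3.congr_deriv ?_
  change _ * (_ / (w + I * sqrt (1 - w ^ 2))) = _
  field_simp
  linear_combination w * I_sq

theorem exists_carccos_re_mem {κ : ℝ} (hκ : 0 < κ) (B : ℝ) (hB : 0 ≤ B) :
    ∃ c > 0, ∀ w : ℂ, |w.re| ≤ 1 - κ → |w.im| ≤ B → c ≤ (carccos w).re ∧ (carccos w).re ≤ π - c := by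
  refine ⟨κ / ((2 + B ^ 2 + B) * (3 + B + B ^ 2)), by positivity, fun w hw hwi => ?_⟩
  obtain ⟨h1, h2⟩ := abs_im_lt_csqrt_re (w := w) (by linarith)
  have hξ := xi_im_pos (w := w) (by linarith)
  set s := sqrt (1 - w ^ 2)
  set ξ := w + I * s with hξdef
  have hw0 := abs_nonneg w.re
  have hwi0 := abs_nonneg w.im
  have hwn : ‖w‖ ^ 2 ≤ 1 + B ^ 2 := by
    rw [← normSq_eq_norm_sq, normSq_apply, ← abs_mul_abs_self w.re, ← abs_mul_abs_self w.im]
    nlinarith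
  have hsn : ‖s‖ ≤ 2 + B ^ 2 := by
    have h3 : ‖s‖ ^ 2 ≤ 1 + ‖w‖ ^ 2 := by
      rw [← norm_pow, csqrt_sq, ← norm_pow, ← norm_one (α := ℂ)]
      exact norm_sub_le (1 : ℂ) (w ^ 2)
    nlinarith [norm_nonneg s]
  have hξn : ‖ξ‖ ≤ 3 + B + B ^ 2 := by
    have h3 : ‖w‖ ≤ 1 + B := by nlinarith [norm_nonneg w]
    have h4 := norm_add_le w (I * s)
    rw [norm_mul, norm_I, one_mul] at h4
    linarith
  have hsre := re_le_norm s
  have him : κ ≤ ξ.im * (2 + B ^ 2 + B) := by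
    have e : ξ.im = w.im + s.re := by simp [hξdef]
    have h3 : κ ≤ 1 - w.re ^ 2 := by rw [← sq_abs]; nlinarith
    have h4 : s.re - |w.im| ≤ ξ.im := by rw [e]; linarith [neg_abs_le w.im]
    have h5 : (s.re - |w.im|) * (s.re + |w.im|) ≤ ξ.im * (2 + B ^ 2 + B) :=
      mul_le_mul h4 (by linarith) (by linarith) hξ.le
    linarith
  have hre : (carccos w).re = arg ξ := by unfold carccos; simp [log_im]; rfl
  have hn0 : 0 < ‖ξ‖ := lt_of_lt_of_le (abs_pos.mpr hξ.ne') (abs_im_le_norm ξ)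
  have hsin : κ / ((2 + B ^ 2 + B) * (3 + B + B ^ 2)) ≤ Real.sin (arg ξ) := by
    rw [sin_arg, div_le_div_iff₀ (by positivity) hn0]
    calc κ * ‖ξ‖ ≤ ξ.im * (2 + B ^ 2 + B) * (3 + B + B ^ 2) :=
          mul_le_mul him hξn hn0.le (by positivity)
      _ = _ := by ring
  have harg : 0 < arg ξ ∧ arg ξ ≤ π := ⟨lt_of_le_of_ne (arg_nonneg_iff.mpr hξ.le) (by
      intro h; rw [← h, Real.sin_zero] at hsin
      have : 0 < κ / ((2 + B ^ 2 + B) * (3 + B + B ^ 2)) := by positivity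
      linarith), arg_le_pi ξ⟩
  rw [hre]
  have h6 := sin_le harg.1.le
  have h7 := sin_le (sub_nonneg.mpr harg.2)
  rw [Real.sin_pi_sub] at h7
  constructor <;> linarith

theorem csqrt_conj (hw : w ∈ slitPlane) : sqrt (conj w) = conj (sqrt w) := by
  have h0 := slitPlane_ne_zero hw
  rw [csqrt_eq_exp h0, csqrt_eq_exp (by simpa using h0), log_conj _ (slitPlane_arg_ne_pi hw),
    ← exp_conj, map_div₀, map_ofNat]

theorem div_mem_slitPlane {u v : ℂ} (hu : 0 < u.re) (hv : 0 < v.re) : u / v ∈ slitPlane := by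
  have hv0 : v ≠ 0 := by rintro rfl; simp at hv
  by_contra h
  rw [mem_slitPlane_iff] at h
  push Not at h
  have e : u = ((u / v).re : ℂ) * v := by
    conv_lhs => rw [← div_mul_cancel₀ u hv0, ← re_add_im (u / v), h.2]
    simp
  rw [e, re_ofReal_mul] at hu
  nlinarith [h.1]

theorem carccos_conj (hw : |w.re| < 1) : carccos (conj w) = conj (carccos w) := by
  have h1 : (1 - w ^ 2).re > 0 := by
    rw [one_sub_sq_re]
    have h4 : w.re ^ 2 < 1 := by rw [← sq_abs]; nlinarith [abs_nonneg w.re]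
    nlinarith [sq_nonneg w.im]
  have hξ := xi_im_pos hw
  have e1 : sqrt (1 - (conj w) ^ 2) = conj (sqrt (1 - w ^ 2)) := by rw [← csqrt_conj (Or.inl h1)]; simp
  have hξ0 : w + I * sqrt (1 - w ^ 2) ≠ 0 := by intro h; rw [h] at hξ; simp at hξ
  have harg : (w + I * sqrt (1 - w ^ 2)).arg ≠ π := by intro h; rw [arg_eq_pi_iff] at h; exact hξ.ne' h.2
  have e2 : conj w + I * conj (sqrt (1 - w ^ 2)) = (conj (w + I * sqrt (1 - w ^ 2)))⁻¹ := by
    refine eq_inv_of_mul_eq_one_left ?_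
    simp only [map_add, map_mul, conj_I]
    have := congrArg conj (csqrt_sq (1 - w ^ 2))
    simp only [map_pow, map_sub, map_one] at this
    linear_combination this - conj (sqrt (1 - w ^ 2)) ^ 2 * I_sq
  unfold carccos
  rw [e1, e2, ← map_inv₀, log_conj _ (by rw [arg_inv, if_neg harg]; intro h; linarith [neg_pi_lt_arg (w + I * sqrt (1 - w ^ 2))]),
    log_inv _ harg]
  simp

theorem rootA_ne_zero (ha : 0 < a) : rootA a ≠ 0 := by
  intro h; have := rootA_sq ha.le; rw [h] at this; simp at this; exact ha.ne (by exact_mod_cast this)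

theorem div_two_rootA (a : ℝ) (z : ℂ) : z / (2 * rootA a) = z / ((2 * √a : ℝ) : ℂ) := by unfold rootA; push_cast; rfl

theorem abs_re_div_lt (ha : 0 < a) (hz : |z.re| < 2 * √a) : |(z / (2 * rootA a)).re| < 1 := by
  have : 0 < 2 * √a := by positivity
  rw [div_two_rootA, div_ofReal_re, abs_div, abs_of_pos this, div_lt_one this]
  exact hz

theorem four_mul_sub_sq_re_pos (ha : 0 < a) (hz : |z.re| < 2 * √a) : 0 < (4 * a - z ^ 2 : ℂ).re := by
  have e : (4 * a - z ^ 2 : ℂ).re = 4 * a - z.re ^ 2 + z.im ^ 2 := by rw [pow_two]; simp; ring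
  have h := sq_sqrt ha.le
  have : z.re ^ 2 < 4 * a := by rw [← sq_abs]; nlinarith [abs_nonneg z.re]
  rw [e]; nlinarith [sq_nonneg z.im]

theorem midPhase_one (a : ℝ) (n : ℕ) (z : ℂ) : midPhase 1 a n z = (-a - rootN n * z) * carccos (z / (2 * rootA a))
    - π / 4 + (z + 4 * rootN n) * sqrt (4 * a - z ^ 2) / 4 := by
  unfold midPhase
  simp only [ofReal_one, one_pow, mul_one, div_one]
  rw [mul_add, ← pow_two, rootN_sq]; ring

theorem hasDerivAt_midPhase (ha : 0 < a) (hz : |z.re| < 2 * √a) :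
    HasDerivAt (midPhase 1 a n) (-rootN n * carccos (z / (2 * rootA a)) + sqrt (4 * a - z ^ 2) / 2) z := by
  have hA := (hasDerivAt_carccos (abs_re_div_lt ha hz)).comp z ((hasDerivAt_id z).div_const (2 * rootA a))
  have h1 : HasDerivAt (fun z : ℂ => 4 * a - z ^ 2) (-(2 * z)) z := by
    simpa using ((hasDerivAt_id z).pow 2).const_sub (4 * a : ℂ)
  have hsl : (4 * a - z ^ 2 : ℂ) ∈ slitPlane := Or.inl (four_mul_sub_sq_re_pos ha hz)
  have hq := hasDerivAt_csqrt h1 hsl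
  have hq0 := csqrt_ne_zero (slitPlane_ne_zero hsl)
  have e : midPhase 1 a n = fun z => (-a - rootN n * z) * carccos (z / (2 * rootA a))
    - π / 4 + (z + 4 * rootN n) * sqrt (4 * a - z ^ 2) / 4 := funext (midPhase_one a n)
  have h2 : HasDerivAt (fun z : ℂ => -(a : ℂ) - rootN n * z) (-rootN n) z := by
    simpa using ((hasDerivAt_id z).const_mul (rootN n)).const_sub (-(a : ℂ))
  have h3 : HasDerivAt (fun z : ℂ => z + 4 * rootN n) 1 z := (hasDerivAt_id z).add_const _
  rw [e]
  refine (((h2.mul hA).sub_const (π / 4 : ℂ)).add ((h3.mul hq).div_const 4)).congr_deriv ?_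
  have hs := csqrt_one_sub_sq ha z
  have hA0 := rootA_ne_zero ha
  have hs0 : sqrt (1 - (z / (2 * rootA a)) ^ 2) ≠ 0 := by intro h; rw [h, mul_zero] at hs; exact hq0 hs.symm
  have hinv : -1 / sqrt (1 - (z / (2 * rootA a)) ^ 2) * (1 / (2 * rootA a))
      = -1 / sqrt (4 * a - z ^ 2) := by rw [← hs]; field_simp
  have hqq := csqrt_sq (4 * a - z ^ 2)
  simp only [Function.comp_apply, id]
  rw [hinv]
  generalize sqrt (4 * (a : ℂ) - z ^ 2) = q at hqq hq0 ⊢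
  field_simp
  linear_combination (-2 : ℂ) * hqq

theorem midPhase_conj (ha : 0 < a) (hz : |z.re| < 2 * √a) : midPhase 1 a n (conj z) = conj (midPhase 1 a n z) := by
  have h1 := carccos_conj (abs_re_div_lt ha hz)
  have h2 := csqrt_conj (Or.inl (four_mul_sub_sq_re_pos ha hz))
  simp only [map_sub, map_mul, map_pow, map_ofNat, map_div₀, conj_ofReal] at h1 h2
  rw [midPhase_one, midPhase_one]
  simp only [map_sub, map_add, map_mul, map_neg, map_ofNat, map_div₀, rootN, rootA, conj_ofReal] at h1 h2 ⊢
  rw [h1, h2]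

theorem exists_midPhase_im (ha : 0 < a) {δ : ℝ} (hδ : 0 < δ) : ∃ c > 0, ∃ C > 0, ∀ (n : ℕ) (z : ℂ),
    |z.re| ≤ 2 * √a - δ → 0 ≤ z.im → z.im ≤ 1 →
      (c * √n - C) * z.im ≤ -(midPhase 1 a n z).im ∧
      (c * √n - C) * z.im ≤ (midPhase 1 a n z).im + π * √n * z.im := by
  have hsa : 0 < 2 * √a := by positivity
  obtain ⟨c, hc, H⟩ := exists_carccos_re_mem (κ := δ / (2 * √a)) (by positivity) (1 / (2 * √a)) (by positivity)
  refine ⟨c, hc, 1 + 4 * a + (2 * √a + 1) ^ 2, by positivity, fun n z hz hz0 hz1 => ?_⟩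
  set C := 1 + 4 * a + (2 * √a + 1) ^ 2 with hC
  have key := im_sub_mem_of_hasDerivAt (F := midPhase 1 a n)
    (F' := fun z => -rootN n * carccos (z / (2 * rootA a)) + sqrt (4 * a - z ^ 2) / 2)
    (A := -√n * (π - c) - C) (B := -√n * c + C) hz0 (fun t ht0 ht1 => by
      set y : ℂ := z.re + t * I with hy
      have hyre : y.re = z.re := by simp [hy]
      have hyim : y.im = t := by simp [hy]
      have hyr : |y.re| ≤ 2 * √a - δ := by rw [hyre]; exact hz
      refine ⟨hasDerivAt_midPhase ha (by linarith), ?_⟩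
      have h1 := H (y / (2 * rootA a)) (by
          rw [div_two_rootA, div_ofReal_re, abs_div, abs_of_pos hsa, div_le_iff₀ hsa, sub_mul,
            div_mul_cancel₀ _ hsa.ne']; linarith) (by
          rw [div_two_rootA, div_ofReal_im, abs_div, abs_of_pos hsa, hyim, abs_of_nonneg ht0]
          gcongr; linarith)
      have h2 : |(sqrt (4 * a - y ^ 2)).re| ≤ C := by
        refine (abs_re_le_norm _).trans ?_
        have h3 : ‖sqrt (4 * a - y ^ 2)‖ ^ 2 ≤ 4 * a + ‖y‖ ^ 2 := by
          rw [← norm_pow, csqrt_sq]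
          refine (norm_sub_le _ _).trans (le_of_eq ?_)
          rw [norm_pow, norm_mul, norm_real, norm_of_nonneg ha.le]; norm_num
        have h4 : ‖y‖ ≤ 2 * √a + 1 := by
          have := norm_le_abs_re_add_abs_im y
          rw [hyim, abs_of_nonneg ht0] at this
          linarith
        have h5 : ‖y‖ ^ 2 ≤ (2 * √a + 1) ^ 2 := by gcongr
        nlinarith [norm_nonneg (sqrt (4 * a - y ^ 2))]
      obtain ⟨h3, h4⟩ := abs_le.mp h2
      have hC0 : 0 < C := by positivity
      have e : (-rootN n * carccos (y / (2 * rootA a)) + sqrt (4 * a - y ^ 2) / 2).re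
          = -√n * (carccos (y / (2 * rootA a))).re + (sqrt (4 * a - y ^ 2)).re / 2 := by
        unfold rootN
        rw [add_re, ← ofReal_neg, re_ofReal_mul]
        simp
      simp only [e]
      have hsn := sqrt_nonneg n
      constructor <;> nlinarith)
  have h0 : (midPhase 1 a n (z.re : ℂ)).im = 0 := by
    have := midPhase_conj (n := n) ha (z := (z.re : ℂ)) (by rw [ofReal_re]; linarith)
    rw [conj_ofReal] at this
    exact conj_eq_iff_im.mp this.symm
  rw [h0, sub_zero] at key
  constructor <;> nlinarith [key.1, key.2]

/-- The logarithm of the amplitude, up to the square root. -/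
def midExp (a : ℝ) (n : ℕ) (z : ℂ) : ℂ :=
  n * Real.log n - n + (n - (xAt n z + a)) * (((Real.log a - Real.log n) / 2 : ℝ) : ℂ)
    + (xAt n z + a) * log (1 + z / rootN n) + (2 * a - z ^ 2 - 4 * rootN n * z) / 4

theorem one_add_div_rootN (hn : 1 ≤ n) (z : ℂ) : 1 + z / rootN n = (rootN n + z) / rootN n :=
  one_add_div (rootN_ne_zero hn)

theorem one_add_div_re (hn : 1 ≤ n) (hz : -√n < z.re) : 0 < (1 + z / rootN n).re := by
  have hs : 0 < √n := sqrt_pos.mpr (by exact_mod_cast hn)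
  unfold rootN
  rw [add_re, div_ofReal_re, one_re, ← sub_lt_iff_lt_add', zero_sub, lt_div_iff₀ hs]
  linarith

theorem midAmp_eq (ha : 0 < a) (hn : 1 ≤ n) (hz : -√n < z.re) : midAmp 1 a n z = exp (midExp a n z)
      * sqrt ((rootN n + z) / sqrt (4 * a - z ^ 2)) := by
  obtain ⟨hA0, hAl⟩ := log_rootA_div_rootN ha hn
  have hU0 : 1 + z / rootN n ≠ 0 := by intro h; have := one_add_div_re hn hz; rw [h] at this; simp at this
  unfold midAmp midExp
  simp only [ofReal_one, one_pow, mul_one, div_one]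
  rw [natCast_div_exp_pow hn, cpow_eq_exp hA0, cpow_eq_exp hU0, hAl, mul_add, ← pow_two, rootN_sq]
  rw [mul_right_comm, ← exp_add, ← exp_add, ← exp_add]
  unfold xAt
  congr 2
  ring

theorem conj_exp_mul_csqrt {P Y P' Y' : ℂ} (hY : Y ∈ slitPlane) (hP : P' = conj P) (hY' : Y' = conj Y) :
    exp P' * sqrt Y' = conj (exp P * sqrt Y) := by
  rw [hP, hY', csqrt_conj hY, exp_conj, map_mul]

theorem log_one_add_conj (hn : 1 ≤ n) (hz : -√n < z.re) :
    log (1 + conj z / rootN n) = conj (log (1 + z / rootN n)) := by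
  rw [← log_conj _ (slitPlane_arg_ne_pi (Or.inl (one_add_div_re hn hz)))]
  simp [rootN]

/-- The regularity properties of a pair of amplitude and phase on a set. -/
structure RegularPair (A θ : ℂ → ℂ) (z : ℂ) : Prop where
  ne_zero : A z ≠ 0
  differentiable : DifferentiableAt ℂ A z
  differentiable_phase : DifferentiableAt ℂ θ z
  amp_conj : A (conj z) = conj (A z)
  phase_conj : θ (conj z) = conj (θ z)

theorem re_add_pos (hz : -√n < z.re) : 0 < (rootN n + z).re := by simp [rootN]; linarith

theorem regularPair_of_eq {A θ P Q : ℂ → ℂ} (hz : -√n < z.re)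
    (hA : ∀ᶠ y in 𝓝 z, A y = exp (P y) * sqrt ((rootN n + y) / Q y))
    (hA' : A (conj z) = exp (P (conj z)) * sqrt ((rootN n + conj z) / Q (conj z)))
    (hP : DifferentiableAt ℂ P z) (hQ : DifferentiableAt ℂ Q z) (hq : 0 < (Q z).re)
    (hPc : P (conj z) = conj (P z)) (hQc : Q (conj z) = conj (Q z)) (hθ : DifferentiableAt ℂ θ z)
    (hθc : θ (conj z) = conj (θ z)) : RegularPair A θ z := by
  have hq0 : Q z ≠ 0 := by intro h; rw [h] at hq; simp at hq
  have hY := div_mem_slitPlane (re_add_pos hz) hq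
  refine ⟨?_, DifferentiableAt.congr_of_eventuallyEq ?_ hA, hθ, ?_, hθc⟩
  · rw [hA.self_of_nhds]
    exact mul_ne_zero (exp_ne_zero _) (csqrt_ne_zero (slitPlane_ne_zero hY))
  · exact (DifferentiableAt.cexp hP).mul (DifferentiableAt.comp z (differentiableAt_sqrt hY)
      (DifferentiableAt.div (c := fun z : ℂ => rootN n + z) (by fun_prop) hQ hq0))
  · rw [hA', hA.self_of_nhds]
    refine conj_exp_mul_csqrt hY hPc ?_
    rw [map_div₀, hQc]
    simp only [rootN, map_add, conj_ofReal]

theorem differentiableAt_midExp (hn : 1 ≤ n) (hz : -√n < z.re) : DifferentiableAt ℂ (midExp a n) z := by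
  have h3 : DifferentiableAt ℂ (fun z : ℂ => log (1 + z / rootN n)) z :=
    DifferentiableAt.clog (by fun_prop) (Or.inl (one_add_div_re hn hz))
  unfold midExp xAt
  fun_prop

theorem midExp_conj (hn : 1 ≤ n) (hz : -√n < z.re) : midExp a n (conj z) = conj (midExp a n z) := by
  unfold midExp xAt
  rw [log_one_add_conj hn hz]
  simp only [rootN, map_sub, map_add, map_mul, map_pow, map_div₀, map_ofNat, conj_ofReal, conj_natCast]

theorem regularPair_mid (ha : 0 < a) (hn : 1 ≤ n) (hz : -√n < z.re)
    (hz2 : |z.re| < 2 * √a) : RegularPair (midAmp 1 a n) (midPhase 1 a n) z := by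
  have hsl : (4 * a - z ^ 2 : ℂ) ∈ slitPlane := Or.inl (four_mul_sub_sq_re_pos ha hz2)
  refine regularPair_of_eq (P := midExp a n) (Q := fun z => sqrt (4 * a - z ^ 2)) hz
    ((continuous_re.continuousAt.eventually (lt_mem_nhds hz)).mono fun y hy => midAmp_eq ha hn hy)
    (midAmp_eq ha hn (by simpa using hz)) (differentiableAt_midExp hn hz)
    (DifferentiableAt.comp z (differentiableAt_sqrt hsl)
      (show DifferentiableAt ℂ (fun z : ℂ => 4 * (a : ℂ) - z ^ 2) z by fun_prop))
    (csqrt_re_pos_of_re_pos (four_mul_sub_sq_re_pos ha hz2)).1 (midExp_conj hn hz) ?_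
    (hasDerivAt_midPhase ha hz2).differentiableAt (midPhase_conj ha hz2)
  rw [← csqrt_conj hsl]
  simp only [map_sub, map_mul, map_pow, map_ofNat, conj_ofReal]

end

section

variable {ι : Type*} {δ a b : ℝ} {l : Filter ι} {T : ι → ℝ} {n : ι → ℕ} {z : ι → ℂ} {m : ℕ}

/-- The exponent of the quotient of the recessive term by its approximation. -/
def recRem (a b : ℝ) (n : ℕ) (z : ℂ) : ℂ :=
  rootN n * z + z ^ 2 / 2 - (xAt n z + a + 1 / 2 + b / a) * log (1 + z / rootN n)

theorem xAt_eq_mul {n : ℕ} (hn : 1 ≤ n) (z : ℂ) : xAt n z = n * (1 + z / rootN n) := by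
  have h0 := rootN_ne_zero hn
  unfold xAt
  rw [← rootN_sq]
  field_simp

theorem log_xAt {n : ℕ} (hn : 1 ≤ n) {z : ℂ} (hx : 0 < (xAt n z).re) :
    log (xAt n z) = Real.log n + log (1 + z / rootN n) := by
  have hn' : (0 : ℝ) < n := by exact_mod_cast hn
  rw [xAt_eq_mul hn] at hx ⊢
  have := log_ofReal_mul hn' (x := 1 + z / rootN n) (by intro h; rw [h] at hx; simp at hx)
  simpa using this

theorem xAt_re (n : ℕ) (z : ℂ) : (xAt n z).re = √n * (√n + z.re) := by
  unfold xAt rootN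
  rw [add_re, re_ofReal_mul, mul_add, mul_self_sqrt (Nat.cast_nonneg n)]
  simp

namespace Edge

variable (ha : 0 < a) (b : ℝ) (hm : 0 < m + 1 + b / a) (h : Edge δ l T n (fun i => xAt (n i) (z i)))
include h

include ha in
theorem tendsto_outer :
    Tendsto (fun i => piSeq a b (xAt (n i) (z i)) (n i) / outerApprox 1 a (n i) (z i)) l (𝓝 1) := by
  obtain ⟨K, hK, H⟩ := exists_norm_piAt_div_outerApprox_sub_one_le ha b
  rw [tendsto_iff_norm_sub_tendsto_zero]
  have h0 : Tendsto (fun i => K / T i ^ 15) l (𝓝 0) := (h.tendsto_pow (by norm_num)).const_div_atTop K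
  refine squeeze_zero' (Eventually.of_forall fun i => norm_nonneg _) ?_ h0
  filter_upwards [h.far a, h.one_le, h.sqrt_eq,
    (h.tendsto_pow (k := 15) (by norm_num)).eventually_ge_atTop K] with i h1 h2 h3 h4
  have hT : 0 < T i := by linarith
  have e : (1 / T i) ^ 5 * √(n i) = T i ^ 15 := by rw [h3]; field_simp
  have := H (1 / T i) (n i) (z i) (by positivity) ((div_le_one hT).mpr h2) (by rw [e]; exact h4) h1
  rwa [e, piAt_one] at this

theorem tendsto_recExp : Tendsto (fun i => recExp a b (xAt (n i) (z i)) (n i) - (recRem a b (n i) (z i)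
      + 2 * midExp a (n i) (z i) + log (1 + z i / rootN (n i)))) l (𝓝 0) := by
  have h1 := (tendsto_mul_log_one_add_div h.tendsto_norm a (a + 1 / 2 - b / a)).sub_const (a : ℂ)
  rw [sub_self] at h1
  refine h1.congr' ?_
  filter_upwards [h.tendsto_n.eventually_ge_atTop 1, h.tendsto_re.eventually_gt_atTop 0,
    (h.tendsto_re_add (a : ℂ)).eventually_gt_atTop 0] with i h2 h3 h4
  rw [log_one_add_div h3 h4, log_xAt h2 h3]
  unfold recExp recRem midExp
  push_cast
  have : xAt (n i) (z i) = n i + rootN (n i) * z i := rfl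
  rw [this]
  ring

/-- The ratio of the recessive solution, relative to its limit. -/
def relRatio (a b : ℝ) (x : ℂ) (n : ℕ) : ℂ := solM a b x n / solM a b x (n - 1) * lam a x n / (a * n)

include ha hm in
theorem norm_relRatio_sub_one_le : ∃ C : ℝ, 0 < C ∧ ∀ᶠ i in l,
      ‖relRatio a b (xAt (n i) (z i)) (n i) - 1‖ ≤ C * (1 + ‖z i‖) / T i ^ 18 := by
  obtain ⟨C, hC, hM⟩ := h.solM_last ha b hm
  obtain ⟨C', -, hR⟩ := h.roots_bounds ha
  have hsa := sqrt_nonneg a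
  refine ⟨C * (1 + √a) / a, by positivity, ?_⟩
  filter_upwards [hM, hR, h.one_le, h.sqrt_eq, h.cast_eq, h.le_im] with i h1 h2 h3 h4 h5 h6
  set x := xAt (n i) (z i) with hx
  have hT : 0 < T i := by linarith
  have hn0 : 0 < (n i : ℝ) := by rw [h5]; positivity
  have han : (a : ℂ) * n i ≠ 0 := mul_ne_zero (ofReal_ne_zero.mpr ha.ne') (mod_cast hn0.ne')
  have e : relRatio a b x (n i) - 1 = (solM a b x (n i) / solM a b x (n i - 1) - sig a x (n i))
      * lam a x (n i) / (a * n i) := by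
    unfold relRatio
    rw [sub_mul, sub_div, mul_comm (sig a x (n i)), h2.2.2.1, div_self han]
  have hv : x - (n i : ℝ) = rootN (n i) * z i := xAt_sub _ _
  have hN : ‖rootN (n i)‖ = T i ^ 20 := by rw [← h4]; exact Complex.norm_of_nonneg (sqrt_nonneg _)
  have hv0 : x - ((n i : ℝ) : ℂ) ≠ 0 := by
    intro h0
    have := congrArg im h0
    rw [sub_im, ofReal_im, zero_im] at this
    linarith [show 0 < T i ^ 19 by positivity]
  have hl : ‖lam a x (n i)‖ ≤ T i ^ 20 * (‖z i‖ + √a) := by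
    have h7 := norm_lam_mul_norm_sig ha.le hn0.le hv0
    have h8 : ‖sig a x (n i)‖ ≤ √(a * n i) :=
      Real.le_sqrt_of_sq_le (by nlinarith [norm_sig_le a x (n i), norm_nonneg (sig a x (n i))])
    have h9 := norm_le_norm_add_norm_sub' (lam a x (n i)) (x - (n i : ℝ))
    rw [show lam a x (n i) - (x - (n i : ℝ)) = -sig a x (n i) by rw [← lam_add_sig]; ring, norm_neg, hv,
      norm_mul, hN] at h9
    rw [sqrt_mul ha.le, h4] at h8
    linarith
  rw [e, norm_div, norm_mul, norm_mul, Complex.norm_of_nonneg ha.le, Complex.norm_natCast]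
  calc _ ≤ C * T i ^ 2 * (T i ^ 20 * (‖z i‖ + √a)) / (a * (n i : ℝ)) := by
        gcongr
        exact h1.2.2
    _ = C / a * (‖z i‖ + √a) / T i ^ 18 := by rw [h5]; field_simp
    _ ≤ _ := by
        rw [show C * (1 + √a) / a * (1 + ‖z i‖) = C / a * ((1 + √a) * (1 + ‖z i‖)) by ring]
        gcongr
        nlinarith [norm_nonneg (z i), mul_nonneg hsa (norm_nonneg (z i))]

theorem im_pos : ∀ᶠ i in l, 0 < (z i).im := by
  filter_upwards [h.le_im, h.one_le] with i h1 h2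
  have h3 : 0 < (xAt (n i) (z i)).im := lt_of_lt_of_le (by positivity) h1
  have : (xAt (n i) (z i)).im = √(n i) * (z i).im := by unfold xAt rootN; rw [add_im, im_ofReal_mul]; simp
  rw [this] at h3
  exact pos_of_mul_pos_right h3 (sqrt_nonneg _)

theorem neg_sqrt_lt : ∀ᶠ i in l, -√(n i) < (z i).re := by
  filter_upwards [h.tendsto_re.eventually_gt_atTop 0] with i h1
  rw [xAt_re] at h1
  linarith [pos_of_mul_pos_right h1 (sqrt_nonneg _)]

include ha hm in
theorem tendsto_recessive_amp : Tendsto (fun i => coefL a b m (xAt (n i) (z i)) * solM a b (xAt (n i) (z i)) (n i)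
      * piSeq a b (xAt (n i) (z i)) (n i) / (relRatio a b (xAt (n i) (z i)) (n i)
        * exp (recRem a b (n i) (z i)) * midAmp 1 a (n i) (z i) ^ 2)) l (𝓝 1) := by
  have h1 := ((h.tendsto_recessive ha b hm).mul (h.tendsto_recFactor ha b)).mul
    ((continuous_exp.tendsto 0).comp (h.tendsto_recExp (a := a) b))
  simp only [exp_zero, mul_one] at h1
  refine h1.congr' ?_
  obtain ⟨C, -, hM⟩ := h.solM_last ha b hm
  obtain ⟨C', -, hR⟩ := h.roots_bounds ha
  filter_upwards [hM, hR, h.tendsto_n.eventually_ge_atTop 1, h.im_pos, h.neg_sqrt_lt, h.one_le, h.offCut ha,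
    h.tendsto_re.eventually_gt_atTop 0, (h.tendsto_re_add (a + 1 : ℂ)).eventually_gt_atTop 0,
    (h.tendsto_re_add (a + b / a + 1 : ℂ)).eventually_gt_atTop 0,
    h.tendsto_n.eventually_ge_atTop (m + 1)]
    with i h1 h2 h3 h4 h5 h6 h7 h8 h9 h10 h11
  have hT : 0 < T i := by linarith
  set x := xAt (n i) (z i) with hx
  have hd0 : disc a x (n i) ≠ 0 := norm_pos_iff.mp (lt_of_lt_of_le (by positivity) h2.1)
  have hN0 := rootN_ne_zero h3
  have hn0 : (n i : ℂ) ≠ 0 := by rw [← rootN_sq]; exact pow_ne_zero 2 hN0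
  have ha0 := ofReal_ne_zero.mpr ha.ne'
  have hc0 : 0 < cutConst a := by unfold cutConst; positivity
  have hdisc : disc a x (n i) = rootN (n i) * rootOuter a (z i) :=
    disc_xAt ha (D := cutConst a / T i * √(a * n i)) (by positivity) (by simpa using h7 (n i) (Nat.cast_nonneg _))
  have hro := rootOuter_eq_I_mul ha h4
  have hU : 1 + z i / rootN (n i) ≠ 0 := by intro h0; have := one_add_div_re h3 h5; rw [h0] at this; simp at this
  set q := sqrt (4 * a - z i ^ 2) with hq
  have hq0 : q ≠ 0 := by intro h0; rw [hro, h0, mul_zero, mul_zero] at hdisc; exact hd0 hdisc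
  have hamp : midAmp 1 a (n i) (z i) ^ 2 = exp (2 * midExp a (n i) (z i)) * ((rootN (n i) + z i) / q) := by
    rw [midAmp_eq ha h3 h5, mul_pow, csqrt_sq, ← exp_nat_mul, Nat.cast_ofNat]
  have hΓ : Gamma (x + a + 1) ≠ 0 := by rw [add_assoc]; exact Gamma_ne_zero_of_re_pos h9
  have hkap : kap a b x (n i - 1) ≠ 0 := by
    refine kap_ne_zero ?_ ?_
    · have : (m : ℝ) ≤ ((n i - 1 : ℕ) : ℝ) := by exact_mod_cast (by omega)
      linarith
    · have e : (a : ℂ) + b / a + 1 = ((a + b / a + 1 : ℝ) : ℂ) := by push_cast; ring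
      rw [e, add_re, ofReal_re] at h10
      linarith
  have hNz : rootN (n i) + z i ≠ 0 := by intro h0; rw [one_add_div_rootN h3, h0, zero_div] at hU; exact hU rfl
  rw [hamp, Function.comp_apply, exp_sub, exp_add, exp_add, exp_log hU, one_add_div_rootN h3]
  unfold recFactor relRatio
  rw [hdisc, hro]
  have hI := I_ne_zero
  have e1 := exp_ne_zero (recExp a b x (n i))
  have e2 := exp_ne_zero (recRem a b (n i) (z i))
  have e3 := exp_ne_zero (2 * midExp a (n i) (z i))
  have hns := rootN_sq (n i)
  have hl0 := h2.2.2.2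
  have hM0 := h1.1
  have hM1 := h1.2.1
  field_simp
  rw [← hns]

end Edge

theorem xAt_im (n : ℕ) (z : ℂ) : (xAt n z).im = √n * z.im := by unfold xAt rootN; rw [add_im, im_ofReal_mul]; simp

theorem norm_per (a : ℝ) (x : ℂ) : ‖per a x‖ = rexp (-(2 * π * x.im)) := by
  unfold per
  rw [norm_exp]
  congr 1
  simp

/-- The exponentials whose sum is twice the cosine times the amplitude. -/
def wave (A θ : ℂ → ℂ) (z : ℂ) : ℂ := A z * exp (-(I * θ z))

theorem norm_rootN (n : ℕ) : ‖rootN n‖ = √n := Complex.norm_of_nonneg (sqrt_nonneg _)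

theorem tendsto_recRem (a b : ℝ) {B : ℝ} (hz : ∀ᶠ i in l, ‖z i‖ ≤ B) (hn : Tendsto n l atTop) :
    Tendsto (fun i => recRem a b (n i) (z i)) l (𝓝 0) := by
  have hN : Tendsto (fun i => √(n i)) l atTop := tendsto_sqrt_atTop.comp (tendsto_natCast_atTop_atTop.comp hn)
  set e : ℂ := a + 1 / 2 + b / a with he
  have hb : Tendsto (fun i => (B ^ 3 / 2 + ‖e‖ * (B + B ^ 2 / 2) + (1 + B + ‖e‖) * B ^ 3)
      / √(n i)) l (𝓝 0) := hN.const_div_atTop _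
  refine squeeze_zero_norm' ?_ hb
  filter_upwards [hz, hN.eventually_ge_atTop 1, hN.eventually_ge_atTop (2 * B),
    hn.eventually_ge_atTop 1] with i h1 h2 h3 h4
  set N := √(n i) with hNd
  have hN0 : 0 < N := by linarith
  have hr0 := rootN_ne_zero h4
  have hB := (norm_nonneg _).trans h1
  set u := z i / rootN (n i) with hu
  have hz' : z i = rootN (n i) * u := by rw [hu]; field_simp
  have hun : ‖u‖ ≤ B / N := by rw [hu, norm_div, norm_rootN]; gcongr
  have hu2 : ‖u‖ ≤ 1 / 2 := hun.trans (by rw [div_le_iff₀ hN0]; linarith)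
  obtain ⟨r, hr, hrn⟩ : ∃ r : ℂ, log (1 + u) = u - u ^ 2 / 2 + r ∧ ‖r‖ ≤ ‖u‖ ^ 3 :=
    ⟨log (1 + u) - (u - u ^ 2 / 2), by ring, (log_taylor_bounds hu2).2⟩
  have e1 : recRem a b (n i) (z i) = rootN (n i) ^ 2 * (u ^ 3 / 2) - e * (u - u ^ 2 / 2)
      - (rootN (n i) ^ 2 * (1 + u) + e) * r := by
    unfold recRem
    rw [hr, xAt_eq_mul h4, ← rootN_sq, ← hu, hz', he]
    ring
  have hBN := div_le_self hB h2
  rw [e1]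
  refine (norm_sub_le _ _).trans ((add_le_add (norm_sub_le _ _) le_rfl).trans ?_)
  simp only [norm_mul, norm_pow, norm_div, norm_rootN]
  have k1 : ‖u - u ^ 2 / 2‖ ≤ B / N + (B / N) * B / 2 := by
    refine (norm_sub_le _ _).trans ?_
    rw [norm_div (u ^ 2), norm_pow, show ‖(2 : ℂ)‖ = 2 by norm_num, pow_two]
    gcongr
    exact hun.trans hBN
  have k2 : ‖rootN (n i) ^ 2 * (1 + u) + e‖ ≤ N ^ 2 * (1 + B + ‖e‖) := by
    refine (norm_add_le _ _).trans ?_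
    rw [norm_mul, norm_pow, norm_rootN]
    have : ‖1 + u‖ ≤ 1 + B := (norm_add_le _ _).trans (by rw [norm_one]; linarith)
    have : 1 ≤ N ^ 2 := one_le_pow₀ h2
    nlinarith [norm_nonneg e]
  rw [show ‖(2 : ℂ)‖ = 2 by norm_num]
  calc N ^ 2 * (‖u‖ ^ 3 / 2) + ‖e‖ * ‖u - u ^ 2 / 2‖ + ‖rootN (n i) ^ 2 * (1 + u) + e‖ * ‖r‖
      ≤ N ^ 2 * ((B / N) ^ 3 / 2) + ‖e‖ * (B / N + (B / N) * B / 2) + N ^ 2 * (1 + B + ‖e‖) * (B / N) ^ 3 := by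
        gcongr
        exact hrn.trans (by gcongr)
    _ = _ := by field_simp

namespace Edge

variable (ha : 0 < a) (b : ℝ) (hm : 0 < m + 1 + b / a) (h : Edge δ l T n (fun i => xAt (n i) (z i)))
include h

include ha hm in
theorem tendsto_gTwo_mid {ρ : ℝ} (hρ : 0 < ρ) (hz : ∀ᶠ i in l, |(z i).re| ≤ 2 * √a - ρ)
    (hz1 : ∀ᶠ i in l, (z i).im ≤ 1) :
    Tendsto (fun i => gTwo a b m (xAt (n i) (z i)) (n i) / wave (midAmp 1 a (n i)) (midPhase 1 a (n i)) (z i)) l (𝓝 1)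
    ∧ Tendsto (fun i => rexp (2 * (midPhase 1 a (n i) (z i)).im)) l (𝓝 0) := by
  obtain ⟨c, hc, C, hC, H⟩ := exists_midPhase_im ha hρ
  have hlow : ∀ᶠ i in l, 0 < (z i).im ∧ c * T i ^ 19 - C ≤ (c * √(n i) - C) * (z i).im := by
    filter_upwards [h.im_pos, h.le_im, hz1] with i h1 h2 h3
    rw [xAt_im] at h2
    exact ⟨h1, by nlinarith⟩
  have hexp : Tendsto (fun i => rexp (-(2 * (c * T i ^ 19 - C)))) l (𝓝 0) := by
    refine Real.tendsto_exp_atBot.comp (tendsto_neg_atTop_atBot.comp (Tendsto.const_mul_atTop two_pos ?_))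
    exact tendsto_atTop_add_const_right _ _ ((h.tendsto_pow (by norm_num)).const_mul_atTop hc)
  have hB : ∀ᶠ i in l, ‖z i‖ ≤ 2 * √a + 1 := by
    filter_upwards [hz, hz1, h.im_pos] with i h1 h2 h3
    have := norm_le_abs_re_add_abs_im (z i)
    rw [abs_of_pos h3] at this
    linarith
  have hrel : Tendsto (fun i => relRatio a b (xAt (n i) (z i)) (n i)) l (𝓝 1) := by
    obtain ⟨C', hC', h1⟩ := h.norm_relRatio_sub_one_le ha b hm
    rw [tendsto_iff_norm_sub_tendsto_zero]
    refine squeeze_zero' (Eventually.of_forall fun i => norm_nonneg _) ?_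
      ((h.tendsto_pow (k := 18) (by norm_num)).const_div_atTop (C' * (1 + (2 * √a + 1))))
    filter_upwards [h1, hB, h.one_le] with i h2 h3 h4
    refine h2.trans ?_
    gcongr
  have hrec := (continuous_exp.tendsto 0).comp (tendsto_recRem a b hB h.tendsto_n)
  rw [exp_zero] at hrec
  have hπ := h.tendsto_outer ha b
  have hev : ∀ᶠ i in l, outerApprox 1 a (n i) (z i) = midAmp 1 a (n i) (z i) * exp (I * midPhase 1 a (n i) (z i))
      ∧ midAmp 1 a (n i) (z i) ≠ 0 := by
    filter_upwards [h.tendsto_n.eventually_ge_atTop 1, h.im_pos, h.tendsto_re.eventually_gt_atTop 0,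
      h.neg_sqrt_lt, hz] with i h1 h2 h3 h4 h5
    exact ⟨outerApprox_eq_mid ha h1 h2 h3, (regularPair_mid ha h1 h4 (by linarith)).ne_zero⟩
  have hpM : Tendsto (fun i => coefL a b m (xAt (n i) (z i)) * solM a b (xAt (n i) (z i)) (n i)
      / wave (midAmp 1 a (n i)) (midPhase 1 a (n i)) (z i)) l (𝓝 1) := by
    have h1 := (((h.tendsto_recessive_amp ha b hm).mul hrel).mul hrec).div hπ one_ne_zero
    simp only [mul_one, div_one] at h1
    refine h1.congr' ?_
    filter_upwards [hev, hrel.eventually_ne one_ne_zero, h.piSeq_ne_zero ha b] with i h2 h3 h4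
    have e1 := exp_ne_zero (recRem a b (n i) (z i))
    have e2 := exp_ne_zero (I * midPhase 1 a (n i) (z i))
    have e3 := h2.2
    simp only [Pi.div_apply, Function.comp_apply, wave]
    rw [h2.1, exp_neg]
    field_simp
  have hper : Tendsto (fun i => per a (xAt (n i) (z i)) * piSeq a b (xAt (n i) (z i)) (n i)
      / (coefL a b m (xAt (n i) (z i)) * solM a b (xAt (n i) (z i)) (n i))) l (𝓝 0) := by
    have h0 : Tendsto (fun i => per a (xAt (n i) (z i)) * exp (2 * I * midPhase 1 a (n i) (z i))) l (𝓝 0) := by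
      refine squeeze_zero_norm' ?_ hexp
      filter_upwards [hlow, hz, hz1] with i h1 h2 h3
      rw [norm_mul, norm_per, norm_exp, ← Real.exp_add, exp_le_exp, xAt_im]
      have := (H (n i) (z i) h2 h1.1.le h3).2
      have e : (2 * I * midPhase 1 a (n i) (z i)).re = -(2 * (midPhase 1 a (n i) (z i)).im) := by simp
      rw [e]
      linarith [h1.2]
    have h1 := (h0.mul hπ).div hpM one_ne_zero
    simp only [mul_one, div_one] at h1
    refine h1.congr' ?_
    filter_upwards [hev, hpM.eventually_ne one_ne_zero, h.piSeq_ne_zero ha b] with i h2 h3 h4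
    have e2 := exp_ne_zero (I * midPhase 1 a (n i) (z i))
    have e3 := h2.2
    simp only [Pi.div_apply, wave] at h3 ⊢
    have h5 : coefL a b m (xAt (n i) (z i)) * solM a b (xAt (n i) (z i)) (n i) ≠ 0 := by
      intro h6; rw [h6, zero_div] at h3; exact h3 rfl
    rw [h2.1, exp_neg, show 2 * I * midPhase 1 a (n i) (z i) = I * midPhase 1 a (n i) (z i)
      + I * midPhase 1 a (n i) (z i) by ring, exp_add]
    field_simp
  refine ⟨?_, ?_⟩
  · have h1 := (h.tendsto_gTwo_of_recessive ha b hm hper).mul hpM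
    rw [mul_one] at h1
    refine h1.congr' ?_
    filter_upwards [hpM.eventually_ne one_ne_zero] with i h3
    have h5 : coefL a b m (xAt (n i) (z i)) * solM a b (xAt (n i) (z i)) (n i) ≠ 0 := by
      intro h6; rw [h6, zero_div] at h3; exact h3 rfl
    exact div_mul_div_cancel₀ h5
  · refine squeeze_zero' (Eventually.of_forall fun i => (exp_pos _).le) ?_ hexp
    filter_upwards [hlow, hz, hz1] with i h1 h2 h3
    rw [exp_le_exp]
    linarith [(H (n i) (z i) h2 h1.1.le h3).1, h1.2]

end Edge

end

section

variable {a : ℝ} {n : ℕ} {z : ℂ}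

/-- The larger root of `w² + (z/√a) w + 1`. -/
def leftZ (a : ℝ) (z : ℂ) : ℂ := (-z + rootLeft a z) / (2 * rootA a)

/-- The difference of the exponents of the two amplitudes. -/
def leftW (a : ℝ) (n : ℕ) (z : ℂ) : ℂ := -(a + rootN n * z) * log (leftZ a z) - (z + 4 * rootN n) * rootLeft a z / 4

theorem rootLeft_args_pos (hz : z.re < -(2 * √a)) : 0 < (-z - 2 * rootA a).re ∧ 0 < (-z + 2 * rootA a).re := by
  have := sqrt_nonneg a
  constructor <;> simp [rootA] <;> linarith

theorem leftZ_re_pos (ha : 0 < a) (hz : z.re < -(2 * √a)) : 0 < (leftZ a z).re := by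
  have hsa : 0 < √a := sqrt_pos.mpr ha
  have h1 := rootLeft_re_pos hz
  unfold leftZ
  rw [div_two_rootA, div_ofReal_re, add_re, neg_re]
  exact div_pos (by linarith) (by positivity)

theorem hasDerivAt_rootLeft (hz : z.re < -(2 * √a)) : HasDerivAt (rootLeft a) (z / rootLeft a z) z := by
  obtain ⟨h1, h2⟩ := rootLeft_args_pos hz
  have d1 := hasDerivAt_csqrt (f := fun z => -z - 2 * rootA a) ((hasDerivAt_neg z).sub_const _) (Or.inl h1)
  have d2 := hasDerivAt_csqrt (f := fun z => -z + 2 * rootA a) ((hasDerivAt_neg z).add_const _) (Or.inl h2)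
  have n1 := csqrt_ne_zero (slitPlane_ne_zero (Or.inl h1))
  have n2 := csqrt_ne_zero (slitPlane_ne_zero (Or.inl h2))
  refine (d1.mul d2).congr_deriv ?_
  unfold rootLeft
  have e1 := csqrt_sq (-z - 2 * rootA a)
  have e2 := csqrt_sq (-z + 2 * rootA a)
  generalize sqrt (-z - 2 * rootA a) = s at *
  generalize sqrt (-z + 2 * rootA a) = t at *
  field_simp
  linear_combination -e1 - e2

theorem hasDerivAt_log_leftZ (ha : 0 < a) (hz : z.re < -(2 * √a)) :
    HasDerivAt (fun z => log (leftZ a z)) (-1 / rootLeft a z) z := by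
  have h := leftZ_re_pos ha hz
  have hq := rootLeft_re_pos hz
  have hq0 : rootLeft a z ≠ 0 := by intro h; rw [h] at hq; simp at hq
  have hA0 := rootA_ne_zero ha
  have hd : HasDerivAt (leftZ a) ((-1 + z / rootLeft a z) / (2 * rootA a)) z :=
    ((hasDerivAt_neg z).add (hasDerivAt_rootLeft hz)).div_const _
  refine (hd.clog (Or.inl h)).congr_deriv ?_
  have hZ : leftZ a z ≠ 0 := by intro h0; rw [h0] at h; simp at h
  unfold leftZ at hZ ⊢
  rw [div_ne_zero_iff] at hZ
  have := hZ.1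
  field_simp
  ring

theorem hasDerivAt_leftW (ha : 0 < a) (n : ℕ) (hz : z.re < -(2 * √a)) :
    HasDerivAt (leftW a n) (-rootN n * log (leftZ a z) - rootLeft a z / 2) z := by
  have hq := rootLeft_re_pos hz
  have hq0 : rootLeft a z ≠ 0 := by intro h; rw [h] at hq; simp at hq
  have h2 : HasDerivAt (fun z : ℂ => -((a : ℂ) + rootN n * z)) (-rootN n) z := by
    have := (((hasDerivAt_id z).const_mul (rootN n)).const_add (a : ℂ)).neg
    rwa [mul_one] at this
  have h3 : HasDerivAt (fun z : ℂ => z + 4 * rootN n) 1 z := (hasDerivAt_id z).add_const _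
  refine ((h2.mul (hasDerivAt_log_leftZ ha hz)).sub ((h3.mul (hasDerivAt_rootLeft hz)).div_const 4)).congr_deriv ?_
  have hsq := rootLeft_sq ha z
  generalize rootLeft a z = q at *
  field_simp
  linear_combination 2 * hsq

theorem rootLeft_conj (hz : z.re < -(2 * √a)) : rootLeft a (conj z) = conj (rootLeft a z) := by
  obtain ⟨h1, h2⟩ := rootLeft_args_pos hz
  unfold rootLeft
  rw [map_mul, ← csqrt_conj (Or.inl h1), ← csqrt_conj (Or.inl h2)]
  simp only [map_sub, map_add, map_neg, map_mul, map_ofNat, rootA, conj_ofReal]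

theorem leftW_conj (ha : 0 < a) (hz : z.re < -(2 * √a)) : leftW a n (conj z) = conj (leftW a n z) := by
  have e : leftZ a (conj z) = conj (leftZ a z) := by
    unfold leftZ
    rw [rootLeft_conj hz]
    simp only [map_add, map_neg, map_mul, map_div₀, map_ofNat, rootA, conj_ofReal]
  unfold leftW
  rw [e, log_conj _ (slitPlane_arg_ne_pi (Or.inl (leftZ_re_pos ha hz))), rootLeft_conj hz]
  simp only [map_sub, map_add, map_neg, map_mul, map_div₀, map_ofNat, rootN, conj_ofReal]

theorem leftAmp_eq (ha : 0 < a) (hn : 1 ≤ n) (hz : -√n < z.re) (hz2 : z.re < -(2 * √a)) :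
    leftAmp 1 a n z = exp (midExp a n z + leftW a n z) * sqrt ((rootN n + z) / rootLeft a z) := by
  have hr0 := rootN_ne_zero hn
  have hA0 := rootA_ne_zero ha
  have hZ := leftZ_re_pos ha hz2
  have hZ0 : leftZ a z ≠ 0 := by intro h; rw [h] at hZ; simp at hZ
  have hU0 : 1 + z / rootN n ≠ 0 := by intro h; have := one_add_div_re hn hz; rw [h] at this; simp at this
  obtain ⟨hB0, hBl⟩ := log_rootA_div_rootN ha hn
  have e1 : (-z + rootLeft a z) / (2 * rootN n) = (√a / √n : ℝ) * leftZ a z := by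
    unfold leftZ
    push_cast
    rw [show ((√a : ℝ) : ℂ) = rootA a from rfl, show ((√n : ℝ) : ℂ) = rootN n from rfl]
    field_simp
  have e2 : ((√a / √n : ℝ) : ℂ) = rootA a / rootN n := by unfold rootA rootN; push_cast; rfl
  have hr : 0 < √a / √n := div_pos (sqrt_pos.mpr ha) (sqrt_pos.mpr (by exact_mod_cast hn))
  have hlog : log ((-z + rootLeft a z) / (2 * rootN n))
      = (((Real.log a - Real.log n) / 2 : ℝ) : ℂ) + log (leftZ a z) := by
    rw [e1, log_ofReal_mul hr hZ0, ofReal_log hr.le, e2, hBl]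
  have hζ0 : (-z + rootLeft a z) / (2 * rootN n) ≠ 0 := by rw [e1, e2]; exact mul_ne_zero hB0 hZ0
  unfold leftAmp midExp leftW
  simp only [ofReal_one, one_pow, mul_one, div_one]
  rw [natCast_div_exp_pow hn, cpow_eq_exp hζ0, cpow_eq_exp hU0, hlog, mul_add (rootN n), ← pow_two, rootN_sq,
    mul_right_comm, ← exp_add, ← exp_add, ← exp_add]
  unfold xAt
  congr 2
  ring

theorem regularPair_left (ha : 0 < a) (hn : 1 ≤ n) (hz : -√n < z.re)
    (hz2 : z.re < -(2 * √a)) : RegularPair (leftAmp 1 a n) (leftPhase 1 a n) z := by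
  refine regularPair_of_eq (P := fun z => midExp a n z + leftW a n z) (Q := rootLeft a) hz ?_
    (leftAmp_eq ha hn (by simpa using hz) (by simpa using hz2))
    ((differentiableAt_midExp hn hz).add (hasDerivAt_leftW ha n hz2).differentiableAt)
    (hasDerivAt_rootLeft hz2).differentiableAt (rootLeft_re_pos hz2) ?_ (rootLeft_conj hz2) ?_ ?_
  · filter_upwards [continuous_re.continuousAt.eventually (lt_mem_nhds hz),
      continuous_re.continuousAt.eventually (gt_mem_nhds hz2)] with y h1 h2
    exact leftAmp_eq ha hn h1 h2
  · rw [midExp_conj hn hz, leftW_conj ha hz2, map_add]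
  · unfold leftPhase; fun_prop
  · unfold leftPhase
    simp only [map_sub, map_neg, map_mul, map_div₀, map_one, map_pow, map_ofNat, rootN, conj_ofReal]

/-- The exponent comparing the recessive term with the dominant one left of the interval. -/
def leftK (a : ℝ) (n : ℕ) (z : ℂ) : ℂ :=
  rootN n * z + z ^ 2 / 2 - (n + rootN n * z) * log (1 + z / rootN n) - 2 * leftW a n z

theorem hasDerivAt_leftK (ha : 0 < a) (hn : 1 ≤ n) (hz : -√n < z.re) (hz2 : z.re < -(2 * √a)) :
    HasDerivAt (leftK a n) (z - rootN n * log (1 + z / rootN n)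
      + 2 * rootN n * log (leftZ a z) + rootLeft a z) z := by
  have hr0 := rootN_ne_zero hn
  have hU := one_add_div_re hn hz
  have hU0 : 1 + z / rootN n ≠ 0 := by intro h; rw [h] at hU; simp at hU
  have h1 : HasDerivAt (fun z : ℂ => 1 + z / rootN n) (1 / rootN n) z := ((hasDerivAt_id z).div_const _).const_add _
  have h2 : HasDerivAt (fun z : ℂ => n + rootN n * z) (rootN n) z := by
    simpa using ((hasDerivAt_id z).const_mul (rootN n)).const_add (n : ℂ)
  have h3 : HasDerivAt (fun z : ℂ => rootN n * z + z ^ 2 / 2) (rootN n + z) z := by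
    refine (((hasDerivAt_id z).const_mul (rootN n)).add (((hasDerivAt_id z).pow 2).div_const 2)).congr_deriv ?_
    simp
  refine ((h3.sub (h2.mul (h1.clog (Or.inl hU)))).sub ((hasDerivAt_leftW ha n hz2).const_mul 2)).congr_deriv ?_
  have e : ((n : ℂ) + rootN n * z) * (1 / rootN n / (1 + z / rootN n)) = rootN n := by
    have hNz : rootN n + z ≠ 0 := by intro h; rw [one_add_div_rootN hn, h, zero_div] at hU0; exact hU0 rfl
    rw [← rootN_sq]; field_simp
  rw [e]
  ring

theorem mul_cosh_sub_sinh_le {v w : ℝ} (hv : 0 ≤ v) (hvw : v ≤ w) :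
    v * Real.cosh v - Real.sinh v ≤ w * Real.cosh w - Real.sinh w := by
  have hd : ∀ x : ℝ, HasDerivAt (fun x => x * Real.cosh x - Real.sinh x) (x * Real.sinh x) x := fun x => by
    refine (((hasDerivAt_id x).mul (Real.hasDerivAt_cosh x)).sub (Real.hasDerivAt_sinh x)).congr_deriv ?_
    simp
  refine monotoneOn_of_deriv_nonneg (convex_Ici 0) (fun x _ => (hd x).continuousAt.continuousWithinAt)
    (fun x _ => (hd x).differentiableAt.differentiableWithinAt) (fun x hx => ?_) (Set.mem_Ici.mpr hv)
    (Set.mem_Ici.mpr (hv.trans hvw)) hvw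
  rw [interior_Ici] at hx
  rw [(hd x).deriv]
  exact mul_nonneg (le_of_lt hx) (Real.sinh_nonneg_iff.mpr (le_of_lt hx))

theorem mul_cosh_sub_sinh_pos {v : ℝ} (hv : 0 < v) : 0 < v * Real.cosh v - Real.sinh v := by
  have h1 := Real.sinh_lt_cosh (v / 2)
  have h2 := Real.self_lt_sinh_iff.mpr (half_pos hv)
  have h3 := mul_cosh_sub_sinh_le (half_pos hv).le (half_le_self hv.le)
  have h4 := mul_cosh_sub_sinh_le le_rfl (half_pos hv).le
  simp at h4
  have e1 := Real.sinh_two_mul (v / 2)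
  have e2 := Real.cosh_sq (v / 2)
  have e3 := Real.cosh_two_mul (v / 2)
  rw [mul_div_cancel₀ v two_ne_zero] at e1 e3
  rw [e1, e3]
  have h5 := cosh_pos (v / 2)
  nlinarith [mul_pos (half_pos hv) (half_pos hv), mul_pos h5 (half_pos hv)]

theorem half_sq_sub_one_le_mul_log {y : ℝ} (hy : 0 < y) (hy1 : y ≤ 1) : (y ^ 2 - 1) / 2 ≤ y * Real.log y := by
  have h1 := self_le_sinh_iff.mpr (Left.nonneg_neg_iff.mpr (Real.log_nonpos hy.le hy1))
  rw [Real.sinh_neg, Real.sinh_log hy] at h1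
  have h2 := mul_le_mul_of_nonneg_left h1 hy.le
  have : y * -((y - y⁻¹) / 2) = (1 - y ^ 2) / 2 := by field_simp; ring
  linarith

theorem exists_leftW_real (ha : 0 < a) {ρ : ℝ} (hρ : 0 < ρ) : ∃ c > 0, ∀ (n : ℕ) (t : ℝ),
    t ≤ -(2 * √a) - ρ → c * √n ≤ (leftW a n t).re := by
  have hsa : 0 < √a := sqrt_pos.mpr ha
  have h0 : 1 < 1 + ρ / (2 * √a) := by linarith [div_pos hρ (mul_pos two_pos hsa)]
  have hv0 := Real.arcosh_pos h0
  set v0 := arcosh (1 + ρ / (2 * √a)) with hv0d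
  refine ⟨2 * √a * (v0 * Real.cosh v0 - Real.sinh v0), by
    have := mul_cosh_sub_sinh_pos hv0; positivity, fun n t ht => ?_⟩
  have hy0 : 1 + ρ / (2 * √a) ≤ -t / (2 * √a) := by rw [one_add_div (by positivity)]; gcongr; linarith
  set v := arcosh (-t / (2 * √a)) with hv
  have hc : Real.cosh v = -t / (2 * √a) := Real.cosh_arcosh (by linarith)
  have hvv : v0 ≤ v := (Real.arcosh_le_arcosh (by linarith) (by linarith)).mpr hy0
  have hvpos : 0 < v := by linarith
  have ht' : t = -(2 * √a * Real.cosh v) := by rw [hc]; field_simp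
  have hs := self_le_sinh_iff.mpr hvpos.le
  have hre : (t : ℂ).re < -(2 * √a) := by simp; linarith
  have hR : rootLeft a t = ((2 * √a * Real.sinh v : ℝ) : ℂ) := by
    have h1 := rootLeft_sq ha (t : ℂ)
    have h2 : (t : ℂ) ^ 2 - 4 * a = ((2 * √a * Real.sinh v : ℝ) : ℂ) ^ 2 := by
      rw [ht']
      norm_cast
      have := Real.cosh_sq v
      have h3 := sq_sqrt ha.le
      linear_combination 4 * √a ^ 2 * this + 4 * h3
    rcases sq_eq_sq_iff_eq_or_eq_neg.mp (h1.trans h2) with h | h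
    · exact h
    · have h3 := rootLeft_re_pos hre
      rw [h, neg_re, ofReal_re] at h3
      have : 0 < 2 * √a * Real.sinh v := by positivity
      linarith
  have hZ : log (leftZ a t) = (v : ℂ) := by
    have : leftZ a t = ((rexp v : ℝ) : ℂ) := by
      unfold leftZ
      rw [hR, div_two_rootA, ← Real.cosh_add_sinh, ht']
      norm_cast
      field_simp
    rw [this, ← ofReal_log (exp_pos v).le, Real.log_exp]
  have e : leftW a n t = ((2 * √a * √n * (v * Real.cosh v - Real.sinh v)
      + a * (Real.sinh v * Real.cosh v - v) : ℝ) : ℂ) := by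
    unfold leftW rootN
    rw [hZ, hR, ht']
    norm_cast
    have h3 := sq_sqrt ha.le
    linear_combination (Real.sinh v * Real.cosh v) * h3
  rw [e, ofReal_re]
  have h1 := mul_cosh_sub_sinh_le hv0.le hvv
  have h2 : 0 ≤ Real.sinh v * Real.cosh v - v := by nlinarith [Real.one_le_cosh v]
  have h3 : 0 ≤ √a * √n := by positivity
  nlinarith [mul_nonneg ha.le h2, mul_le_mul_of_nonneg_left h1 h3]

theorem exists_leftK_re_le (ha : 0 < a) {ρ : ℝ} (hρ : 0 < ρ) : ∃ c > 0, ∃ η > 0, η ≤ 1 ∧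
    ∀ (n : ℕ) (z : ℂ), 1 ≤ n → -√n < z.re → z.re ≤ -(2 * √a) - ρ → 0 ≤ z.im →
      z.im ≤ η → (leftK a n z).re ≤ -(c * √n) := by
  obtain ⟨c, hc, H⟩ := exists_leftW_real ha hρ
  have hsa := sqrt_nonneg a
  have hpi := pi_pos
  set C := 3 + 3 * π + 2 * √a with hC
  refine ⟨c, hc, min 1 (c / C), by positivity, min_le_left _ _, fun n z hn h1 h2 h3 h4 => ?_⟩
  have hN : 1 ≤ √n := one_le_sqrt.mpr (by exact_mod_cast hn)
  have key := (im_sub_mem_of_hasDerivAt (F := fun z => I * leftK a n z)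
    (F' := fun z => I * (z - rootN n * log (1 + z / rootN n)
      + 2 * rootN n * log (leftZ a z) + rootLeft a z)) (A := -(C * √n))
    (B := C * √n) h3 (fun t ht0 ht1 => by
      set y : ℂ := z.re + t * I with hy
      have hyre : y.re = z.re := by simp [hy]
      have hyim : y.im = t := by simp [hy]
      refine ⟨(hasDerivAt_leftK ha hn (by rw [hyre]; exact h1) (by rw [hyre]; linarith)).const_mul _, ?_⟩
      rw [← abs_le]
      have ht : |t| ≤ 1 := by rw [abs_of_nonneg ht0]; exact ht1.trans (h4.trans (min_le_left _ _))
      have hq : |(rootLeft a y).im| ≤ √n + 1 + 2 * √a := by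
        refine (abs_im_le_norm _).trans ?_
        have h5 : ‖y‖ ≤ √n + 1 := by
          have := norm_le_abs_re_add_abs_im y
          rw [hyim, hyre, abs_of_neg (by linarith : z.re < 0)] at this
          linarith
        have h6 : ‖rootLeft a y‖ ^ 2 ≤ (‖y‖ + 2 * √a) ^ 2 := by
          rw [← norm_pow, rootLeft_sq ha]
          refine (norm_sub_le _ _).trans ?_
          rw [norm_pow, norm_mul, Complex.norm_of_nonneg ha.le, show ‖(4 : ℂ)‖ = 4 by norm_num]
          nlinarith [sq_sqrt ha.le, norm_nonneg y, mul_nonneg (norm_nonneg y) hsa]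
        have := abs_le_of_sq_le_sq' h6 (by positivity)
        linarith [this.2]
      have e : (I * (y - rootN n * log (1 + y / rootN n) + 2 * rootN n * log (leftZ a y) + rootLeft a y)).re
          = -(t - √n * (1 + y / rootN n).arg + 2 * √n * (leftZ a y).arg + (rootLeft a y).im) := by
        have : 2 * rootN n = ((2 * √n : ℝ) : ℂ) := by unfold rootN; push_cast; rfl
        rw [I_mul_re, this, show rootN n * log (1 + y / rootN n)
          = (√n : ℝ) * log (1 + y / rootN n) from rfl, add_im, add_im,
          sub_im, im_ofReal_mul, im_ofReal_mul, log_im, log_im, hyim]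
      simp only [e, abs_neg]
      have a1 := abs_arg_le_pi (1 + y / rootN n)
      have a2 := abs_arg_le_pi (leftZ a y)
      rw [abs_le] at a1 a2 ht hq ⊢
      rw [hC]
      constructor <;> nlinarith)).2
  simp only [I_mul_im] at key
  have hreal : (leftK a n (z.re : ℂ)).re ≤ -(2 * (c * √n)) := by
    have hr0 := rootN_ne_zero hn
    have hU : 0 < 1 + z.re / √n := by rw [← neg_lt_iff_pos_add', lt_div_iff₀ (by linarith)]; linarith
    have h5 := half_sq_sub_one_le_mul_log hU (by
      have : z.re / √n ≤ 0 := div_nonpos_of_nonpos_of_nonneg (by linarith) (by linarith)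
      linarith)
    have e : leftK a n (z.re : ℂ) = ((n * (((1 + z.re / √n) ^ 2 - 1) / 2 - (1 + z.re / √n)
        * Real.log (1 + z.re / √n)) : ℝ) : ℂ) - 2 * leftW a n z.re := by
      unfold leftK
      congr 1
      push_cast
      rw [ofReal_log hU.le]
      push_cast
      rw [show ((√n : ℝ) : ℂ) = rootN n from rfl, ← rootN_sq]
      field_simp
      ring
    rw [e, sub_re, ofReal_re]
    have h6 := H n z.re h2
    have h7 : (2 * leftW a n z.re).re = 2 * (leftW a n z.re).re := by simp
    rw [h7]
    have : (n : ℝ) * (((1 + z.re / √n) ^ 2 - 1) / 2 - (1 + z.re / √n) * Real.log (1 + z.re / √n)) ≤ 0 :=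
      mul_nonpos_of_nonneg_of_nonpos (Nat.cast_nonneg n) (by linarith)
    linarith
  have h8 : C * √n * z.im ≤ c * √n := by
    have hCp : 0 < C := by positivity
    have : z.im ≤ c / C := h4.trans (min_le_right _ _)
    calc C * √n * z.im ≤ C * √n * (c / C) := by gcongr
      _ = _ := by field_simp
  linarith

end

section

variable {ι : Type*} {δ a b : ℝ} {l : Filter ι} {T : ι → ℝ} {n : ι → ℕ} {z : ι → ℂ} {m : ℕ}

theorem tendsto_sq_mul_exp (hT : Tendsto T l atTop) {c : ℝ} (hc : 0 < c) {c' : ℝ} (hc' : 0 ≤ c') (C : ℝ) :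
    Tendsto (fun i => C * T i ^ 2 * rexp (-(c * T i ^ 20) + c' * (3 + 21 * T i))) l (𝓝 0) := by
  have h0 : Tendsto (fun i => |C| * rexp (-T i)) l (𝓝 0) := by
    simpa using (tendsto_exp_neg_atTop_nhds_zero.comp hT).const_mul |C|
  refine squeeze_zero_norm' ?_ h0
  filter_upwards [hT.eventually_ge_atTop 1, hT.eventually_ge_atTop ((24 * c' + 3) / c)] with i h1 h2
  rw [norm_mul, norm_mul, norm_eq_abs, norm_pow, norm_of_nonneg (exp_pos _).le,
    norm_of_nonneg (by linarith), mul_assoc]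
  gcongr
  have h3 : T i ^ 2 ≤ rexp (2 * T i) := by
    rw [two_mul, Real.exp_add, pow_two]
    have := add_one_le_exp (T i)
    gcongr <;> linarith
  have h4 : T i ^ 2 ≤ T i ^ 20 := pow_le_pow_right₀ h1 (by norm_num)
  rw [div_le_iff₀ hc] at h2
  calc _ ≤ rexp (2 * T i) * rexp (-(c * T i ^ 20) + c' * (3 + 21 * T i)) := by gcongr
    _ ≤ _ := by
      rw [← Real.exp_add, exp_le_exp]
      nlinarith [mul_le_mul_of_nonneg_left h4 hc.le]

namespace Edge

variable (ha : 0 < a) (b : ℝ) (hm : 0 < m + 1 + b / a) (h : Edge δ l T n (fun i => xAt (n i) (z i)))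
include h

theorem abs_log_le : ∀ᶠ i in l, |(log (1 + z i / rootN (n i))).re| ≤ 3 + 21 * T i := by
  filter_upwards [h.norm_le, h.le_norm, h.one_le, h.cast_eq, h.tendsto_n.eventually_ge_atTop 1] with i h1 h2 h3 h4 h5
  have hT : 0 < T i := by linarith
  rw [xAt_eq_mul h5, norm_mul, Complex.norm_natCast, h4] at h1 h2
  set r := ‖1 + z i / rootN (n i)‖
  have hr1 : r ≤ 3 := by
    rw [mul_comm] at h1
    exact le_of_mul_le_mul_right h1 (by positivity)
  have hr2 : (T i ^ 21)⁻¹ ≤ r := by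
    rw [inv_le_iff_one_le_mul₀ (by positivity)]
    have : T i ^ 40 * r = T i ^ 19 * (T i ^ 21 * r) := by ring
    rw [this] at h2
    have h6 : 0 < T i ^ 19 := by positivity
    rw [mul_comm]
    exact le_of_mul_le_mul_left (by linarith) h6
  have hr0 : 0 < r := lt_of_lt_of_le (by positivity) hr2
  rw [log_re, abs_le]
  have hl := log_le_sub_one_of_pos hT
  constructor
  · have := Real.log_le_log (by positivity) hr2
    rw [Real.log_inv, Real.log_pow] at this
    push_cast at this
    linarith
  · have := log_le_sub_one_of_pos hr0
    linarith

include ha hm in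
theorem tendsto_gTwo_left {ρ c : ℝ} (hρ : 0 < ρ) (hc : 0 < c)
    (hz : ∀ᶠ i in l, (z i).re ≤ -(2 * √a) - ρ) (hz1 : ∀ᶠ i in l, (z i).im ≤ 1)
    (hK : ∀ᶠ i in l, (leftK a (n i) (z i)).re ≤ -(c * √(n i))) :
    Tendsto (fun i => gTwo a b m (xAt (n i) (z i)) (n i) / wave (leftAmp 1 a (n i)) (leftPhase 1 a (n i)) (z i)) l (𝓝 1)
    ∧ Tendsto (fun i => rexp (2 * (leftPhase 1 a (n i) (z i)).im)) l (𝓝 0) := by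
  have hπ := h.tendsto_outer ha b
  have hev : ∀ᶠ i in l, outerApprox 1 a (n i) (z i) ≠ 0 ∧ wave (leftAmp 1 a (n i)) (leftPhase 1 a (n i)) (z i)
        = -(per a (xAt (n i) (z i)) * outerApprox 1 a (n i) (z i))
      ∧ ‖exp (recRem a b (n i) (z i)) * midAmp 1 a (n i) (z i) ^ 2
        / (per a (xAt (n i) (z i)) * outerApprox 1 a (n i) (z i) ^ 2)‖
        = rexp ((leftK a (n i) (z i)).re - (a + 1 / 2 + b / a) * (log (1 + z i / rootN (n i))).re) := by
    filter_upwards [h.tendsto_n.eventually_ge_atTop 1, h.im_pos, h.tendsto_re.eventually_gt_atTop 0,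
      h.neg_sqrt_lt, hz] with i h1 h2 h3 h4 h5
    have hre : (z i).re < -(2 * √a) := by linarith
    have hA := (regularPair_left ha h1 h4 hre).ne_zero
    have hΦ := outerApprox_eq_left ha h1 h2 hre h3
    have hΨ := exp_neg_leftPhase a (n i) (z i)
    have eI := exp_ne_zero (I * leftPhase 1 a (n i) (z i))
    refine ⟨by rw [hΦ]; exact mul_ne_zero hA eI, by unfold wave; rw [hΨ, hΦ]; ring, ?_⟩
    have hq0 : rootLeft a (z i) ≠ 0 := by intro h0; have := rootLeft_re_pos hre; rw [h0] at this; simp at this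
    have hNz : rootN (n i) + z i ≠ 0 := by intro h0; have := re_add_pos h4; rw [h0] at this; simp at this
    have hper : per a (xAt (n i) (z i)) * exp (I * leftPhase 1 a (n i) (z i)) ^ 2 = -1 := by
      rw [exp_neg] at hΨ
      field_simp at hΨ
      linear_combination hΨ
    have hqq : sqrt (4 * a - z i ^ 2) = I * rootLeft a (z i) := by
      have := rootOuter_eq_I_mul ha h2
      rw [rootOuter_eq_neg_rootLeft ha h2] at this
      linear_combination I * this + sqrt (4 * a - z i ^ 2) * I_sq
    have e : exp (recRem a b (n i) (z i)) * midAmp 1 a (n i) (z i) ^ 2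
        / (per a (xAt (n i) (z i)) * outerApprox 1 a (n i) (z i) ^ 2)
        = I * exp (leftK a (n i) (z i) - (a + 1 / 2 + b / a : ℝ) * log (1 + z i / rootN (n i))) := by
      rw [hΦ, mul_pow, mul_left_comm, hper, leftAmp_eq ha h1 h4 hre, midAmp_eq ha h1 h4, mul_pow, mul_pow,
        csqrt_sq, csqrt_sq, hqq, ← exp_nat_mul, ← exp_nat_mul]
      have e1 : recRem a b (n i) (z i) = leftK a (n i) (z i) - (a + 1 / 2 + b / a : ℝ)
          * log (1 + z i / rootN (n i)) + 2 * leftW a (n i) (z i) := by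
        unfold leftK recRem xAt; push_cast; ring
      rw [e1, exp_add, mul_add, exp_add]
      push_cast
      have k1 := exp_ne_zero (2 * midExp a (n i) (z i))
      have k2 := exp_ne_zero (2 * leftW a (n i) (z i))
      have hI := I_ne_zero
      field_simp
      rw [I_sq]
    rw [e, norm_mul, norm_I, one_mul, norm_exp, sub_re, re_ofReal_mul]
  have hr : Tendsto (fun i => coefL a b m (xAt (n i) (z i)) * solM a b (xAt (n i) (z i)) (n i)
      / (per a (xAt (n i) (z i)) * piSeq a b (xAt (n i) (z i)) (n i))) l (𝓝 0) := by
    obtain ⟨C, hC, hrel⟩ := h.norm_relRatio_sub_one_le ha b hm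
    have h0 : Tendsto (fun i => relRatio a b (xAt (n i) (z i)) (n i)
        * (exp (recRem a b (n i) (z i)) * midAmp 1 a (n i) (z i) ^ 2
        / (per a (xAt (n i) (z i)) * outerApprox 1 a (n i) (z i) ^ 2))) l (𝓝 0) := by
      refine squeeze_zero_norm' ?_ (tendsto_sq_mul_exp h.tendsto hc (abs_nonneg (a + 1 / 2 + b / a)) (1 + 3 * C))
      filter_upwards [hrel, hev, hz, hz1, h.im_pos, h.one_le, h.neg_sqrt_lt, h.sqrt_eq, hK, h.abs_log_le]
        with i h1 h2 h3 h4 h5 h6 h7 h8 h9 h10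
      rw [norm_mul, h2.2.2]
      rw [h8] at h7 h9
      have hT : 0 < T i := by linarith
      gcongr
      · have hzn : ‖z i‖ ≤ T i ^ 20 + 1 := by
          have := norm_le_abs_re_add_abs_im (z i)
          rw [abs_of_pos h5, abs_of_neg (by linarith [sqrt_nonneg a])] at this
          linarith
        have h11 : C * (1 + ‖z i‖) / T i ^ 18 ≤ 3 * C * T i ^ 2 := by
          rw [div_le_iff₀ (by positivity)]
          have : 1 ≤ T i ^ 20 := one_le_pow₀ h6
          calc C * (1 + ‖z i‖) ≤ C * (3 * T i ^ 20) := by gcongr; linarith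
            _ = _ := by ring
        have h12 : 1 ≤ T i ^ 2 := one_le_pow₀ h6
        have h13 := norm_le_norm_add_norm_sub' (relRatio a b (xAt (n i) (z i)) (n i)) 1
        rw [norm_one] at h13
        linarith
      · have := neg_abs_le ((a + 1 / 2 + b / a) * (log (1 + z i / rootN (n i))).re)
        rw [abs_mul] at this
        have := mul_le_mul_of_nonneg_left h10 (abs_nonneg (a + 1 / 2 + b / a))
        linarith
    have h1 := ((h.tendsto_recessive_amp ha b hm).mul h0).div (hπ.pow 2) (by norm_num)
    simp only [one_mul, one_pow, div_one] at h1
    refine h1.congr' ?_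
    have hne := (h.tendsto_recessive_amp ha b hm).eventually_ne one_ne_zero
    filter_upwards [hev, hne, h.piSeq_ne_zero ha b] with i h2 h3 h4
    have h5 := h2.1
    have h6 : relRatio a b (xAt (n i) (z i)) (n i)
        * exp (recRem a b (n i) (z i)) * midAmp 1 a (n i) (z i) ^ 2 ≠ 0 := by
      intro h7; rw [h7, div_zero] at h3; exact h3 rfl
    have k1 := exp_ne_zero (recRem a b (n i) (z i))
    have k2 := (pow_ne_zero_iff two_ne_zero).mp (right_ne_zero_of_mul h6)
    have k3 := left_ne_zero_of_mul (left_ne_zero_of_mul h6)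
    have k4 : per a (xAt (n i) (z i)) ≠ 0 := exp_ne_zero _
    rw [Pi.div_apply]
    field_simp
  refine ⟨?_, ?_⟩
  · have h1 := (h.tendsto_gTwo_of_dominant ha b hm hr).mul hπ
    rw [mul_one] at h1
    refine h1.congr' ?_
    filter_upwards [hev, h.piSeq_ne_zero ha b] with i h2 h4
    have h5 := h2.1
    have k4 : per a (xAt (n i) (z i)) ≠ 0 := exp_ne_zero _
    rw [h2.2.1]
    field_simp
  · have h0 : Tendsto (fun i => rexp (-T i ^ 19)) l (𝓝 0) :=
      tendsto_exp_neg_atTop_nhds_zero.comp (h.tendsto_pow (by norm_num))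
    refine squeeze_zero' (Eventually.of_forall fun i => (exp_pos _).le) ?_ h0
    filter_upwards [h.le_im, h.one_le] with i h1 h2
    rw [xAt_im] at h1
    have e : (leftPhase 1 a (n i) (z i)).im = -(π * (√(n i) * (z i).im)) := by
      unfold leftPhase rootN
      rw [im_ofReal_mul]
      simp
    rw [e, exp_le_exp]
    have : 0 ≤ T i ^ 19 := by positivity
    nlinarith [pi_gt_three]

end Edge

end

theorem norm_clog_le (w : ℂ) : ‖log w‖ ≤ ‖w‖ + ‖w‖⁻¹ + π := by
  have h1 := norm_le_abs_re_add_abs_im (log w)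
  rw [log_re, log_im] at h1
  have h2 := abs_arg_le_pi w
  have h3 : |Real.log ‖w‖| ≤ ‖w‖ + ‖w‖⁻¹ := by
    rcases (norm_nonneg w).eq_or_lt with h | h
    · simp [← h]
    · have k1 := log_le_sub_one_of_pos h
      have k2 := log_le_sub_one_of_pos (inv_pos.mpr h)
      rw [Real.log_inv] at k2
      have := inv_pos.mpr h
      rw [abs_le]; constructor <;> linarith
  linarith

theorem exists_norm_Gamma_le : ∃ C : ℝ, 0 < C ∧ ∀ w : ℂ, 1 ≤ w.re → ‖Gamma w‖ ≤ rexp (C * (1 + ‖w‖) ^ 2) ∧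
    ‖(Gamma w)⁻¹‖ ≤ rexp (C * (1 + ‖w‖) ^ 2) := by
  have hpi := pi_gt_three
  have hpi4 := pi_lt_four
  set K : Set ℂ := Metric.closedBall 0 (12 * π) ∩ {w | 1 ≤ w.re} with hK
  have hKc : IsCompact K := (isCompact_closedBall _ _).inter_right (isClosed_le continuous_const continuous_re)
  have hcont : ContinuousOn Gamma K := fun w hw => by
    refine (differentiableAt_Gamma w fun k h => ?_).continuousAt.continuousWithinAt
    have h1 : (1 : ℝ) ≤ w.re := hw.2
    rw [h, neg_re, natCast_re] at h1
    linarith [Nat.cast_nonneg (α := ℝ) k]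
  obtain ⟨B1, hB1⟩ := hKc.exists_bound_of_continuousOn hcont
  obtain ⟨B2, hB2⟩ := hKc.exists_bound_of_continuousOn differentiable_rGamma.continuous.continuousOn
  set L := |Real.log (√(2 * π))| with hL
  refine ⟨8 + L + |B1| + |B2|, by positivity, fun w hw => ?_⟩
  have hwn : 1 ≤ ‖w‖ := hw.trans (re_le_norm w)
  have hL0 : 0 ≤ L := abs_nonneg _
  by_cases hbig : 12 * π ≤ ‖w‖
  · have hs : ‖stirLog w‖ ≤ (7 + L) * (1 + ‖w‖) ^ 2 := by
      unfold stirLog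
      have h1 : ‖w - 1 / 2‖ ≤ ‖w‖ + 1 := (norm_sub_le _ _).trans (by norm_num)
      have h2 : ‖log w‖ ≤ ‖w‖ + 5 := (norm_clog_le w).trans (by linarith [inv_le_one_of_one_le₀ hwn])
      refine (norm_add_le _ _).trans ?_
      rw [norm_real, norm_eq_abs, ← hL]
      have h3 := norm_sub_le ((w - 1 / 2) * log w) w
      rw [norm_mul] at h3
      have h4 : ‖w - 1 / 2‖ * ‖log w‖ ≤ (‖w‖ + 1) * (‖w‖ + 5) := by gcongr
      nlinarith [mul_nonneg hL0 (norm_nonneg w)]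
    have hr : ‖stirRatio w - 1‖ ≤ 1 / 2 := by
      refine (norm_stirRatio_sub_one_le (by linarith) (by linarith)).trans ?_
      rw [div_le_iff₀ (by linarith)]; linarith
    have hr1 : ‖stirRatio w‖ ≤ 2 := by
      have := norm_le_norm_add_norm_sub' (stirRatio w) 1; rw [norm_one] at this; linarith
    have hr2 : 1 / 2 ≤ ‖stirRatio w‖ := by
      have := norm_le_norm_add_norm_sub (stirRatio w) 1; rw [norm_one] at this; linarith
    have h2e : (2 : ℝ) ≤ rexp ((1 + ‖w‖) ^ 2) := by have := add_one_le_exp ((1 + ‖w‖) ^ 2); nlinarith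
    have hfin : 2 * rexp ‖stirLog w‖ ≤ rexp ((8 + L + |B1| + |B2|) * (1 + ‖w‖) ^ 2) := by
      calc _ ≤ rexp ((1 + ‖w‖) ^ 2) * rexp ((7 + L) * (1 + ‖w‖) ^ 2) := by gcongr
        _ = rexp ((8 + L) * (1 + ‖w‖) ^ 2) := by rw [← Real.exp_add]; congr 1; ring
        _ ≤ _ := by
            refine exp_le_exp.mpr (mul_le_mul_of_nonneg_right ?_ (by positivity))
            linarith [abs_nonneg B1, abs_nonneg B2]
    rw [Gamma_eq_stirRatio_mul, mul_inv, ← exp_neg, norm_mul, norm_mul, norm_inv]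
    constructor
    · refine le_trans ?_ hfin
      gcongr
      exact norm_exp_le_exp_norm _
    · refine le_trans ?_ hfin
      have := norm_exp_le_exp_norm (-stirLog w)
      rw [norm_neg] at this
      gcongr
      rw [inv_le_comm₀ (by linarith) two_pos]; linarith
  · have hmem : w ∈ K := ⟨by rw [mem_closedBall_zero_iff]; linarith, hw⟩
    have key : ∀ B : ℝ, |B| ≤ |B1| + |B2| → B ≤ rexp ((8 + L + |B1| + |B2|) * (1 + ‖w‖) ^ 2) := by
      intro B hB
      have h1 := add_one_le_exp ((8 + L + |B1| + |B2|) * (1 + ‖w‖) ^ 2)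
      have h2 : 8 + L + |B1| + |B2| ≤ (8 + L + |B1| + |B2|) * (1 + ‖w‖) ^ 2 :=
        le_mul_of_one_le_right (by positivity) (one_le_pow₀ (by linarith))
      linarith [le_abs_self B]
    exact ⟨(hB1 w hmem).trans (key _ (by linarith [abs_nonneg B2])),
      (hB2 w hmem).trans (key _ (by linarith [abs_nonneg B1]))⟩

theorem exists_norm_inv_Gamma_le : ∃ C : ℝ, 0 < C ∧ ∀ w : ℂ, ‖(Gamma w)⁻¹‖ ≤ rexp (C * (1 + ‖w‖) ^ 2) := by
  obtain ⟨C, hC, H⟩ := exists_norm_Gamma_le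
  have key : ∀ (k : ℕ) (w : ℂ), 1 - (k : ℝ) ≤ w.re →
      ‖(Gamma w)⁻¹‖ ≤ rexp (k * (‖w‖ + k) + C * (1 + ‖w‖ + k) ^ 2) := by
    intro k
    induction k with
    | zero => intro w hw; simpa using (H w (by simpa using hw)).2
    | succ k ih =>
      intro w hw
      push_cast at hw ⊢
      have h1 := ih (w + 1) (by simp; linarith)
      have h2 : ‖w + 1‖ ≤ ‖w‖ + 1 := (norm_add_le _ _).trans (by simp)
      rw [rGamma_eq, norm_mul]
      calc _ ≤ rexp ‖w‖ * rexp (k * (‖w‖ + 1 + k) + C * (1 + (‖w‖ + 1) + k) ^ 2) := by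
            gcongr
            · linarith [add_one_le_exp ‖w‖]
            · exact h1.trans (by gcongr)
        _ ≤ _ := by
            rw [← Real.exp_add, exp_le_exp]
            have : C * (1 + (‖w‖ + 1) + k) ^ 2 = C * (1 + ‖w‖ + (k + 1)) ^ 2 := by ring
            nlinarith [norm_nonneg w]
  refine ⟨4 + 9 * C, by positivity, fun w => ?_⟩
  set k := ⌈1 + ‖w‖⌉₊ with hk
  have hk1 : 1 + ‖w‖ ≤ k := Nat.le_ceil _
  have hk2 : (k : ℝ) < 1 + ‖w‖ + 1 := Nat.ceil_lt_add_one (by positivity)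
  refine (key k w (by linarith [neg_abs_le w.re, abs_re_le_norm w])).trans ?_
  rw [exp_le_exp]
  have hw := norm_nonneg w
  have h1 : (k : ℝ) * (‖w‖ + k) ≤ (2 + ‖w‖) * (‖w‖ + (2 + ‖w‖)) := by gcongr <;> linarith
  have h2 : (1 + ‖w‖ + k) ^ 2 ≤ (3 * (1 + ‖w‖)) ^ 2 := by gcongr; linarith
  nlinarith [mul_le_mul_of_nonneg_left h2 hC.le]

theorem norm_kSer_le {a ν E : ℂ} {ρ : ℝ} (hρ : ∀ j : ℕ, ρ ≤ ‖E - ν + j + 1‖) (hρ0 : 0 < ρ) :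
    ‖kSer a ν E‖ ≤ ‖(Gamma (ν + 1))⁻¹ * (Gamma (E - ν + 1))⁻¹‖ * rexp (‖a‖ * (1 + ‖E + 1‖ / ρ)) := by
  set q := ‖a‖ * (1 + ‖E + 1‖ / ρ) with hq
  have hterm : ∀ j : ℕ, ‖kTerm a ν E j‖ ≤ ‖(Gamma (ν + 1))⁻¹ * (Gamma (E - ν + 1))⁻¹‖ * (q ^ j / j.factorial) := by
    intro j
    induction j with
    | zero => simp [kTerm]
    | succ j ih =>
      have hw := lt_of_lt_of_le hρ0 (hρ j)
      have hn := congrArg norm (kTerm_succ a ν E j)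
      rw [norm_mul, norm_mul, norm_mul, norm_mul, norm_neg, show ‖(j : ℂ) + 1‖ = j + 1 by
        rw [← Nat.cast_add_one, Complex.norm_natCast]; push_cast; ring] at hn
      have h1 : ‖ν - j‖ ≤ (1 + ‖E + 1‖ / ρ) * ‖E - ν + j + 1‖ := by
        have h2 : ‖E + 1‖ ≤ ‖E + 1‖ / ρ * ‖E - ν + j + 1‖ := by
          rw [div_mul_eq_mul_div, le_div_iff₀ hρ0]
          gcongr
          exact hρ j
        have h3 := norm_sub_le (E + 1) (E - ν + j + 1)
        rw [show (E + 1) - (E - ν + j + 1) = ν - j by ring] at h3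
        linarith
      have hpos : 0 < ((j : ℝ) + 1) * ‖E - ν + j + 1‖ := by positivity
      refine le_of_mul_le_mul_left ?_ hpos
      rw [hn, Nat.factorial_succ]
      calc _ ≤ ‖a‖ * ((1 + ‖E + 1‖ / ρ) * ‖E - ν + j + 1‖)
            * (‖(Gamma (ν + 1))⁻¹ * (Gamma (E - ν + 1))⁻¹‖ * (q ^ j / j.factorial)) := by gcongr
        _ = q * ‖E - ν + j + 1‖ * (‖(Gamma (ν + 1))⁻¹ * (Gamma (E - ν + 1))⁻¹‖ * (q ^ j / j.factorial)) := by
          rw [hq]; ring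
        _ = _ := by
          push_cast
          field_simp
          ring
  have hs := NormedSpace.expSeries_div_hasSum_exp (𝔸 := ℝ) q
  rw [← Real.exp_eq_exp_ℝ] at hs
  exact tsum_of_norm_bounded (hs.mul_left _) hterm

section

variable {ι : Type*} {a b : ℝ} {l : Filter ι} {n : ι → ℕ} {x : ι → ℂ} {f g : ι → ℂ} {m : ℕ}

/-- Growth at most `e^{C n²}`. -/
def Crude (l : Filter ι) (n : ι → ℕ) (f : ι → ℂ) : Prop := ∃ C : ℝ, ∀ᶠ i in l, ‖f i‖ ≤ rexp (C * (n i : ℝ) ^ 2)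

/-- Growth at most linear. -/
def Lin (l : Filter ι) (n : ι → ℕ) (f : ι → ℂ) : Prop := f =O[l] fun i => (n i : ℝ)

theorem lin_const (hn : Tendsto n l atTop) (c : ℂ) : Lin l n fun _ => c :=
  (isBigO_refl _ _).trans (isLittleO_const_left.mpr (Or.inr (by
    simpa [Function.comp_def] using (tendsto_natCast_atTop_atTop (R := ℝ)).comp hn))).isBigO

namespace Crude

theorem mul (hf : Crude l n f) (hg : Crude l n g) : Crude l n fun i => f i * g i := by
  obtain ⟨C, hC⟩ := hf
  obtain ⟨D, hD⟩ := hg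
  refine ⟨C + D, ?_⟩
  filter_upwards [hC, hD] with i h1 h2
  rw [norm_mul, add_mul, Real.exp_add]
  gcongr

theorem neg (hf : Crude l n f) : Crude l n fun i => -f i := by simpa [Crude] using hf

theorem add (hn : Tendsto n l atTop) (hf : Crude l n f) (hg : Crude l n g) : Crude l n fun i => f i + g i := by
  obtain ⟨C, hC⟩ := hf
  obtain ⟨D, hD⟩ := hg
  refine ⟨1 + |C| + |D|, ?_⟩
  filter_upwards [hC, hD, hn.eventually_ge_atTop 1] with i h1 h2 h3
  have hn1 : (1 : ℝ) ≤ (n i : ℝ) ^ 2 := one_le_pow₀ (by exact_mod_cast h3)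
  have e1 : rexp (C * (n i : ℝ) ^ 2) ≤ rexp ((|C| + |D|) * (n i : ℝ) ^ 2) := by
    gcongr; linarith [le_abs_self C, abs_nonneg D]
  have e2 : rexp (D * (n i : ℝ) ^ 2) ≤ rexp ((|C| + |D|) * (n i : ℝ) ^ 2) := by
    gcongr; linarith [le_abs_self D, abs_nonneg C]
  have e3 : 2 ≤ rexp ((n i : ℝ) ^ 2) := by linarith [add_one_le_exp ((n i : ℝ) ^ 2)]
  calc ‖f i + g i‖ ≤ 2 * rexp ((|C| + |D|) * (n i : ℝ) ^ 2) := (norm_add_le _ _).trans (by linarith)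
    _ ≤ rexp ((n i : ℝ) ^ 2) * rexp ((|C| + |D|) * (n i : ℝ) ^ 2) := by gcongr
    _ = _ := by rw [← Real.exp_add]; congr 1; ring

theorem sub (hn : Tendsto n l atTop) (hf : Crude l n f) (hg : Crude l n g) : Crude l n fun i => f i - g i := by
  simpa [sub_eq_add_neg] using hf.add hn hg.neg

theorem of_le (hf : Crude l n f) (h : ∀ᶠ i in l, ‖g i‖ ≤ ‖f i‖) : Crude l n g := by
  obtain ⟨C, hC⟩ := hf
  exact ⟨C, by filter_upwards [hC, h] with i h1 h2; exact h2.trans h1⟩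

theorem of_bound {c : ℝ} (h : ∀ᶠ i in l, ‖g i‖ ≤ rexp (c * (n i : ℝ) ^ 2)) : Crude l n g := ⟨c, h⟩

theorem exp (h : f =O[l] fun i => (n i : ℝ) ^ 2) : Crude l n fun i => Complex.exp (f i) := by
  obtain ⟨C, hC⟩ := h.bound
  refine ⟨C, hC.mono fun i hi => (norm_exp_le_exp_norm _).trans (exp_le_exp.mpr ?_)⟩
  rwa [norm_of_nonneg (by positivity)] at hi

theorem of_isBigO (h : f =O[l] fun i => (n i : ℝ) ^ 2) : Crude l n f := by
  obtain ⟨C, hC⟩ := h.bound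
  refine ⟨C, hC.mono fun i hi => hi.trans ?_⟩
  rw [norm_of_nonneg (by positivity)]
  linarith [add_one_le_exp (C * (n i : ℝ) ^ 2)]

end Crude

theorem Lin.mul (hf : Lin l n f) (hg : Lin l n g) : (fun i => f i * g i) =O[l] fun i => (n i : ℝ) ^ 2 := by
  simpa [pow_two] using IsBigO.mul hf hg

theorem Lin.add (hf : Lin l n f) (hg : Lin l n g) : Lin l n fun i => f i + g i := IsBigO.add hf hg

theorem Lin.sq (hn : Tendsto n l atTop) (hf : Lin l n f) : f =O[l] fun i => (n i : ℝ) ^ 2 := by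
  simpa using (lin_const hn 1).mul hf

theorem Lin.natCast : Lin l n fun i => (n i : ℂ) := IsBigO.of_bound 1 (Eventually.of_forall fun i => by simp)

theorem Lin.crude (hn : Tendsto n l atTop) (hf : Lin l n f) : Crude l n f := Crude.of_isBigO (hf.sq hn)

theorem Lin.exp_le (hn : Tendsto n l atTop) (hf : Lin l n f) (C : ℝ) (hC : 0 ≤ C) :
    ∃ c : ℝ, ∀ᶠ i in l, rexp (C * (1 + ‖f i‖) ^ 2) ≤ rexp (c * (n i : ℝ) ^ 2) := by
  obtain ⟨D, hD⟩ := IsBigO.bound hf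
  refine ⟨C * (1 + D) ^ 2, ?_⟩
  filter_upwards [hD, hn.eventually_ge_atTop 1] with i h1 h2
  have hn1 : (1 : ℝ) ≤ n i := by exact_mod_cast h2
  rw [norm_of_nonneg (by positivity)] at h1
  rw [exp_le_exp, mul_assoc, ← mul_pow]
  gcongr
  linarith

theorem Crude.inv_Gamma (hn : Tendsto n l atTop) (hf : Lin l n f) : Crude l n fun i => (Gamma (f i))⁻¹ := by
  obtain ⟨C, hC, H⟩ := exists_norm_inv_Gamma_le
  obtain ⟨c, hc⟩ := hf.exp_le hn C hC.le
  exact ⟨c, hc.mono fun i hi => (H _).trans hi⟩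

theorem Crude.Gamma (hn : Tendsto n l atTop) (hf : Lin l n f) (h1 : ∀ᶠ i in l, 1 ≤ (f i).re) :
    Crude l n fun i => Gamma (f i) := by
  obtain ⟨C, hC, H⟩ := exists_norm_Gamma_le
  obtain ⟨c, hc⟩ := hf.exp_le hn C hC.le
  exact ⟨c, by filter_upwards [hc, h1] with i hi h; exact (H _ h).1.trans hi⟩

theorem crude_eval (hn : Tendsto n l atTop) (hx : Lin l n x) (p : Polynomial ℂ) :
    Crude l n fun i => p.eval (x i) := by
  induction p using Polynomial.induction_on with
  | C c => simpa using (lin_const hn c).crude hn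
  | add p q hp hq => simpa using hp.add hn hq
  | monomial k c h =>
    have := h.mul (hx.crude hn)
    simpa [pow_succ, mul_assoc] using this

theorem Lin.norm (hf : Lin l n f) : Lin l n fun i => ((‖f i‖ : ℝ) : ℂ) := by simpa [Lin, isBigO_iff] using hf

theorem Crude.kSer (hn : Tendsto n l atTop) (hf : Lin l n f) (hg : Lin l n g)
    (h : ∀ᶠ i in l, ∀ j : ℕ, 1 / 2 ≤ ‖g i - f i + j + 1‖) (c : ℂ) :
    Crude l n fun i => PlancherelRotach.kSer c (f i) (g i) := by
  have h1 := ((inv_Gamma hn (hf.add (lin_const hn 1))).mul (inv_Gamma hn ((IsBigO.sub hg hf).add (lin_const hn 1)))).mul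
    (Crude.exp ((lin_const hn ‖c‖).mul ((lin_const hn 1).add ((hg.add (lin_const hn 1)).norm.add
      (hg.add (lin_const hn 1)).norm))))
  refine h1.of_le (h.mono fun i hi => (norm_kSer_le hi (by norm_num)).trans (le_of_eq ?_))
  rw [norm_mul _ (Complex.exp _), norm_exp]
  congr 2
  rw [re_ofReal_mul, div_div_eq_mul_div, div_one, mul_two]
  simp

theorem half_le_norm_of_re {w : ℂ} {k : ℤ} (h : w.re = k + 1 / 2) (j : ℤ) : 1 / 2 ≤ ‖w + j‖ := by
  refine le_trans ?_ (abs_re_le_norm _)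
  rw [add_re, h, intCast_re]
  rcases le_or_gt 0 (k + j) with h1 | h1
  · have : (0 : ℝ) ≤ (k + j : ℤ) := by exact_mod_cast h1
    push_cast at this
    rw [abs_of_nonneg (by linarith)]; linarith
  · have : ((k + j : ℤ) : ℝ) ≤ -1 := by exact_mod_cast (by omega)
    push_cast at this
    rw [abs_of_nonpos (by linarith)]; linarith

theorem one_le_norm_one_sub_per {x : ℂ} {k : ℤ} (h : (x + a).re = k + 1 / 2) : 1 ≤ ‖1 - per a x‖ := by
  have e : per a x = -(rexp (-(2 * π * x.im)) : ℝ) := by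
    unfold per
    have hx : x + a = k + 1 / 2 + x.im * I := by
      refine Complex.ext ?_ (by simp)
      rw [h]; simp
    rw [hx, show 2 * π * I * (k + 1 / 2 + x.im * I) = k * (2 * π * I) + (π * I + ((-(2 * π * x.im) : ℝ) : ℂ)) by
        push_cast; linear_combination (2 * π * x.im : ℂ) * I_sq,
      exp_add, exp_int_mul_two_pi_mul_I, one_mul, exp_add, exp_pi_mul_I,
      ← ofReal_exp]
    ring
  have hp := exp_pos (-(2 * π * x.im))
  rw [e, sub_neg_eq_add, ← ofReal_one, ← ofReal_add, Complex.norm_of_nonneg (by linarith)]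
  linarith

section
variable (ha : 0 < a) (hm : 0 ≤ m + b / a) (hn : Tendsto n l atTop) (hx : Lin l n x)
  (hh : ∀ᶠ i in l, ∃ k : ℤ, (x i + a).re = k + 1 / 2) {k : ι → ℕ} (hk : ∀ᶠ i in l, m ≤ k i ∧ k i ≤ n i)
include hm hn hx hh hk

theorem crude_solL_solM : Crude l n (fun i => solL a b (x i) (k i)) ∧ Crude l n (fun i => solM a b (x i) (k i)) := by
  have hkl : Lin l n fun i => (k i : ℂ) := IsBigO.of_bound 1 (hk.mono fun i hi => by simpa using hi.2)
  have hν := hkl.add (lin_const hn (b / a))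
  have hE := (hx.add (lin_const hn a)).add (lin_const hn (b / a))
  have hΓ := Crude.Gamma hn (hν.add (lin_const hn 1)) (hk.mono fun i hi => by
    have : ((b : ℂ) / a) = ((b / a : ℝ) : ℂ) := by push_cast; rfl
    have h1 : (m : ℝ) ≤ k i := by exact_mod_cast hi.1
    rw [this]; simp only [add_re, natCast_re, ofReal_re, one_re]; linarith)
  have h1 := Crude.kSer hn hν hE (hh.mono fun i ⟨p, hp⟩ j => by
    have := half_le_norm_of_re hp (j + 1 - k i)
    push_cast at this
    refine this.trans (le_of_eq (congrArg norm (by ring)))) a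
  have h2 := Crude.kSer hn hE hν (hh.mono fun i ⟨p, hp⟩ j => by
    have := half_le_norm_of_re hp (-(k i + j + 1))
    rw [← norm_neg] at this
    push_cast at this
    refine this.trans (le_of_eq (congrArg norm (by ring)))) a
  have h3 := Crude.exp ((lin_const hn (π * I - Real.log a)).mul (IsBigO.sub (hx.add (lin_const hn a)) hkl))
  exact ⟨hΓ.mul h1, (hΓ.mul h3).mul h2⟩

theorem crude_solP_solN : Crude l n (fun i => solP a b (x i) (k i)) ∧ Crude l n (fun i => solN a b (x i) (k i)) := by
  obtain ⟨hL, hM⟩ := crude_solL_solM hm hn hx hh hk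
  have hper : Crude l n fun i => per a (x i) := Crude.exp ((lin_const hn (2 * π * I)).mul (hx.add (lin_const hn a)))
  have hne : ∀ᶠ i in l, 1 ≤ ‖1 - per a (x i)‖ := hh.mono fun i ⟨p, hp⟩ => one_le_norm_one_sub_per hp
  constructor
  · refine (hM.sub hn (hper.mul hL)).of_le (hne.mono fun i hi => ?_)
    rw [solP_eq (norm_pos_iff.mp (by linarith)), norm_div]
    exact div_le_self (norm_nonneg _) hi
  · refine (hL.sub hn hM).of_le (hne.mono fun i hi => ?_)
    rw [solN_eq (norm_pos_iff.mp (by linarith)), norm_div]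
    exact div_le_self (norm_nonneg _) hi

end

theorem crude_gTwo (hm : 0 ≤ m + b / a) (hn : Tendsto n l atTop) (hx : Lin l n x)
    (hre : ∀ᶠ i in l, 1 ≤ (x i + (a + b / a + 1)).re) (hh : ∀ᶠ i in l, ∃ k : ℤ, (x i + a).re = k + 1 / 2) :
    Crude l n fun i => gTwo a b m (x i) (n i) := by
  have hnm := hn.eventually_ge_atTop (m + 1)
  have hP := (crude_solP_solN hm hn hx hh (hnm.mono fun i hi => ⟨by omega, le_rfl⟩)).1
  have hN0 := (crude_solP_solN hm hn hx hh (k := fun _ => m) (hnm.mono fun i hi => ⟨le_rfl, by omega⟩)).2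
  have hN1 := (crude_solP_solN hm hn hx hh (k := fun _ => m + 1) (hnm.mono fun i hi => ⟨by omega, by omega⟩)).2
  have hcas : Crude l n fun i => casor (piSeq a b (x i)) (solN a b (x i)) m :=
    ((crude_eval hn hx _).mul hN0).sub hn ((crude_eval hn hx _).mul hN1)
  have hkap : Crude l n fun i => (kap a b (x i) m)⁻¹ := by
    have h1 := (((lin_const hn (2 * π / (Gamma (m + b / a + 1) * Complex.exp a))).crude hn).mul
      (Crude.Gamma hn (hx.add (lin_const hn _)) hre)).mul (Crude.exp ((lin_const hn (Real.log a)).mul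
        (hx.add (lin_const hn (a - m)))))
    refine h1.of_le (Eventually.of_forall fun i => le_of_eq (congrArg norm ?_))
    unfold kap
    rw [show (Real.log a : ℂ) * (x i + (a - m)) = -(Real.log a * (m - (x i + a))) by ring, exp_neg,
      show x i + ((a : ℂ) + b / a + 1) = x i + a + b / a + 1 by ring]
    simp only [div_eq_mul_inv, mul_inv, inv_inv]
    ring
  exact ((((lin_const hn I).crude hn).mul hkap).mul hcas).mul hP

end

section

variable {ι : Type*} {a b : ℝ} {l : Filter ι} {n : ι → ℕ} {z : ι → ℂ}

theorem sqrt_natCast_le (k : ℕ) : √k ≤ k := by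
  rw [sqrt_le_left (Nat.cast_nonneg k)]
  exact_mod_cast Nat.le_self_pow two_ne_zero k

theorem Lin.of_le {f : ι → ℂ} (hn : Tendsto n l atTop) {B C : ℝ} (hB : 0 ≤ B)
    (h : ∀ᶠ i in l, ‖f i‖ ≤ C * √(n i) + B) : Lin l n f := by
  refine IsBigO.of_bound (|C| + B) ?_
  filter_upwards [h, hn.eventually_ge_atTop 1] with i h1 h2
  have hn1 : (1 : ℝ) ≤ n i := by exact_mod_cast h2
  have h3 := sqrt_natCast_le (n i)
  rw [norm_of_nonneg (by positivity)]
  nlinarith [mul_le_mul_of_nonneg_right (le_abs_self C) (sqrt_nonneg (n i)), abs_nonneg C,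
    mul_le_mul_of_nonneg_left h3 (abs_nonneg C)]

theorem Crude.inv_wave {A P Q θ : ι → ℂ} (hn : Tendsto n l atTop) {δ : ℝ} (hδ : 0 < δ)
    (hz : ∀ᶠ i in l, -√(n i) + δ ≤ (z i).re) (hP : P =O[l] fun i => (n i : ℝ) ^ 2)
    (hQ : Lin l n Q) (hθ : ∀ᶠ i in l, |(θ i).im| ≤ 4 * (n i : ℝ) ^ 2)
    (hA : ∀ᶠ i in l, A i = Complex.exp (P i) * sqrt ((rootN (n i) + z i) / Q i)) :
    Crude l n fun i => (A i * Complex.exp (-(I * θ i)))⁻¹ := by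
  have h1 : Crude l n fun i => (sqrt ((rootN (n i) + z i) / Q i))⁻¹ := by
    have h2 : Lin l n fun i => 1 + ((‖(δ⁻¹ : ℂ) * Q i‖ : ℝ) : ℂ) :=
      (lin_const hn 1).add (Lin.norm (f := fun i => (δ⁻¹ : ℂ) * Q i) (IsBigO.const_mul_left hQ _))
    refine (h2.crude hn).of_le (hz.mono fun i hi => ?_)
    rw [← ofReal_one, ← ofReal_add, Complex.norm_of_nonneg (by positivity), norm_inv, norm_mul,
      norm_inv, Complex.norm_of_nonneg hδ.le]
    have hN : δ ≤ ‖rootN (n i) + z i‖ := by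
      refine le_trans ?_ (re_le_norm _)
      unfold rootN; simp; linarith
    have h3 : (‖sqrt ((rootN (n i) + z i) / Q i)‖⁻¹) ^ 2 ≤ δ⁻¹ * ‖Q i‖ := by
      rw [inv_pow, ← norm_pow, csqrt_sq, norm_div, inv_div, div_eq_inv_mul]
      gcongr
    nlinarith [sq_nonneg (‖sqrt ((rootN (n i) + z i) / Q i)‖⁻¹ - 1)]
  have h2 : Crude l n fun i => Complex.exp (I * θ i) := .of_bound (c := 4) (hθ.mono fun i hi => by
      rw [norm_exp, I_mul_re]
      exact exp_le_exp.mpr ((neg_le_abs _).trans hi))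
  refine (((Crude.exp hP.neg_left).mul h1).mul h2).of_le (hA.mono fun i hi => le_of_eq (congrArg norm ?_))
  rw [hi, mul_inv, mul_inv, ← exp_neg, ← exp_neg, neg_neg]

section
variable (hn : Tendsto n l atTop) {δ B : ℝ} (hδ : 0 < δ) (hB : 0 ≤ B)
  (hz : ∀ᶠ i in l, -√(n i) + δ ≤ (z i).re) (hz2 : ∀ᶠ i in l, (z i).re ≤ B)
  (hz3 : ∀ᶠ i in l, |(z i).im| ≤ 1)
include hδ hB hz hz2 hz3

theorem norm_le_of_strip : ∀ᶠ i in l, ‖z i‖ ≤ √(n i) + (B + 1) := by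
  filter_upwards [hz, hz2, hz3] with i h1 h2 h3
  have h4 : |(z i).re| ≤ √(n i) + B := by rw [abs_le]; constructor <;> linarith [sqrt_nonneg (n i)]
  linarith [norm_le_abs_re_add_abs_im (z i)]

include hn

theorem lin_strip : Lin l n z ∧ Lin l n (fun i => rootN (n i)) ∧ Lin l n (fun i => rootN (n i) * z i) := by
  have h := norm_le_of_strip hδ hB hz hz2 hz3
  refine ⟨Lin.of_le hn (C := 1) (B := B + 1) (by linarith) (by simpa using h),
    Lin.of_le hn (C := 1) le_rfl (Eventually.of_forall fun i => by simp [norm_rootN]),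
    IsBigO.of_bound (B + 2) ?_⟩
  filter_upwards [h] with i hi
  rw [norm_mul, norm_rootN, norm_of_nonneg (by positivity)]
  have := mul_self_sqrt (Nat.cast_nonneg (α := ℝ) (n i))
  nlinarith [sqrt_natCast_le (n i), mul_le_mul_of_nonneg_left hi (sqrt_nonneg (n i))]

theorem isBigO_midExp (a : ℝ) : (fun i => midExp a (n i) (z i)) =O[l] fun i => (n i : ℝ) ^ 2 := by
  obtain ⟨l1, l2, l3⟩ := lin_strip hn hδ hB hz hz2 hz3
  have hlog : Lin l n fun i => ((Real.log (n i) : ℝ) : ℂ) := by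
    refine IsBigO.of_bound 1 (Eventually.of_forall fun i => ?_)
    rw [norm_real, one_mul]
    rw [norm_of_nonneg (Real.log_natCast_nonneg _), norm_of_nonneg (by positivity)]
    exact Real.log_le_self (by positivity)
  have hE : Lin l n fun i => xAt (n i) (z i) + a := (Lin.natCast.add l3).add (lin_const hn a)
  have hl : Lin l n fun i => log (1 + z i / rootN (n i)) := by
    refine Lin.of_le hn (C := 1 / δ) (B := B + 7) (by linarith) ?_
    filter_upwards [norm_le_of_strip hδ hB hz hz2 hz3, hz, hn.eventually_ge_atTop 1] with i h1 h2 h3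
    have hs : 1 ≤ √(n i) := one_le_sqrt.mpr (by exact_mod_cast h3)
    have hN : δ ≤ ‖rootN (n i) + z i‖ := by
      refine le_trans ?_ (re_le_norm _)
      unfold rootN; simp; linarith
    have k1 : ‖1 + z i / rootN (n i)‖ ≤ B + 3 := by
      refine (norm_add_le _ _).trans ?_
      rw [norm_one, norm_div, norm_rootN]
      have : ‖z i‖ / √(n i) ≤ B + 2 := by rw [div_le_iff₀ (by linarith)]; nlinarith
      linarith
    have k2 : ‖1 + z i / rootN (n i)‖⁻¹ ≤ 1 / δ * √(n i) := by
      rw [one_add_div_rootN h3, norm_div, inv_div, norm_rootN, one_div_mul_eq_div]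
      gcongr
    linarith [norm_clog_le (1 + z i / rootN (n i)), pi_lt_four]
  have hl2 : Lin l n fun i => ((1 / 2 : ℂ)) * (Real.log a - ((Real.log (n i) : ℝ) : ℂ)) :=
    IsBigO.const_mul_left (IsBigO.sub (lin_const hn (Real.log a)) hlog) _
  refine (((((Lin.natCast.mul hlog).sub (Lin.natCast.sq hn)).add (Lin.mul (IsBigO.sub Lin.natCast hE) hl2)).add
    (hE.mul hl)).add (((lin_const hn (a / 2)).sq hn).sub ((l1.mul l1).const_mul_left (1 / 4) |>.add
      (l3.sq hn)))).congr_left fun i => ?_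
  unfold midExp
  push_cast
  ring

theorem Crude.inv_wave_mid (ha : 0 < a) {ρ : ℝ} (hρ : 0 < ρ) (hz4 : ∀ᶠ i in l, |(z i).re| ≤ 2 * √a - ρ) :
    Crude l n fun i => (wave (midAmp 1 a (n i)) (midPhase 1 a (n i)) (z i))⁻¹ := by
  obtain ⟨c, hc, C, hC, H⟩ := exists_midPhase_im ha hρ
  have hN : ∀ᶠ i in l, C / c ≤ √(n i) :=
    (tendsto_sqrt_atTop.comp (tendsto_natCast_atTop_atTop.comp hn)).eventually_ge_atTop _
  have hq : Lin l n fun i => sqrt (4 * a - z i ^ 2) := by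
    refine Lin.of_le hn (C := 1) (B := B + 1 + 2 * √a) (by positivity) ?_
    filter_upwards [norm_le_of_strip hδ hB hz hz2 hz3] with i h1
    have h2 : ‖sqrt (4 * a - z i ^ 2)‖ ^ 2 ≤ (‖z i‖ + 2 * √a) ^ 2 := by
      rw [← norm_pow, csqrt_sq]
      refine (norm_sub_le _ _).trans ?_
      rw [norm_mul, norm_pow, Complex.norm_of_nonneg ha.le, show ‖(4 : ℂ)‖ = 4 by norm_num]
      nlinarith [sq_sqrt ha.le, norm_nonneg (z i), mul_nonneg (norm_nonneg (z i)) (sqrt_nonneg a)]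
    linarith [(abs_le_of_sq_le_sq' h2 (by positivity)).2]
  refine Crude.inv_wave hn hδ hz (isBigO_midExp hn hδ hB hz hz2 hz3 a) hq ?_ ?_
  · filter_upwards [hz3, hz4, hN, hn.eventually_ge_atTop 1] with i h1 h2 h3 h4
    rw [div_le_iff₀ hc] at h3
    have hn1 : (1 : ℝ) ≤ n i := by exact_mod_cast h4
    have key : ∀ y : ℂ, |y.re| ≤ 2 * √a - ρ → 0 ≤ y.im → y.im ≤ 1 →
        |(midPhase 1 a (n i) y).im| ≤ 4 * (n i : ℝ) ^ 2 := by
      intro y k1 k2 k3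
      have k4 := H (n i) y k1 k2 k3
      have k5 : 0 ≤ (c * √(n i) - C) * y.im := mul_nonneg (by linarith) k2
      have k6 : π * √(n i) * y.im ≤ 4 * (n i : ℝ) ^ 2 := by
        calc π * √(n i) * y.im ≤ 4 * (n i) * 1 := by
              gcongr
              · exact pi_lt_four.le
              · exact sqrt_natCast_le _
          _ ≤ _ := by nlinarith
      rw [abs_le]
      constructor <;> nlinarith
    rw [abs_le] at h1
    rcases le_total 0 (z i).im with h5 | h5
    · exact key _ h2 h5 h1.2
    · have := key (starRingEnd ℂ (z i)) (by simpa using h2) (by simpa using h5) (by simp; linarith)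
      rwa [midPhase_conj ha (by linarith), conj_im, abs_neg] at this
  · filter_upwards [hz, hn.eventually_ge_atTop 1] with i h1 h2
    exact midAmp_eq ha h2 (by linarith)

theorem Crude.inv_wave_left (ha : 0 < a) {ρ : ℝ} (hρ : 0 < ρ) (hz4 : ∀ᶠ i in l, (z i).re ≤ -(2 * √a) - ρ) :
    Crude l n fun i => (wave (leftAmp 1 a (n i)) (leftPhase 1 a (n i)) (z i))⁻¹ := by
  obtain ⟨l1, l2, l3⟩ := lin_strip hn hδ hB hz hz2 hz3
  have hsa : 0 < √a := sqrt_pos.mpr ha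
  have hq' : ∀ᶠ i in l, ‖rootLeft a (z i)‖ ≤ ‖z i‖ + 2 * √a := by
    refine Eventually.of_forall fun i => ?_
    have h2 : ‖rootLeft a (z i)‖ ^ 2 ≤ (‖z i‖ + 2 * √a) ^ 2 := by
      rw [← norm_pow, rootLeft_sq ha]
      refine (norm_sub_le _ _).trans ?_
      rw [norm_mul, norm_pow, Complex.norm_of_nonneg ha.le, show ‖(4 : ℂ)‖ = 4 by norm_num]
      nlinarith [sq_sqrt ha.le, norm_nonneg (z i), mul_nonneg (norm_nonneg (z i)) (sqrt_nonneg a)]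
    exact (abs_le_of_sq_le_sq' h2 (by positivity)).2
  have hs := norm_le_of_strip hδ hB hz hz2 hz3
  have hq : Lin l n fun i => rootLeft a (z i) := by
    refine Lin.of_le hn (C := 1) (B := B + 1 + 2 * √a) (by positivity) ?_
    filter_upwards [hs, hq'] with i h1 h2
    linarith
  have hlZ : Lin l n fun i => log (leftZ a (z i)) := by
    refine Lin.of_le hn (C := 1 / √a) (B := (B + 1) / √a + 6) (by positivity) ?_
    filter_upwards [hs, hq', hz4] with i h1 h2 h3
    have hr := rootLeft_re_pos (a := a) (z := z i) (by linarith)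
    have k1 : ‖leftZ a (z i)‖ ≤ 1 / √a * √(n i) + (B + 1) / √a + 1 := by
      unfold leftZ
      rw [div_two_rootA, norm_div, Complex.norm_of_nonneg (by positivity), div_le_iff₀ (by positivity)]
      have := norm_add_le (-z i) (rootLeft a (z i))
      rw [norm_neg] at this
      have e : (1 / √a * √(n i) + (B + 1) / √a + 1) * (2 * √a) = 2 * (√(n i) + (B + 1)) + 2 * √a := by field_simp
      linarith
    have k2 : 1 ≤ ‖leftZ a (z i)‖ := by
      refine le_trans ?_ (re_le_norm _)
      unfold leftZ
      rw [div_two_rootA, div_ofReal_re, le_div_iff₀ (by positivity), add_re, neg_re]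
      linarith
    linarith [norm_clog_le (leftZ a (z i)), pi_lt_four, inv_le_one_of_one_le₀ k2]
  have hW : (fun i => leftW a (n i) (z i)) =O[l] fun i => (n i : ℝ) ^ 2 := by
    have h1 : Lin l n fun i => -((a : ℂ) + rootN (n i) * z i) := IsBigO.neg_left ((lin_const hn a).add l3)
    have h2 : Lin l n fun i => (1 / 4 : ℂ) * (z i + 4 * rootN (n i)) :=
      IsBigO.const_mul_left (IsBigO.add l1 (IsBigO.const_mul_left l2 _)) _
    refine ((h1.mul hlZ).sub (h2.mul hq)).congr_left fun i => ?_
    unfold leftW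
    ring
  refine Crude.inv_wave hn hδ hz ((isBigO_midExp hn hδ hB hz hz2 hz3 a).add hW) hq ?_ ?_
  · filter_upwards [hz3, hn.eventually_ge_atTop 1] with i h1 h2
    have hn1 : (1 : ℝ) ≤ n i := by exact_mod_cast h2
    have e : (leftPhase 1 a (n i) (z i)).im = -(π * (√(n i) * (z i).im)) := by
      unfold leftPhase rootN
      rw [im_ofReal_mul]
      simp
    rw [e, abs_neg, abs_mul, abs_mul, abs_of_pos pi_pos, abs_of_nonneg (sqrt_nonneg _)]
    calc _ ≤ 4 * ((n i : ℝ) * 1) := by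
          gcongr
          · exact pi_lt_four.le
          · exact sqrt_natCast_le _
      _ ≤ _ := by nlinarith
  · filter_upwards [hz, hz4, hn.eventually_ge_atTop 1] with i h1 h2 h3
    exact leftAmp_eq ha h3 (by linarith) (by linarith)

end

end

section

theorem cosh_re (w : ℂ) : (cosh w).re = Real.cosh w.re * Real.cos w.im := by
  rw [cosh, cosh_eq]
  have : (2 : ℂ) = ((2 : ℝ) : ℂ) := by norm_num
  rw [this, div_ofReal_re, add_re, exp_re, exp_re]
  simp
  ring

theorem norm_le_of_rectangle {f : ℂ → ℂ} {z₀ : ℂ} {ε κ M r r₁ r₂ : ℝ} (hε : 0 < ε) (hr : 0 ≤ r)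
    (hr₁ : r₁ ≤ z₀.re - r) (hr₂ : z₀.re + r ≤ r₂)
    (hf : ∀ z : ℂ, r₁ ≤ z.re → z.re ≤ r₂ → |z.im| ≤ ε → DifferentiableAt ℂ f z)
    (htop : ∀ z : ℂ, r₁ ≤ z.re → z.re ≤ r₂ → |z.im| = ε → ‖f z‖ ≤ κ)
    (hside : ∀ z : ℂ, z.re = r₁ ∨ z.re = r₂ → |z.im| ≤ ε → ‖f z‖ ≤ M) (hκ : 0 ≤ κ) (hlt : r₁ < r₂)
    (hM : M * rexp (-(Real.cosh (π / (4 * ε) * r) / 2)) ≤ κ) (hz₀ : |z₀.im| ≤ ε) :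
    ‖f z₀‖ ≤ 3 * κ := by
  have hpi := pi_pos
  set c := π / (4 * ε) with hc
  have hc0 : 0 < c := by positivity
  set W : ℂ → ℂ := fun z => c * (z - z₀.re) with hW
  set g : ℂ → ℂ := fun z => f z * exp (-cosh (W z)) with hg
  have hWre : ∀ z, (W z).re = c * (z.re - z₀.re) := fun z => by simp [hW]
  have hWim : ∀ z, (W z).im = c * z.im := fun z => by simp [hW]
  have hcos : ∀ z : ℂ, |z.im| ≤ ε → 1 / 2 ≤ Real.cos (W z).im := by
    intro z hz
    rw [← Real.cos_abs, hWim, abs_mul, abs_of_pos hc0, ← Real.cos_pi_div_three]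
    refine Real.cos_le_cos_of_nonneg_of_le_pi (by positivity) (by linarith) ?_
    calc c * |z.im| ≤ c * ε := by gcongr
      _ = π / 4 := by rw [hc]; field_simp
      _ ≤ _ := by linarith
  have hgn : ∀ z, ‖g z‖ = ‖f z‖ * rexp (-(Real.cosh (c * (z.re - z₀.re)) * Real.cos (W z).im)) := by
    intro z
    simp only [hg]
    rw [norm_mul, norm_exp, neg_re, cosh_re, hWre]
  have hε' : -ε < ε := by linarith
  have hcl : closure (Set.Ioo r₁ r₂ ×ℂ Set.Ioo (-ε) ε) = Set.Icc r₁ r₂ ×ℂ Set.Icc (-ε) ε := by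
    rw [closure_reProdIm, closure_Ioo hlt.ne, closure_Ioo hε'.ne]
  have hdiff : DiffContOnCl ℂ g (Set.Ioo r₁ r₂ ×ℂ Set.Ioo (-ε) ε) := by
    refine DifferentiableOn.diffContOnCl fun z hz => DifferentiableAt.differentiableWithinAt ?_
    rw [hcl, mem_reProdIm] at hz
    have h1 : DifferentiableAt ℂ (fun z => exp (-cosh (W z))) z := by simp only [hW]; fun_prop
    exact (hf z hz.1.1 hz.1.2 (abs_le.mpr hz.2)).mul h1
  have hb : Bornology.IsBounded (Set.Ioo r₁ r₂ ×ℂ Set.Ioo (-ε) ε) :=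
    (Metric.isBounded_Ioo r₁ r₂).reProdIm (Metric.isBounded_Ioo (-ε) ε)
  have hz₀' : z₀ ∈ closure (Set.Ioo r₁ r₂ ×ℂ Set.Ioo (-ε) ε) := by
    rw [hcl, mem_reProdIm]
    exact ⟨⟨by linarith, by linarith⟩, abs_le.mp hz₀⟩
  have hmain := norm_le_of_forall_mem_frontier_norm_le (C := κ) hb hdiff (fun z hz => by
    rw [frontier_reProdIm, closure_Ioo hlt.ne, closure_Ioo hε'.ne, frontier_Ioo hlt, frontier_Ioo hε'] at hz
    rw [hgn]
    rcases hz with hz | hz <;> rw [mem_reProdIm] at hz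
    · have him : |z.im| = ε := by
        rcases hz.2 with h | h
        · rw [h, abs_neg, abs_of_pos hε]
        · rw [h, abs_of_pos hε]
      have h1 := hcos z him.le
      refine (mul_le_of_le_one_right (norm_nonneg _) (Real.exp_le_one_iff.mpr ?_)).trans (htop z hz.1.1 hz.1.2 him)
      have := cosh_pos (c * (z.re - z₀.re))
      nlinarith
    · have him : |z.im| ≤ ε := abs_le.mpr hz.2
      have h1 := hcos z him
      have h2 := hside z hz.1 him
      refine le_trans ?_ hM
      have h3 : Real.cosh (c * r) ≤ Real.cosh (c * (z.re - z₀.re)) := by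
        rw [Real.cosh_le_cosh, abs_of_nonneg (by positivity), abs_mul, abs_of_pos hc0]
        gcongr
        rcases hz.1 with h | h
        · rw [h, abs_of_nonpos (by linarith)]; linarith
        · rw [h, abs_of_nonneg (by linarith)]; linarith
      have h4 := cosh_pos (c * r)
      have hM0 := (norm_nonneg _).trans h2
      gcongr
      nlinarith) hz₀'
  have h1 := hgn z₀
  rw [sub_self, mul_zero, Real.cosh_zero, one_mul] at h1
  rw [h1, Real.exp_neg] at hmain
  have h2 : rexp (Real.cos (W z₀).im) ≤ 3 :=
    (exp_le_exp.mpr (Real.cos_le_one _)).trans (by linarith [exp_one_lt_d9])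
  rw [← div_eq_mul_inv, div_le_iff₀ (exp_pos _)] at hmain
  nlinarith

theorem eventually_exp_cosh_le {c : ℝ} (hc : 0 < c) (C : ℝ) {κ : ℝ} (hκ : 0 < κ) : ∀ᶠ t : ℝ in atTop,
    rexp (C * t ^ 80) * rexp (-(Real.cosh (c * t) / 2)) ≤ κ := by
  have h1 := (isLittleO_pow_exp_pos_mul_atTop 80 hc).bound (c := 1 / (4 * (|C| + 1))) (by positivity)
  have h2 := (tendsto_exp_neg_atTop_nhds_zero.eventually (ge_mem_nhds hκ))
  filter_upwards [h1, h2, eventually_ge_atTop 1] with t h3 h4 h5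
  refine le_trans ?_ h4
  rw [← Real.exp_add, exp_le_exp]
  rw [norm_of_nonneg (by positivity), norm_of_nonneg (exp_pos _).le, one_div,
    inv_mul_eq_div, le_div_iff₀ (by positivity)] at h3
  have h6 : rexp (c * t) / 2 ≤ Real.cosh (c * t) := by rw [cosh_eq]; linarith [exp_pos (-(c * t))]
  have h7 : t ≤ t ^ 80 := le_self_pow₀ h5 (by norm_num)
  have h8 : 0 ≤ t ^ 80 := by positivity
  nlinarith [mul_le_mul_of_nonneg_right (le_abs_self C) h8]

theorem exists_half_int {p q : ℝ} (h : p + 1 ≤ q) : ∃ k : ℤ, p ≤ k + 1 / 2 ∧ (k : ℝ) + 1 / 2 ≤ q :=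
  ⟨⌈p - 1 / 2⌉, by linarith [Int.le_ceil (p - 1 / 2)], by linarith [Int.ceil_lt_add_one (p - 1 / 2)]⟩

variable {a b : ℝ} {m n : ℕ} {A θ : ℂ → ℂ} {z : ℂ}

theorem xAt_conj (n : ℕ) (z : ℂ) : xAt n (conj z) = conj (xAt n z) := by simp [xAt, rootN]

/-- One part of `π_n` relative to one of the two exponentials. -/
def relTwo (a b : ℝ) (m n : ℕ) (A θ : ℂ → ℂ) (z : ℂ) : ℂ := gTwo a b m (xAt n z) n / wave A θ z

/-- `π_n` relative to the other exponential. -/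
def relOne (a b : ℝ) (n : ℕ) (A θ : ℂ → ℂ) (z : ℂ) : ℂ := piAt 1 a b n z / (A z * exp (I * θ z))

theorem conj_relTwo_conj (ha : 0 < a) (hm : 0 < m + 1 + b / a) (hx : 0 < (xAt n z).re + a + b / a + 1)
    (hn : m ≤ n) (h : RegularPair A θ z) : conj (relTwo a b m n A θ (conj z))
      = relOne a b n A θ z - relTwo a b m n A θ z * exp (-(2 * I * θ z)) := by
  have h1 := piSeq_eq ha hm hx hn
  have h0 := h.ne_zero
  have h2 := exp_ne_zero (I * θ z)
  unfold relTwo relOne wave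
  rw [piAt_one, show (piPoly 1 a b n).eval (xAt n z) = piSeq a b (xAt n z) n from rfl, h1, h.amp_conj,
    h.phase_conj, map_div₀, map_mul, conj_conj, ← exp_conj, map_neg, map_mul, conj_conj,
    conj_I, xAt_conj, neg_mul, neg_neg, exp_neg, exp_neg,
    show 2 * I * θ z = I * θ z + I * θ z by ring, exp_add]
  field_simp
  ring

theorem norm_exp_I_mul_le (w : ℂ) : ‖exp (I * w)‖ ≤ rexp |w.im| ∧ ‖exp (-(I * w))‖ ≤ rexp |w.im| := by
  rw [norm_exp, norm_exp, neg_re, I_mul_re, neg_neg]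
  exact ⟨exp_le_exp.mpr (neg_le_abs _), exp_le_exp.mpr (le_abs_self _)⟩

theorem two_cos_eq (w : ℂ) : 2 * cos w = exp (I * w) + exp (-(I * w)) := by
  rw [two_cos, mul_comm w, ← neg_mul_eq_neg_mul, mul_comm w]

theorem norm_sub_cos_le_of_center (ha : 0 < a) (hm : 0 < m + 1 + b / a)
    (hx : 0 < (xAt n z).re + a + b / a + 1) (hn : m ≤ n) (h : RegularPair A θ z) {κ : ℝ}
    (h1 : ‖relTwo a b m n A θ z - 1‖ ≤ κ) (h2 : ‖relTwo a b m n A θ (conj z) - 1‖ ≤ κ) :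
    ‖piAt 1 a b n z - A z * (2 * cos (θ z))‖ ≤ 2 * κ * (‖A z‖ * rexp |(θ z).im|) := by
  have h3 := conj_relTwo_conj ha hm hx hn h
  have h4 : ‖conj (relTwo a b m n A θ (conj z)) - 1‖ ≤ κ := by rwa [← map_one conj, ← map_sub, norm_conj]
  have h0 := h.ne_zero
  have h5 := exp_ne_zero (I * θ z)
  have e : piAt 1 a b n z - A z * (2 * cos (θ z)) = A z * (exp (I * θ z) * (conj (relTwo a b m n A θ (conj z)) - 1)
        + exp (-(I * θ z)) * (relTwo a b m n A θ z - 1)) := by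
    rw [h3, two_cos_eq, show -(2 * I * θ z) = -(I * θ z) + -(I * θ z) by ring, exp_add, exp_neg]
    unfold relOne
    field_simp
    ring
  obtain ⟨k1, k2⟩ := norm_exp_I_mul_le (θ z)
  rw [e, norm_mul]
  calc _ ≤ ‖A z‖ * (rexp |(θ z).im| * κ + rexp |(θ z).im| * κ) := by
        gcongr
        refine (norm_add_le _ _).trans ?_
        rw [norm_mul, norm_mul]
        gcongr
    _ = _ := by ring

theorem norm_sub_cos_le_of_upper (h : RegularPair A θ z) {κ : ℝ} (h1 : ‖relOne a b n A θ z - 1‖ ≤ κ)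
    (h2 : rexp (2 * (θ z).im) ≤ κ) :
    ‖piAt 1 a b n z - A z * (2 * cos (θ z))‖ ≤ 2 * κ * (‖A z‖ * rexp |(θ z).im|) := by
  have h0 := h.ne_zero
  have h5 := exp_ne_zero (I * θ z)
  have e : piAt 1 a b n z - A z * (2 * cos (θ z)) = A z * exp (I * θ z)
      * ((relOne a b n A θ z - 1) - exp (-(2 * I * θ z))) := by
    rw [two_cos_eq, show -(2 * I * θ z) = -(I * θ z) + -(I * θ z) by ring, exp_add, exp_neg]
    unfold relOne
    field_simp
    ring
  rw [e, norm_mul, norm_mul]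
  have h3 : ‖exp (-(2 * I * θ z))‖ ≤ κ := by rw [norm_exp]; simpa using h2
  calc _ ≤ ‖A z‖ * rexp |(θ z).im| * (κ + κ) := by
        gcongr
        · exact (norm_exp_I_mul_le (θ z)).1
        · exact (norm_sub_le _ _).trans (add_le_add h1 h3)
    _ = _ := by ring

theorem norm_sub_cos_conj (h : RegularPair A θ z) : ‖piAt 1 a b n (conj z) - A (conj z) * (2 * cos (θ (conj z)))‖
      = ‖piAt 1 a b n z - A z * (2 * cos (θ z))‖
    ∧ ‖A (conj z)‖ * rexp |(θ (conj z)).im| = ‖A z‖ * rexp |(θ z).im| := by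
  have h1 : piAt 1 a b n (conj z) = conj (piAt 1 a b n z) := by
    rw [piAt_one, piAt_one, xAt_conj]
    have := conj_piSeq a b (xAt n z) n
    unfold piSeq at this
    rw [← this, conj_conj]
  rw [h1, h.amp_conj, h.phase_conj, cos_conj, norm_conj, conj_im, abs_neg]
  refine ⟨?_, rfl⟩
  rw [← norm_conj (piAt 1 a b n z - _)]
  simp only [map_sub, map_mul, map_ofNat]

end

section

variable {a b : ℝ} {m : ℕ}

/-- The reciprocal of the height above which the outer asymptotics hold. -/
def level (n : ℕ) : ℝ := (n : ℝ) ^ (1 / 40 : ℝ)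

theorem level_pow (n k : ℕ) : level n ^ (40 * k) = (n : ℝ) ^ k := by
  unfold level
  rw [pow_mul, ← Real.rpow_natCast ((n : ℝ) ^ (1 / 40 : ℝ)) 40, ← Real.rpow_mul (Nat.cast_nonneg n)]
  norm_num

theorem level_pow_twenty (n : ℕ) : √n = level n ^ 20 := by
  have h0 : 0 ≤ level n := rpow_nonneg (Nat.cast_nonneg n) _
  rw [Real.sqrt_eq_iff_eq_sq (Nat.cast_nonneg n) (by positivity), ← pow_mul]
  simpa using (level_pow n 1).symm

theorem tendsto_level : Tendsto level atTop atTop :=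
  (tendsto_rpow_atTop (by norm_num)).comp tendsto_natCast_atTop_atTop

theorem differentiableAt_relTwo (ha : 0 < a) (hm : 0 < m + 1 + b / a) {n : ℕ} {A θ : ℂ → ℂ} {z : ℂ}
    (hx : 0 < (xAt n z).re + a + b / a + 1) (h : RegularPair A θ z) :
    DifferentiableAt ℂ (relTwo a b m n A θ) z := by
  have h1 : DifferentiableAt ℂ (fun z => gTwo a b m (xAt n z) n) z :=
    DifferentiableAt.comp z (differentiableAt_gTwo ha hm hx n)
      (show DifferentiableAt ℂ (fun z => xAt n z) z by unfold xAt; fun_prop)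
  exact h1.div (h.differentiable.mul ((h.differentiable_phase.const_mul _).neg.cexp))
    (mul_ne_zero h.ne_zero (exp_ne_zero _))

theorem uniformCosEquiv_of_relTwo (ha : 0 < a) (hm : 0 ≤ m + b / a) {A θ : ℕ → ℂ → ℂ} {L R : ℕ → ℝ} {δ η : ℝ}
    (hδ : 0 < δ) (hη : 0 < η) (hη1 : η ≤ 1) (hL : ∀ᶠ n : ℕ in atTop, -√n ≤ L n)
    (hreg : ∀ᶠ n in atTop, ∀ z : ℂ, L n + δ / 2 ≤ z.re → z.re ≤ R n - δ / 2 → RegularPair (A n) (θ n) z)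
    (h1 : ∀ κ : ℝ, 0 < κ → ∀ᶠ n in atTop, ∀ z : ℂ, L n + δ / 2 ≤ z.re → z.re ≤ R n - δ / 2 →
      (level n)⁻¹ ≤ z.im → z.im ≤ η → ‖relTwo a b m n (A n) (θ n) z - 1‖ ≤ κ ∧
        ‖relOne a b n (A n) (θ n) z - 1‖ ≤ κ ∧ rexp (2 * (θ n z).im) ≤ κ)
    (h2 : ∃ C : ℝ, ∀ᶠ n in atTop, ∀ z : ℂ, L n + δ / 2 ≤ z.re → z.re ≤ R n - δ / 2 → |z.im| ≤ 1 →
      (∃ k : ℤ, (xAt n z + a).re = k + 1 / 2) → ‖relTwo a b m n (A n) (θ n) z‖ ≤ rexp (C * (n : ℝ) ^ 2)) :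
    UniformCosEquiv (piAt 1 a b) A θ (fun n => box (L n) (R n) δ η) := by
  intro ε₀ hε₀
  obtain ⟨C, hC⟩ := h2
  set κ := min 1 (ε₀ / 18) with hκ
  have hκ0 : 0 < κ := by positivity
  have hκ1 : κ ≤ 1 := min_le_left _ _
  have hκ2 : 18 * κ ≤ ε₀ := by have := min_le_right 1 (ε₀ / 18); linarith
  have hm1 : 0 < m + 1 + b / a := by linarith
  have hsq : Tendsto (fun n : ℕ => √n) atTop atTop := tendsto_sqrt_atTop.comp tendsto_natCast_atTop_atTop
  filter_upwards [hL, hreg, h1 κ hκ0, hC, eventually_ge_atTop (m + 1), tendsto_level.eventually_ge_atTop 1,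
    tendsto_level.eventually_ge_atTop η⁻¹, hsq.eventually_ge_atTop (8 / δ),
    hsq.eventually_ge_atTop (2 * |b / a| / δ),
    tendsto_level.eventually (eventually_exp_cosh_le (c := π * δ / 16) (by positivity) (|C| + 1) hκ0)]
    with n hL hreg h1 hC hn ht1 htη hs1 hs2 hcosh z hz
  have ht : 0 < level n := by linarith
  have hsn : 0 < √n := lt_of_lt_of_le (by positivity) hs1
  rw [div_le_iff₀ hδ] at hs1 hs2
  set ε := (level n)⁻¹ with hε
  have hε0 : 0 < ε := by positivity
  have hεη : ε ≤ η := inv_le_of_inv_le₀ hη htη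
  have hx : ∀ z : ℂ, L n + δ / 2 ≤ z.re → 0 < (xAt n z).re + a + b / a + 1 := by
    intro z hz
    rw [xAt_re]
    have h3 : δ / 2 ≤ √n + z.re := by linarith
    have := mul_le_mul_of_nonneg_left h3 hsn.le
    linarith [neg_abs_le (b / a)]
  have hbot : ∀ z : ℂ, L n + δ / 2 ≤ z.re → z.re ≤ R n - δ / 2 → ε ≤ z.im → z.im ≤ η →
      ‖relTwo a b m n (A n) (θ n) (conj z) - 1‖ ≤ 3 * κ := by
    intro z k1 k2 k3 k4
    obtain ⟨j1, j2, j3⟩ := h1 z k1 k2 k3 k4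
    have e := conj_relTwo_conj ha hm1 (hx z k1) (by omega) (hreg z k1 k2)
    rw [← norm_conj, map_sub, map_one, e]
    have j4 : ‖exp (-(2 * I * θ n z))‖ ≤ κ := by rw [norm_exp]; simpa using j3
    have j5 : ‖relTwo a b m n (A n) (θ n) z‖ ≤ 1 + κ := by
      have := norm_le_norm_add_norm_sub' (relTwo a b m n (A n) (θ n) z) 1
      rw [norm_one] at this; linarith
    rw [sub_right_comm]
    refine (norm_sub_le _ _).trans ?_
    rw [norm_mul]
    have : ‖relTwo a b m n (A n) (θ n) z‖ * ‖exp (-(2 * I * θ n z))‖ ≤ (1 + κ) * κ := by gcongr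
    nlinarith
  have hcen : ∀ z : ℂ, L n + δ ≤ z.re → z.re ≤ R n - δ → |z.im| ≤ ε → ‖relTwo a b m n (A n) (θ n) z - 1‖ ≤ 9 * κ := by
    intro z k1 k2 k3
    have hside : ∀ t : ℝ, ∃ r : ℝ, t ≤ r ∧ r ≤ t + δ / 4 ∧ ∃ k : ℤ, √n * (√n + r) + a = k + 1 / 2 := by
      intro t
      obtain ⟨k, hk1, hk2⟩ := exists_half_int (p := √n * (√n + t) + a)
        (q := √n * (√n + (t + δ / 4)) + a) (by nlinarith)
      refine ⟨(k + 1 / 2 - a) / √n - √n, ?_, ?_, k, by field_simp; ring⟩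
      · rw [le_sub_iff_add_le, le_div_iff₀ hsn]; nlinarith
      · rw [sub_le_iff_le_add, div_le_iff₀ hsn]; nlinarith
    obtain ⟨r₁, p1, p2, kk1, p3⟩ := hside (z.re - δ / 2)
    obtain ⟨r₂, q1, q2, kk2, q3⟩ := hside (z.re + δ / 4)
    have hM : (rexp (C * (n : ℝ) ^ 2) + 1) * rexp (-(Real.cosh (π / (4 * ε) * (δ / 4)) / 2)) ≤ 3 * κ := by
      rw [show π / (4 * ε) * (δ / 4) = π * δ / 16 * level n by rw [hε]; field_simp; norm_num]
      refine le_trans ?_ (hcosh.trans (by linarith))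
      rw [show (80 : ℕ) = 40 * 2 from rfl, level_pow]
      gcongr
      have hn2 : (1 : ℝ) ≤ (n : ℝ) ^ 2 := one_le_pow₀ (by exact_mod_cast (by omega : 1 ≤ n))
      have e1 := add_one_le_exp ((n : ℝ) ^ 2)
      have e2 : rexp (C * (n : ℝ) ^ 2) ≤ rexp (|C| * (n : ℝ) ^ 2) := by gcongr; exact le_abs_self C
      have e3 : 1 ≤ rexp (|C| * (n : ℝ) ^ 2) := Real.one_le_exp (by positivity)
      rw [add_mul, one_mul, Real.exp_add]
      nlinarith
    have := norm_le_of_rectangle (f := fun z => relTwo a b m n (A n) (θ n) z - 1) (z₀ := z) (κ := 3 * κ)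
      (r := δ / 4) (r₁ := r₁) (r₂ := r₂) hε0 (by positivity) (by linarith) (by linarith)
      (fun y y1 y2 _ => (differentiableAt_relTwo ha hm1 (hx y (by linarith))
        (hreg y (by linarith) (by linarith))).sub_const 1)
      (fun y y1 y2 y3 => by
        rcases abs_eq hε0.le |>.mp y3 with y4 | y4
        · exact (h1 y (by linarith) (by linarith) y4.ge (by linarith)).1.trans (by linarith)
        · have := hbot (conj y) (by simp; linarith) (by simp; linarith) (by simp [y4]) (by simp [y4]; linarith)
          rwa [conj_conj] at this)
      (fun y y1 y2 => by
        refine (norm_sub_le _ _).trans ?_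
        rw [norm_one]
        gcongr
        refine hC y ?_ ?_ (by linarith) ?_
        · rcases y1 with h | h <;> rw [h] <;> linarith
        · rcases y1 with h | h <;> rw [h] <;> linarith
        · rcases y1 with h | h
          · exact ⟨kk1, by rw [add_re, xAt_re, h, ofReal_re, p3]⟩
          · exact ⟨kk2, by rw [add_re, xAt_re, h, ofReal_re, q3]⟩)
      (by positivity) (by linarith) hM k3
    linarith
  obtain ⟨hz1, hz2, hz3⟩ := hz
  have hr := hreg z (by linarith) (by linarith)
  have hup : ∀ y : ℂ, L n + δ ≤ y.re → y.re ≤ R n - δ → ε ≤ y.im → y.im ≤ η →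
      ‖piAt 1 a b n y - A n y * (2 * cos (θ n y))‖ ≤ ε₀ * (‖A n y‖ * rexp |(θ n y).im|) := by
    intro y y1 y2 y3 y4
    obtain ⟨-, j2, j3⟩ := h1 y (by linarith) (by linarith) y3 y4
    refine (norm_sub_cos_le_of_upper (hreg y (by linarith) (by linarith)) j2 j3).trans ?_
    gcongr
    linarith
  rcases le_total |z.im| ε with h3 | h3
  · refine (norm_sub_cos_le_of_center ha hm1 (hx z (by linarith)) (by omega) hr (hcen z hz1 hz2 h3)
      (hcen (conj z) (by simpa using hz1) (by simpa using hz2) (by simpa using h3))).trans ?_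
    gcongr
    linarith
  · rcases le_abs.mp h3 with h4 | h4
    · exact hup z hz1 hz2 h4 ((le_abs_self _).trans hz3)
    · have h5 := hup (conj z) (by simpa using hz1) (by simpa using hz2) (by simpa using h4)
        (by simpa using (neg_le_abs _).trans hz3)
      obtain ⟨e1, e2⟩ := norm_sub_cos_conj (b := b) (n := n) hr (a := a)
      rwa [e1, e2] at h5

/-- Uniform convergence along all points of the sets `S n`. -/
def unif (S : ℕ → Set ℂ) : Filter (ℕ × ℂ) := comap Prod.fst atTop ⊓ 𝓟 {p | p.2 ∈ S p.1}

theorem eventually_unif {S : ℕ → Set ℂ} {P : ℕ → ℂ → Prop} :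
    (∀ᶠ p in unif S, P p.1 p.2) ↔ ∀ᶠ n in atTop, ∀ z ∈ S n, P n z := by
  unfold unif
  rw [eventually_inf_principal, eventually_comap]
  exact ⟨fun h => h.mono fun n hn z hz => hn (n, z) rfl hz, fun h => h.mono fun n hn p hp hz => by
    subst hp; exact hn p.2 hz⟩

theorem tendsto_fst_unif (S : ℕ → Set ℂ) : Tendsto Prod.fst (unif S) atTop := tendsto_comap.mono_left inf_le_left

theorem edge_unif {δ B : ℝ} (hδ : 0 < δ) {S : ℕ → Set ℂ} (hS : ∀ᶠ n in atTop, ∀ z ∈ S n,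
    -√n + δ ≤ z.re ∧ z.re ≤ B ∧ (level n)⁻¹ ≤ z.im ∧ z.im ≤ 1) :
    Edge δ (unif S) (fun p => level p.1) Prod.fst (fun p => xAt p.1 p.2) := by
  have h0 := tendsto_fst_unif S
  have h1 : ∀ᶠ p in unif S, -√p.1 + δ ≤ p.2.re ∧ p.2.re ≤ B ∧ (level p.1)⁻¹ ≤ p.2.im ∧ p.2.im ≤ 1 :=
    eventually_unif.mpr hS
  have h2 := (tendsto_level.comp h0).eventually_ge_atTop 1
  refine ⟨hδ, tendsto_level.comp h0, Eventually.of_forall fun p => level_pow_twenty _, ?_, ?_, ?_, ?_⟩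
  · filter_upwards [h1, h2] with p h3 h4
    simp only [Function.comp_apply] at h4
    rw [xAt_im, level_pow_twenty]
    calc level p.1 ^ 19 = level p.1 ^ 20 * (level p.1)⁻¹ := by field_simp
      _ ≤ _ := by gcongr; exact h3.2.2.1
  · filter_upwards [h1, h2] with p h3 h4
    simp only [Function.comp_apply] at h4
    rw [xAt_im, level_pow_twenty]
    exact mul_le_of_le_one_right (by positivity) h3.2.2.2
  · filter_upwards [h1, h2] with p h3 h4
    simp only [Function.comp_apply] at h4
    rw [xAt_re, ← level_pow_twenty, mul_comm]
    gcongr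
    linarith
  · have h5 : Tendsto (fun p : ℕ × ℂ => √p.1) (unif S) atTop :=
      (tendsto_sqrt_atTop.comp tendsto_natCast_atTop_atTop).comp h0
    filter_upwards [h1, h5.eventually_ge_atTop B] with p h3 h4
    rw [xAt_re, show level p.1 ^ 40 = √p.1 * √p.1 by rw [level_pow_twenty, ← pow_add]]
    nlinarith [sqrt_nonneg p.1]

end

section

variable {a b : ℝ}

theorem eventually_relTwo {m : ℕ} {A θ : ℕ → ℂ → ℂ} {L R : ℕ → ℝ} {δ η B : ℝ} (ha : 0 < a) (hδ : 0 < δ) (hη1 : η ≤ 1)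
    (hL : ∀ᶠ n : ℕ in atTop, -√n ≤ L n) (hR : ∀ n, R n - δ / 2 ≤ B)
    (hout : ∀ᶠ n in atTop, ∀ z : ℂ, L n + δ / 2 ≤ z.re → z.re ≤ R n - δ / 2 → 0 < z.im →
      outerApprox 1 a n z = A n z * exp (I * θ n z))
    (hrec : ∀ S : ℕ → Set ℂ, (∀ n, ∀ z ∈ S n, L n + δ / 2 ≤ z.re ∧ z.re ≤ R n - δ / 2 ∧ 0 ≤ z.im ∧ z.im ≤ η) →
      Edge (δ / 2) (unif S) (fun p => level p.1) Prod.fst (fun p => xAt p.1 p.2) →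
      Tendsto (fun p => gTwo a b m (xAt p.1 p.2) p.1 / wave (A p.1) (θ p.1) p.2) (unif S) (𝓝 1) ∧
        Tendsto (fun p => rexp (2 * (θ p.1 p.2).im)) (unif S) (𝓝 0)) {κ : ℝ} (hκ : 0 < κ) :
    ∀ᶠ n in atTop, ∀ z : ℂ, L n + δ / 2 ≤ z.re → z.re ≤ R n - δ / 2 → (level n)⁻¹ ≤ z.im → z.im ≤ η →
      ‖relTwo a b m n (A n) (θ n) z - 1‖ ≤ κ ∧ ‖relOne a b n (A n) (θ n) z - 1‖ ≤ κ ∧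
        rexp (2 * (θ n z).im) ≤ κ := by
  set S : ℕ → Set ℂ := fun n => {z | L n + δ / 2 ≤ z.re ∧ z.re ≤ R n - δ / 2 ∧ (level n)⁻¹ ≤ z.im ∧ z.im ≤ η} with hS
  have hlev : ∀ n : ℕ, 0 ≤ (level n)⁻¹ := fun n => inv_nonneg.mpr (rpow_nonneg (Nat.cast_nonneg n) _)
  have hE : Edge (δ / 2) (unif S) (fun p => level p.1) Prod.fst (fun p => xAt p.1 p.2) := by
    refine edge_unif (B := B) (by positivity) ?_
    filter_upwards [hL] with n h1 z hz
    exact ⟨by linarith [hz.1], hz.2.1.trans (hR n), hz.2.2.1, hz.2.2.2.trans hη1⟩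
  obtain ⟨h1, h2⟩ := hrec S (fun n z hz => ⟨hz.1, hz.2.1, (hlev n).trans hz.2.2.1, hz.2.2.2⟩) hE
  have h3 := hE.tendsto_outer ha b
  have key : ∀ {f : ℕ × ℂ → ℂ}, Tendsto f (unif S) (𝓝 1) → ∀ᶠ p in unif S, ‖f p - 1‖ ≤ κ := fun hf =>
    ((tendsto_iff_norm_sub_tendsto_zero.mp hf).eventually_lt_const hκ).mono fun _ h => h.le
  have k1 := eventually_unif (P := fun n z => ‖gTwo a b m (xAt n z) n / wave (A n) (θ n) z - 1‖ ≤ κ) |>.mp (key h1)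
  have k2 := eventually_unif (P := fun n z => rexp (2 * (θ n z).im) < κ) |>.mp (h2.eventually_lt_const hκ)
  have k3 := eventually_unif (P := fun n z => ‖piSeq a b (xAt n z) n / outerApprox 1 a n z - 1‖ ≤ κ) |>.mp (key h3)
  filter_upwards [k1, k2, k3, hout, tendsto_level.eventually_gt_atTop 0] with n k1 k2 k3 k4 k5 z z1 z2 z3 z4
  have hz : z ∈ S n := ⟨z1, z2, z3, z4⟩
  refine ⟨k1 z hz, ?_, (k2 z hz).le⟩
  have := k3 z hz
  rwa [k4 z z1 z2 ((inv_pos.mpr k5).trans_le z3), piSeq, ← piAt_one] at this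

theorem exists_norm_relTwo_le {m : ℕ} {A θ : ℕ → ℂ → ℂ} {L R : ℕ → ℝ} {δ B : ℝ} (ha : 0 < a) (hm : 0 ≤ m + b / a)
    (hδ : 0 < δ) (hB : 0 ≤ B) (hL : ∀ᶠ n : ℕ in atTop, -√n ≤ L n) (hR : ∀ n, R n - δ / 2 ≤ B)
    (hinv : ∀ S : ℕ → Set ℂ, (∀ n, ∀ z ∈ S n, L n + δ / 2 ≤ z.re ∧ z.re ≤ R n - δ / 2 ∧ |z.im| ≤ 1) →
      Crude (unif S) Prod.fst fun p => (wave (A p.1) (θ p.1) p.2)⁻¹) :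
    ∃ C : ℝ, ∀ᶠ n in atTop, ∀ z : ℂ, L n + δ / 2 ≤ z.re → z.re ≤ R n - δ / 2 → |z.im| ≤ 1 →
      (∃ k : ℤ, (xAt n z + a).re = k + 1 / 2) → ‖relTwo a b m n (A n) (θ n) z‖ ≤ rexp (C * (n : ℝ) ^ 2) := by
  set S : ℕ → Set ℂ := fun n => {z | L n + δ / 2 ≤ z.re ∧ z.re ≤ R n - δ / 2 ∧ |z.im| ≤ 1 ∧
    ∃ k : ℤ, (xAt n z + a).re = k + 1 / 2} with hS
  have hn := tendsto_fst_unif S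
  have hmem : ∀ᶠ p in unif S, p.2 ∈ S p.1 := eventually_unif (P := fun n z => z ∈ S n) |>.mpr
    (Eventually.of_forall fun n z hz => hz)
  have hre : ∀ᶠ p in unif S, -√p.1 + δ / 2 ≤ p.2.re := by
    filter_upwards [hmem, hn.eventually hL] with p h1 h2
    linarith [h1.1]
  have hx : Lin (unif S) Prod.fst fun p => xAt p.1 p.2 :=
    Lin.natCast.add (lin_strip hn (half_pos hδ) hB hre (hmem.mono fun p h => h.2.1.trans (hR _))
      (hmem.mono fun p h => h.2.2.1)).2.2
  have h1 : ∀ᶠ p in unif S, 1 ≤ (xAt p.1 p.2 + (a + b / a + 1)).re := by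
    have hsq : Tendsto (fun p : ℕ × ℂ => √p.1) (unif S) atTop :=
      tendsto_sqrt_atTop.comp (tendsto_natCast_atTop_atTop.comp hn)
    filter_upwards [hre, hsq.eventually_ge_atTop (2 * |b / a| / δ)] with p h1 h2
    rw [div_le_iff₀ hδ] at h2
    have e : (xAt p.1 p.2 + (a + b / a + 1)).re = (xAt p.1 p.2).re + (a + b / a + 1) := by
      rw [add_re, ← ofReal_re (a + b / a + 1)]; push_cast; rfl
    rw [e, xAt_re]
    nlinarith [neg_abs_le (b / a), mul_le_mul_of_nonneg_left (show δ / 2 ≤ √p.1 + p.2.re by linarith)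
      (sqrt_nonneg p.1)]
  obtain ⟨C, hC⟩ := (crude_gTwo hm hn hx h1 (hmem.mono fun p h => h.2.2.2)).mul
    (hinv S fun n z hz => ⟨hz.1, hz.2.1, hz.2.2.1⟩)
  refine ⟨C, (eventually_unif (P := fun n z => ‖gTwo a b m (xAt n z) n * (wave (A n) (θ n) z)⁻¹‖
    ≤ rexp (C * (n : ℝ) ^ 2)) |>.mp hC).mono fun n hn z z1 z2 z3 z4 => ?_⟩
  rw [relTwo, div_eq_mul_inv]
  exact hn z ⟨z1, z2, z3, z4⟩

theorem exists_natCast_add_nonneg (a b : ℝ) : ∃ m : ℕ, 0 ≤ m + b / a := by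
  obtain ⟨m, hm⟩ := exists_nat_ge |b / a|
  exact ⟨m, by linarith [neg_abs_le (b / a)]⟩

theorem tendsto_sqrt_natCast : Tendsto (fun n : ℕ => √n) atTop atTop :=
  tendsto_sqrt_atTop.comp tendsto_natCast_atTop_atTop

theorem eventually_unif_of_mem {S : ℕ → Set ℂ} {P : ℕ × ℂ → Prop} (h : ∀ n, ∀ z ∈ S n, P (n, z)) :
    ∀ᶠ p in unif S, P p :=
  eventually_unif (P := fun n z => P (n, z)) |>.mpr (Eventually.of_forall h)

theorem xAt_re_pos {n : ℕ} {z : ℂ} (hn : 1 ≤ n) (hz : -√n < z.re) : 0 < (xAt n z).re := by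
  rw [xAt_re]
  exact mul_pos (sqrt_pos.mpr (by exact_mod_cast hn)) (by linarith)

theorem uniformCosEquiv_mid_one (ha : 0 < a) (b : ℝ) {δ : ℝ} (hδ : 0 < δ) :
    UniformCosEquiv (piAt 1 a b) (midAmp 1 a) (midPhase 1 a) (fun _ => box (-(2 * √a)) (2 * √a) δ 1) := by
  obtain ⟨m, hm⟩ := exists_natCast_add_nonneg a b
  have hsa := sqrt_nonneg a
  have hL : ∀ᶠ n : ℕ in atTop, -√n ≤ -(2 * √a) :=
    (tendsto_sqrt_natCast.eventually_ge_atTop (2 * √a)).mono fun n h => by linarith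
  have hB : ∀ _ : ℕ, 2 * √a - δ / 2 ≤ 2 * √a := fun _ => by linarith
  have habs : ∀ z : ℂ, -(2 * √a) + δ / 2 ≤ z.re → z.re ≤ 2 * √a - δ / 2 →
      |z.re| ≤ 2 * √a - δ / 2 := fun z h1 h2 => abs_le.mpr ⟨by linarith, h2⟩
  refine uniformCosEquiv_of_relTwo ha hm hδ one_pos le_rfl hL ?_
    (fun κ hκ => eventually_relTwo ha hδ le_rfl hL hB ?_ (fun S hS hE => ?_) hκ)
    (exists_norm_relTwo_le ha hm hδ (by positivity) hL hB fun S hS => ?_)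
  · filter_upwards [hL, eventually_ge_atTop 1] with n h1 hn z z1 z2
    exact regularPair_mid ha hn (by linarith) (by linarith [habs z z1 z2])
  · filter_upwards [hL, eventually_ge_atTop 1] with n h1 hn z z1 z2 z3
    exact outerApprox_eq_mid ha hn z3 (xAt_re_pos hn (by linarith))
  · exact hE.tendsto_gTwo_mid ha b (by linarith) (half_pos hδ)
      (eventually_unif_of_mem fun n z hz => habs z (hS n z hz).1 (hS n z hz).2.1)
      (eventually_unif_of_mem fun n z hz => (hS n z hz).2.2.2)
  · refine Crude.inv_wave_mid (tendsto_fst_unif S) (half_pos hδ) (by positivity) ?_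
      (eventually_unif_of_mem fun n z hz => (hS n z hz).2.1.trans (hB n))
      (eventually_unif_of_mem fun n z hz => (hS n z hz).2.2) ha (half_pos hδ)
      (eventually_unif_of_mem fun n z hz => habs z (hS n z hz).1 (hS n z hz).2.1)
    exact eventually_unif (P := fun n z => -√n + δ / 2 ≤ z.re) |>.mpr
      (hL.mono fun n h z hz => by linarith [(hS n z hz).1])

theorem exists_uniformCosEquiv_left_one (ha : 0 < a) (b : ℝ) {δ : ℝ} (hδ : 0 < δ) : ∃ η : ℝ, 0 < η ∧
    UniformCosEquiv (piAt 1 a b) (leftAmp 1 a) (leftPhase 1 a) (fun n => box (-√n) (-(2 * √a)) δ η) := by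
  obtain ⟨m, hm⟩ := exists_natCast_add_nonneg a b
  obtain ⟨c, hc, η, hη, hη1, hK⟩ := exists_leftK_re_le ha (half_pos hδ)
  have hsa := sqrt_nonneg a
  have hL : ∀ᶠ n : ℕ in atTop, -√n ≤ -√n := Eventually.of_forall fun n => le_rfl
  have hB : ∀ _ : ℕ, -(2 * √a) - δ / 2 ≤ 0 := fun _ => by linarith
  refine ⟨η, hη, uniformCosEquiv_of_relTwo ha hm hδ hη hη1 hL ?_
    (fun κ hκ => eventually_relTwo ha hδ hη1 hL hB ?_ (fun S hS hE => ?_) hκ)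
    (exists_norm_relTwo_le ha hm hδ le_rfl hL hB fun S hS => ?_)⟩
  · filter_upwards [eventually_ge_atTop 1] with n hn z z1 z2
    exact regularPair_left ha hn (by linarith) (by linarith)
  · filter_upwards [eventually_ge_atTop 1] with n hn z z1 z2 z3
    exact outerApprox_eq_left ha hn z3 (by linarith) (xAt_re_pos hn (by linarith))
  · refine hE.tendsto_gTwo_left ha b (by linarith) (half_pos hδ) hc
      (eventually_unif_of_mem fun n z hz => (hS n z hz).2.1)
      (eventually_unif_of_mem fun n z hz => (hS n z hz).2.2.2.trans hη1) ?_
    exact eventually_unif (P := fun n z => (leftK a n z).re ≤ -(c * √n)) |>.mpr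
      ((eventually_ge_atTop 1).mono fun n hn z hz => hK n z hn (by linarith [(hS n z hz).1]) (hS n z hz).2.1
        (hS n z hz).2.2.1 (hS n z hz).2.2.2)
  · exact Crude.inv_wave_left (tendsto_fst_unif S) (half_pos hδ) le_rfl
      (eventually_unif_of_mem fun n z hz => (hS n z hz).1)
      (eventually_unif_of_mem fun n z hz => (hS n z hz).2.1.trans (hB n))
      (eventually_unif_of_mem fun n z hz => (hS n z hz).2.2) ha (half_pos hδ)
      (eventually_unif_of_mem fun n z hz => (hS n z hz).2.1)

theorem UniformCosEquiv.scale {f f' G G' Θ Θ' : ℕ → ℂ → ℂ} {d δ η : ℝ} {L R L' R' : ℕ → ℝ} (hd : 0 < d)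
    (hL : ∀ n, L n = d * L' n) (hR : ∀ n, R n = d * R' n) (hf : ∀ n z, f n (d * z) = d ^ n * f' n z)
    (hG : ∀ᶠ n in atTop, ∀ z ∈ box (L' n) (R' n) (δ / d) η, G n (d * z) = d ^ n * G' n z)
    (hΘ : ∀ n z, Θ n (d * z) = Θ' n z) (h : UniformCosEquiv f' G' Θ' fun n => box (L' n) (R' n) (δ / d) η) :
    UniformCosEquiv f G Θ fun n => box (L n) (R n) δ (d * η) := by
  intro ε hε
  filter_upwards [h ε hε, hG] with n h1 h2 z hz
  obtain ⟨z, rfl⟩ := exists_eq_ofReal_mul hd z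
  have hb : z ∈ box (L' n) (R' n) (δ / d) η := by
    obtain ⟨z1, z2, z3⟩ := hz
    rw [re_ofReal_mul] at z1 z2
    rw [im_ofReal_mul, abs_mul, abs_of_pos hd] at z3
    rw [hL] at z1
    rw [hR] at z2
    have e : δ = d * (δ / d) := (mul_div_cancel₀ δ hd.ne').symm
    rw [e] at z1 z2
    exact ⟨by nlinarith, by nlinarith, le_of_mul_le_mul_left z3 hd⟩
  rw [hf, h2 z hb, hΘ, mul_assoc, ← mul_sub, norm_mul, norm_mul, norm_pow, Complex.norm_of_nonneg hd.le]
  calc _ ≤ d ^ n * _ := mul_le_mul_of_nonneg_left (h1 z hb) (by positivity)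
    _ = _ := by ring

theorem one_add_div_rootN_ne_zero {n : ℕ} {z : ℂ} (hn : 1 ≤ n) (hz : -√n < z.re) : 1 + z / rootN n ≠ 0 := by
  have hs : 0 < √n := sqrt_pos.mpr (by exact_mod_cast hn)
  intro h
  have h1 := congrArg re h
  rw [rootN, add_re, div_ofReal_re, one_re, zero_re] at h1
  field_simp at h1
  linarith

theorem uniformCosEquiv_mid {d : ℝ} (hd : 0 < d) (ha : 0 < a) (b : ℝ) {δ : ℝ} (hδ : 0 < δ) :
    UniformCosEquiv (piAt d (d ^ 2 * a) (d ^ 2 * b)) (midAmp d (d ^ 2 * a)) (midPhase d (d ^ 2 * a))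
      (fun _ => box (-(2 * √(d ^ 2 * a))) (2 * √(d ^ 2 * a)) δ (d * 1)) := by
  refine UniformCosEquiv.scale (L' := fun _ => -(2 * √a)) (R' := fun _ => 2 * √a) hd
    (fun _ => by rw [sqrt_scale hd]; ring) (fun _ => by rw [sqrt_scale hd]; ring) (fun n z => piAt_scale hd a n z b) ?_
    (midPhase_scale hd a) (uniformCosEquiv_mid_one ha b (div_pos hδ hd))
  filter_upwards [tendsto_sqrt_natCast.eventually_ge_atTop (2 * √a), eventually_ge_atTop 1] with n h1 hn z hz
  exact midAmp_scale hd a ha hn (one_add_div_rootN_ne_zero hn (by linarith [hz.1, div_pos hδ hd]))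

theorem exists_uniformCosEquiv_left {d : ℝ} (hd : 0 < d) (ha : 0 < a) (b : ℝ) {δ : ℝ} (hδ : 0 < δ) : ∃ η : ℝ, 0 < η ∧
    UniformCosEquiv (piAt d (d ^ 2 * a) (d ^ 2 * b)) (leftAmp d (d ^ 2 * a)) (leftPhase d (d ^ 2 * a))
      (fun n => box (-(√n * d)) (-(2 * √(d ^ 2 * a))) δ η) := by
  obtain ⟨η, hη, h⟩ := exists_uniformCosEquiv_left_one ha b (div_pos hδ hd)
  refine ⟨d * η, by positivity, UniformCosEquiv.scale (L' := fun n => -√n) (R' := fun _ => -(2 * √a)) hd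
    (fun _ => by ring) (fun _ => by rw [sqrt_scale hd]; ring) (fun n z => piAt_scale hd a n z b) ?_
    (leftPhase_scale hd a) h⟩
  filter_upwards [eventually_ge_atTop 1] with n hn z hz
  have h0 := div_pos hδ hd
  have h2 : z.re < -(2 * √a) := by linarith [hz.2.1]
  refine leftAmp_scale hd a hn (one_add_div_rootN_ne_zero hn (by linarith [hz.1])) fun h0 => ?_
  have h1 := congrArg re h0
  rw [add_re, neg_re, zero_re] at h1
  linarith [rootLeft_re_pos h2, sqrt_nonneg a]

end

end PlancherelRotach

end

theorem mainTheorem2 (d a b : ℝ) (hd : 0 < d) (ha : 0 < a) :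
    (∀ δ : ℝ, 0 < δ →
      PlancherelRotach.UniformEquiv
        (PlancherelRotach.piAt d a b)
        (PlancherelRotach.outerApprox d a)
        (PlancherelRotach.outerRegion d a δ)) ∧
    (∀ δ : ℝ, 0 < δ → ∃ η : ℝ, 0 < η ∧
      PlancherelRotach.UniformCosEquiv
        (PlancherelRotach.piAt d a b)
        (PlancherelRotach.midAmp d a)
        (PlancherelRotach.midPhase d a)
        (fun _ => PlancherelRotach.box (-(2 * Real.sqrt a)) (2 * Real.sqrt a) δ η)) ∧
    (∀ δ : ℝ, 0 < δ → ∃ η : ℝ, 0 < η ∧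
      PlancherelRotach.UniformCosEquiv
        (PlancherelRotach.piAt d a b)
        (PlancherelRotach.leftAmp d a)
        (PlancherelRotach.leftPhase d a)
        (fun n => PlancherelRotach.box (-(Real.sqrt n * d)) (-(2 * Real.sqrt a)) δ η)) := by
  obtain ⟨a, rfl⟩ : ∃ a', d ^ 2 * a' = a := ⟨a / d ^ 2, mul_div_cancel₀ a (by positivity)⟩
  obtain ⟨b, rfl⟩ : ∃ b', d ^ 2 * b' = b := ⟨b / d ^ 2, mul_div_cancel₀ b (by positivity)⟩
  have ha := pos_of_mul_pos_right ha (sq_nonneg d)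
  exact ⟨fun δ hδ => PlancherelRotach.uniformEquiv_outer hd ha b hδ,
    fun δ hδ => ⟨d * 1, by positivity, PlancherelRotach.uniformCosEquiv_mid hd ha b hδ⟩,
    fun δ hδ => PlancherelRotach.exists_uniformCosEquiv_left hd ha b hδ⟩
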